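/- Let $E=\mathbb C/\Lambda$ be an elliptic curve, let $B$ be a compact connected Riemann surface (a smooth complex projective curve), and let $\pi:X\to B$ be a holomorphic principal $E$-bundle which is not topologically trivial. Let $c=c_1(L)\in NS(X)\subset H^2(X,\mathbb Z)$ be the first Chern class of a holomorphic line bundle $L$ on $X$, and let $\widehat c$ be its class modulo torsion, regarded as a class in de Rham cohomology $H^2(X,\mathbb R)$ (where $c_1(L)$ is represented by the Chern form $-\frac{i}{2\pi}\partial\bar\partial\log h$ of any Hermitian metric $h$ on $L$, and the cup product is given by the wedge product). Say that a holomorphic map $\varphi:B\to E$ corresponds to $\widehat c$ if for every smooth loop $\gamma$ in $X$ and every $\lambda\in\Lambda=H_1(E,\mathbb Z)$ $$\int_{T_{\gamma,\lambda}}\widehat c\;=\;\varphi_*[\pi\circ\gamma]\cdot\lambda ,$$ where $T_{\gamma,\lambda}$ is the torus $(s,t)\mapsto [t\lambda]\cdot\gamma(s)$, $0\le s,t\le 1$, in $X$, $\varphi_*:H_1(B,\mathbb Z)\to H_1(E,\mathbb Z)$ is the induced map, and the dot on the right-hand side is the intersection number in $H_1(E,\mathbb Z)$. (Equivalently, the homomorphism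 $H_1(B,\mathbb Z)\to H^1(E,\mathbb Z)\cong H_1(E^\vee,\mathbb Z)$ defined by $\widehat c$ through $H^2(X,\mathbb Z)/\mathrm{Tors}\cong H^1(B,\mathbb Z)\otimes H^1(E,\mathbb Z)$ is the one given by the homomorphism $J_B\to E^\vee\cong E$ induced by $\varphi$.) Then there is a holomorphic map $\varphi:B\to E$ corresponding to $\widehat c$; it is unique up to a translation of $E$; and for every such $\varphi$ $$\widehat c^{\,2}=\int_X\widehat c\wedge\widehat c=-2\deg(\varphi),$$ where $\deg(\varphi)$ is the number of points in a general fibre of $\varphi$ (so it is $0$ if $\varphi$ is constant). -/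

import Mathlib

open scoped Manifold ContDiff Topology
open MeasureTheory

noncomputable section

namespace PrincipalElliptic

/-! ### Elliptic curves `ℂ / Λ` -/

/-- The elliptic curve `ℂ / Λ` attached to a lattice `Λ` in `ℂ`. -/
abbrev Torus (Λ : Submodule ℤ ℂ) : Type := ℂ ⧸ Λ.toAddSubgroup

/-- The intersection form on `H₁(ℂ / Λ, ℤ) = Λ` with respect to the complex orientation: the
alternating form which takes the value `1` on every positively oriented basis of `Λ`. -/
def latticeIntersection (Λ : Submodule ℤ ℂ) (w l : ℂ) : ℝ :=
  ((starRingEnd ℂ) w * l).im / ZLattice.covolume Λ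

/-- A map from a Riemann surface to `ℂ / Λ` is holomorphic if locally it lifts to a holomorphic
function with values in `ℂ`. -/
def IsHolomorphicToTorus {B : Type*} [TopologicalSpace B] [ChartedSpace ℂ B]
    (Λ : Submodule ℤ ℂ) (φ : B → Torus Λ) : Prop :=
  ∀ b : B, ∃ U : Set B, IsOpen U ∧ b ∈ U ∧ ∃ f : B → ℂ,
    ContMDiffOn 𝓘(ℂ, ℂ) 𝓘(ℂ, ℂ) ω f U ∧ ∀ u ∈ U, (QuotientAddGroup.mk (f u) : Torus Λ) = φ u

/-- `n` is the degree of the map `φ`: the number of points in a general fibre. For a constant map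
to an infinite target the general fibre is empty and the degree is `0`. -/
def HasDegree {B E : Type*} (φ : B → E) (n : ℕ) : Prop :=
  ∀ᶠ p in Filter.cofinite, (φ ⁻¹' {p}).Finite ∧ (φ ⁻¹' {p}).ncard = n

/-! ### Principal elliptic bundles -/

/-- `π : X → B` is a holomorphic principal bundle, with structure group the elliptic curve
`ℂ / Λ`, from a complex surface to a Riemann surface: the group acts holomorphically and freely
on `X`, preserving the fibres, and over a neighbourhood `U` of each point of `B` there is a
holomorphic section `σ` such that `(u, a) ↦ a +ᵥ σ u` is a bijection from `U × ℂ / Λ` to `π⁻¹ U`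
with holomorphic inverse `y ↦ (π y, [f y])`. -/
structure IsPrincipalBundle {X B : Type*} [TopologicalSpace X] [ChartedSpace (ℂ × ℂ) X]
    [TopologicalSpace B] [ChartedSpace ℂ B] (Λ : Submodule ℤ ℂ) [AddAction (Torus Λ) X]
    (π : X → B) : Prop where
  holomorphic_proj : ContMDiff 𝓘(ℂ, ℂ × ℂ) 𝓘(ℂ, ℂ) ω π
  holomorphic_vadd : ContMDiff (𝓘(ℂ, ℂ).prod 𝓘(ℂ, ℂ × ℂ)) 𝓘(ℂ, ℂ × ℂ) ω
    (fun p : ℂ × X => (QuotientAddGroup.mk p.1 : Torus Λ) +ᵥ p.2)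
  proj_vadd : ∀ (a : Torus Λ) (x : X), π (a +ᵥ x) = π x
  free : ∀ (a : Torus Λ) (x : X), a +ᵥ x = x → a = 0
  locally_trivial : ∀ b : B, ∃ U : Set B, IsOpen U ∧ b ∈ U ∧ ∃ σ : B → X,
    ContMDiffOn 𝓘(ℂ, ℂ) 𝓘(ℂ, ℂ × ℂ) ω σ U ∧ (∀ u ∈ U, π (σ u) = u) ∧
    ∀ x : X, π x ∈ U → ∃ W : Set X, IsOpen W ∧ x ∈ W ∧ W ⊆ π ⁻¹' U ∧ ∃ f : X → ℂ,
      ContMDiffOn 𝓘(ℂ, ℂ × ℂ) 𝓘(ℂ, ℂ) ω f W ∧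
      ∀ y ∈ W, (QuotientAddGroup.mk (f y) : Torus Λ) +ᵥ σ (π y) = y

/-- `π : X → B` is topologically a product with the fibre `ℂ / Λ`. -/
def IsTopologicallyTrivial {X B : Type*} [TopologicalSpace X] [TopologicalSpace B]
    (Λ : Submodule ℤ ℂ) (π : X → B) : Prop :=
  ∃ Φ : X ≃ₜ B × Torus Λ, ∀ x, (Φ x).1 = π x

/-! ### Differential forms and de Rham cohomology of a complex surface -/

/-- A smooth real differential `k`-form on a complex surface `X`, given by a smooth form on the
image of every chart, compatibly with the pullback under changes of charts. (The values of
`toFun e` outside of the image of the chart `e`, or for `e` not in the atlas, have no meaning.) -/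
structure Form (X : Type*) [TopologicalSpace X] [ChartedSpace (ℂ × ℂ) X] (k : ℕ) where
  toFun : OpenPartialHomeomorph X (ℂ × ℂ) → ℂ × ℂ → (ℂ × ℂ) [⋀^Fin k]→L[ℝ] ℝ
  smooth : ∀ e ∈ atlas (ℂ × ℂ) X, ContDiffOn ℝ ∞ (toFun e) e.target
  compat : ∀ e ∈ atlas (ℂ × ℂ) X, ∀ e' ∈ atlas (ℂ × ℂ) X, ∀ y ∈ (e.symm.trans e').source,
    toFun e y = (toFun e' (e' (e.symm y))).compContinuousLinearMap
      (fderiv ℝ (fun z => e' (e.symm z)) y)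

section Forms

variable {X : Type*} [TopologicalSpace X] [ChartedSpace (ℂ × ℂ) X]

/-- The form `α` is closed, `dα = 0`. -/
def Form.IsClosed {k : ℕ} (α : Form X k) : Prop :=
  ∀ e ∈ atlas (ℂ × ℂ) X, ∀ y ∈ e.target, extDeriv (α.toFun e) y = 0

/-- The forms `α` and `β` differ by an exact form: `α = β + dη` for some form `η`. Two closed forms
with this property represent the same class in de Rham cohomology. -/
def Form.Cohomologous {k : ℕ} (α β : Form X (k + 1)) : Prop :=
  ∃ η : Form X k, ∀ e ∈ atlas (ℂ × ℂ) X, ∀ y ∈ e.target,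
    α.toFun e y = β.toFun e y + extDeriv (η.toFun e) y

/-- The wedge product of two alternating 2-forms, evaluated on four vectors. -/
def wedge (α β : (ℂ × ℂ) [⋀^Fin 2]→L[ℝ] ℝ) (v : Fin 4 → ℂ × ℂ) : ℝ :=
  α ![v 0, v 1] * β ![v 2, v 3] - α ![v 0, v 2] * β ![v 1, v 3] + α ![v 0, v 3] * β ![v 1, v 2]
  + α ![v 1, v 2] * β ![v 0, v 3] - α ![v 1, v 3] * β ![v 0, v 2] + α ![v 2, v 3] * β ![v 0, v 1]

/-- The density of the 4-form `α ∧ β` on `ℂ²` with respect to Lebesgue measure, for the complex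
orientation `(x₁, y₁, x₂, y₂)`. -/
def wedgeDensity (α β : (ℂ × ℂ) [⋀^Fin 2]→L[ℝ] ℝ) : ℝ :=
  wedge α β ![(1, 0), (Complex.I, 0), (0, 1), (0, Complex.I)]

/-- A complex surface is in particular a smooth real manifold. -/
theorem isManifold_real (X : Type*) [TopologicalSpace X] [ChartedSpace (ℂ × ℂ) X]
    [IsManifold 𝓘(ℂ, ℂ × ℂ) ω X] : IsManifold 𝓘(ℝ, ℂ × ℂ) ∞ X := by
  apply isManifold_of_contDiffOn
  intro e e' he he'
  have h := (contDiffGroupoid ω 𝓘(ℂ, ℂ × ℂ)).compatible he he'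
  rw [contDiffGroupoid, mem_groupoid_of_pregroupoid] at h
  have h1 : ContDiffOn ℂ ω (𝓘(ℂ, ℂ × ℂ) ∘ e.symm ≫ₕ e' ∘ 𝓘(ℂ, ℂ × ℂ).symm)
    (𝓘(ℂ, ℂ × ℂ).symm ⁻¹' (e.symm ≫ₕ e').source ∩ Set.range 𝓘(ℂ, ℂ × ℂ)) := h.1
  exact (h1.restrict_scalars ℝ).of_le le_top

/-- Compact complex surfaces have smooth partitions of unity subordinate to coordinate charts. -/
theorem exists_partition (X : Type*) [TopologicalSpace X] [ChartedSpace (ℂ × ℂ) X]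
    [IsManifold 𝓘(ℂ, ℂ × ℂ) ω X] [T2Space X] [CompactSpace X] :
    ∃ ρ : SmoothPartitionOfUnity X 𝓘(ℝ, ℂ × ℂ) X Set.univ,
      ρ.IsSubordinate (fun x => (chartAt (ℂ × ℂ) x).source) :=
  haveI := isManifold_real X
  SmoothPartitionOfUnity.exists_isSubordinate_chartAt_source 𝓘(ℝ, ℂ × ℂ) X

/-- The intersection pairing `∫_X α ∧ β` of two 2-forms on a compact complex surface with its
complex orientation. The integral is computed by means of a smooth partition of unity subordinate
to coordinate charts (it does not depend on its choice). -/
def intersection [IsManifold 𝓘(ℂ, ℂ × ℂ) ω X] [T2Space X] [CompactSpace X]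
    (α β : Form X 2) : ℝ :=
  let ρ := Classical.choose (exists_partition X)
  ∑ᶠ p : X, ∫ y in (chartAt (ℂ × ℂ) p).target,
    ρ p ((chartAt (ℂ × ℂ) p).symm y) *
      wedgeDensity (α.toFun (chartAt (ℂ × ℂ) p) y) (β.toFun (chartAt (ℂ × ℂ) p) y)

/-- The integral of the 2-form `α` over the parametrized square `F : [0, 1]² → X`. -/
def squareIntegral (α : Form X 2) (F : ℝ → ℝ → X) : ℝ :=
  ∫ s in (0 : ℝ)..1, ∫ t in (0 : ℝ)..1,
    α.toFun (chartAt (ℂ × ℂ) (F s t)) (chartAt (ℂ × ℂ) (F s t) (F s t))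
      ![deriv (fun s' => chartAt (ℂ × ℂ) (F s t) (F s' t)) s,
        deriv (fun t' => chartAt (ℂ × ℂ) (F s t) (F s t')) t]

end Forms

/-! ### The first Chern class of a holomorphic line bundle -/

section Chern

variable {X : Type*} [TopologicalSpace X] [ChartedSpace (ℂ × ℂ) X]

/-- A smooth Hermitian metric on a line bundle `L`, given by the squared length of vectors. Its
smoothness is tested on the local frames `x ↦ (trivializationAt ℂ L x₀).symm x 1`. -/
structure HermitianMetric (L : X → Type*) [∀ x, AddCommGroup (L x)] [∀ x, Module ℂ (L x)]
    [∀ x, TopologicalSpace (L x)] [TopologicalSpace (Bundle.TotalSpace ℂ L)] [FiberBundle ℂ L]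
    where
  normSq : ∀ x, L x → ℝ
  pos : ∀ x (v : L x), v ≠ 0 → 0 < normSq x v
  smul : ∀ x (a : ℂ) (v : L x), normSq x (a • v) = ‖a‖ ^ 2 * normSq x v
  smooth : ∀ x₀ : X, ContMDiffOn 𝓘(ℝ, ℂ × ℂ) 𝓘(ℝ, ℝ) ∞
    (fun x => normSq x ((trivializationAt ℂ L x₀).symm x 1)) (trivializationAt ℂ L x₀).baseSet

/-- The value on the tangent vectors `v, w` of the real `(1,1)`-form
`-(i/2π) ∂∂̄ u = (1/4π) d(du ∘ J)` on `ℂ²`, where `J` is multiplication by `i`. -/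
def ddc (u : ℂ × ℂ → ℝ) (y v w : ℂ × ℂ) : ℝ :=
  1 / (4 * Real.pi) * (fderiv ℝ (fderiv ℝ u) y v (Complex.I • w)
    - fderiv ℝ (fderiv ℝ u) y w (Complex.I • v))

variable {L : X → Type*} [∀ x, AddCommGroup (L x)] [∀ x, Module ℂ (L x)]
    [∀ x, TopologicalSpace (L x)] [TopologicalSpace (Bundle.TotalSpace ℂ L)] [FiberBundle ℂ L]

/-- `χ` is the Chern form `(i/2π) Θ = -(i/2π) ∂∂̄ log h(s, s)` of the Hermitian line bundle `(L, h)`;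
here `s` is any of the local holomorphic frames of `L`. -/
def IsChernForm (h : HermitianMetric L) (χ : Form X 2) : Prop :=
  ∀ e ∈ atlas (ℂ × ℂ) X, ∀ x₀ : X, ∀ y ∈ e.target,
    e.symm y ∈ (trivializationAt ℂ L x₀).baseSet → ∀ v w : ℂ × ℂ,
      χ.toFun e y ![v, w] = ddc (fun z =>
        Real.log (h.normSq (e.symm z) ((trivializationAt ℂ L x₀).symm (e.symm z) 1))) y v w

variable (L) in
/-- The closed 2-form `α` represents the first Chern class of the holomorphic line bundle `L` in
the de Rham cohomology group `H²(X, ℝ)`, i.e. it represents the class of `c₁(L)` modulo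
torsion. -/
def RepresentsChernClass (α : Form X 2) : Prop :=
  α.IsClosed ∧ ∃ (h : HermitianMetric L) (χ : Form X 2), IsChernForm h χ ∧ α.Cohomologous χ

end Chern

/-! ### The map from the base to the fibre attached to a class -/

/-- The map `φ : B → ℂ / Λ` corresponds to the class of the closed 2-form `α` on `X`: it is
holomorphic, and the homomorphism `φ_* : H₁(B, ℤ) → H₁(ℂ / Λ, ℤ) = Λ` agrees with the component of
the class of `α` in `H¹(B, ℤ) ⊗ H¹(ℂ / Λ, ℤ) = Hom(H₁(B, ℤ), H¹(ℂ / Λ, ℤ))`, where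
`H¹(ℂ / Λ, ℤ)` is identified with `H₁(ℂ / Λ, ℤ)` by Poincaré duality. Explicitly: for each loop `γ`
in `X` and each `l ∈ Λ`, the integral of `α` over the torus swept out by `γ` under the action of
the loop `t ↦ [t l]` of `ℂ / Λ` is the intersection number of `φ_* [π ∘ γ]` and `l`. The element
`φ_* [π ∘ γ]` of `Λ` is `f 1 - f 0` for any lift `f` of the path `φ ∘ π ∘ γ` to `ℂ`. -/
def Corresponds {X B : Type*} [TopologicalSpace X] [ChartedSpace (ℂ × ℂ) X]
    [TopologicalSpace B] [ChartedSpace ℂ B] (Λ : Submodule ℤ ℂ) [AddAction (Torus Λ) X]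
    (π : X → B) (α : Form X 2) (φ : B → Torus Λ) : Prop :=
  IsHolomorphicToTorus Λ φ ∧
  ∀ γ : ℝ → X, ContMDiff 𝓘(ℝ, ℝ) 𝓘(ℝ, ℂ × ℂ) ∞ γ → Function.Periodic γ 1 →
  ∀ f : ℝ → ℂ, Continuous f → (∀ s, (QuotientAddGroup.mk (f s) : Torus Λ) = φ (π (γ s))) →
  ∀ l ∈ Λ, squareIntegral α (fun s t => (QuotientAddGroup.mk ((t : ℂ) * l) : Torus Λ) +ᵥ γ s) =
    latticeIntersection Λ (f 1 - f 0) l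

end PrincipalElliptic

end

noncomputable section

set_option maxSynthPendingDepth 3
set_option linter.unusedSectionVars false

namespace PrincipalElliptic

open Complex (I)
open ZLattice (covolume covolume_ne_zero)
open ContinuousLinearMap (inl fst snd toSpanSingleton toSpanSingleton_apply integral_apply)

notation "ℂ²" => ℂ × ℂ

notation "⟪" z "⟫[" Λ "]" => (QuotientAddGroup.mk z : Torus Λ)

/-! ### Smoothness of integrals depending on a parameter -/

section Parametric

variable {V P W : Type} [NormedAddCommGroup V] [NormedSpace ℝ V]
  [NormedAddCommGroup P] [NormedSpace ℝ P] [MeasurableSpace P] [BorelSpace P]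
  [SecondCountableTopology P]
  [NormedAddCommGroup W] [NormedSpace ℝ W]

theorem eventually_of_forall_prod_compact {K : Set P} (hK : IsCompact K) {Q : V × P → Prop}
    {y : V} (h : ∀ z ∈ K, ∀ᶠ p in 𝓝 (y, z), Q p) :
    ∃ u ∈ 𝓝 y, ∀ x ∈ u, ∀ z ∈ K, Q (x, z) := by
  have := hK.eventually_forall_of_forall_eventually (x₀ := y) (P := fun x z => Q (x, z)) h
  exact ⟨_, this, fun x hx => hx⟩

theorem aestronglyMeasurable_of_continuousAt [CompleteSpace W] {K : Set P} (hK : IsCompact K)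
    {μ : Measure P} (hμ : ∀ᵐ z ∂μ, z ∈ K) {f : P → W} (hf : ∀ z ∈ K, ContinuousAt f z) :
    AEStronglyMeasurable f μ := by
  have h1 : ContinuousOn f K := fun z hz => (hf z hz).continuousWithinAt
  have h2 := h1.aestronglyMeasurable (μ := μ) hK.measurableSet
  rwa [Measure.restrict_eq_self_of_ae_mem hμ] at h2

theorem integrable_of_continuousAt [CompleteSpace W] {K : Set P} (hK : IsCompact K)
    {μ : Measure P} [IsFiniteMeasure μ] (hμ : ∀ᵐ z ∂μ, z ∈ K) {f : P → W}
    (hf : ∀ z ∈ K, ContinuousAt f z) : Integrable f μ := by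
  have h1 : ContinuousOn f K := fun z hz => (hf z hz).continuousWithinAt
  have h2 := h1.integrableOn_compact (μ := μ) hK
  rwa [IntegrableOn, Measure.restrict_eq_self_of_ae_mem hμ] at h2

theorem hasFDerivAt_integral_of_contDiffAt [CompleteSpace W] {K : Set P} (hK : IsCompact K)
    {μ : Measure P} [IsFiniteMeasure μ] (hμ : ∀ᵐ z ∂μ, z ∈ K) {f : V × P → W} {y : V}
    (hf : ∀ z ∈ K, ContDiffAt ℝ 1 f (y, z)) :
    HasFDerivAt (fun x => ∫ z, f (x, z) ∂μ)
      (∫ z, (fderiv ℝ f (y, z)).comp (inl ℝ V P) ∂μ) y := by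
  have hev : ∀ z ∈ K, ∀ᶠ p in 𝓝 (y, z), ContDiffAt ℝ 1 f p := fun z hz =>
    (hf z hz).eventually (by simp)
  obtain ⟨u, hu, hu1⟩ := eventually_of_forall_prod_compact hK hev
  have hcont : ∀ p, ContDiffAt ℝ 1 f p → ContinuousAt (fun p => (fderiv ℝ f p).comp
      (inl ℝ V P)) p := fun p hp =>
    ((hp.fderiv_right (m := 0) (by simp)).continuousAt).clm_comp continuousAt_const
  -- a uniform bound near `y`
  obtain ⟨C, hC⟩ : ∃ C, ∀ z ∈ K, ‖(fderiv ℝ f (y, z)).comp (inl ℝ V P)‖ ≤ C := by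
    apply hK.exists_bound_of_continuousOn
    intro z hz
    exact ((hcont _ (hf z hz)).comp (x := z) (f := fun z => (y, z))
      (by fun_prop)).continuousWithinAt
  have hb : ∀ z ∈ K, ∀ᶠ p in 𝓝 (y, z),
      ‖(fderiv ℝ f p).comp (inl ℝ V P)‖ ≤ C + 1 := by
    intro z hz
    have := (hcont _ (hf z hz)).norm
    filter_upwards [this.eventually (gt_mem_nhds (lt_of_le_of_lt (hC z hz) (lt_add_one C)))]
      with p hp using hp.le
  obtain ⟨s, hs, hs1⟩ := eventually_of_forall_prod_compact hK hb
  refine hasFDerivAt_integral_of_dominated_of_fderiv_le (s := u ∩ s) (bound := fun _ => C + 1)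
    (F := fun x z => f (x, z))
    (F' := fun x z => (fderiv ℝ f (x, z)).comp (inl ℝ V P))
    (Filter.inter_mem hu hs) ?_ ?_ ?_ ?_ ?_ ?_
  · filter_upwards [hu] with x hx
    exact aestronglyMeasurable_of_continuousAt hK hμ fun z hz =>
      (hu1 x hx z hz).continuousAt.comp (f := fun z => (x, z)) (by fun_prop)
  · exact integrable_of_continuousAt hK hμ fun z hz =>
      (hf z hz).continuousAt.comp (f := fun z => (y, z)) (by fun_prop)
  · exact aestronglyMeasurable_of_continuousAt hK hμ fun z hz =>
      (hcont _ (hf z hz)).comp (f := fun z => (y, z)) (by fun_prop)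
  · filter_upwards [hμ] with z hz x hx using hs1 x hx.2 z hz
  · exact integrable_const _
  · filter_upwards [hμ] with z hz x hx
    have h1 := ((hu1 x hx.1 z hz).differentiableAt (by simp)).hasFDerivAt
    exact h1.comp x (hasFDerivAt_prodMk_left x z)

theorem contDiffAt_integral [CompleteSpace W] {K : Set P} (hK : IsCompact K)
    {μ : Measure P} [IsFiniteMeasure μ] (hμ : ∀ᵐ z ∂μ, z ∈ K) {f : V × P → W} {y : V}
    (hf : ∀ z ∈ K, ContDiffAt ℝ ∞ f (y, z)) :
    ContDiffAt ℝ ∞ (fun x => ∫ z, f (x, z) ∂μ) y := by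
  rw [contDiffAt_infty]
  intro n
  replace hf : ∀ z ∈ K, ContDiffAt ℝ n f (y, z) := fun z hz => (hf z hz).of_le (by
    exact_mod_cast le_top)
  induction n generalizing W with
  | zero =>
    have hev : ∀ z ∈ K, ∀ᶠ p in 𝓝 (y, z), ContinuousAt f p := fun z hz => by
      have := (hf z hz).eventually (by simp)
      filter_upwards [this] with p hp using hp.continuousAt
    obtain ⟨u, hu, hu1⟩ := eventually_of_forall_prod_compact hK hev
    rw [Nat.cast_zero, contDiffAt_zero]
    obtain ⟨C, hC⟩ : ∃ C, ∀ z ∈ K, ‖f (y, z)‖ ≤ C := by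
      apply hK.exists_bound_of_continuousOn
      intro z hz
      exact (((hf z hz).continuousAt).comp (x := z) (f := fun z => (y, z))
        (by fun_prop)).continuousWithinAt
    have hb : ∀ z ∈ K, ∀ᶠ p in 𝓝 (y, z), ‖f p‖ ≤ C + 1 := by
      intro z hz
      have := (hf z hz).continuousAt.norm
      filter_upwards [this.eventually (gt_mem_nhds (lt_of_le_of_lt (hC z hz) (lt_add_one C)))]
        with p hp using hp.le
    obtain ⟨s, hs, hs1⟩ := eventually_of_forall_prod_compact hK hb
    refine ⟨_, interior_mem_nhds.2 (Filter.inter_mem hu hs), ?_⟩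
    intro x hx
    apply ContinuousAt.continuousWithinAt
    apply continuousAt_of_dominated (bound := fun _ => C + 1)
    · filter_upwards [mem_interior_iff_mem_nhds.1 hx] with x hx
      exact aestronglyMeasurable_of_continuousAt hK hμ fun z hz =>
        (hu1 x hx.1 z hz).comp (f := fun z => (x, z)) (by fun_prop)
    · filter_upwards [mem_interior_iff_mem_nhds.1 hx] with x hx
      filter_upwards [hμ] with z hz using hs1 x hx.2 z hz
    · exact integrable_const _
    · filter_upwards [hμ] with z hz
      exact (hu1 x (interior_subset hx).1 z hz).comp (f := fun x => (x, z)) (by fun_prop)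
  | succ n ih =>
    have hev : ∀ z ∈ K, ∀ᶠ p in 𝓝 (y, z), ContDiffAt ℝ 1 f p := fun z hz => by
      have h1 : ContDiffAt ℝ 1 f (y, z) := (hf z hz).of_le (by
        exact_mod_cast Nat.le_add_left 1 n)
      exact h1.eventually (by simp)
    obtain ⟨u, hu, hu1⟩ := eventually_of_forall_prod_compact hK hev
    push_cast
    rw [contDiffAt_succ_iff_hasFDerivAt]
    refine ⟨fun x => ∫ z, (fderiv ℝ f (x, z)).comp (inl ℝ V P) ∂μ,
      ⟨u, hu, fun x hx => hasFDerivAt_integral_of_contDiffAt hK hμ (hu1 x hx)⟩, ?_⟩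
    refine ih (f := fun p => (fderiv ℝ f p).comp (inl ℝ V P)) fun z hz => ?_
    exact ((hf z hz).fderiv_right (m := n) (by push_cast; exact le_rfl)).clm_comp contDiffAt_const

end Parametric

/-! ### Smooth maps from vector spaces to manifolds -/

section Smooth

theorem contMDiffAt_real_of_complex {E E' M M' : Type*} [NormedAddCommGroup E] [NormedSpace ℂ E]
    [NormedAddCommGroup E'] [NormedSpace ℂ E'] [TopologicalSpace M] [ChartedSpace E M]
    [TopologicalSpace M'] [ChartedSpace E' M'] {f : M → M'} {x : M}
    (h : ContMDiffAt 𝓘(ℂ, E) 𝓘(ℂ, E') ω f x) : ContMDiffAt 𝓘(ℝ, E) 𝓘(ℝ, E') ∞ f x := by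
  rw [contMDiffAt_iff] at h ⊢
  refine ⟨h.1, ?_⟩
  have h2 := (h.2.restrict_scalars ℝ).of_le (m := ∞) le_top
  exact h2

variable {E M : Type*} [NormedAddCommGroup E] [NormedSpace ℝ E] [TopologicalSpace M]
  [ChartedSpace E M]
variable {V W : Type*} [NormedAddCommGroup V] [NormedSpace ℝ V] [NormedAddCommGroup W]
  [NormedSpace ℝ W]

/-- `H` is smooth in a neighbourhood of `y`. -/
def SmAt (H : V → M) (y : V) : Prop := ∀ᶠ z in 𝓝 y, ContMDiffAt 𝓘(ℝ, V) 𝓘(ℝ, E) ∞ H z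

/-- Smoothness of a map to a complex surface. -/
notation "SmX" => SmAt (E := ℂ²)

/-- The map `g` between normed spaces is smooth in a neighbourhood of `y`. -/
def SmF (g : V → W) (y : V) : Prop := ∀ᶠ z in 𝓝 y, ContDiffAt ℝ ∞ g z

theorem SmF.contDiffAt {g : V → W} {y : V} (h : SmF g y) : ContDiffAt ℝ ∞ g y := h.self_of_nhds

theorem SmF.differentiableAt {g : V → W} {y : V} (h : SmF g y) : DifferentiableAt ℝ g y :=
  h.contDiffAt.differentiableAt (by simp)

theorem SmAt.contMDiffAt {H : V → M} {y : V} (h : SmAt (E := E) H y) :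
    ContMDiffAt 𝓘(ℝ, V) 𝓘(ℝ, E) ∞ H y := h.self_of_nhds

theorem SmAt.continuousAt {H : V → M} {y : V} (h : SmAt (E := E) H y) : ContinuousAt H y :=
  h.contMDiffAt.continuousAt

theorem SmAt.eventually {H : V → M} {y : V} (h : SmAt (E := E) H y) :
    ∀ᶠ z in 𝓝 y, SmAt (E := E) H z := eventually_eventually_nhds.2 h

theorem SmF.eventually {g : V → W} {y : V} (h : SmF g y) : ∀ᶠ z in 𝓝 y, SmF g z :=
  eventually_eventually_nhds.2 h

theorem SmF.of_contDiff {g : V → W} (h : ContDiff ℝ ∞ g) (y : V) : SmF g y :=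
  Filter.Eventually.of_forall fun _ => h.contDiffAt

theorem SmAt.congr {H H' : V → M} {y : V} (h : SmAt (E := E) H y) (h' : H =ᶠ[𝓝 y] H') :
    SmAt (E := E) H' y := by
  filter_upwards [h, h'.eventuallyEq_nhds] with z hz hz'
  exact hz.congr_of_eventuallyEq hz'.symm

theorem SmAt.comp {H : W → M} {g : V → W} (y : V) (h : SmAt (E := E) H (g y)) (hg : SmF g y) :
    SmAt (E := E) (fun z => H (g z)) y := by
  filter_upwards [hg, hg.contDiffAt.continuousAt.eventually h] with z hz hz'
  exact hz'.comp z hz.contMDiffAt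

/-- Composition of a smooth parametrization with a smooth function on the manifold. -/
theorem SmAt.comp_left {T : M → W} {H : V → M} {y : V} (hT : ∀ᶠ x in 𝓝 (H y),
    ContMDiffAt 𝓘(ℝ, E) 𝓘(ℝ, W) ∞ T x) (h : SmAt (E := E) H y) : SmF (fun z => T (H z)) y := by
  filter_upwards [h, h.continuousAt.eventually hT] with z hz hz'
  exact (hz'.comp z hz).contDiffAt

theorem SmAt.chart [IsManifold 𝓘(ℝ, E) ∞ M] {H : V → M} {y : V} (h : SmAt (E := E) H y)
    {e : OpenPartialHomeomorph M E} (he : e ∈ atlas E M) (hy : H y ∈ e.source) :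
    SmF (fun z => e (H z)) y := by
  refine h.comp_left ?_
  filter_upwards [e.open_source.mem_nhds hy] with x hx
  exact contMDiffAt_of_mem_maximalAtlas (IsManifold.subset_maximalAtlas he) hx

theorem smAt_chart_symm [IsManifold 𝓘(ℝ, E) ∞ M] {e : OpenPartialHomeomorph M E}
    (he : e ∈ atlas E M) {y : E} (hy : y ∈ e.target) : SmAt (E := E) e.symm y := by
  filter_upwards [e.open_target.mem_nhds hy] with z hz
  exact contMDiffAt_symm_of_mem_maximalAtlas (IsManifold.subset_maximalAtlas he) hz

end Smooth

/-! ### Differential forms on manifolds as natural families -/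

section NaturalForms

/-- The exterior derivative of a 2-form given by a bilinear form. -/
def d2 {V : Type} [NormedAddCommGroup V] [NormedSpace ℝ V] (B : V → V →L[ℝ] V →L[ℝ] ℝ) (y : V)
    (a b c : V) : ℝ :=
  fderiv ℝ B y a b c - fderiv ℝ B y b a c + fderiv ℝ B y c a b

/-- The exterior derivative of a 1-form. -/
def d1 {V F : Type} [NormedAddCommGroup V] [NormedSpace ℝ V] [NormedAddCommGroup F]
    [NormedSpace ℝ F] (B : V → V →L[ℝ] F) (y : V) (a b : V) : F :=
  fderiv ℝ B y a b - fderiv ℝ B y b a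

/-- The pullback of a bilinear form under a linear map. -/
def pull2 {V W : Type} [NormedAddCommGroup V] [NormedSpace ℝ V] [NormedAddCommGroup W]
    [NormedSpace ℝ W] (B : W →L[ℝ] W →L[ℝ] ℝ) (g : V →L[ℝ] W) : V →L[ℝ] V →L[ℝ] ℝ :=
  ((ContinuousLinearMap.compL ℝ V W ℝ).flip g).comp (B.comp g)

@[simp] theorem pull2_apply {V W : Type} [NormedAddCommGroup V] [NormedSpace ℝ V]
    [NormedAddCommGroup W] [NormedSpace ℝ W] (B : W →L[ℝ] W →L[ℝ] ℝ) (g : V →L[ℝ] W) (v w : V) :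
    pull2 B g v w = B (g v) (g w) := rfl

theorem contDiffAt_pull2 {U V W : Type} [NormedAddCommGroup U] [NormedSpace ℝ U]
    [NormedAddCommGroup V] [NormedSpace ℝ V] [NormedAddCommGroup W] [NormedSpace ℝ W]
    {B : U → W →L[ℝ] W →L[ℝ] ℝ} {g : U → V →L[ℝ] W} {y : U} {n : WithTop ℕ∞}
    (hB : ContDiffAt ℝ n B y) (hg : ContDiffAt ℝ n g y) :
    ContDiffAt ℝ n (fun z => pull2 (B z) (g z)) y :=
  have h0 : ContDiff ℝ n (fun g : V →L[ℝ] W => (ContinuousLinearMap.compL ℝ V W ℝ).flip g) :=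
    ContinuousLinearMap.contDiff (𝕜 := ℝ) (F := (W →L[ℝ] ℝ) →L[ℝ] V →L[ℝ] ℝ)
      (ContinuousLinearMap.compL ℝ V W ℝ).flip
  have h : ContDiffAt ℝ n (fun z => (ContinuousLinearMap.compL ℝ V W ℝ).flip (g z)) y :=
    h0.contDiffAt.comp y hg
  h.clm_comp (hB.clm_comp hg)

/-- A smooth `F`-valued 1-form on a manifold, given by its pullbacks under all smooth maps from
normed spaces. -/
structure OneForm (E : Type) [NormedAddCommGroup E] [NormedSpace ℝ E] (M : Type*)
    [TopologicalSpace M] [ChartedSpace E M] (F : Type) [NormedAddCommGroup F]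
    [NormedSpace ℝ F] where
  val : ∀ {V : Type} [NormedAddCommGroup V] [NormedSpace ℝ V], (V → M) → V → V →L[ℝ] F
  congr : ∀ {V : Type} [NormedAddCommGroup V] [NormedSpace ℝ V] {H H' : V → M} {y : V},
    SmAt (E := E) H y → H =ᶠ[𝓝 y] H' → val H y = val H' y
  natural : ∀ {V W : Type} [NormedAddCommGroup V] [NormedSpace ℝ V] [NormedAddCommGroup W]
    [NormedSpace ℝ W] {H : W → M} {g : V → W} {y : V}, SmAt (E := E) H (g y) → SmF g y →
    val (fun z => H (g z)) y = (val H (g y)).comp (fderiv ℝ g y)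
  smooth : ∀ {V : Type} [NormedAddCommGroup V] [NormedSpace ℝ V] {H : V → M} {y : V},
    SmAt (E := E) H y → ContDiffAt ℝ ∞ (val H) y

/-- A smooth real 2-form on a manifold, given by its pullbacks under all smooth maps from
normed spaces. -/
structure TwoForm (E : Type) [NormedAddCommGroup E] [NormedSpace ℝ E] (M : Type*)
    [TopologicalSpace M] [ChartedSpace E M] where
  val : ∀ {V : Type} [NormedAddCommGroup V] [NormedSpace ℝ V], (V → M) → V → V →L[ℝ] V →L[ℝ] ℝ
  congr : ∀ {V : Type} [NormedAddCommGroup V] [NormedSpace ℝ V] {H H' : V → M} {y : V},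
    SmAt (E := E) H y → H =ᶠ[𝓝 y] H' → val H y = val H' y
  natural : ∀ {V W : Type} [NormedAddCommGroup V] [NormedSpace ℝ V] [NormedAddCommGroup W]
    [NormedSpace ℝ W] {H : W → M} {g : V → W} {y : V}, SmAt (E := E) H (g y) → SmF g y →
    val (fun z => H (g z)) y = pull2 (val H (g y)) (fderiv ℝ g y)
  smooth : ∀ {V : Type} [NormedAddCommGroup V] [NormedSpace ℝ V] {H : V → M} {y : V},
    SmAt (E := E) H y → ContDiffAt ℝ ∞ (val H) y
  skew : ∀ {V : Type} [NormedAddCommGroup V] [NormedSpace ℝ V] {H : V → M} {y : V},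
    SmAt (E := E) H y → ∀ v w, val H y v w = - val H y w v

variable {E : Type} [NormedAddCommGroup E] [NormedSpace ℝ E] {M : Type*}
    [TopologicalSpace M] [ChartedSpace E M]

def OneForm.Closed {F : Type} [NormedAddCommGroup F] [NormedSpace ℝ F] (μ : OneForm E M F) :
    Prop :=
  ∀ {V : Type} [NormedAddCommGroup V] [NormedSpace ℝ V] {H : V → M} {y : V},
    SmAt (E := E) H y → ∀ v w, d1 (μ.val H) y v w = 0

def TwoForm.Closed (χ : TwoForm E M) : Prop :=
  ∀ {V : Type} [NormedAddCommGroup V] [NormedSpace ℝ V] {H : V → M} {y : V},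
    SmAt (E := E) H y → ∀ a b c, d2 (χ.val H) y a b c = 0

/-- `α = β + dη`. -/
def TwoForm.CohomologousVia (α β : TwoForm E M) (η : OneForm E M ℝ) : Prop :=
  ∀ {V : Type} [NormedAddCommGroup V] [NormedSpace ℝ V] {H : V → M} {y : V},
    SmAt (E := E) H y → ∀ v w, α.val H y v w = β.val H y v w + d1 (η.val H) y v w

end NaturalForms

/-! ### The natural families defined by forms in charts -/

section OfForm

variable {X : Type*} [TopologicalSpace X] [ChartedSpace ℂ² X]

/-- The bilinear form attached to an alternating form. -/
def bilin (V : Type) [NormedAddCommGroup V] [NormedSpace ℝ V] :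
    (V [⋀^Fin 2]→L[ℝ] ℝ) →L[ℝ] (V →L[ℝ] V →L[ℝ] ℝ) :=
  (ContinuousLinearMap.compL ℝ V (V [⋀^Fin 1]→L[ℝ] ℝ) (V →L[ℝ] ℝ)
    ((ContinuousAlternatingMap.ofSubsingletonLIE (𝕜 := ℝ) (E := V) (F := ℝ)
      (0 : Fin 1)).symm.toContinuousLinearEquiv :
      (V [⋀^Fin 1]→L[ℝ] ℝ) →L[ℝ] (V →L[ℝ] ℝ))).comp
    (ContinuousAlternatingMap.curryLeftLI (𝕜 := ℝ) (E := V) (F := ℝ)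
      (n := 1)).toContinuousLinearMap

variable {V : Type} [NormedAddCommGroup V] [NormedSpace ℝ V]

theorem bilin_apply (α : V [⋀^Fin 2]→L[ℝ] ℝ) (v w : V) : bilin V α v w = α ![v, w] := by
  change α (Matrix.vecCons v (fun _ => w)) = _
  congr 1
  ext i; fin_cases i <;> rfl

theorem contDiff_bilin (V : Type) [NormedAddCommGroup V] [NormedSpace ℝ V] :
    ContDiff ℝ ∞ (bilin V) :=
  ContinuousLinearMap.contDiff (𝕜 := ℝ) (F := V →L[ℝ] V →L[ℝ] ℝ) (bilin V)

theorem hasFDerivAt_bilin (x : V [⋀^Fin 2]→L[ℝ] ℝ) : HasFDerivAt (bilin V) (bilin V) x :=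
  ContinuousLinearMap.hasFDerivAt (𝕜 := ℝ) (F := V →L[ℝ] V →L[ℝ] ℝ) (bilin V)

/-- The linear form attached to an alternating form of degree 1. -/
def linForm (V : Type) [NormedAddCommGroup V] [NormedSpace ℝ V] :
    (V [⋀^Fin 1]→L[ℝ] ℝ) →L[ℝ] (V →L[ℝ] ℝ) :=
  ((ContinuousAlternatingMap.ofSubsingletonLIE (𝕜 := ℝ) (E := V) (F := ℝ)
      (0 : Fin 1)).symm.toContinuousLinearEquiv :
      (V [⋀^Fin 1]→L[ℝ] ℝ) →L[ℝ] (V →L[ℝ] ℝ))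

theorem linForm_apply (α : V [⋀^Fin 1]→L[ℝ] ℝ) (v : V) : linForm V α v = α ![v] := by
  change α (fun _ => v) = _
  congr 1
  ext i; fin_cases i; rfl

theorem contDiff_linForm (V : Type) [NormedAddCommGroup V] [NormedSpace ℝ V] :
    ContDiff ℝ ∞ (linForm V) :=
  ContinuousLinearMap.contDiff (𝕜 := ℝ) (F := V →L[ℝ] ℝ) (linForm V)

theorem hasFDerivAt_linForm (x : V [⋀^Fin 1]→L[ℝ] ℝ) : HasFDerivAt (linForm V) (linForm V) x :=
  ContinuousLinearMap.hasFDerivAt (𝕜 := ℝ) (F := V →L[ℝ] ℝ) (linForm V)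

/-- The pullback of a form under a map from a normed space. -/
def Form.pb {k : ℕ} (α : Form X k) (H : V → X)
    (y : V) : V [⋀^Fin k]→L[ℝ] ℝ :=
  (α.toFun (chartAt ℂ² (H y)) (chartAt ℂ² (H y) (H y))).compContinuousLinearMap
    (fderiv ℝ (fun z => chartAt ℂ² (H y) (H z)) y)

variable [IsManifold 𝓘(ℝ, ℂ²) ∞ X]

theorem Form.pb_eq {k : ℕ} (α : Form X k) {H : V → X} {y : V} (hH : SmX H y) {e : OpenPartialHomeomorph X ℂ²}
    (he : e ∈ atlas ℂ² X) (hy : H y ∈ e.source) :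
    α.pb H y = (α.toFun e (e (H y))).compContinuousLinearMap
      (fderiv ℝ (fun z => e (H z)) y) := by
  set e' := chartAt ℂ² (H y) with he'
  have hy' : H y ∈ e'.source := mem_chart_source _ _
  have hmem : e' (H y) ∈ (e'.symm.trans e).source := by
    simp [e'.map_source hy', e'.left_inv hy', hy]
  have h1 := α.compat e' (chart_mem_atlas _ _) e he (e' (H y)) hmem
  rw [e'.left_inv hy'] at h1
  rw [Form.pb, ← he', h1]
  have hd : HasFDerivAt (fun z => e (H z)) ((fderiv ℝ (fun z => e (e'.symm z)) (e' (H y))).comp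
      (fderiv ℝ (fun z => e' (H z)) y)) y := by
    have h2 := (hH.chart (chart_mem_atlas ℂ² (H y)) hy').differentiableAt.hasFDerivAt
    have h3 : SmX e'.symm (e' (H y)) :=
      smAt_chart_symm (chart_mem_atlas ℂ² (H y)) (e'.map_source hy')
    have h4 := (h3.chart he (by rwa [e'.left_inv hy'])).differentiableAt.hasFDerivAt
    refine (h4.comp y h2).congr_of_eventuallyEq ?_
    filter_upwards [hH.continuousAt.eventually (e'.open_source.mem_nhds hy')] with z hz
    exact congrArg e (e'.left_inv hz).symm
  rw [hd.fderiv]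
  rfl

theorem Form.pb_eventuallyEq {k : ℕ} (α : Form X k) {H : V → X} {y : V} (hH : SmX H y)
    {e : OpenPartialHomeomorph X ℂ²} (he : e ∈ atlas ℂ² X) (hy : H y ∈ e.source) :
    α.pb H =ᶠ[𝓝 y] fun z => (α.toFun e (e (H z))).compContinuousLinearMap
      (fderiv ℝ (fun z => e (H z)) z) := by
  filter_upwards [hH.eventually, hH.continuousAt.eventually (e.open_source.mem_nhds hy)]
    with z hz hz'
  exact α.pb_eq hz he hz'

theorem Form.pb_congr {k : ℕ} (α : Form X k) {H H' : V → X} {y : V} (h : H =ᶠ[𝓝 y] H') : α.pb H y = α.pb H' y := by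
  have hy : H y = H' y := h.self_of_nhds
  rw [Form.pb, Form.pb, hy]
  congr 1
  apply Filter.EventuallyEq.fderiv_eq
  filter_upwards [h] with z hz
  rw [hz]

theorem Form.pb_natural {k : ℕ} (α : Form X k) {V W : Type} [NormedAddCommGroup V]
    [NormedSpace ℝ V] [NormedAddCommGroup W] [NormedSpace ℝ W] {H : W → X} {g : V → W} {y : V}
    (hH : SmX H (g y)) (hg : SmF g y) :
    α.pb (fun z => H (g z)) y = (α.pb H (g y)).compContinuousLinearMap (fderiv ℝ g y) := by
  have h2 := (hH.chart (chart_mem_atlas ℂ² (H (g y))) (mem_chart_source _ _)).differentiableAt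
  rw [Form.pb, Form.pb]
  have := fderiv_fun_comp (f := g) (g := fun z => chartAt ℂ² (H (g y)) (H z)) y h2
    hg.differentiableAt
  rw [this]
  rfl

theorem Form.toFun_smooth {k : ℕ} (α : Form X k) {e : OpenPartialHomeomorph X ℂ²}
    (he : e ∈ atlas ℂ² X) {y : ℂ²} (hy : y ∈ e.target) :
    ContDiffAt ℝ ∞ (α.toFun e) y :=
  (α.smooth e he).contDiffAt (e.open_target.mem_nhds hy)

theorem Form.pb_differentiableAt {k : ℕ} (α : Form X k) {H : V → X} {y : V} (hH : SmX H y) :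
    DifferentiableAt ℝ (α.pb H) y := by
  set e := chartAt ℂ² (H y)
  have he : e ∈ atlas ℂ² X := chart_mem_atlas _ _
  have hy : H y ∈ e.source := mem_chart_source _ _
  have hs := hH.chart he hy
  refine DifferentiableAt.congr_of_eventuallyEq ?_ (α.pb_eventuallyEq hH he hy)
  apply DifferentiableAt.continuousAlternatingMapCompContinuousLinearMap
  · exact ((α.toFun_smooth he (e.map_source hy)).differentiableAt (by simp)).comp y
      hs.differentiableAt
  · exact (hs.contDiffAt.fderiv_right (m := ∞) (by simp)).differentiableAt (by simp)

theorem Form.extDeriv_pb {k : ℕ} (α : Form X k) {H : V → X} {y : V} (hH : SmX H y)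
    {e : OpenPartialHomeomorph X ℂ²} (he : e ∈ atlas ℂ² X) (hy : H y ∈ e.source) :
    extDeriv (α.pb H) y = (extDeriv (α.toFun e) (e (H y))).compContinuousLinearMap
      (fderiv ℝ (fun z => e (H z)) y) := by
  rw [(α.pb_eventuallyEq hH he hy).extDeriv_eq]
  have hs := hH.chart he hy
  exact extDeriv_pullback (f := fun z => e (H z)) (r := ∞)
    ((α.toFun_smooth he (e.map_source hy)).differentiableAt (by simp)) hs.contDiffAt (by
      rw [minSmoothness_of_isRCLikeNormedField]; exact WithTop.coe_le_coe.2 le_top)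

/-- The natural family defined by a form of degree 2. -/
def Form.toTwoForm (α : Form X 2) : TwoForm ℂ² X where
  val {V} _ _ H y := bilin V (α.pb H y)
  congr _ h := by rw [α.pb_congr h]
  natural {V W} _ _ _ _ {H g y} hH hg := by
    rw [α.pb_natural hH hg]
    ext v w
    rw [bilin_apply, pull2_apply, bilin_apply, ContinuousAlternatingMap.compContinuousLinearMap_apply]
    congr 1
    funext i; fin_cases i <;> rfl
  smooth {V} _ _ {H y} hH := by
    set e := chartAt ℂ² (H y)
    have he : e ∈ atlas ℂ² X := chart_mem_atlas _ _
    have hy : H y ∈ e.source := mem_chart_source _ _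
    have hs := hH.chart he hy
    have h1 : ContDiffAt ℝ ∞ (fun z => pull2 (bilin _ (α.toFun e (e (H z))))
        (fderiv ℝ (fun z => e (H z)) z)) y :=
      contDiffAt_pull2 ((contDiff_bilin ℂ²).contDiffAt.comp y
        ((α.toFun_smooth he (e.map_source hy)).comp y hs.contDiffAt))
        (hs.contDiffAt.fderiv_right (m := ∞) (by simp))
    refine h1.congr_of_eventuallyEq ?_
    filter_upwards [α.pb_eventuallyEq hH he hy] with z hz
    rw [hz]
    ext v w
    rw [bilin_apply, pull2_apply, bilin_apply, ContinuousAlternatingMap.compContinuousLinearMap_apply]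
    congr 1
    funext i; fin_cases i <;> rfl
  skew {V} _ _ {H y} _ v w := by
    rw [bilin_apply, bilin_apply]
    have := (α.pb H y).map_swap ![w, v] (i := 0) (j := 1) (by simp)
    have h2 : (![w, v] ∘ ⇑(Equiv.swap (0 : Fin 2) 1)) = ![v, w] := by
      ext i; fin_cases i <;> rfl
    rw [h2] at this
    exact this

/-- The natural family defined by a form of degree 1. -/
def Form.toOneForm (α : Form X 1) : OneForm ℂ² X ℝ where
  val {V} _ _ H y := linForm V (α.pb H y)
  congr _ h := by rw [α.pb_congr h]
  natural {V W} _ _ _ _ {H g y} hH hg := by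
    rw [α.pb_natural hH hg]
    ext v
    rw [linForm_apply, ContinuousLinearMap.comp_apply, linForm_apply,
      ContinuousAlternatingMap.compContinuousLinearMap_apply]
    congr 1
    funext i; fin_cases i; rfl
  smooth {V} _ _ {H y} hH := by
    set e := chartAt ℂ² (H y)
    have he : e ∈ atlas ℂ² X := chart_mem_atlas _ _
    have hy : H y ∈ e.source := mem_chart_source _ _
    have hs := hH.chart he hy
    have h1 : ContDiffAt ℝ ∞ (fun z => (linForm _ (α.toFun e (e (H z)))).comp
        (fderiv ℝ (fun z => e (H z)) z)) y :=
      ContDiffAt.clm_comp (g := fun z => linForm ℂ² (α.toFun e (e (H z))))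
        ((contDiff_linForm ℂ²).contDiffAt.comp y
          ((α.toFun_smooth he (e.map_source hy)).comp y hs.contDiffAt))
        (hs.contDiffAt.fderiv_right (m := ∞) (by simp))
    refine h1.congr_of_eventuallyEq ?_
    filter_upwards [α.pb_eventuallyEq hH he hy] with z hz
    rw [hz]
    ext v
    rw [linForm_apply, ContinuousLinearMap.comp_apply, linForm_apply,
      ContinuousAlternatingMap.compContinuousLinearMap_apply]
    congr 1
    funext i; fin_cases i; rfl

theorem Form.toTwoForm_apply (α : Form X 2) (H : V → X) (y v w : V) :
    α.toTwoForm.val H y v w = α.pb H y ![v, w] := bilin_apply _ _ _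

theorem Form.d2_toTwoForm (α : Form X 2) {H : V → X} {y : V} (hH : SmX H y) (a b c : V) :
    d2 (α.toTwoForm.val H) y a b c = extDeriv (α.pb H) y ![a, b, c] := by
  have h : ∀ u v w : V, fderiv ℝ (α.toTwoForm.val H) y u v w = fderiv ℝ (α.pb H) y u ![v, w] := by
    intro u v w
    have h1 := (HasFDerivAt.comp (G := V →L[ℝ] V →L[ℝ] ℝ) (g := bilin V) y
      (hasFDerivAt_bilin (α.pb H y)) (α.pb_differentiableAt hH).hasFDerivAt).fderiv
    change fderiv ℝ (α.toTwoForm.val H) y = _ at h1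
    rw [h1, ContinuousLinearMap.comp_apply, bilin_apply]
  rw [d2, h, h, h, extDeriv, ContinuousAlternatingMap.alternatizeUncurryFin_apply]
  have e1 : (0 : Fin 3).removeNth ![a, b, c] = ![b, c] := by ext i; fin_cases i <;> rfl
  have e2 : (1 : Fin 3).removeNth ![a, b, c] = ![a, c] := by ext i; fin_cases i <;> rfl
  have e3 : (2 : Fin 3).removeNth ![a, b, c] = ![a, b] := by ext i; fin_cases i <;> rfl
  simp [Fin.sum_univ_three, e1, e2, e3]
  ring

theorem Form.d1_toOneForm (α : Form X 1) {H : V → X} {y : V} (hH : SmX H y) (a b : V) :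
    d1 (α.toOneForm.val H) y a b = extDeriv (α.pb H) y ![a, b] := by
  have h : ∀ u v : V, fderiv ℝ (α.toOneForm.val H) y u v = fderiv ℝ (α.pb H) y u ![v] := by
    intro u v
    have h1 := ((hasFDerivAt_linForm (α.pb H y)).comp y (α.pb_differentiableAt hH).hasFDerivAt).fderiv
    change fderiv ℝ (α.toOneForm.val H) y = _ at h1
    rw [h1, ContinuousLinearMap.comp_apply, linForm_apply]
  rw [d1, h, h, extDeriv, ContinuousAlternatingMap.alternatizeUncurryFin_apply]
  have e1 : (0 : Fin 2).removeNth ![a, b] = ![b] := by ext i; fin_cases i; rfl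
  have e2 : (1 : Fin 2).removeNth ![a, b] = ![a] := by ext i; fin_cases i; rfl
  simp [Fin.sum_univ_two, e1, e2]
  ring

theorem Form.IsClosed.toTwoForm {α : Form X 2} (hα : α.IsClosed) : α.toTwoForm.Closed := by
  intro V _ _ H y hH a b c
  rw [α.d2_toTwoForm hH, α.extDeriv_pb hH (chart_mem_atlas _ (H y)) (mem_chart_source _ _),
    hα _ (chart_mem_atlas _ _) _ ((chartAt _ (H y)).map_source (mem_chart_source _ _))]
  rfl

theorem Form.cohomologousVia {α β : Form X 2} {η : Form X 1} (h : ∀ e ∈ atlas ℂ² X,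
    ∀ y ∈ e.target, α.toFun e y = β.toFun e y + extDeriv (η.toFun e) y) :
    α.toTwoForm.CohomologousVia β.toTwoForm η.toOneForm := by
  intro V _ _ H y hH v w
  have he := chart_mem_atlas ℂ² (H y)
  have hy := mem_chart_source ℂ² (H y)
  rw [η.d1_toOneForm hH, η.extDeriv_pb hH he hy, α.toTwoForm_apply, β.toTwoForm_apply,
    α.pb_eq hH he hy, β.pb_eq hH he hy, h _ he _ ((chartAt _ (H y)).map_source hy)]
  rfl

end OfForm

/-! ### A fundamental domain of the lattice -/

section Lattice

variable (Λ : Submodule ℤ ℂ) [DiscreteTopology Λ] [IsZLattice ℝ Λ]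

theorem finrank_lattice : Module.finrank ℤ Λ = 2 := by
  rw [ZLattice.rank ℝ Λ, Complex.finrank_real_complex]

/-- A basis of the lattice. -/
def latBasis : Module.Basis (Fin 2) ℤ Λ :=
  haveI := ZLattice.module_finite ℝ Λ
  haveI := ZLattice.module_free ℝ Λ
  Module.finBasisOfFinrankEq ℤ Λ (finrank_lattice Λ)

/-- The real basis of `ℂ` given by the basis of the lattice. -/
def realBasis : Module.Basis (Fin 2) ℝ ℂ := (latBasis Λ).ofZLatticeBasis ℝ Λ

/-- The half-open fundamental parallelogram of the lattice. -/
def fd : Set ℂ := ZSpan.fundamentalDomain (realBasis Λ)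

theorem isAddFundamentalDomain_fd : IsAddFundamentalDomain Λ (fd Λ) (volume : Measure ℂ) :=
  ZLattice.isAddFundamentalDomain (latBasis Λ) volume

theorem measurableSet_fd : MeasurableSet (fd Λ) :=
  ZSpan.fundamentalDomain_measurableSet _

theorem isBounded_fd : Bornology.IsBounded (fd Λ) := ZSpan.fundamentalDomain_isBounded _

theorem volume_real_fd : volume.real (fd Λ) = covolume Λ :=
  (ZLattice.covolume_eq_measure_fundamentalDomain Λ volume (isAddFundamentalDomain_fd Λ)).symm

theorem volume_fd_lt_top : volume (fd Λ) < ⊤ := (isBounded_fd Λ).measure_lt_top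

instance : IsFiniteMeasure (volume.restrict (fd Λ)) :=
  ⟨by simpa using volume_fd_lt_top Λ⟩

theorem span_realBasis : Submodule.span ℤ (Set.range (realBasis Λ)) = Λ :=
  (latBasis Λ).ofZLatticeBasis_span ℝ

theorem realBasis_mem (i : Fin 2) : realBasis Λ i ∈ Λ := by
  simp [realBasis]

theorem exists_mem_fd (z : ℂ) : ∃ w ∈ fd Λ, z - w ∈ Λ := by
  refine ⟨ZSpan.fract (realBasis Λ) z, ZSpan.fract_mem_fundamentalDomain _ _, ?_⟩
  rw [ZSpan.fract_apply, sub_sub_cancel]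
  exact (span_realBasis Λ).le (ZSpan.floor (realBasis Λ) z).2

theorem eq_of_mem_fd {z w : ℂ} (hz : z ∈ fd Λ) (hw : w ∈ fd Λ) (h : z - w ∈ Λ) : z = w := by
  rw [← (ZSpan.fract_eq_self (b := realBasis Λ)).2 hz, ← (ZSpan.fract_eq_self (b := realBasis Λ)).2 hw,
    ZSpan.fract_eq_fract, span_realBasis, neg_add_eq_sub]
  simpa using Λ.neg_mem h

/-- A compact set containing the fundamental parallelogram. -/
def fdBall : Set ℂ := closure (fd Λ)

theorem isCompact_fdBall : IsCompact (fdBall Λ) := (isBounded_fd Λ).isCompact_closure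

theorem ae_mem_fdBall : ∀ᵐ z ∂(volume.restrict (fd Λ)), z ∈ fdBall Λ := by
  filter_upwards [ae_restrict_mem (measurableSet_fd Λ)] with z hz using subset_closure hz

open scoped Pointwise in
theorem integral_fd_add {F : Type*} [NormedAddCommGroup F] [NormedSpace ℝ F] {f : ℂ → F}
    (hf : ∀ z, ∀ l ∈ Λ, f (z + l) = f z) (w : ℂ) :
    ∫ z in fd Λ, f (z + w) = ∫ z in fd Λ, f z := by
  have h1 : IsAddFundamentalDomain Λ (w +ᵥ fd Λ) (volume : Measure ℂ) := by
    have : MeasurableVAdd Λ ℂ := (inferInstance : MeasurableVAdd Λ.toAddSubgroup ℂ)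
    have : VAddInvariantMeasure Λ ℂ volume :=
      (inferInstance : VAddInvariantMeasure Λ.toAddSubgroup ℂ volume)
    exact (isAddFundamentalDomain_fd Λ).vadd_of_comm w
  have h2 : ∫ z in fd Λ, f (z + w) = ∫ z in (w +ᵥ fd Λ), f z := by
    have h3 : (w +ᵥ fd Λ) = (fun z => z + w) '' fd Λ := by
      ext z; simp only [Set.mem_vadd_set, vadd_eq_add, Set.mem_image, add_comm]
    rw [h3]
    exact ((measurePreserving_add_right volume w).setIntegral_image_emb
      (measurableEmbedding_addRight w) f (fd Λ)).symm
  rw [h2]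
  have : MeasurableVAdd Λ ℂ := (inferInstance : MeasurableVAdd Λ.toAddSubgroup ℂ)
  have : VAddInvariantMeasure Λ ℂ volume :=
    (inferInstance : VAddInvariantMeasure Λ.toAddSubgroup ℂ volume)
  refine h1.setIntegral_eq (isAddFundamentalDomain_fd Λ) ?_
  intro g x
  have := hf x g g.2
  rw [← this]
  congr 1
  exact add_comm _ _

theorem covolume_eq : covolume Λ =
    |((starRingEnd ℂ) (realBasis Λ 0) * realBasis Λ 1).im| := by
  rw [ZLattice.covolume_eq_det_mul_measureReal Λ volume (latBasis Λ) Complex.basisOneI]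
  have h1 : volume.real (ZSpan.fundamentalDomain Complex.basisOneI) = 1 := by
    rw [measureReal_congr (ZSpan.fundamentalDomain_ae_parallelepiped _ volume),
      ← Complex.toBasis_orthonormalBasisOneI, OrthonormalBasis.coe_toBasis, measureReal_def,
      OrthonormalBasis.volume_parallelepiped]
    simp
  rw [h1, mul_one, Module.Basis.det_apply, Matrix.det_fin_two]
  simp [Module.Basis.toMatrix_apply, realBasis]
  congr 1
  ring

/-- An element is determined by its intersection numbers with the lattice. -/
theorem eq_zero_of_latticeIntersection {w : ℂ} (h : ∀ l ∈ Λ, latticeIntersection Λ w l = 0) :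
    w = 0 := by
  have hA0 : covolume Λ ≠ 0 := covolume_ne_zero Λ volume
  set r := realBasis Λ
  have key : ∀ l : ℂ, ((starRingEnd ℂ) w * l).im = 0 := by
    intro l
    have h0 := h (r 0) (realBasis_mem Λ 0)
    have h1 := h (r 1) (realBasis_mem Λ 1)
    rw [latticeIntersection, div_eq_zero_iff, or_iff_left hA0] at h0 h1
    rw [← r.sum_repr l, Fin.sum_univ_two]
    rw [mul_add, mul_smul_comm, mul_smul_comm, Complex.add_im, Complex.smul_im, Complex.smul_im,
      h0, h1]
    simp
  have h1 := key 1
  have hI := key I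
  apply Complex.ext <;> simp_all

end Lattice

/-! ### Averaging over the action of the elliptic curve -/

section Averaging

variable {Λ : Submodule ℤ ℂ} {X : Type*} [TopologicalSpace X] [ChartedSpace ℂ² X]
  [AddAction (Torus Λ) X]

/-- The map `(y, z) ↦ [z] + H y` attached to a map `H` to `X`. -/
def lift (Λ : Submodule ℤ ℂ) {X : Type*} [AddAction (Torus Λ) X] {V : Type*} (H : V → X) :
    V × ℂ → X :=
  fun p => ⟪p.2⟫[Λ] +ᵥ H p.1

/-- The group acts smoothly on `X`. -/
def SmoothAction (Λ : Submodule ℤ ℂ) (X : Type*) [TopologicalSpace X] [ChartedSpace ℂ² X]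
    [AddAction (Torus Λ) X] : Prop :=
  ContMDiff (𝓘(ℝ, ℂ).prod 𝓘(ℝ, ℂ²)) 𝓘(ℝ, ℂ²) ∞
    (fun p : ℂ × X => ⟪p.1⟫[Λ] +ᵥ p.2)

theorem IsPrincipalBundle.smoothAction {B : Type*} [TopologicalSpace B] [ChartedSpace ℂ B]
    {π : X → B} (h : IsPrincipalBundle Λ π) : SmoothAction Λ X := by
  intro p
  have h1 := h.holomorphic_vadd p
  rw [contMDiffAt_iff] at h1 ⊢
  refine ⟨h1.1, ?_⟩
  have h2 := (h1.2.restrict_scalars ℝ).of_le (m := ∞) le_top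
  exact h2

variable {V W : Type} [NormedAddCommGroup V] [NormedSpace ℝ V] [NormedAddCommGroup W]
  [NormedSpace ℝ W]

theorem SmAt.lift (hact : SmoothAction Λ X) {H : V → X} {y : V} (hH : SmX H y)
    (z : ℂ) : SmX (lift Λ H) (y, z) := by
  have h1 : ∀ᶠ p : V × ℂ in 𝓝 (y, z), ContMDiffAt 𝓘(ℝ, V) 𝓘(ℝ, ℂ²) ∞ H p.1 :=
    continuousAt_fst.eventually hH
  filter_upwards [h1] with p hp
  have h2 : ContMDiffAt 𝓘(ℝ, V × ℂ) (𝓘(ℝ, ℂ).prod 𝓘(ℝ, ℂ²)) ∞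
      (fun p : V × ℂ => (p.2, H p.1)) p := by
    refine ContMDiffAt.prodMk contDiff_snd.contMDiff.contMDiffAt ?_
    exact hp.comp p contDiff_fst.contMDiff.contMDiffAt
  exact (hact (p.2, H p.1)).comp p h2

theorem mk_add_lattice {z l : ℂ} (hl : l ∈ Λ) :
    ⟪z + l⟫[Λ] = QuotientAddGroup.mk z := by
  rw [QuotientAddGroup.eq]
  simpa using hl

theorem lift_add_lattice (H : V → X) (y : V) (z : ℂ) {l : ℂ} (hl : l ∈ Λ) :
    lift Λ H (y, z + l) = lift Λ H (y, z) := by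
  simp only [lift, mk_add_lattice hl]

theorem lift_lift (H : V → X) (p : (V × ℂ) × ℂ) :
    lift Λ (lift Λ H) p = lift Λ H (p.1.1, p.1.2 + p.2) := by
  simp only [lift, vadd_vadd, ← QuotientAddGroup.mk_add]
  rw [add_comm]

theorem lift_zero (H : V → X) (y : V) : lift Λ H (y, 0) = H y := by
  simp [lift]

theorem bilin_ext {B C : V →L[ℝ] V →L[ℝ] ℝ} (h : ∀ v w, B v w = C v w) : B = C :=
  ContinuousLinearMap.ext fun v => ContinuousLinearMap.ext fun w => h v w

theorem TwoForm.val_lift_add_lattice (hact : SmoothAction Λ X) (χ : TwoForm ℂ² X) {H : V → X}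
    {y : V} (hH : SmX H y) (z l : ℂ) (hl : l ∈ Λ) :
    χ.val (lift Λ H) (y, z + l) = χ.val (lift Λ H) (y, z) := by
  have h1 : lift Λ H = fun p => lift Λ H (p.1, p.2 + l) := by
    funext p; rw [lift_add_lattice _ _ _ hl]
  have hg : ContDiff ℝ ∞ (fun p : V × ℂ => (p.1, p.2 + l)) := by fun_prop
  have h2 := χ.natural (H := lift Λ H) (g := fun p : V × ℂ => (p.1, p.2 + l))
    (y := (y, z)) (hH.lift hact _) (SmF.of_contDiff hg _)
  have h3 : fderiv ℝ (fun p : V × ℂ => (p.1, p.2 + l)) (y, z) = ContinuousLinearMap.id ℝ _ := by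
    have : HasFDerivAt (fun p : V × ℂ => (p.1, p.2 + l)) (ContinuousLinearMap.id ℝ (V × ℂ)) (y, z) := by
      have h4 := (hasFDerivAt_id (𝕜 := ℝ) (y, z)).add_const ((0 : V), l)
      convert! h4 using 2 with p
      ext <;> simp
    exact this.fderiv
  rw [h3] at h2
  rw [← h1] at h2
  rw [h2]
  exact bilin_ext fun v w => rfl

/-- The pullback of a form to `V × ℂ`, restricted to the tangent vectors along `V`. -/
theorem TwoForm.val_eq_lift (hact : SmoothAction Λ X) (χ : TwoForm ℂ² X) {H : V → X}
    {y : V} (hH : SmX H y) (v w : V) :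
    χ.val H y v w = χ.val (lift Λ H) (y, 0) (v, 0) (w, 0) := by
  have h1 : H = fun y => lift Λ H (y, 0) := by
    funext y; rw [lift_zero]
  have h2 := χ.natural (H := lift Λ H) (g := fun y : V => (y, (0 : ℂ)))
    (y := y) (hH.lift hact _) (SmF.of_contDiff (by fun_prop) _)
  rw [← h1, (hasFDerivAt_prodMk_left y (0 : ℂ)).fderiv] at h2
  rw [h2]
  simp

variable [DiscreteTopology Λ] [IsZLattice ℝ Λ]

theorem TwoForm.contDiffAt_lift (hact : SmoothAction Λ X) (χ : TwoForm ℂ² X) {H : V → X}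
    {y : V} (hH : SmX H y) (z : ℂ) :
    ContDiffAt ℝ ∞ (χ.val (lift Λ H)) (y, z) :=
  χ.smooth (hH.lift hact z)

/-- The integrand of the average of a form. -/
def avgIntegrand (Λ : Submodule ℤ ℂ) {X : Type*} [TopologicalSpace X] [ChartedSpace ℂ² X]
    [AddAction (Torus Λ) X] (χ : TwoForm ℂ² X) {V : Type} [NormedAddCommGroup V]
    [NormedSpace ℝ V] (H : V → X) (p : V × ℂ) : V →L[ℝ] V →L[ℝ] ℝ :=
  pull2 (χ.val (lift Λ H) p) (inl ℝ V ℂ)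

theorem contDiffAt_avgIntegrand (hact : SmoothAction Λ X) (χ : TwoForm ℂ² X) {H : V → X}
    {y : V} (hH : SmX H y) (z : ℂ) :
    ContDiffAt ℝ ∞ (avgIntegrand Λ χ H) (y, z) :=
  contDiffAt_pull2 (χ.contDiffAt_lift hact hH z) contDiffAt_const

/-- The value of the average of a form. -/
def avgVal (Λ : Submodule ℤ ℂ) [DiscreteTopology Λ] [IsZLattice ℝ Λ] {X : Type*}
    [TopologicalSpace X] [ChartedSpace ℂ² X]
    [AddAction (Torus Λ) X] (χ : TwoForm ℂ² X) {V : Type} [NormedAddCommGroup V]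
    [NormedSpace ℝ V] (H : V → X) (y : V) : V →L[ℝ] V →L[ℝ] ℝ :=
  (covolume Λ)⁻¹ • ∫ z in fd Λ, avgIntegrand Λ χ H (y, z)

theorem integrable_avgIntegrand (hact : SmoothAction Λ X) (χ : TwoForm ℂ² X) {H : V → X}
    {y : V} (hH : SmX H y) :
    Integrable (fun z => avgIntegrand Λ χ H (y, z)) (volume.restrict (fd Λ)) := by
  refine integrable_of_continuousAt (isCompact_fdBall Λ) (ae_mem_fdBall Λ) fun z _ => ?_
  exact (contDiffAt_avgIntegrand hact χ hH z).continuousAt.comp (f := fun z => (y, z)) (by fun_prop)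

theorem avgVal_apply (hact : SmoothAction Λ X) (χ : TwoForm ℂ² X) {H : V → X}
    {y : V} (hH : SmX H y) (v w : V) :
    avgVal Λ χ H y v w = (covolume Λ)⁻¹ *
      ∫ z in fd Λ, χ.val (lift Λ H) (y, z) (v, 0) (w, 0) := by
  have h1 := integrable_avgIntegrand (Λ := Λ) hact χ hH
  rw [avgVal, smul_apply, smul_apply, smul_eq_mul,
    integral_apply h1,
    integral_apply (h1.apply_continuousLinearMap v)]
  rfl

theorem lift_congr {H H' : V → X} {y : V} (h : H =ᶠ[𝓝 y] H') (z : ℂ) :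
    lift Λ H =ᶠ[𝓝 (y, z)] lift Λ H' := by
  have h1 : ∀ᶠ p : V × ℂ in 𝓝 (y, z), H p.1 = H' p.1 :=
    (continuous_fst.tendsto (y, z)).eventually h
  filter_upwards [h1] with p hp
  simp only [lift, hp]

theorem val_lift_comp (hact : SmoothAction Λ X) (χ : TwoForm ℂ² X) {H : W → X} {g : V → W}
    {y : V} (hH : SmX H (g y)) (hg : SmF g y) (z : ℂ) (v w : V × ℂ) :
    χ.val (lift Λ (fun y => H (g y))) (y, z) v w =
      χ.val (lift Λ H) (g y, z) (fderiv ℝ g y v.1, v.2) (fderiv ℝ g y w.1, w.2) := by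
  have hG : SmF (fun p : V × ℂ => (g p.1, p.2)) (y, z) := by
    have h1 : ∀ᶠ p : V × ℂ in 𝓝 (y, z), ContDiffAt ℝ ∞ g p.1 := continuousAt_fst.eventually hg
    filter_upwards [h1] with p hp
    exact (hp.comp p contDiffAt_fst).prodMk contDiffAt_snd
  have h2 := χ.natural (H := lift Λ H) (g := fun p : V × ℂ => (g p.1, p.2))
    (y := (y, z)) (hH.lift hact _) hG
  have h3 : HasFDerivAt (fun p : V × ℂ => (g p.1, p.2)) ((fderiv ℝ g y).prodMap
      (ContinuousLinearMap.id ℝ ℂ)) (y, z) :=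
    hg.differentiableAt.hasFDerivAt.prodMap (y, z) (hasFDerivAt_id z)
  rw [h3.fderiv] at h2
  have h4 : lift Λ (fun y => H (g y)) = fun p : V × ℂ => lift Λ H (g p.1, p.2) := rfl
  rw [h4, h2]
  rfl

/-- The average of a form over the action of the elliptic curve. -/
def TwoForm.avg (hact : SmoothAction Λ X) (χ : TwoForm ℂ² X) : TwoForm ℂ² X where
  val {V} _ _ H y := avgVal Λ χ H y
  congr {V} _ _ {H H' y} hH h := by
    refine bilin_ext fun v w => ?_
    rw [avgVal_apply hact χ hH, avgVal_apply hact χ (hH.congr h)]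
    congr 2
    funext z
    rw [χ.congr (hH.lift hact z) (lift_congr h z)]
  natural {V W} _ _ _ _ {H g y} hH hg := by
    refine bilin_ext fun v w => ?_
    rw [pull2_apply, avgVal_apply hact χ (hH.comp y hg), avgVal_apply hact χ hH]
    congr 2
    funext z
    rw [val_lift_comp hact χ hH hg]
  smooth {V} _ _ {H y} hH := by
    have h1 := contDiffAt_integral (isCompact_fdBall Λ) (ae_mem_fdBall Λ)
      (f := avgIntegrand Λ χ H) fun z _ => contDiffAt_avgIntegrand hact χ hH z
    exact h1.const_smul (covolume Λ)⁻¹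
  skew {V} _ _ {H y} hH v w := by
    rw [avgVal_apply hact χ hH, avgVal_apply hact χ hH, ← mul_neg, ← integral_neg]
    congr 2
    funext z
    exact χ.skew (hH.lift hact z) _ _

theorem TwoForm.avg_apply (hact : SmoothAction Λ X) (χ : TwoForm ℂ² X) {H : V → X}
    {y : V} (hH : SmX H y) (v w : V) :
    (χ.avg hact).val H y v w = (covolume Λ)⁻¹ *
      ∫ z in fd Λ, χ.val (lift Λ H) (y, z) (v, 0) (w, 0) :=
  avgVal_apply hact χ hH v w

theorem TwoForm.fderiv_avg_apply (hact : SmoothAction Λ X) (χ : TwoForm ℂ² X) {H : V → X}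
    {y : V} (hH : SmX H y) (u v w : V) :
    fderiv ℝ ((χ.avg hact).val H) y u v w = (covolume Λ)⁻¹ *
      ∫ z in fd Λ, fderiv ℝ (χ.val (lift Λ H)) (y, z) (u, 0) (v, 0) (w, 0) := by
  have hs : ∀ z ∈ fdBall Λ, ContDiffAt ℝ 1 (avgIntegrand Λ χ H) (y, z) := fun z _ =>
    (contDiffAt_avgIntegrand hact χ hH z).of_le (by exact_mod_cast le_top)
  have h1 := hasFDerivAt_integral_of_contDiffAt (isCompact_fdBall Λ) (ae_mem_fdBall Λ) hs
  have h2 : HasFDerivAt ((χ.avg hact).val H) ((covolume Λ)⁻¹ • ∫ z in fd Λ,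
      (fderiv ℝ (avgIntegrand Λ χ H) (y, z)).comp (inl ℝ V ℂ)) y := by
    have e : (χ.avg hact).val H = fun y => (covolume Λ)⁻¹ •
      ∫ z in fd Λ, avgIntegrand Λ χ H (y, z) := rfl
    rw [e]
    exact h1.fun_const_smul (covolume Λ volume)⁻¹
  have hi : Integrable (fun z => (fderiv ℝ (avgIntegrand Λ χ H) (y, z)).comp
      (inl ℝ V ℂ)) (volume.restrict (fd Λ)) := by
    refine integrable_of_continuousAt (isCompact_fdBall Λ) (ae_mem_fdBall Λ) fun z _ => ?_
    have h3 : ContinuousAt (fderiv ℝ (avgIntegrand Λ χ H)) (y, z) :=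
      ((contDiffAt_avgIntegrand hact χ hH z).fderiv_right (m := 0) (by simp)).continuousAt
    exact (h3.comp (f := fun z => (y, z)) (by fun_prop)).clm_comp continuousAt_const
  rw [h2.fderiv, smul_apply, smul_apply,
    smul_apply, smul_eq_mul,
    integral_apply hi,
    integral_apply (hi.apply_continuousLinearMap u),
    integral_apply
      ((hi.apply_continuousLinearMap u).apply_continuousLinearMap v)]
  congr 2
  funext z
  have h4 : HasFDerivAt (χ.val (lift Λ H))
      (fderiv ℝ (χ.val (lift Λ H)) (y, z)) (y, z) :=
    ((χ.contDiffAt_lift hact hH z).differentiableAt (by simp)).hasFDerivAt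
  have h5 : ∀ v w : V, HasFDerivAt (fun p => avgIntegrand Λ χ H p v w) _ (y, z) := fun v w =>
    (h4.clm_apply (hasFDerivAt_const (v, (0 : ℂ)) (y, z))).clm_apply
      (hasFDerivAt_const (w, (0 : ℂ)) (y, z))
  have h6 : HasFDerivAt (avgIntegrand Λ χ H) (fderiv ℝ (avgIntegrand Λ χ H) (y, z)) (y, z) :=
    ((contDiffAt_avgIntegrand hact χ hH z).differentiableAt (by simp)).hasFDerivAt
  have h7 : HasFDerivAt (fun p => avgIntegrand Λ χ H p v w) _ (y, z) :=
    (h6.clm_apply (hasFDerivAt_const v (y, z))).clm_apply (hasFDerivAt_const w (y, z))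
  have h8 := h7.unique (h5 v w)
  have h9 := congrArg (fun L => L (u, (0 : ℂ))) h8
  simpa using h9

theorem TwoForm.integrable_fderiv_lift (hact : SmoothAction Λ X) (χ : TwoForm ℂ² X)
    {H : V → X} {y : V} (hH : SmX H y) (a b c : V × ℂ) :
    Integrable (fun z => fderiv ℝ (χ.val (lift Λ H)) (y, z) a b c)
      (volume.restrict (fd Λ)) := by
  refine integrable_of_continuousAt (isCompact_fdBall Λ) (ae_mem_fdBall Λ) fun z _ => ?_
  have h3 : ContinuousAt (fderiv ℝ (χ.val (lift Λ H))) (y, z) :=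
    ((χ.contDiffAt_lift hact hH z).fderiv_right (m := 0) (by simp)).continuousAt
  exact (((h3.comp (f := fun z => (y, z)) (by fun_prop)).clm_apply
    continuousAt_const).clm_apply continuousAt_const).clm_apply continuousAt_const

theorem TwoForm.Closed.avg (hact : SmoothAction Λ X) {χ : TwoForm ℂ² X} (hχ : χ.Closed) :
    (χ.avg hact).Closed := by
  intro V _ _ H y hH a b c
  rw [d2, χ.fderiv_avg_apply hact hH, χ.fderiv_avg_apply hact hH, χ.fderiv_avg_apply hact hH,
    ← mul_sub, ← mul_add, ← integral_sub, ← integral_add]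
  · rw [mul_eq_zero]
    right
    rw [← integral_zero ℂ ℝ]
    congr 1
    funext z
    exact hχ (hH.lift hact z) (a, 0) (b, 0) (c, 0)
  · exact (χ.integrable_fderiv_lift hact hH _ _ _).sub (χ.integrable_fderiv_lift hact hH _ _ _)
  all_goals exact χ.integrable_fderiv_lift hact hH _ _ _

/-- A form is invariant under the action of the elliptic curve. -/
def TwoForm.Invariant (Λ : Submodule ℤ ℂ) {X : Type*} [TopologicalSpace X]
    [ChartedSpace ℂ² X] [AddAction (Torus Λ) X] (χ : TwoForm ℂ² X) : Prop :=
  ∀ {V : Type} [NormedAddCommGroup V] [NormedSpace ℝ V] {H : V → X} {y : V},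
    SmX H y → ∀ z, χ.val (lift Λ H) (y, z) = χ.val (lift Λ H) (y, 0)

theorem TwoForm.avg_lift_apply (hact : SmoothAction Λ X) (χ : TwoForm ℂ² X) {H : V → X}
    {y : V} (hH : SmX H y) (z : ℂ) (v w : V × ℂ) :
    (χ.avg hact).val (lift Λ H) (y, z) v w = (covolume Λ)⁻¹ *
      ∫ z in fd Λ, χ.val (lift Λ H) (y, z) v w := by
  rw [χ.avg_apply hact (hH.lift hact z)]
  congr 1
  rw [← integral_fd_add Λ (f := fun z => χ.val (lift Λ H) (y, z) v w)
    (fun z l hl => by rw [χ.val_lift_add_lattice hact hH z l hl]) z]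
  congr 1
  funext z'
  have h1 : lift Λ (lift Λ H) =
      fun p : (V × ℂ) × ℂ => lift Λ H (p.1.1, p.1.2 + p.2) := by
    funext p; exact lift_lift H p
  have h2 := χ.natural (H := lift Λ H)
    (g := fun p : (V × ℂ) × ℂ => (p.1.1, p.1.2 + p.2))
    (y := ((y, z), z')) (hH.lift hact _) (SmF.of_contDiff (by fun_prop) _)
  have h3 : HasFDerivAt (fun p : (V × ℂ) × ℂ => (p.1.1, p.1.2 + p.2))
      ((((fst ℝ V ℂ).comp (fst ℝ (V × ℂ) ℂ))).prod
      (((snd ℝ V ℂ).comp (fst ℝ (V × ℂ) ℂ)) +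
      snd ℝ (V × ℂ) ℂ)) ((y, z), z') := by
    have h4 := ((((fst ℝ V ℂ).comp
      (fst ℝ (V × ℂ) ℂ))).prod
      (((snd ℝ V ℂ).comp (fst ℝ (V × ℂ) ℂ)) +
      snd ℝ (V × ℂ) ℂ)).hasFDerivAt (x := ((y, z), z'))
    exact h4
  rw [h1, h2, h3.fderiv, add_comm z' z]
  simp

theorem TwoForm.invariant_avg (hact : SmoothAction Λ X) (χ : TwoForm ℂ² X) :
    (χ.avg hact).Invariant Λ := by
  intro V _ _ H y hH z
  refine bilin_ext fun v w => ?_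
  rw [χ.avg_lift_apply hact hH, χ.avg_lift_apply hact hH]

end Averaging

section Homotopy

variable {Λ : Submodule ℤ ℂ} [DiscreteTopology Λ] [IsZLattice ℝ Λ]
  {X : Type*} [TopologicalSpace X] [ChartedSpace ℂ² X] [AddAction (Torus Λ) X]
  {V W : Type} [NormedAddCommGroup V] [NormedSpace ℝ V] [NormedAddCommGroup W] [NormedSpace ℝ W]

theorem hasDerivAt_bilin_comp {B : W → V →L[ℝ] V →L[ℝ] ℝ} {B' : W →L[ℝ] V →L[ℝ] V →L[ℝ] ℝ}
    {c : ℝ → W} {c' : W} {t : ℝ} (hB : HasFDerivAt B B' (c t)) (hc : HasDerivAt c c' t) (v w : V) :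
    HasDerivAt (fun t => B (c t) v w) (B' c' v w) t := by
  have h1 : HasDerivAt (fun t => B (c t)) (B' c') t := hB.comp_hasDerivAt t hc
  have h2 := (h1.clm_apply (hasDerivAt_const t v)).clm_apply (hasDerivAt_const t w)
  simpa using h2

variable {V : Type} [NormedAddCommGroup V] [NormedSpace ℝ V]

/-- The integrand of the primitive of `χ.avg - χ`. -/
def homIntegrand (Λ : Submodule ℤ ℂ) {X : Type*} [TopologicalSpace X] [ChartedSpace ℂ² X]
    [AddAction (Torus Λ) X] (χ : TwoForm ℂ² X) (H : V → X) (p : V × (ℂ × ℝ)) : V →L[ℝ] ℝ :=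
  (χ.val (lift Λ H) (p.1, p.2.2 • p.2.1) ((0 : V), p.2.1)).comp (inl ℝ V ℂ)

/-- The parameter space of the homotopy. -/
def homSet (Λ : Submodule ℤ ℂ) [DiscreteTopology Λ] [IsZLattice ℝ Λ] : Set (ℂ × ℝ) :=
  fd Λ ×ˢ Set.Icc (0 : ℝ) 1

theorem measurableSet_homSet : MeasurableSet (homSet Λ) :=
  (measurableSet_fd Λ).prod measurableSet_Icc

theorem isCompact_homBall : IsCompact (fdBall Λ ×ˢ Set.Icc (0 : ℝ) 1) :=
  (isCompact_fdBall Λ).prod isCompact_Icc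

theorem homSet_subset : homSet Λ ⊆ fdBall Λ ×ˢ Set.Icc (0 : ℝ) 1 :=
  Set.prod_mono subset_closure le_rfl

theorem ae_mem_homBall : ∀ᵐ p ∂((volume : Measure (ℂ × ℝ)).restrict (homSet Λ)),
    p ∈ fdBall Λ ×ˢ Set.Icc (0 : ℝ) 1 := by
  filter_upwards [ae_restrict_mem measurableSet_homSet] with z hz using homSet_subset hz

instance : IsFiniteMeasure ((volume : Measure (ℂ × ℝ)).restrict (homSet Λ)) :=
  ⟨by simpa using lt_of_le_of_lt (measure_mono homSet_subset) isCompact_homBall.measure_lt_top⟩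

theorem contDiffAt_homIntegrand (hact : SmoothAction Λ X) (χ : TwoForm ℂ² X) {H : V → X}
    {y : V} (hH : SmX H y) (p : ℂ × ℝ) :
    ContDiffAt ℝ ∞ (homIntegrand Λ χ H) (y, p) := by
  have h1 : ContDiffAt ℝ ∞ (fun p : V × (ℂ × ℝ) => χ.val (lift Λ H) (p.1, p.2.2 • p.2.1))
      (y, p) := by
    refine ContDiffAt.comp (y, p) (f := fun p : V × (ℂ × ℝ) => (p.1, p.2.2 • p.2.1))
      (χ.contDiffAt_lift hact hH (p.2 • p.1)) ?_
    fun_prop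
  have h2 : ContDiffAt ℝ ∞ (fun p : V × (ℂ × ℝ) => ((0 : V), p.2.1)) (y, p) := by fun_prop
  exact (h1.clm_apply h2).clm_comp contDiffAt_const

theorem integrable_homIntegrand (hact : SmoothAction Λ X) (χ : TwoForm ℂ² X) {H : V → X}
    {y : V} (hH : SmX H y) :
    Integrable (fun p => homIntegrand Λ χ H (y, p)) (volume.restrict (homSet Λ)) := by
  refine integrable_of_continuousAt isCompact_homBall ae_mem_homBall fun z _ => ?_
  exact (contDiffAt_homIntegrand hact χ hH z).continuousAt.comp (f := fun z => (y, z)) (by fun_prop)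

/-- The value of the primitive of `χ.avg - χ`. -/
def homVal (Λ : Submodule ℤ ℂ) [DiscreteTopology Λ] [IsZLattice ℝ Λ] {X : Type*}
    [TopologicalSpace X] [ChartedSpace ℂ² X]
    [AddAction (Torus Λ) X] (χ : TwoForm ℂ² X) (H : V → X) (y : V) : V →L[ℝ] ℝ :=
  (covolume Λ)⁻¹ • ∫ p in homSet Λ, homIntegrand Λ χ H (y, p)

theorem homVal_apply (hact : SmoothAction Λ X) (χ : TwoForm ℂ² X) {H : V → X}
    {y : V} (hH : SmX H y) (v : V) :
    homVal Λ χ H y v = (covolume Λ)⁻¹ *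
      ∫ p in homSet Λ, χ.val (lift Λ H) (y, p.2 • p.1) ((0 : V), p.1) (v, 0) := by
  have h1 := integrable_homIntegrand (Λ := Λ) hact χ hH
  rw [homVal, smul_apply, smul_eq_mul, integral_apply h1]
  rfl

/-- The primitive of the difference of the average of a closed form and the form itself. -/
def TwoForm.hom (hact : SmoothAction Λ X) (χ : TwoForm ℂ² X) : OneForm ℂ² X ℝ where
  val {V} _ _ H y := homVal Λ χ H y
  congr {V} _ _ {H H' y} hH h := by
    refine ContinuousLinearMap.ext fun v => ?_
    rw [homVal_apply hact χ hH, homVal_apply hact χ (hH.congr h)]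
    congr 2
    funext p
    rw [χ.congr (hH.lift hact _) (lift_congr h _)]
  natural {V W} _ _ _ _ {H g y} hH hg := by
    refine ContinuousLinearMap.ext fun v => ?_
    rw [ContinuousLinearMap.comp_apply, homVal_apply hact χ (hH.comp y hg),
      homVal_apply hact χ hH]
    congr 2
    funext z
    rw [val_lift_comp hact χ hH hg]
    simp
  smooth {V} _ _ {H y} hH := by
    have h1 := contDiffAt_integral isCompact_homBall (ae_mem_homBall (Λ := Λ))
      (f := homIntegrand Λ χ H) fun z _ => contDiffAt_homIntegrand hact χ hH z
    exact h1.const_smul (covolume Λ)⁻¹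

theorem TwoForm.fderiv_hom_apply (hact : SmoothAction Λ X) (χ : TwoForm ℂ² X) {H : V → X}
    {y : V} (hH : SmX H y) (u v : V) :
    Integrable (fun p : ℂ × ℝ => fderiv ℝ (χ.val (lift Λ H)) (y, p.2 • p.1)
        (u, 0) (0, p.1) (v, 0)) (volume.restrict (homSet Λ)) ∧
    fderiv ℝ ((χ.hom hact).val H) y u v = (covolume Λ)⁻¹ *
      ∫ p in homSet Λ, fderiv ℝ (χ.val (lift Λ H)) (y, p.2 • p.1)
        (u, 0) (0, p.1) (v, 0) := by
  have hs : ∀ z ∈ fdBall Λ ×ˢ Set.Icc (0 : ℝ) 1, ContDiffAt ℝ 1 (homIntegrand Λ χ H) (y, z) :=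
    fun z _ => (contDiffAt_homIntegrand hact χ hH z).of_le (by exact_mod_cast le_top)
  have h1 := hasFDerivAt_integral_of_contDiffAt isCompact_homBall (ae_mem_homBall (Λ := Λ)) hs
  have h2 : HasFDerivAt ((χ.hom hact).val H) ((covolume Λ)⁻¹ • ∫ z in homSet Λ,
      (fderiv ℝ (homIntegrand Λ χ H) (y, z)).comp (inl ℝ V (ℂ × ℝ))) y := by
    have e : (χ.hom hact).val H = fun y => (covolume Λ)⁻¹ •
      ∫ z in homSet Λ, homIntegrand Λ χ H (y, z) := rfl
    rw [e]
    exact h1.fun_const_smul (covolume Λ volume)⁻¹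
  have hi : Integrable (fun z => (fderiv ℝ (homIntegrand Λ χ H) (y, z)).comp
      (inl ℝ V (ℂ × ℝ))) (volume.restrict (homSet Λ)) := by
    refine integrable_of_continuousAt isCompact_homBall ae_mem_homBall fun z _ => ?_
    have h3 : ContinuousAt (fderiv ℝ (homIntegrand Λ χ H)) (y, z) :=
      ((contDiffAt_homIntegrand hact χ hH z).fderiv_right (m := 0) (by simp)).continuousAt
    exact (h3.comp (f := fun z => (y, z)) (by fun_prop)).clm_comp continuousAt_const
  have key : ∀ z : ℂ × ℝ, (fderiv ℝ (homIntegrand Λ χ H) (y, z)).comp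
      (inl ℝ V (ℂ × ℝ)) u v =
      fderiv ℝ (χ.val (lift Λ H)) (y, z.2 • z.1) (u, 0) (0, z.1) (v, 0) := by
    intro z
    have h4 : HasFDerivAt (χ.val (lift Λ H))
        (fderiv ℝ (χ.val (lift Λ H)) (y, z.2 • z.1)) (y, z.2 • z.1) :=
      ((χ.contDiffAt_lift hact hH _).differentiableAt (by simp)).hasFDerivAt
    have h5 : HasFDerivAt (fun x : V => χ.val (lift Λ H) (x, z.2 • z.1)
        ((0 : V), z.1) (v, (0 : ℂ))) _ y :=
      ((h4.comp y (hasFDerivAt_prodMk_left y (z.2 • z.1))).clm_apply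
        (hasFDerivAt_const ((0 : V), z.1) y)).clm_apply (hasFDerivAt_const (v, (0 : ℂ)) y)
    have h6 : HasFDerivAt (homIntegrand Λ χ H) (fderiv ℝ (homIntegrand Λ χ H) (y, z)) (y, z) :=
      ((contDiffAt_homIntegrand hact χ hH z).differentiableAt (by simp)).hasFDerivAt
    have h7 : HasFDerivAt (fun x : V => homIntegrand Λ χ H (x, z) v) _ y :=
      (HasFDerivAt.comp (g := homIntegrand Λ χ H) (f := fun x => (x, z)) y h6
        (hasFDerivAt_prodMk_left y z)).clm_apply (hasFDerivAt_const v y)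
    have h8 := h7.unique h5
    have h9 := congrArg (fun L => L u) h8
    simpa using h9
  refine ⟨((hi.apply_continuousLinearMap u).apply_continuousLinearMap v).congr
    (Filter.Eventually.of_forall key), ?_⟩
  rw [h2.fderiv, smul_apply, smul_apply, smul_eq_mul,
    integral_apply hi,
    integral_apply (hi.apply_continuousLinearMap u)]
  congr 2
  funext z
  exact key z

/-- Cartan's formula: a closed form is cohomologous to its average. -/
theorem TwoForm.Closed.avg_cohomologous (hact : SmoothAction Λ X) {χ : TwoForm ℂ² X}
    (hχ : χ.Closed) : (χ.avg hact).CohomologousVia χ (χ.hom hact) := by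
  intro V _ _ H y hH v v'
  have hA : covolume Λ ≠ 0 := covolume_ne_zero Λ volume
  obtain ⟨i1, e1⟩ := χ.fderiv_hom_apply hact hH v v'
  obtain ⟨i2, e2⟩ := χ.fderiv_hom_apply hact hH v' v
  set f : ℂ → ℝ := fun z => χ.val (lift Λ H) (y, z) (v, 0) (v', 0) with hf
  have hder : ∀ (w : ℂ) (t : ℝ), HasDerivAt (fun t : ℝ => f (t • w))
      (fderiv ℝ (χ.val (lift Λ H)) (y, t • w) (0, w) (v, 0) (v', 0)) t := by
    intro w t
    have h4 : HasFDerivAt (χ.val (lift Λ H))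
        (fderiv ℝ (χ.val (lift Λ H)) (y, t • w)) (y, t • w) :=
      ((χ.contDiffAt_lift hact hH _).differentiableAt (by simp)).hasFDerivAt
    have h5 : HasDerivAt (fun t : ℝ => (y, t • w)) ((0 : V), w) t := by
      have := (hasDerivAt_id t).smul_const w
      simpa using (hasDerivAt_const t y).prodMk this
    exact hasDerivAt_bilin_comp h4 h5 _ _
  have hcl : ∀ (w : ℂ) (t : ℝ),
      fderiv ℝ (χ.val (lift Λ H)) (y, t • w) (0, w) (v, 0) (v', 0) =
      fderiv ℝ (χ.val (lift Λ H)) (y, t • w) (v, 0) (0, w) (v', 0) -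
      fderiv ℝ (χ.val (lift Λ H)) (y, t • w) (v', 0) (0, w) (v, 0) := by
    intro w t
    have := hχ (hH.lift hact (t • w)) ((0 : V), w) (v, (0 : ℂ)) (v', (0 : ℂ))
    rw [d2] at this
    linarith
  have hi : Integrable f (volume.restrict (fd Λ)) := by
    refine integrable_of_continuousAt (isCompact_fdBall Λ) (ae_mem_fdBall Λ) fun z _ => ?_
    exact (((χ.contDiffAt_lift hact hH z).continuousAt.comp (f := fun z => (y, z))
      (by fun_prop)).clm_apply continuousAt_const).clm_apply continuousAt_const
  have hi2 := i1.sub i2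
  have hint : ∫ w in fd Λ, (f w - f 0) = ∫ p in homSet Λ,
      ((fderiv ℝ (χ.val (lift Λ H)) (y, p.2 • p.1) (v, 0) (0, p.1) (v', 0)) -
      (fderiv ℝ (χ.val (lift Λ H)) (y, p.2 • p.1) (v', 0) (0, p.1) (v, 0))) := by
    refine Eq.trans ?_ (setIntegral_prod _ hi2).symm
    congr 1
    funext w
    rw [integral_Icc_eq_integral_Ioc, ← intervalIntegral.integral_of_le zero_le_one]
    have hcont : Continuous (fun t : ℝ =>
        fderiv ℝ (χ.val (lift Λ H)) (y, t • w) (0, w) (v, 0) (v', 0)) := by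
      rw [continuous_iff_continuousAt]
      intro t
      have h3 : ContinuousAt (fderiv ℝ (χ.val (lift Λ H))) (y, t • w) :=
        ((χ.contDiffAt_lift hact hH _).fderiv_right (m := 0) (by simp)).continuousAt
      exact (((h3.comp (f := fun t : ℝ => (y, t • w)) (by fun_prop)).clm_apply
        continuousAt_const).clm_apply continuousAt_const).clm_apply continuousAt_const
    have := intervalIntegral.integral_eq_sub_of_hasDerivAt (a := 0) (b := 1)
      (fun t _ => hder w t) (hcont.intervalIntegrable _ _)
    simp only [one_smul, zero_smul] at this
    rw [← this]
    congr 1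
    funext t
    exact hcl w t
  rw [d1, e1, e2, ← mul_sub, ← integral_sub i1 i2, ← hint, χ.avg_apply hact hH,
    χ.val_eq_lift hact hH, integral_sub hi (integrable_const _), setIntegral_const,
    volume_real_fd, smul_eq_mul]
  simp only [hf]
  field_simp
  ring

end Homotopy

section Mu

variable {Λ : Submodule ℤ ℂ} [DiscreteTopology Λ] [IsZLattice ℝ Λ]
  {X : Type*} [TopologicalSpace X] [ChartedSpace ℂ² X] [AddAction (Torus Λ) X]
  {V W : Type} [NormedAddCommGroup V] [NormedSpace ℝ V] [NormedAddCommGroup W] [NormedSpace ℝ W]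

/-- The value of the complex 1-form attached to an invariant 2-form by contraction with the
vertical vector fields. -/
def muVal (Λ : Submodule ℤ ℂ) {X : Type*} [TopologicalSpace X] [ChartedSpace ℂ² X]
    [AddAction (Torus Λ) X] (χ : TwoForm ℂ² X) {V : Type} [NormedAddCommGroup V]
    [NormedSpace ℝ V] (H : V → X) (y : V) : V →L[ℝ] ℂ :=
  covolume Λ •
    (I • Complex.ofRealCLM.comp ((χ.val (lift Λ H) (y, 0) ((0 : V), (1 : ℂ))).comp
      (inl ℝ V ℂ)) -
    Complex.ofRealCLM.comp ((χ.val (lift Λ H) (y, 0) ((0 : V), I)).comp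
      (inl ℝ V ℂ)))

theorem muVal_apply (χ : TwoForm ℂ² X) (H : V → X) (y v : V) :
    muVal Λ χ H y v = (covolume Λ : ℂ) *
      (I * (χ.val (lift Λ H) (y, 0) ((0 : V), (1 : ℂ)) (v, 0) : ℝ) -
        (χ.val (lift Λ H) (y, 0) ((0 : V), I) (v, 0) : ℝ)) := by
  simp [muVal]

/-- The complex 1-form attached to an invariant 2-form by contraction with the vertical vector
fields. -/
def TwoForm.mu (hact : SmoothAction Λ X) (χ : TwoForm ℂ² X) : OneForm ℂ² X ℂ where
  val {V} _ _ H y := muVal Λ χ H y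
  congr {V} _ _ {H H' y} hH h := by
    refine ContinuousLinearMap.ext fun v => ?_
    rw [muVal_apply, muVal_apply, χ.congr (hH.lift hact _) (lift_congr h _)]
  natural {V W} _ _ _ _ {H g y} hH hg := by
    refine ContinuousLinearMap.ext fun v => ?_
    rw [ContinuousLinearMap.comp_apply, muVal_apply, muVal_apply, val_lift_comp hact χ hH hg,
      val_lift_comp hact χ hH hg]
    simp
  smooth {V} _ _ {H y} hH := by
    have h1 : ContDiffAt ℝ ∞ (fun x : V => χ.val (lift Λ H) (x, 0)) y :=
      (χ.contDiffAt_lift hact hH 0).comp y (f := fun x : V => (x, (0 : ℂ))) (by fun_prop)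
    have h2 : ∀ w : ℂ, ContDiffAt ℝ ∞ (fun x : V => Complex.ofRealCLM.comp
        ((χ.val (lift Λ H) (x, 0) ((0 : V), w)).comp
          (inl ℝ V ℂ))) y := fun w =>
      contDiffAt_const.clm_comp ((h1.clm_apply contDiffAt_const).clm_comp contDiffAt_const)
    exact (((h2 1).const_smul I).sub (h2 I)).const_smul (covolume Λ)

theorem TwoForm.mu_apply (hact : SmoothAction Λ X) (χ : TwoForm ℂ² X) (H : V → X) (y v : V) :
    (χ.mu hact).val H y v = (covolume Λ : ℂ) *
      (I * (χ.val (lift Λ H) (y, 0) ((0 : V), (1 : ℂ)) (v, 0) : ℝ) -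
        (χ.val (lift Λ H) (y, 0) ((0 : V), I) (v, 0) : ℝ)) :=
  muVal_apply χ H y v

/-- The form is recovered from the contraction. -/
theorem TwoForm.latticeIntersection_mu (hact : SmoothAction Λ X) (χ : TwoForm ℂ² X)
    {H : V → X} {y : V} (hH : SmX H y) (v : V) (w : ℂ) :
    latticeIntersection Λ ((χ.mu hact).val H y v) w =
      χ.val (lift Λ H) (y, 0) (v, 0) (0, w) := by
  have hA : covolume Λ ≠ 0 := covolume_ne_zero Λ volume
  rw [χ.skew (hH.lift hact 0), χ.mu_apply, latticeIntersection, div_eq_iff hA]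
  have h1 : ((0 : V), w) = w.re • ((0 : V), (1 : ℂ)) + w.im • ((0 : V), I) := by
    ext <;> simp
  rw [h1, map_add, map_smul, map_smul]
  simp
  ring

theorem TwoForm.fderiv_vertical_eq_zero (hact : SmoothAction Λ X) {χ : TwoForm ℂ² X}
    (hi : χ.Invariant Λ) {H : V → X} {y : V} (hH : SmX H y) (z w : ℂ) :
    fderiv ℝ (χ.val (lift Λ H)) (y, z) ((0 : V), w) = 0 := by
  have h4 : HasFDerivAt (χ.val (lift Λ H))
      (fderiv ℝ (χ.val (lift Λ H)) (y, z)) (y, z) :=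
    ((χ.contDiffAt_lift hact hH _).differentiableAt (by simp)).hasFDerivAt
  have h5 := h4.comp z (hasFDerivAt_prodMk_right y z)
  have h6 : (χ.val (lift Λ H) ∘ fun z => (y, z)) =
      fun _ => χ.val (lift Λ H) (y, 0) := by
    funext z
    exact hi hH z
  rw [h6] at h5
  have h7 := congrArg (fun L => L w) (h5.unique (hasFDerivAt_const _ z))
  simpa using h7

theorem TwoForm.fderiv_mu_apply (hact : SmoothAction Λ X) (χ : TwoForm ℂ² X)
    {H : V → X} {y : V} (hH : SmX H y) (u v : V) :
    fderiv ℝ ((χ.mu hact).val H) y u v = (covolume Λ : ℂ) *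
      (I * (fderiv ℝ (χ.val (lift Λ H)) (y, 0) (u, 0)
          ((0 : V), (1 : ℂ)) (v, 0) : ℝ) -
        (fderiv ℝ (χ.val (lift Λ H)) (y, 0) (u, 0)
          ((0 : V), I) (v, 0) : ℝ)) := by
  have hc : HasDerivAt (fun t : ℝ => y + t • u) u 0 := by
    simpa using ((hasDerivAt_id (0 : ℝ)).smul_const u).const_add y
  have hc2 : HasDerivAt (fun t : ℝ => (y + t • u, (0 : ℂ))) (u, 0) 0 :=
    hc.prodMk (hasDerivAt_const 0 0)
  have h0 : y + (0 : ℝ) • u = y := by simp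
  have h4 : HasFDerivAt (χ.val (lift Λ H))
      (fderiv ℝ (χ.val (lift Λ H)) (y, 0)) (y + (0 : ℝ) • u, 0) := by
    rw [h0]
    exact ((χ.contDiffAt_lift hact hH _).differentiableAt (by simp)).hasFDerivAt
  have h5 : ∀ w : ℂ, HasDerivAt (fun t : ℝ =>
      ((χ.val (lift Λ H) (y + t • u, 0) ((0 : V), w) (v, 0) : ℝ) : ℂ))
      ((fderiv ℝ (χ.val (lift Λ H)) (y, 0) (u, 0) (0, w) (v, 0) : ℝ) : ℂ) 0 :=
    fun w => (hasDerivAt_bilin_comp h4 hc2 _ _).ofReal_comp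
  have h6 : HasFDerivAt ((χ.mu hact).val H) (fderiv ℝ ((χ.mu hact).val H) y)
      (y + (0 : ℝ) • u) := by
    rw [h0]
    exact (((χ.mu hact).smooth hH).differentiableAt (by simp)).hasFDerivAt
  have h7 : HasDerivAt (fun t : ℝ => (χ.mu hact).val H (y + t • u))
      (fderiv ℝ ((χ.mu hact).val H) y u) 0 := h6.comp_hasDerivAt (0 : ℝ) hc
  have h8 := h7.clm_apply (hasDerivAt_const (0 : ℝ) v)
  rw [map_zero, add_zero] at h8
  simp only [χ.mu_apply] at h8
  refine h8.unique ?_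
  exact (((h5 1).const_mul I).sub (h5 I)).const_mul _

theorem TwoForm.closed_mu (hact : SmoothAction Λ X) {χ : TwoForm ℂ² X} (hχ : χ.Closed)
    (hi : χ.Invariant Λ) : (χ.mu hact).Closed := by
  intro V _ _ H y hH v w
  have key : ∀ z : ℂ, fderiv ℝ (χ.val (lift Λ H)) (y, 0) (v, 0)
      ((0 : V), z) (w, 0) = fderiv ℝ (χ.val (lift Λ H)) (y, 0) (w, 0)
      ((0 : V), z) (v, 0) := by
    intro z
    have := hχ (hH.lift hact 0) ((0 : V), z) (v, (0 : ℂ)) (w, (0 : ℂ))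
    rw [d2, TwoForm.fderiv_vertical_eq_zero hact hi hH] at this
    simp at this
    linarith
  rw [d1, χ.fderiv_mu_apply hact hH, χ.fderiv_mu_apply hact hH, key, key, sub_self]

/-- The integral of an invariant 2-form over the fibre through `x`. -/
def TwoForm.fib (Λ : Submodule ℤ ℂ) {X : Type*} [TopologicalSpace X] [ChartedSpace ℂ² X]
    [AddAction (Torus Λ) X] (χ : TwoForm ℂ² X) (x : X) : ℝ :=
  covolume Λ * χ.val (fun z : ℂ => ⟪z⟫[Λ] +ᵥ x) 0 1 I

theorem TwoForm.fib_comp (hact : SmoothAction Λ X) (χ : TwoForm ℂ² X)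
    {H : V → X} {y : V} (hH : SmX H y) :
    χ.fib Λ (H y) = covolume Λ *
      χ.val (lift Λ H) (y, 0) (0, 1) (0, I) := by
  have h2 := χ.natural (H := lift Λ H) (g := fun z : ℂ => (y, z))
    (y := (0 : ℂ)) (hH.lift hact _) (SmF.of_contDiff (by fun_prop) _)
  rw [(hasFDerivAt_prodMk_right y (0 : ℂ)).fderiv] at h2
  rw [TwoForm.fib]
  have h3 : (fun z : ℂ => ⟪z⟫[Λ] +ᵥ H y) =
    fun z => lift Λ H (y, z) := rfl
  rw [h3, h2]
  simp

theorem TwoForm.hasFDerivAt_fib (hact : SmoothAction Λ X) {χ : TwoForm ℂ² X} (hχ : χ.Closed)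
    (hi : χ.Invariant Λ) {H : V → X} {y : V} (hH : SmX H y) :
    HasFDerivAt (fun y => χ.fib Λ (H y)) (0 : V →L[ℝ] ℝ) y := by
  have h4 : HasFDerivAt (χ.val (lift Λ H))
      (fderiv ℝ (χ.val (lift Λ H)) (y, 0)) (y, 0) :=
    ((χ.contDiffAt_lift hact hH _).differentiableAt (by simp)).hasFDerivAt
  have h5 := HasFDerivAt.comp (g := χ.val (lift Λ H))
    (f := fun y => (y, (0 : ℂ))) y h4 (hasFDerivAt_prodMk_left y (0 : ℂ))
  have h6 := ((h5.clm_apply (hasFDerivAt_const ((0 : V), (1 : ℂ)) y)).clm_apply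
    (hasFDerivAt_const ((0 : V), I) y)).const_mul (covolume Λ)
  have h7 : (fun y => χ.fib Λ (H y)) =ᶠ[𝓝 y] fun y => covolume Λ *
      χ.val (lift Λ H) (y, 0) (0, 1) (0, I) := by
    filter_upwards [hH.eventually] with z hz
    exact χ.fib_comp hact hz
  refine (h6.congr_of_eventuallyEq h7).congr_fderiv ?_
  refine ContinuousLinearMap.ext fun v => ?_
  have := hχ (hH.lift hact 0) (v, (0 : ℂ)) ((0 : V), (1 : ℂ)) ((0 : V), I)
  rw [d2, TwoForm.fderiv_vertical_eq_zero hact hi hH,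
    TwoForm.fderiv_vertical_eq_zero hact hi hH] at this
  simp at this
  simp [this]

variable [IsManifold 𝓘(ℝ, ℂ²) ∞ X]

theorem TwoForm.isLocallyConstant_fib (hact : SmoothAction Λ X) {χ : TwoForm ℂ² X}
    (hχ : χ.Closed) (hi : χ.Invariant Λ) : IsLocallyConstant (χ.fib Λ) := by
  rw [IsLocallyConstant.iff_eventually_eq]
  intro x
  set e := chartAt ℂ² x
  have he : e ∈ atlas ℂ² X := chart_mem_atlas _ _
  have hx : x ∈ e.source := mem_chart_source _ _
  obtain ⟨r, hr, hb⟩ := Metric.isOpen_iff.1 e.open_target _ (e.map_source hx)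
  have hz : ∀ y ∈ Metric.ball (e x) r, HasFDerivAt (fun y => χ.fib Λ (e.symm y))
      (0 : ℂ² →L[ℝ] ℝ) y := fun y hy =>
    TwoForm.hasFDerivAt_fib hact hχ hi (smAt_chart_symm he (hb hy))
  have hconst : ∀ y ∈ Metric.ball (e x) r, χ.fib Λ (e.symm y) = χ.fib Λ (e.symm (e x)) := by
    intro y hy
    refine (convex_ball (e x) r).is_const_of_fderivWithin_eq_zero (𝕜 := ℝ)
      (f := fun y => χ.fib Λ (e.symm y))
      (fun y hy => (hz y hy).differentiableAt.differentiableWithinAt) (fun y hy => ?_) hy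
      (Metric.mem_ball_self hr)
    rw [fderivWithin_of_isOpen Metric.isOpen_ball hy, (hz y hy).fderiv]
  have h1 : ∀ᶠ x' in 𝓝 x, x' ∈ e.source ∧ e x' ∈ Metric.ball (e x) r :=
    (e.open_source.mem_nhds hx |> Filter.eventually_mem_set.2).and
      ((e.continuousAt hx).eventually (Metric.ball_mem_nhds _ hr))
  filter_upwards [h1] with x' hx'
  have := hconst _ hx'.2
  rwa [e.left_inv hx'.1, e.left_inv hx] at this

theorem TwoForm.fib_eq [PreconnectedSpace X] (hact : SmoothAction Λ X) {χ : TwoForm ℂ² X}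
    (hχ : χ.Closed) (hi : χ.Invariant Λ) (x x' : X) : χ.fib Λ x = χ.fib Λ x' :=
  (TwoForm.isLocallyConstant_fib hact hχ hi).apply_eq_of_preconnectedSpace x x'

theorem TwoForm.mu_lift (hact : SmoothAction Λ X) {χ : TwoForm ℂ² X}
    (hi : χ.Invariant Λ) {H : V → X} {y : V} (hH : SmX H y) (z w : ℂ) (v : V) :
    (χ.mu hact).val (lift Λ H) (y, z) (v, w) =
      (χ.mu hact).val H y v + χ.fib Λ (H y) * w := by
  have h1 : lift Λ (lift Λ H) =
      fun p : (V × ℂ) × ℂ => lift Λ H (p.1.1, p.1.2 + p.2) := by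
    funext p; exact lift_lift H p
  have h2 := χ.natural (H := lift Λ H)
    (g := fun p : (V × ℂ) × ℂ => (p.1.1, p.1.2 + p.2))
    (y := ((y, z), 0)) (hH.lift hact _) (SmF.of_contDiff (by fun_prop) _)
  have h3 : HasFDerivAt (fun p : (V × ℂ) × ℂ => (p.1.1, p.1.2 + p.2))
      ((((fst ℝ V ℂ).comp (fst ℝ (V × ℂ) ℂ))).prod
      (((snd ℝ V ℂ).comp (fst ℝ (V × ℂ) ℂ)) +
      snd ℝ (V × ℂ) ℂ)) ((y, z), 0) := by
    have h4 := ((((fst ℝ V ℂ).comp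
      (fst ℝ (V × ℂ) ℂ))).prod
      (((snd ℝ V ℂ).comp (fst ℝ (V × ℂ) ℂ)) +
      snd ℝ (V × ℂ) ℂ)).hasFDerivAt (x := ((y, z), (0 : ℂ)))
    exact h4
  have hsk : ∀ v, χ.val (lift Λ H) (y, 0) v v = 0 := by
    intro v
    have := χ.skew (hH.lift hact 0) v v
    linarith
  rw [χ.mu_apply, χ.mu_apply, h1, h2, h3.fderiv, χ.fib_comp hact hH]
  simp only [add_zero]
  rw [hi hH z]
  have e1 : ((v, w) : V × ℂ) = (v, 0) + (w.re • ((0 : V), (1 : ℂ)) + w.im • ((0 : V), I)) := by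
    ext <;> simp
  have e2 := χ.skew (hH.lift hact 0) ((0 : V), I) ((0 : V), (1 : ℂ))
  simp only [pull2_apply, ContinuousLinearMap.prod_apply, ContinuousLinearMap.comp_apply,
    ContinuousLinearMap.coe_fst', add_apply, ContinuousLinearMap.coe_snd',
    add_zero, zero_add, Prod.fst_zero, Prod.snd_zero]
  rw [e1]
  simp only [map_add, map_smul, hsk, e2, smul_eq_mul, mul_zero, zero_add, add_zero]
  apply Complex.ext <;> simp <;> ring

end Mu

/-! ### Differential forms of top degree -/

section Wedge

/-- The standard real basis of `ℂ²`. -/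
def stdBasis : Module.Basis (Fin 4) ℝ ℂ² :=
  (Complex.basisOneI.prod Complex.basisOneI).reindex finSumFinEquiv

theorem stdBasis_eq : ⇑stdBasis = ![((1 : ℂ), (0 : ℂ)), (I, 0), (0, 1), (0, I)] := by
  have h0 : finSumFinEquiv.symm (0 : Fin (2 + 2)) = Sum.inl (0 : Fin 2) := by decide
  have h1 : finSumFinEquiv.symm (1 : Fin (2 + 2)) = Sum.inl (1 : Fin 2) := by decide
  have h2 : finSumFinEquiv.symm (2 : Fin (2 + 2)) = Sum.inr (0 : Fin 2) := by decide
  have h3 : finSumFinEquiv.symm (3 : Fin (2 + 2)) = Sum.inr (1 : Fin 2) := by decide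
  funext i
  have hi : i = 0 ∨ i = 1 ∨ i = 2 ∨ i = 3 := by omega
  rcases hi with rfl | rfl | rfl | rfl <;> rw [stdBasis, Module.Basis.reindex_apply]
  · rw [h0]; simp
  · rw [h1]; simp
  · rw [h2]; simp
  · rw [h3]; simp

/-- The wedge product of two bilinear forms on four vectors. -/
def wedgeVal (A B : ℂ² →L[ℝ] ℂ² →L[ℝ] ℝ) (a b c d : ℂ²) : ℝ :=
  A a b * B c d - A a c * B b d + A a d * B b c + A b c * B a d - A b d * B a c + A c d * B a b

/-- The density of the wedge product of two bilinear forms. -/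
def wdens (A B : ℂ² →L[ℝ] ℂ² →L[ℝ] ℝ) : ℝ :=
  wedgeVal A B (1, 0) (I, 0) (0, 1) (0, I)

/-- The wedge product of two skew bilinear forms as an alternating map. -/
def wedgeAlt (A B : ℂ² →L[ℝ] ℂ² →L[ℝ] ℝ) (hA : ∀ v w, A v w = - A w v)
    (hB : ∀ v w, B v w = - B w v) : ℂ² [⋀^Fin 4]→ₗ[ℝ] ℝ where
  toFun v := wedgeVal A B (v 0) (v 1) (v 2) (v 3)
  map_update_add' {inst} v i x y := by
    obtain rfl : inst = instDecidableEqFin 4 := Subsingleton.elim _ _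
    have hi : i = 0 ∨ i = 1 ∨ i = 2 ∨ i = 3 := by omega
    rcases hi with rfl | rfl | rfl | rfl <;> simp [wedgeVal] <;> ring
  map_update_smul' {inst} v i x y := by
    obtain rfl : inst = instDecidableEqFin 4 := Subsingleton.elim _ _
    have hi : i = 0 ∨ i = 1 ∨ i = 2 ∨ i = 3 := by omega
    rcases hi with rfl | rfl | rfl | rfl <;> simp [wedgeVal] <;> ring
  map_eq_zero_of_eq' v i j h hij := by
    have hA0 : ∀ v, A v v = 0 := fun v => by linarith [hA v v]
    have hB0 : ∀ v, B v v = 0 := fun v => by linarith [hB v v]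
    have key : ∀ a b c : ℂ², wedgeVal A B a a b c = 0 ∧ wedgeVal A B a b a c = 0 ∧
        wedgeVal A B a b c a = 0 ∧ wedgeVal A B a b b c = 0 ∧ wedgeVal A B a b c b = 0 ∧
        wedgeVal A B a b c c = 0 := by
      intro a b c
      simp only [wedgeVal, hA0, hB0]
      rw [hA b a, hB b a, hA c a, hB c a, hA c b, hB c b]
      refine ⟨?_, ?_, ?_, ?_, ?_, ?_⟩ <;> ring
    fin_cases i <;> fin_cases j <;> simp at h hij ⊢
    · rw [h]; exact (key _ _ _).1
    · rw [h]; exact (key _ _ _).2.1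
    · rw [h]; exact (key _ _ _).2.2.1
    · rw [h]; exact (key _ _ _).1
    · rw [h]; exact (key _ _ _).2.2.2.1
    · rw [h]; exact (key _ _ _).2.2.2.2.1
    · rw [h]; exact (key _ _ _).2.1
    · rw [h]; exact (key _ _ _).2.2.2.1
    · rw [h]; exact (key _ _ _).2.2.2.2.2
    · rw [h]; exact (key _ _ _).2.2.1
    · rw [h]; exact (key _ _ _).2.2.2.2.1
    · rw [h]; exact (key _ _ _).2.2.2.2.2

theorem wdens_pull2 {A B : ℂ² →L[ℝ] ℂ² →L[ℝ] ℝ} (hA : ∀ v w, A v w = - A w v)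
    (hB : ∀ v w, B v w = - B w v) (g : ℂ² →L[ℝ] ℂ²) :
    wdens (pull2 A g) (pull2 B g) = g.det * wdens A B := by
  have h1 := congrArg (fun f => f (g ∘ stdBasis))
    (AlternatingMap.eq_smul_basis_det stdBasis (wedgeAlt A B hA hB))
  have h2 := Module.Basis.det_comp stdBasis (g : ℂ² →ₗ[ℝ] ℂ²) stdBasis
  have h3 : wdens (pull2 A g) (pull2 B g) = wedgeAlt A B hA hB (g ∘ stdBasis) := by
    rw [stdBasis_eq]; rfl
  have h4 : wdens A B = wedgeAlt A B hA hB stdBasis := by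
    rw [stdBasis_eq]; rfl
  rw [h3, h4, h1]
  simp only [AlternatingMap.smul_apply, smul_eq_mul]
  rw [show (g ∘ stdBasis : Fin 4 → ℂ²) = (g : ℂ² →ₗ[ℝ] ℂ²) ∘ stdBasis from rfl, h2,
    Module.Basis.det_self, mul_one, mul_comm]

theorem wdens_comm (A B : ℂ² →L[ℝ] ℂ² →L[ℝ] ℝ) : wdens A B = wdens B A := by
  simp only [wdens, wedgeVal]; ring

theorem wdens_add_left (A A' B : ℂ² →L[ℝ] ℂ² →L[ℝ] ℝ) :
    wdens (A + A') B = wdens A B + wdens A' B := by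
  simp only [wdens, wedgeVal, add_apply]; ring

/-- A natural family of densities. -/
structure TopForm (X : Type*) [TopologicalSpace X] [ChartedSpace ℂ² X] where
  val : (ℂ² → X) → ℂ² → ℝ
  congr : ∀ {H H' : ℂ² → X} {y : ℂ²}, SmX H y → H =ᶠ[𝓝 y] H' →
    val H y = val H' y
  natural : ∀ {H : ℂ² → X} {g : ℂ² → ℂ²} {y : ℂ²}, SmX H (g y) →
    SmF g y → val (fun z => H (g z)) y = (fderiv ℝ g y).det * val H (g y)
  continuousAt : ∀ {H : ℂ² → X} {y : ℂ²}, SmX H y → ContinuousAt (val H) y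

variable {X : Type*} [TopologicalSpace X] [ChartedSpace ℂ² X]

theorem continuousAt_wdens {V : Type*} [TopologicalSpace V]
    {A B : V → ℂ² →L[ℝ] ℂ² →L[ℝ] ℝ} {y : V}
    (hA : ContinuousAt A y) (hB : ContinuousAt B y) :
    ContinuousAt (fun y => wdens (A y) (B y)) y := by
  have h1 : ∀ v w, ContinuousAt (fun y => A y v w) y := fun v w =>
    (hA.clm_apply continuousAt_const).clm_apply continuousAt_const
  have h2 : ∀ v w, ContinuousAt (fun y => B y v w) y := fun v w =>
    (hB.clm_apply continuousAt_const).clm_apply continuousAt_const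
  simp only [wdens, wedgeVal]
  exact ((((((h1 _ _).mul (h2 _ _)).sub ((h1 _ _).mul (h2 _ _))).add ((h1 _ _).mul (h2 _ _))).add
    ((h1 _ _).mul (h2 _ _))).sub ((h1 _ _).mul (h2 _ _))).add ((h1 _ _).mul (h2 _ _))

/-- The wedge product of two 2-forms. -/
def TwoForm.wedge (α β : TwoForm ℂ² X) : TopForm X where
  val H y := wdens (α.val H y) (β.val H y)
  congr hH h := by rw [α.congr hH h, β.congr hH h]
  natural hH hg := by
    rw [α.natural hH hg, β.natural hH hg, wdens_pull2 (α.skew hH) (β.skew hH)]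
  continuousAt hH := continuousAt_wdens (α.smooth hH).continuousAt (β.smooth hH).continuousAt

end Wedge

section ExtDeriv

variable {E : Type} [NormedAddCommGroup E] [NormedSpace ℝ E] {M : Type*}
    [TopologicalSpace M] [ChartedSpace E M]
  {V W : Type} [NormedAddCommGroup V] [NormedSpace ℝ V] [NormedAddCommGroup W] [NormedSpace ℝ W]

theorem d1_comp {B : W → W →L[ℝ] ℝ} {g : V → W} {y : V} (hB : DifferentiableAt ℝ B (g y))
    (hg : ContDiffAt ℝ ∞ g y) (u v : V) :
    d1 (fun z => (B (g z)).comp (fderiv ℝ g z)) y u v =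
      d1 B (g y) (fderiv ℝ g y u) (fderiv ℝ g y v) := by
  have h1 : HasFDerivAt (fun z => B (g z)) _ y :=
    hB.hasFDerivAt.comp y (hg.differentiableAt (by simp)).hasFDerivAt
  have h2 : HasFDerivAt (fderiv ℝ g) _ y :=
    ((hg.fderiv_right (m := ∞) (by simp)).differentiableAt (by simp)).hasFDerivAt
  have hs : fderiv ℝ (fderiv ℝ g) y u v = fderiv ℝ (fderiv ℝ g) y v u :=
    (hg.isSymmSndFDerivAt (by rw [minSmoothness_of_isRCLikeNormedField]; exact WithTop.coe_le_coe.2 le_top)) u v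
  have h3 := h1.clm_comp h2
  rw [d1, d1, h3.fderiv]
  simp [hs]

theorem OneForm.eventuallyEq {F : Type} [NormedAddCommGroup F] [NormedSpace ℝ F]
    (η : OneForm E M F) {H H' : V → M} {y : V} (hH : SmAt (E := E) H y) (h : H =ᶠ[𝓝 y] H') :
    η.val H =ᶠ[𝓝 y] η.val H' := by
  filter_upwards [hH.eventually, h.eventuallyEq_nhds] with z hz hz'
  exact η.congr hz hz'

theorem OneForm.differentiableAt {F : Type} [NormedAddCommGroup F] [NormedSpace ℝ F]
    (η : OneForm E M F) {H : V → M} {y : V} (hH : SmAt (E := E) H y) :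
    DifferentiableAt ℝ (η.val H) y := (η.smooth hH).differentiableAt (by simp)

theorem TwoForm.differentiableAt (η : TwoForm E M) {H : V → M} {y : V} (hH : SmAt (E := E) H y) :
    DifferentiableAt ℝ (η.val H) y := (η.smooth hH).differentiableAt (by simp)

/-- The exterior derivative of a 1-form. -/
def OneForm.d (η : OneForm E M ℝ) : TwoForm E M where
  val {V} _ _ H y := fderiv ℝ (η.val H) y - (fderiv ℝ (η.val H) y).flip
  congr {V} _ _ {H H' y} hH h := by
    rw [(η.eventuallyEq hH h).fderiv_eq]
  natural {V W} _ _ _ _ {H g y} hH hg := by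
    refine bilin_ext fun u v => ?_
    have h1 : η.val (fun z => H (g z)) =ᶠ[𝓝 y] fun z => (η.val H (g z)).comp (fderiv ℝ g z) := by
      filter_upwards [hg.eventually, hg.contDiffAt.continuousAt.eventually hH.eventually]
        with z hz hz'
      exact η.natural hz' hz
    rw [h1.fderiv_eq]
    exact d1_comp (η.differentiableAt hH) hg.contDiffAt u v
  smooth {V} _ _ {H y} hH := by
    have h1 : ContDiffAt ℝ ∞ (fderiv ℝ (η.val H)) y := (η.smooth hH).fderiv_right (by simp)
    have h2 : ContDiff ℝ ∞ (fun B : V →L[ℝ] V →L[ℝ] ℝ => B.flip) :=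
      ContinuousLinearMap.contDiff (𝕜 := ℝ) (E := V →L[ℝ] V →L[ℝ] ℝ) (F := V →L[ℝ] V →L[ℝ] ℝ)
        ((ContinuousLinearMap.flipₗᵢ ℝ V V ℝ).toContinuousLinearEquiv :
          (V →L[ℝ] V →L[ℝ] ℝ) →L[ℝ] (V →L[ℝ] V →L[ℝ] ℝ))
    exact h1.sub (h2.contDiffAt.comp y h1)
  skew {V} _ _ {H y} hH v w := by simp

theorem OneForm.d_apply (η : OneForm E M ℝ) (H : V → M) (y v w : V) :
    η.d.val H y v w = d1 (η.val H) y v w := rfl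

theorem TwoForm.CohomologousVia.val_eq {α β : TwoForm E M} {η : OneForm E M ℝ}
    (h : α.CohomologousVia β η) {H : V → M} {y : V} (hH : SmAt (E := E) H y) :
    α.val H y = β.val H y + η.d.val H y :=
  bilin_ext fun v w => h hH v w

/-- The product of a 1-form with a smooth function. -/
def OneForm.mulFn (η : OneForm E M ℝ) (f : M → ℝ) (hf : ContMDiff 𝓘(ℝ, E) 𝓘(ℝ, ℝ) ∞ f) :
    OneForm E M ℝ where
  val {V} _ _ H y := f (H y) • η.val H y
  congr {V} _ _ {H H' y} hH h := by rw [η.congr hH h, h.self_of_nhds]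
  natural {V W} _ _ _ _ {H g y} hH hg := by rw [η.natural hH hg]; rfl
  smooth {V} _ _ {H y} hH :=
    (SmAt.comp_left (W := ℝ) (Filter.Eventually.of_forall fun x => hf x) hH).contDiffAt.smul
      (η.smooth hH)

end ExtDeriv

/-! ### Integration of top degree forms -/

section Compact

variable {V : Type} [NormedAddCommGroup V] [NormedSpace ℝ V]

theorem contDiff_indicator {W : Type} [NormedAddCommGroup W] [NormedSpace ℝ W] {T K : Set V}
    (hT : IsOpen T) (hK : IsCompact K) {n : WithTop ℕ∞} {f : V → W}
    (hf : ∀ y ∈ T, ContDiffAt ℝ n f y) (h0 : ∀ y ∈ T, y ∉ K → f y = 0) (hKT : K ⊆ T) :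
    ContDiff ℝ n (T.indicator f) := by
  rw [contDiff_iff_contDiffAt]
  intro y
  by_cases hy : y ∈ T
  · refine (hf y hy).congr_of_eventuallyEq ?_
    filter_upwards [hT.mem_nhds hy] with z hz using Set.indicator_of_mem hz f
  · have h1 : T.indicator f =ᶠ[𝓝 y] fun _ => 0 := by
      filter_upwards [hK.isClosed.isOpen_compl.mem_nhds fun h => hy (hKT h)] with z hz
      by_cases hzT : z ∈ T
      · rw [Set.indicator_of_mem hzT, h0 z hzT hz]
      · rw [Set.indicator_of_notMem hzT]
    exact contDiffAt_const.congr_of_eventuallyEq h1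

theorem hasCompactSupport_indicator {W : Type} [NormedAddCommGroup W] {T K : Set V}
    (hK : IsCompact K) {f : V → W} (h0 : ∀ y ∈ T, y ∉ K → f y = 0) :
    HasCompactSupport (T.indicator f) := by
  refine HasCompactSupport.intro hK fun y hy => ?_
  by_cases hyT : y ∈ T
  · rw [Set.indicator_of_mem hyT, h0 y hyT hy]
  · rw [Set.indicator_of_notMem hyT]

theorem integrableOn_of_continuousAt [MeasurableSpace V] [BorelSpace V] {μ : Measure V}
    [IsFiniteMeasureOnCompacts μ] {T K : Set V}
    (hT : IsOpen T) (hK : IsCompact K) {f : V → ℝ}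
    (hf : ∀ y ∈ T, ContinuousAt f y) (h0 : ∀ y ∈ T, y ∉ K → f y = 0) (hKT : K ⊆ T) :
    IntegrableOn f T μ := by
  rw [← integrable_indicator_iff hT.measurableSet]
  refine Continuous.integrable_of_hasCompactSupport ?_ (hasCompactSupport_indicator hK h0)
  rw [← contDiff_zero (𝕜 := ℝ)]
  rw [contDiff_iff_contDiffAt]
  intro y
  by_cases hy : y ∈ T
  · have h2 : ContDiffOn ℝ 0 (T.indicator f) T := by
      rw [contDiffOn_zero]
      exact ContinuousOn.congr (f := f) (fun z hz => (hf z hz).continuousWithinAt) fun z hz =>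
        Set.indicator_of_mem hz f
    exact h2.contDiffAt (hT.mem_nhds hy)
  · have h1 : T.indicator f =ᶠ[𝓝 y] fun _ => 0 := by
      filter_upwards [hK.isClosed.isOpen_compl.mem_nhds fun h => hy (hKT h)] with z hz
      by_cases hzT : z ∈ T
      · rw [Set.indicator_of_mem hzT, h0 z hzT hz]
      · rw [Set.indicator_of_notMem hzT]
    exact contDiffAt_const.congr_of_eventuallyEq h1

theorem integral_fderiv_eq_zero [FiniteDimensional ℝ V] [MeasurableSpace V] [BorelSpace V]
    {μ : Measure V} [μ.IsAddHaarMeasure] {f : V → ℝ} (hf : ContDiff ℝ 1 f)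
    (hc : HasCompactSupport f) (v : V) : Integrable (fun y => fderiv ℝ f y v) μ ∧
    ∫ y, fderiv ℝ f y v ∂μ = 0 := by
  have h1 : Integrable (fun y => fderiv ℝ f y v) μ :=
    ((hf.continuous_fderiv (by simp)).clm_apply continuous_const).integrable_of_hasCompactSupport
      (hc.fderiv_apply (𝕜 := ℝ) v)
  refine ⟨h1, ?_⟩
  have := integral_mul_fderiv_eq_neg_fderiv_mul_of_integrable (μ := μ) (f := fun _ : V => (1 : ℝ))
    (g := f) (v := v) (by simp) (by simpa using h1)
    (by simpa using hf.continuous.integrable_of_hasCompactSupport hc)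
    (fun _ _ => differentiableAt_const _) (fun y _ => hf.differentiable (by simp) y)
  simpa using this

/-- The integral of the derivative of a compactly supported function on an open set vanishes. -/
theorem setIntegral_fderiv_eq_zero [FiniteDimensional ℝ V] [MeasurableSpace V] [BorelSpace V]
    {μ : Measure V} [μ.IsAddHaarMeasure] {T K : Set V} (hT : IsOpen T) (hK : IsCompact K)
    {f : V → ℝ} (hf : ∀ y ∈ T, ContDiffAt ℝ 1 f y) (h0 : ∀ y ∈ T, y ∉ K → f y = 0) (hKT : K ⊆ T)
    (v : V) : IntegrableOn (fun y => fderiv ℝ f y v) T μ ∧ ∫ y in T, fderiv ℝ f y v ∂μ = 0 := by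
  obtain ⟨h1, h2⟩ := integral_fderiv_eq_zero (μ := μ) (contDiff_indicator hT hK hf h0 hKT)
    (hasCompactSupport_indicator hK h0) v
  have h3 : ∀ y ∈ T, fderiv ℝ (T.indicator f) y v = fderiv ℝ f y v := by
    intro y hy
    have : T.indicator f =ᶠ[𝓝 y] f := by
      filter_upwards [hT.mem_nhds hy] with z hz using Set.indicator_of_mem hz f
    rw [this.fderiv_eq]
  have h4 : ∀ y, y ∉ T → fderiv ℝ (T.indicator f) y v = 0 := by
    intro y hy
    have h1 : T.indicator f =ᶠ[𝓝 y] fun _ => 0 := by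
      filter_upwards [hK.isClosed.isOpen_compl.mem_nhds fun h => hy (hKT h)] with z hz
      by_cases hzT : z ∈ T
      · rw [Set.indicator_of_mem hzT, h0 z hzT hz]
      · rw [Set.indicator_of_notMem hzT]
    rw [h1.fderiv_eq]; simp
  refine ⟨h1.integrableOn.congr_fun h3 hT.measurableSet, ?_⟩
  rw [← setIntegral_congr_fun hT.measurableSet h3, setIntegral_eq_integral_of_forall_compl_eq_zero h4,
    h2]

end Compact

section Integration

instance : (volume : Measure ℂ²).IsAddHaarMeasure :=
  inferInstanceAs ((volume : Measure ℂ).prod (volume : Measure ℂ)).IsAddHaarMeasure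

variable {X : Type*} [TopologicalSpace X] [ChartedSpace ℂ² X]

/-- A holomorphic parametrization of a subset of a complex surface. -/
structure PosParam (D : Set ℂ²) (Ψ : ℂ² → X) : Prop where
  meas : MeasurableSet D
  hol : ∀ y ∈ D, ∀ᶠ z in 𝓝 y, ContMDiffAt 𝓘(ℂ, ℂ²) 𝓘(ℂ, ℂ²) ω Ψ z
  inj : Set.InjOn Ψ D

theorem PosParam.smAt {D : Set ℂ²} {Ψ : ℂ² → X} (h : PosParam D Ψ) {y : ℂ²}
    (hy : y ∈ D) : SmX Ψ y := by
  filter_upwards [h.hol y hy] with z hz using contMDiffAt_real_of_complex hz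

theorem det_restrictScalars_nonneg (f : ℂ² →L[ℂ] ℂ²) :
    0 ≤ (f.restrictScalars ℝ).det := by
  have : (f.restrictScalars ℝ).det = Complex.normSq (LinearMap.det (f : ℂ² →ₗ[ℂ] ℂ²)) := by
    rw [← Algebra.norm_complex_apply, ← LinearMap.det_restrictScalars]
    rfl
  rw [this]
  exact Complex.normSq_nonneg _

variable [IsManifold 𝓘(ℂ, ℂ²) ω X]

theorem PosParam.det_nonneg {D : Set ℂ²} {Ψ : ℂ² → X} (h : PosParam D Ψ) {y : ℂ²}
    (hy : y ∈ D) {e : OpenPartialHomeomorph X ℂ²} (he : e ∈ atlas ℂ² X)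
    (hs : Ψ y ∈ e.source) : 0 ≤ (fderiv ℝ (fun z => e (Ψ z)) y).det := by
  have h1 : ContMDiffAt 𝓘(ℂ, ℂ²) 𝓘(ℂ, ℂ²) ω e (Ψ y) :=
    contMDiffAt_of_mem_maximalAtlas (IsManifold.subset_maximalAtlas he) hs
  have h2 : DifferentiableAt ℂ (fun z => e (Ψ z)) y :=
    (h1.comp y (h.hol y hy).self_of_nhds).contDiffAt.differentiableAt (by simp)
  rw [h2.fderiv_restrictScalars ℝ]
  exact det_restrictScalars_nonneg _

theorem posParam_chart_symm {e : OpenPartialHomeomorph X ℂ²} (he : e ∈ atlas ℂ² X) :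
    PosParam e.target e.symm where
  meas := e.open_target.measurableSet
  hol y hy := by
    filter_upwards [e.open_target.mem_nhds hy] with z hz
    exact contMDiffAt_symm_of_mem_maximalAtlas (IsManifold.subset_maximalAtlas he) hz
  inj := e.symm.injOn

theorem PosParam.measurableSet_inter {D : Set ℂ²} {Ψ : ℂ² → X} (h : PosParam D Ψ)
    {s : Set X} (hs : IsOpen s) : MeasurableSet (D ∩ Ψ ⁻¹' s) := by
  have hc : ContinuousOn Ψ D := fun y hy => (h.smAt hy).continuousAt.continuousWithinAt
  obtain ⟨u, hu, hu'⟩ := (continuousOn_iff'.1 hc) s hs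
  rw [Set.inter_comm, hu']
  exact hu.measurableSet.inter h.meas

/-- Change of variables between a chart and a parametrization. -/
theorem PosParam.change_of_variables (Ω : TopForm X) (G : X → ℝ) {D : Set ℂ²}
    {Ψ : ℂ² → X} (h : PosParam D Ψ) {e : OpenPartialHomeomorph X ℂ²}
    (he : e ∈ atlas ℂ² X) :
    MeasurableSet (e.target ∩ e.symm ⁻¹' (Ψ '' D)) ∧
    (IntegrableOn (fun y => G (e.symm y) * Ω.val e.symm y) (e.target ∩ e.symm ⁻¹' (Ψ '' D)) ↔
      IntegrableOn (fun y => G (Ψ y) * Ω.val Ψ y) (D ∩ Ψ ⁻¹' e.source)) ∧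
    ∫ y in e.target ∩ e.symm ⁻¹' (Ψ '' D), G (e.symm y) * Ω.val e.symm y =
      ∫ y in D ∩ Ψ ⁻¹' e.source, G (Ψ y) * Ω.val Ψ y := by
  have := isManifold_real X
  have himg : e.target ∩ e.symm ⁻¹' (Ψ '' D) = (fun z => e (Ψ z)) '' (D ∩ Ψ ⁻¹' e.source) := by
    ext y
    constructor
    · rintro ⟨hy, x, hx, hxy⟩
      refine ⟨x, ⟨hx, ?_⟩, ?_⟩
      · rw [Set.mem_preimage, hxy]; exact e.map_target hy
      · change e (Ψ x) = y
        rw [hxy, e.right_inv hy]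
    · rintro ⟨x, ⟨hx, hx'⟩, rfl⟩
      exact ⟨e.map_source hx', x, hx, (e.left_inv hx').symm⟩
  have hmeas : MeasurableSet (D ∩ Ψ ⁻¹' e.source) := h.measurableSet_inter e.open_source
  have hd : ∀ x ∈ D ∩ Ψ ⁻¹' e.source, HasFDerivWithinAt (fun z => e (Ψ z))
      (fderiv ℝ (fun z => e (Ψ z)) x) (D ∩ Ψ ⁻¹' e.source) x := fun x hx =>
    ((h.smAt hx.1).chart he hx.2).differentiableAt.hasFDerivAt.hasFDerivWithinAt
  have hinj : Set.InjOn (fun z => e (Ψ z)) (D ∩ Ψ ⁻¹' e.source) := fun x hx x' hx' hxx =>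
    h.inj hx.1 hx'.1 (e.injOn hx.2 hx'.2 hxx)
  have hval : ∀ x ∈ D ∩ Ψ ⁻¹' e.source, |(fderiv ℝ (fun z => e (Ψ z)) x).det| •
      (G (e.symm (e (Ψ x))) * Ω.val e.symm (e (Ψ x))) = G (Ψ x) * Ω.val Ψ x := by
    intro x hx
    have hs := (h.smAt hx.1)
    have h1 := Ω.natural (H := e.symm) (g := fun z => e (Ψ z)) (y := x)
      (smAt_chart_symm he (e.map_source hx.2)) (hs.chart he hx.2)
    have h2 : Ψ =ᶠ[𝓝 x] fun z => e.symm (e (Ψ z)) := by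
      filter_upwards [hs.continuousAt.preimage_mem_nhds (e.open_source.mem_nhds hx.2)] with z hz
      exact (e.left_inv hz).symm
    rw [abs_of_nonneg (h.det_nonneg hx.1 he hx.2), e.left_inv hx.2, Ω.congr hs h2, h1, smul_eq_mul]
    ring
  rw [himg]
  refine ⟨measurable_image_of_fderivWithin hmeas hd hinj, ?_, ?_⟩
  · rw [integrableOn_image_iff_integrableOn_abs_det_fderiv_smul volume hmeas hd hinj]
    exact integrableOn_congr_fun hval hmeas
  · rw [integral_image_eq_integral_abs_det_fderiv_smul volume hmeas hd hinj]
    exact setIntegral_congr_fun hmeas hval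

variable [T2Space X] [CompactSpace X]

/-- A partition of unity subordinate to the coordinate charts. -/
def chartPartition (X : Type*) [TopologicalSpace X] [ChartedSpace ℂ² X]
    [IsManifold 𝓘(ℂ, ℂ²) ω X] [T2Space X] [CompactSpace X] :
    SmoothPartitionOfUnity X 𝓘(ℝ, ℂ²) X Set.univ :=
  Classical.choose (exists_partition X)

theorem chartPartition_tsupport (p : X) :
    tsupport (chartPartition X p) ⊆ (chartAt ℂ² p).source :=
  Classical.choose_spec (exists_partition X) p

theorem chartPartition_finite : {p : X | (Function.support (chartPartition X p)).Nonempty}.Finite :=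
  (chartPartition X).locallyFinite.finite_nonempty_of_compact

/-- The finite set of indices of the nonzero members of the partition of unity. -/
def partitionIndex (X : Type*) [TopologicalSpace X] [ChartedSpace ℂ² X]
    [IsManifold 𝓘(ℂ, ℂ²) ω X] [T2Space X] [CompactSpace X] : Finset X :=
  (chartPartition_finite (X := X)).toFinset

theorem chartPartition_eq_zero {p : X} (hp : p ∉ partitionIndex X) (x : X) :
    chartPartition X p x = 0 := by
  by_contra h
  exact hp ((chartPartition_finite (X := X)).mem_toFinset.2 ⟨x, h⟩)

theorem sum_chartPartition (x : X) : ∑ p ∈ partitionIndex X, chartPartition X p x = 1 := by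
  rw [← (chartPartition X).sum_eq_one (Set.mem_univ x)]
  refine (finsum_eq_sum_of_support_subset _ fun p hp => ?_).symm
  by_contra h
  exact hp (chartPartition_eq_zero h x)

/-- The integral of a form of top degree. -/
def TopForm.int (Ω : TopForm X) : ℝ :=
  ∑ᶠ p : X, ∫ y in (chartAt ℂ² p).target,
    chartPartition X p ((chartAt ℂ² p).symm y) * Ω.val (chartAt ℂ² p).symm y

theorem TopForm.int_eq (Ω : TopForm X) : Ω.int = ∑ p ∈ partitionIndex X,
    ∫ y in (chartAt ℂ² p).target,
      chartPartition X p ((chartAt ℂ² p).symm y) * Ω.val (chartAt ℂ² p).symm y := by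
  refine finsum_eq_sum_of_support_subset _ fun p hp => ?_
  by_contra h
  refine hp ?_
  simp only [chartPartition_eq_zero h, zero_mul, integral_zero]

theorem intersection_eq [IsManifold 𝓘(ℝ, ℂ²) ∞ X] (α β : Form X 2) :
    intersection α β = (α.toTwoForm.wedge β.toTwoForm).int := by
  have key : ∀ (γ : Form X 2) (p : X), ∀ y ∈ (chartAt ℂ² p).target,
      γ.pb (chartAt ℂ² p).symm y = γ.toFun (chartAt ℂ² p) y := by
    intro γ p y hy
    set e := chartAt ℂ² p
    have he : e ∈ atlas ℂ² X := chart_mem_atlas _ _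
    rw [γ.pb_eq (smAt_chart_symm he hy) he (e.map_target hy), e.right_inv hy]
    have : (fun z => e (e.symm z)) =ᶠ[𝓝 y] id := by
      filter_upwards [e.open_target.mem_nhds hy] with z hz using e.right_inv hz
    rw [this.fderiv_eq, fderiv_id]
    rfl
  rw [intersection, TopForm.int]
  refine finsum_congr fun p => setIntegral_congr_fun (chartAt ℂ² p).open_target.measurableSet
    fun y hy => ?_
  simp only [TwoForm.wedge, wdens, wedgeVal, Form.toTwoForm_apply, key _ p y hy]
  rfl

theorem TopForm.int_eq_sum (Ω : TopForm X) {ι : Type*} [Fintype ι] {D : ι → Set ℂ²}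
    {Ψ : ι → ℂ² → X} (hP : ∀ k, PosParam (D k) (Ψ k))
    (hdisj : Pairwise (Function.onFun Disjoint fun k => Ψ k '' D k))
    (hzero : ∀ (H : ℂ² → X) (y : ℂ²), SmX H y → (∀ k, H y ∉ Ψ k '' D k) →
      Ω.val H y = 0)
    (hint : ∀ k, IntegrableOn (Ω.val (Ψ k)) (D k)) :
    Ω.int = ∑ k, ∫ y in D k, Ω.val (Ψ k) y := by
  have := isManifold_real X
  have hi : ∀ (p : X) k, IntegrableOn (fun y => chartPartition X p (Ψ k y) * Ω.val (Ψ k) y)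
      (D k) := by
    intro p k
    refine Integrable.bdd_mul (hint k) (c := 1) ?_ ?_
    · have hc : ContinuousOn (fun y => chartPartition X p (Ψ k y)) (D k) := fun y hy =>
        ((chartPartition X p).contMDiff.continuous.continuousAt.comp
          ((hP k).smAt hy).continuousAt).continuousWithinAt
      exact hc.aestronglyMeasurable (hP k).meas
    · refine Filter.Eventually.of_forall fun y => ?_
      rw [Real.norm_of_nonneg ((chartPartition X).nonneg p _)]
      exact (chartPartition X).le_one p _
  have h1 : ∀ p : X, ∫ y in (chartAt ℂ² p).target,
      chartPartition X p ((chartAt ℂ² p).symm y) * Ω.val (chartAt ℂ² p).symm y =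
      ∑ k, ∫ y in D k, chartPartition X p (Ψ k y) * Ω.val (Ψ k) y := by
    intro p
    set e := chartAt ℂ² p
    have he : e ∈ atlas ℂ² X := chart_mem_atlas _ _
    have hc := fun k => (hP k).change_of_variables Ω (chartPartition X p) he
    have hsub : ⋃ k, (e.target ∩ e.symm ⁻¹' (Ψ k '' D k)) ⊆ e.target :=
      Set.iUnion_subset fun k => Set.inter_subset_left
    rw [setIntegral_eq_of_subset_of_forall_sdiff_eq_zero e.open_target.measurableSet hsub,
      integral_iUnion_fintype (fun k => (hc k).1)]
    · refine Finset.sum_congr rfl fun k _ => ?_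
      rw [(hc k).2.2]
      refine (setIntegral_eq_of_subset_of_forall_sdiff_eq_zero (hP k).meas Set.inter_subset_left
        fun y hy => ?_).symm
      have : chartPartition X p (Ψ k y) = 0 := by
        by_contra hne
        exact hy.2 ⟨hy.1, chartPartition_tsupport p (subset_tsupport _ hne)⟩
      rw [this, zero_mul]
    · intro k k' hkk
      refine Set.disjoint_left.2 fun y hy hy' => ?_
      exact Set.disjoint_left.1 (hdisj hkk) hy.2 hy'.2
    · exact fun k => (hc k).2.1.2 ((hi p k).mono_set Set.inter_subset_left)
    · intro y hy
      rw [hzero e.symm y (smAt_chart_symm he hy.1), mul_zero]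
      intro k hk
      exact hy.2 (Set.mem_iUnion.2 ⟨k, hy.1, hk⟩)
  rw [Ω.int_eq, Finset.sum_congr rfl fun p _ => h1 p, Finset.sum_comm]
  refine Finset.sum_congr rfl fun k _ => ?_
  rw [← integral_finsetSum _ fun p _ => hi p k]
  refine setIntegral_congr_fun (hP k).meas fun y _ => ?_
  change ∑ p ∈ partitionIndex X, chartPartition X p (Ψ k y) * Ω.val (Ψ k) y = _
  rw [← Finset.sum_mul, sum_chartPartition, one_mul]

end Integration

/-! ### Stokes' theorem -/

section Stokes

variable {V : Type} [NormedAddCommGroup V] [NormedSpace ℝ V]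

/-- The wedge product of a linear form and a bilinear form on three vectors. -/
def wedge3 (a : V →L[ℝ] ℝ)
    (B : V →L[ℝ] V →L[ℝ] ℝ) (u v w : V) : ℝ := a u * B v w - a v * B u w + a w * B u v

theorem hasFDerivAt_wedge3 {a : V → V →L[ℝ] ℝ} {B : V → V →L[ℝ] V →L[ℝ] ℝ} {y : V}
    (ha : DifferentiableAt ℝ a y) (hB : DifferentiableAt ℝ B y) (u v w x : V) :
    fderiv ℝ (fun y => wedge3 (a y) (B y) u v w) y x =
      wedge3 (fderiv ℝ a y x) (B y) u v w + wedge3 (a y) (fderiv ℝ B y x) u v w := by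
  have h1 : ∀ u, HasFDerivAt (fun y => a y u) _ y := fun u =>
    ha.hasFDerivAt.clm_apply (hasFDerivAt_const u y)
  have h2 : ∀ u v, HasFDerivAt (fun y => B y u v) _ y := fun u v =>
    (hB.hasFDerivAt.clm_apply (hasFDerivAt_const u y)).clm_apply (hasFDerivAt_const v y)
  have h3 := (((h1 u).mul (h2 v w)).sub ((h1 v).mul (h2 u w))).add ((h1 w).mul (h2 u v))
  have h4 : HasFDerivAt (fun y => wedge3 (a y) (B y) u v w) _ y := h3
  rw [h4.fderiv]
  simp [wedge3]
  ring

theorem contDiffAt_wedge3 {a : V → V →L[ℝ] ℝ} {B : V → V →L[ℝ] V →L[ℝ] ℝ} {y : V} {n : WithTop ℕ∞}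
    (ha : ContDiffAt ℝ n a y) (hB : ContDiffAt ℝ n B y) (u v w : V) :
    ContDiffAt ℝ n (fun y => wedge3 (a y) (B y) u v w) y := by
  have h1 : ∀ u, ContDiffAt ℝ n (fun y => a y u) y := fun u => ha.clm_apply contDiffAt_const
  have h2 : ∀ u v, ContDiffAt ℝ n (fun y => B y u v) y := fun u v =>
    (hB.clm_apply contDiffAt_const).clm_apply contDiffAt_const
  exact (((h1 u).mul (h2 v w)).sub ((h1 v).mul (h2 u w))).add ((h1 w).mul (h2 u v))

theorem wdens_d_eq {a : ℂ² → ℂ² →L[ℝ] ℝ} {B : ℂ² → ℂ² →L[ℝ] ℂ² →L[ℝ] ℝ}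
    {y : ℂ²} (ha : DifferentiableAt ℝ a y) (hB : DifferentiableAt ℝ B y)
    (hd : ∀ u v w, d2 B y u v w = 0) :
    wdens (fderiv ℝ a y - (fderiv ℝ a y).flip) (B y) =
      fderiv ℝ (fun y => wedge3 (a y) (B y) (I, 0) (0, 1) (0, I)) y (1, 0) -
      fderiv ℝ (fun y => wedge3 (a y) (B y) (1, 0) (0, 1) (0, I)) y (I, 0) +
      fderiv ℝ (fun y => wedge3 (a y) (B y) (1, 0) (I, 0) (0, I)) y (0, 1) -
      fderiv ℝ (fun y => wedge3 (a y) (B y) (1, 0) (I, 0) (0, 1)) y (0, I) := by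
  simp only [hasFDerivAt_wedge3 ha hB]
  have h1 := hd (I, 0) (0, 1) (0, I)
  have h2 := hd (1, 0) (0, 1) (0, I)
  have h3 := hd (1, 0) (I, 0) (0, I)
  have h4 := hd (1, 0) (I, 0) (0, 1)
  simp only [d2] at h1 h2 h3 h4
  simp only [wdens, wedgeVal, wedge3, sub_apply, ContinuousLinearMap.flip_apply]
  linear_combination a y (1, 0) * h1 - a y (I, 0) * h2 + a y (0, 1) * h3 -
    a y (0, I) * h4

variable {X : Type*} [TopologicalSpace X] [ChartedSpace ℂ² X]
  [IsManifold 𝓘(ℂ, ℂ²) ω X] [T2Space X] [CompactSpace X]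

theorem wdens_zero_left (B : ℂ² →L[ℝ] ℂ² →L[ℝ] ℝ) : wdens 0 B = 0 := by
  simp [wdens, wedgeVal]

theorem wdens_sum_left {ι : Type*} (s : Finset ι) (A : ι → ℂ² →L[ℝ] ℂ² →L[ℝ] ℝ)
    (B : ℂ² →L[ℝ] ℂ² →L[ℝ] ℝ) :
    wdens (∑ i ∈ s, A i) B = ∑ i ∈ s, wdens (A i) B := by
  classical
  induction s using Finset.induction_on with
  | empty => simp [wdens_zero_left]
  | insert i s hi ih => rw [Finset.sum_insert hi, Finset.sum_insert hi, wdens_add_left, ih]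

/-- A member of the partition of unity times a 1-form. -/
def OneForm.loc (η : OneForm ℂ² X ℝ) (p : X) : OneForm ℂ² X ℝ :=
  η.mulFn (chartPartition X p) (chartPartition X p).contMDiff

theorem OneForm.d_eq_sum_loc (η : OneForm ℂ² X ℝ) {H : ℂ² → X} {y : ℂ²}
    (hH : SmX H y) :
    η.d.val H y = ∑ p ∈ partitionIndex X, (η.loc p).d.val H y := by
  have h1 : η.val H = fun z => ∑ p ∈ partitionIndex X, (η.loc p).val H z := by
    funext z
    change _ = ∑ p ∈ partitionIndex X, chartPartition X p (H z) • η.val H z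
    rw [← Finset.sum_smul, sum_chartPartition, one_smul]
  have h2 : fderiv ℝ (η.val H) y = ∑ p ∈ partitionIndex X, fderiv ℝ ((η.loc p).val H) y := by
    conv_lhs => rw [h1]
    exact fderiv_fun_sum fun p _ => (η.loc p).differentiableAt hH
  refine bilin_ext fun u v => ?_
  change fderiv ℝ (η.val H) y u v - fderiv ℝ (η.val H) y v u = _
  rw [h2]
  simp only [sum_apply]
  rw [← Finset.sum_sub_distrib]
  rfl

theorem OneForm.loc_d_eq_zero (η : OneForm ℂ² X ℝ) (p : X) {H : ℂ² → X} {y : ℂ²}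
    (hH : SmX H y) (hy : H y ∉ tsupport (chartPartition X p)) :
    (η.loc p).val H y = 0 ∧ (η.loc p).d.val H y = 0 := by
  have h1 : (η.loc p).val H =ᶠ[𝓝 y] fun _ => 0 := by
    have : ∀ᶠ z in 𝓝 y, H z ∈ (tsupport (chartPartition X p))ᶜ :=
      hH.continuousAt.eventually ((isClosed_tsupport _).isOpen_compl.mem_nhds hy)
    filter_upwards [this] with z hz
    change chartPartition X p (H z) • η.val H z = 0
    rw [image_eq_zero_of_notMem_tsupport hz, zero_smul]
  refine ⟨h1.self_of_nhds, ?_⟩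
  refine bilin_ext fun u v => ?_
  change fderiv ℝ ((η.loc p).val H) y u v - fderiv ℝ ((η.loc p).val H) y v u = _
  rw [h1.fderiv_eq]
  simp

theorem isCompact_image_tsupport (p : X) :
    IsCompact (chartAt ℂ² p '' tsupport (chartPartition X p)) :=
  (isClosed_tsupport _).isCompact.image_of_continuousOn
    ((chartAt ℂ² p).continuousOn.mono (chartPartition_tsupport p))

theorem image_tsupport_subset (p : X) :
    chartAt ℂ² p '' tsupport (chartPartition X p) ⊆ (chartAt ℂ² p).target := by
  rintro _ ⟨x, hx, rfl⟩
  exact (chartAt ℂ² p).map_source (chartPartition_tsupport p hx)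

theorem notMem_tsupport {p : X} {y : ℂ²} (hy : y ∈ (chartAt ℂ² p).target)
    (hy' : y ∉ chartAt ℂ² p '' tsupport (chartPartition X p)) :
    (chartAt ℂ² p).symm y ∉ tsupport (chartPartition X p) := fun h =>
  hy' ⟨_, h, (chartAt ℂ² p).right_inv hy⟩

theorem OneForm.int_loc_d_wedge (η : OneForm ℂ² X ℝ) {ζ : TwoForm ℂ² X} (hζ : ζ.Closed)
    (p : X) : ((η.loc p).d.wedge ζ).int = 0 := by
  have := isManifold_real X
  set e := chartAt ℂ² p with he'
  have he : e ∈ atlas ℂ² X := chart_mem_atlas _ _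
  set K := e '' tsupport (chartPartition X p) with hKdef
  have hK : IsCompact K := isCompact_image_tsupport p
  have hKT : K ⊆ e.target := image_tsupport_subset p
  have hsm : ∀ y ∈ e.target, SmX e.symm y := fun y hy => smAt_chart_symm he hy
  have hz : ∀ y ∈ e.target, y ∉ K → (η.loc p).val e.symm y = 0 ∧ (η.loc p).d.val e.symm y = 0 :=
    fun y hy hyK => η.loc_d_eq_zero p (hsm y hy) (notMem_tsupport hy hyK)
  have hint : IntegrableOn (((η.loc p).d.wedge ζ).val e.symm) e.target :=
    integrableOn_of_continuousAt e.open_target hK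
      (fun y hy => ((η.loc p).d.wedge ζ).continuousAt (hsm y hy))
      (fun y hy hyK => by
        change wdens ((η.loc p).d.val e.symm y) _ = 0
        rw [(hz y hy hyK).2, wdens_zero_left]) hKT
  rw [TopForm.int_eq_sum ((η.loc p).d.wedge ζ) (ι := Unit) (D := fun _ => e.target)
    (Ψ := fun _ => e.symm) (fun _ => posParam_chart_symm he)
    (fun i j hij => (hij (Subsingleton.elim i j)).elim) ?_ fun _ => hint]
  · simp only [Finset.univ_unique, Finset.sum_singleton]
    have hS : ∀ u v w x : ℂ², IntegrableOn (fun y => fderiv ℝ (fun y =>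
        wedge3 ((η.loc p).val e.symm y) (ζ.val e.symm y) u v w) y x) e.target ∧
        ∫ y in e.target, fderiv ℝ (fun y =>
        wedge3 ((η.loc p).val e.symm y) (ζ.val e.symm y) u v w) y x = 0 := by
      intro u v w x
      refine setIntegral_fderiv_eq_zero e.open_target hK (fun y hy => ?_) (fun y hy hyK => ?_) hKT x
      · exact (contDiffAt_wedge3 ((η.loc p).smooth (hsm y hy)) (ζ.smooth (hsm y hy)) u v w).of_le
          (by exact_mod_cast le_top)
      · rw [(hz y hy hyK).1]; simp [wedge3]
    have hval : ∀ y ∈ e.target, ((η.loc p).d.wedge ζ).val e.symm y = _ := fun y hy =>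
      wdens_d_eq ((η.loc p).differentiableAt (hsm y hy)) (ζ.differentiableAt (hsm y hy))
        (hζ (hsm y hy))
    rw [setIntegral_congr_fun e.open_target.measurableSet hval, integral_sub, integral_add,
      integral_sub, (hS _ _ _ _).2, (hS _ _ _ _).2, (hS _ _ _ _).2, (hS _ _ _ _).2]
    · simp
    · exact (hS _ _ _ _).1
    · exact (hS _ _ _ _).1
    · exact (hS _ _ _ _).1.sub (hS _ _ _ _).1
    · exact (hS _ _ _ _).1
    · exact ((hS _ _ _ _).1.sub (hS _ _ _ _).1).add (hS _ _ _ _).1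
    · exact (hS _ _ _ _).1
  · intro H y hH hy
    change wdens ((η.loc p).d.val H y) _ = 0
    rw [(η.loc_d_eq_zero p hH ?_).2, wdens_zero_left]
    intro h
    exact hy () ⟨e (H y), e.map_source (chartPartition_tsupport p h),
      e.left_inv (chartPartition_tsupport p h)⟩

theorem integrableOn_chartPartition (Ω : TopForm X) (p : X) : IntegrableOn (fun y =>
    chartPartition X p ((chartAt ℂ² p).symm y) * Ω.val (chartAt ℂ² p).symm y)
    (chartAt ℂ² p).target := by
  have := isManifold_real X
  set e := chartAt ℂ² p with he'
  have he : e ∈ atlas ℂ² X := chart_mem_atlas _ _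
  refine integrableOn_of_continuousAt e.open_target (isCompact_image_tsupport p) (fun y hy => ?_)
    (fun y hy hyK => ?_) (image_tsupport_subset p)
  · exact ((chartPartition X p).contMDiff.continuous.continuousAt.comp
      (smAt_chart_symm he hy).continuousAt).mul (Ω.continuousAt (smAt_chart_symm he hy))
  · rw [image_eq_zero_of_notMem_tsupport (notMem_tsupport hy hyK), zero_mul]

theorem TopForm.int_sum {ι : Type*} (s : Finset ι) (Ω : TopForm X) (Ω' : ι → TopForm X)
    (h : ∀ (H : ℂ² → X) y, SmX H y → Ω.val H y = ∑ i ∈ s, (Ω' i).val H y) :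
    Ω.int = ∑ i ∈ s, (Ω' i).int := by
  have := isManifold_real X
  simp only [TopForm.int_eq]
  rw [Finset.sum_comm]
  refine Finset.sum_congr rfl fun p _ => ?_
  rw [← integral_finsetSum _ fun i _ => integrableOn_chartPartition (Ω' i) p]
  refine setIntegral_congr_fun (chartAt ℂ² p).open_target.measurableSet fun y hy => ?_
  simp only [h _ y (smAt_chart_symm (chart_mem_atlas _ p) hy), Finset.mul_sum]

theorem TopForm.int_congr {Ω Ω' : TopForm X}
    (h : ∀ (H : ℂ² → X) y, SmX H y → Ω.val H y = Ω'.val H y) :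
    Ω.int = Ω'.int := by
  simpa using TopForm.int_sum {()} Ω (fun _ => Ω') (by simpa using h)

theorem TopForm.int_add {Ω Ω₁ Ω₂ : TopForm X}
    (h : ∀ (H : ℂ² → X) y, SmX H y → Ω.val H y = Ω₁.val H y + Ω₂.val H y) :
    Ω.int = Ω₁.int + Ω₂.int := by
  have := TopForm.int_sum (Finset.univ : Finset (Fin 2)) Ω ![Ω₁, Ω₂] (by simpa using h)
  simpa using this

/-- **Stokes' theorem** for products with closed forms. -/
theorem OneForm.int_d_wedge (η : OneForm ℂ² X ℝ) {ζ : TwoForm ℂ² X} (hζ : ζ.Closed) :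
    (η.d.wedge ζ).int = 0 := by
  rw [TopForm.int_sum (partitionIndex X) (η.d.wedge ζ) (fun p => (η.loc p).d.wedge ζ)]
  · exact Finset.sum_eq_zero fun p _ => η.int_loc_d_wedge hζ p
  · intro H y hH
    change wdens (η.d.val H y) (ζ.val H y) = _
    rw [η.d_eq_sum_loc hH, wdens_sum_left]
    rfl

/-- The self-intersection of a closed form depends only on its cohomology class. -/
theorem TwoForm.CohomologousVia.int_wedge_self {α β : TwoForm ℂ² X}
    {η : OneForm ℂ² X ℝ} (h : α.CohomologousVia β η) (hα : α.Closed) (hβ : β.Closed) :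
    (α.wedge α).int = (β.wedge β).int := by
  have h1 : ∀ ζ : TwoForm ℂ² X, ζ.Closed → (α.wedge ζ).int = (β.wedge ζ).int := by
    intro ζ hζ
    rw [TopForm.int_add (Ω := α.wedge ζ) (Ω₁ := β.wedge ζ) (Ω₂ := η.d.wedge ζ),
      η.int_d_wedge hζ, add_zero]
    intro H y hH
    change wdens (α.val H y) _ = wdens (β.val H y) _ + wdens (η.d.val H y) _
    rw [h.val_eq hH, wdens_add_left]
  rw [h1 α hα, TopForm.int_congr (Ω := β.wedge α) (Ω' := α.wedge β), h1 β hβ]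
  intro H y _
  exact wdens_comm _ _

end Stokes

/-! ### Geometry of principal bundles -/

section Bundle

theorem isManifold_real_curve (B : Type*) [TopologicalSpace B] [ChartedSpace ℂ B]
    [IsManifold 𝓘(ℂ, ℂ) ω B] : IsManifold 𝓘(ℝ, ℂ) ∞ B := by
  apply isManifold_of_contDiffOn
  intro e e' he he'
  have h := (contDiffGroupoid ω 𝓘(ℂ, ℂ)).compatible he he'
  rw [contDiffGroupoid, mem_groupoid_of_pregroupoid] at h
  have h1 : ContDiffOn ℂ ω (𝓘(ℂ, ℂ) ∘ e.symm ≫ₕ e' ∘ 𝓘(ℂ, ℂ).symm)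
    (𝓘(ℂ, ℂ).symm ⁻¹' (e.symm ≫ₕ e').source ∩ Set.range 𝓘(ℂ, ℂ)) := h.1
  exact (h1.restrict_scalars ℝ).of_le le_top

variable {X B : Type*} [TopologicalSpace X] [ChartedSpace ℂ² X]
    [TopologicalSpace B] [ChartedSpace ℂ B] {Λ : Submodule ℤ ℂ} [AddAction (Torus Λ) X] {π : X → B}

theorem IsPrincipalBundle.smooth_proj (h : IsPrincipalBundle Λ π) :
    ContMDiff 𝓘(ℝ, ℂ²) 𝓘(ℝ, ℂ) ∞ π := fun x =>
  contMDiffAt_real_of_complex (h.holomorphic_proj x)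

theorem IsPrincipalBundle.continuous_proj (h : IsPrincipalBundle Λ π) : Continuous π :=
  h.holomorphic_proj.continuous

/-- `s` is a holomorphic section of `π` in a neighbourhood of `b`. -/
def LocSec (π : X → B) (s : B → X) (b : B) : Prop :=
  ∀ᶠ x in 𝓝 b, ContMDiffAt 𝓘(ℂ, ℂ) 𝓘(ℂ, ℂ²) ω s x ∧ π (s x) = x

theorem LocSec.eventually {s : B → X} {b : B} (h : LocSec π s b) : ∀ᶠ x in 𝓝 b, LocSec π s x :=
  eventually_eventually_nhds.2 h

theorem LocSec.proj {s : B → X} {b : B} (h : LocSec π s b) : π (s b) = b := h.self_of_nhds.2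

theorem LocSec.continuousAt {s : B → X} {b : B} (h : LocSec π s b) : ContinuousAt s b :=
  h.self_of_nhds.1.continuousAt

theorem LocSec.smooth {s : B → X} {b : B} (h : LocSec π s b) :
    ∀ᶠ x in 𝓝 b, ContMDiffAt 𝓘(ℝ, ℂ) 𝓘(ℝ, ℂ²) ∞ s x := by
  filter_upwards [h] with x hx using contMDiffAt_real_of_complex hx.1

theorem IsPrincipalBundle.exists_locSec (h : IsPrincipalBundle Λ π) (b : B) :
    ∃ s : B → X, LocSec π s b := by
  obtain ⟨U, hU, hb, σ, hσ, hσ', -⟩ := h.locally_trivial b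
  refine ⟨σ, ?_⟩
  filter_upwards [hU.mem_nhds hb] with x hx
  exact ⟨hσ.contMDiffAt (hU.mem_nhds hx), hσ' x hx⟩

/-- The vertical coordinate with respect to a local section. -/
theorem IsPrincipalBundle.exists_coord (h : IsPrincipalBundle Λ π) {s : B → X} {x : X}
    (hs : LocSec π s (π x)) : ∃ f : X → ℂ, ∀ᶠ y in 𝓝 x,
      ContMDiffAt 𝓘(ℂ, ℂ²) 𝓘(ℂ, ℂ) ω f y ∧
        ⟪f y⟫[Λ] +ᵥ s (π y) = y := by
  obtain ⟨U, hU, hb, σ, hσ, hσ', hloc⟩ := h.locally_trivial (π x)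
  obtain ⟨W, hW, hxW, -, f, hf, hf'⟩ := hloc x hb
  obtain ⟨W₂, hW₂, hxW₂, -, f₂, hf₂, hf₂'⟩ := hloc (s (π x)) (by rwa [hs.proj])
  refine ⟨fun y => f y - f₂ (s (π y)), ?_⟩
  have h1 : ∀ᶠ y in 𝓝 x, LocSec π s (π y) :=
    h.continuous_proj.continuousAt.eventually hs.eventually
  have h2 : ∀ᶠ y in 𝓝 x, s (π y) ∈ W₂ :=
    (ContinuousAt.comp (g := s) hs.continuousAt h.continuous_proj.continuousAt).eventually
      (hW₂.mem_nhds hxW₂)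
  filter_upwards [hW.mem_nhds hxW, h1, h2] with y hy h1 h2
  constructor
  · refine (hf.contMDiffAt (hW.mem_nhds hy)).sub ?_
    exact (hf₂.contMDiffAt (hW₂.mem_nhds h2)).comp y
      (h1.self_of_nhds.1.comp y (h.holomorphic_proj y))
  · have e1 := hf' y hy
    have e2 := hf₂' _ h2
    rw [h1.proj] at e2
    have e3 : -⟪f₂ (s (π y))⟫[Λ] +ᵥ s (π y) = σ (π y) := by
      rw [neg_vadd_eq_iff, e2]
    rw [QuotientAddGroup.mk_sub, sub_eq_add_neg, add_vadd, e3, e1]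

theorem IsPrincipalBundle.exists_vadd_eq (h : IsPrincipalBundle Λ π) {x y : X} (hxy : π x = π y) :
    ∃ z : ℂ, ⟪z⟫[Λ] +ᵥ x = y := by
  obtain ⟨s, hs⟩ := h.exists_locSec (π x)
  obtain ⟨f, hf⟩ := h.exists_coord hs
  obtain ⟨g, hg⟩ := h.exists_coord (x := y) (hxy ▸ hs)
  have e1 := hf.self_of_nhds.2
  have e2 := hg.self_of_nhds.2
  refine ⟨g y - f x, ?_⟩
  have e3 : -⟪f x⟫[Λ] +ᵥ x = s (π x) := by
    rw [neg_vadd_eq_iff, e1]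
  rw [QuotientAddGroup.mk_sub, sub_eq_add_neg, add_vadd, e3, hxy, e2]

theorem IsPrincipalBundle.sub_mem (h : IsPrincipalBundle Λ π) {x : X} {z w : ℂ}
    (hzw : ⟪z⟫[Λ] +ᵥ x = ⟪w⟫[Λ] +ᵥ x) :
    z - w ∈ Λ := by
  have h1 : ⟪-w + z⟫[Λ] = 0 := by
    refine h.free _ x ?_
    rw [QuotientAddGroup.mk_add, add_vadd, hzw, QuotientAddGroup.mk_neg, neg_vadd_vadd]
  rw [QuotientAddGroup.eq_zero_iff] at h1
  rw [sub_eq_neg_add]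
  exact h1

theorem IsPrincipalBundle.proj_mk_vadd (h : IsPrincipalBundle Λ π) (z : ℂ) (x : X) :
    π (⟪z⟫[Λ] +ᵥ x) = π x := h.proj_vadd _ _

theorem IsPrincipalBundle.continuous_vadd (h : IsPrincipalBundle Λ π) (x : X) :
    Continuous fun z : ℂ => ⟪z⟫[Λ] +ᵥ x :=
  h.holomorphic_vadd.continuous.comp (f := fun z : ℂ => (z, x)) (by fun_prop)

theorem IsPrincipalBundle.preconnectedSpace (h : IsPrincipalBundle Λ π) [PreconnectedSpace B] :
    PreconnectedSpace X := by
  rw [preconnectedSpace_iff_clopen]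
  intro S hS
  have hfib : ∀ x y, π x = π y → x ∈ S → y ∈ S := by
    intro x y hxy hx
    obtain ⟨z, rfl⟩ := h.exists_vadd_eq hxy
    have h1 : IsClopen ((fun z : ℂ => ⟪z⟫[Λ] +ᵥ x) ⁻¹' S) :=
      hS.preimage (h.continuous_vadd x)
    rcases isClopen_iff.1 h1 with h2 | h2
    · have : (0 : ℂ) ∈ ((fun z : ℂ => ⟪z⟫[Λ] +ᵥ x) ⁻¹' S) := by
        simpa using hx
      rw [h2] at this
      exact this.elim
    · have : z ∈ ((fun z : ℂ => ⟪z⟫[Λ] +ᵥ x) ⁻¹' S) := by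
        rw [h2]; trivial
      exact this
  have hopen : ∀ T : Set X, IsOpen T → (∀ x y, π x = π y → x ∈ T → y ∈ T) → IsOpen (π '' T) := by
    intro T hT hT'
    rw [isOpen_iff_mem_nhds]
    rintro _ ⟨x, hx, rfl⟩
    obtain ⟨s, hs⟩ := h.exists_locSec (π x)
    have h1 : s (π x) ∈ T := hT' x _ hs.proj.symm hx
    filter_upwards [hs.continuousAt.preimage_mem_nhds (hT.mem_nhds h1), hs] with b hb hb'
    exact ⟨s b, hb, hb'.2⟩
  have hcompl : π '' Sᶜ = (π '' S)ᶜ := by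
    ext b
    constructor
    · rintro ⟨x, hx, rfl⟩ ⟨y, hy, hxy⟩
      exact hx (hfib y x hxy hy)
    · intro hb
      obtain ⟨s, hs⟩ := h.exists_locSec b
      exact ⟨s b, fun hsb => hb ⟨s b, hsb, hs.proj⟩, hs.proj⟩
  have hclopen : IsClopen (π '' S) := by
    refine ⟨⟨?_⟩, hopen S hS.isOpen hfib⟩
    rw [← hcompl]
    exact hopen Sᶜ hS.compl.isOpen fun x y hxy hx hy => hx (hfib y x hxy.symm hy)
  rcases isClopen_iff.1 hclopen with h1 | h1
  · left; exact Set.image_eq_empty.1 h1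
  · right
    ext x
    simp only [Set.mem_univ, iff_true]
    obtain ⟨y, hy, hxy⟩ : π x ∈ π '' S := h1 ▸ Set.mem_univ _
    exact hfib y x hxy hy

/-- The chart expression of a local section. -/
def chartSec (s : B → X) (e : OpenPartialHomeomorph B ℂ) (u : ℂ) : X := s (e.symm u)

variable [IsManifold 𝓘(ℂ, ℂ) ω B]

theorem LocSec.hol_chartSec {s : B → X} {e : OpenPartialHomeomorph B ℂ} (he : e ∈ atlas ℂ B)
    {u : ℂ} (hu : u ∈ e.target) (hs : LocSec π s (e.symm u)) :
    ∀ᶠ v in 𝓝 u, ContMDiffAt 𝓘(ℂ, ℂ) 𝓘(ℂ, ℂ²) ω (chartSec s e) v := by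
  have h1 : ∀ᶠ v in 𝓝 u, LocSec π s (e.symm v) :=
    (e.continuousAt_symm hu).eventually hs.eventually
  filter_upwards [h1, e.open_target.mem_nhds hu] with v hv hv'
  exact hv.self_of_nhds.1.comp v
    (contMDiffAt_symm_of_mem_maximalAtlas (IsManifold.subset_maximalAtlas he) hv')

theorem LocSec.smAt_chartSec {s : B → X} {e : OpenPartialHomeomorph B ℂ} (he : e ∈ atlas ℂ B)
    {u : ℂ} (hu : u ∈ e.target) (hs : LocSec π s (e.symm u)) :
    SmX (chartSec s e) u := by
  filter_upwards [hs.hol_chartSec he hu] with v hv using contMDiffAt_real_of_complex hv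

theorem LocSec.proj_chartSec {s : B → X} {e : OpenPartialHomeomorph B ℂ}
    {u : ℂ} (hs : LocSec π s (e.symm u)) : π (chartSec s e u) = e.symm u := hs.proj

/-- The parametrization of a part of the bundle given by a local section. -/
theorem IsPrincipalBundle.posParam [DiscreteTopology Λ] [IsZLattice ℝ Λ]
    (h : IsPrincipalBundle Λ π) {s : B → X}
    {e : OpenPartialHomeomorph B ℂ} (he : e ∈ atlas ℂ B) {V : Set ℂ} (hV : MeasurableSet V)
    (hVe : V ⊆ e.target) (hs : ∀ u ∈ V, LocSec π s (e.symm u)) :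
    PosParam (V ×ˢ fd Λ) (lift Λ (chartSec s e)) where
  meas := hV.prod (measurableSet_fd Λ)
  hol := by
    rintro ⟨u, z⟩ ⟨hu, -⟩
    have h1 : ∀ᶠ p : ℂ² in 𝓝 (u, z),
        ContMDiffAt 𝓘(ℂ, ℂ) 𝓘(ℂ, ℂ²) ω (chartSec s e) p.1 :=
      (continuous_fst.tendsto (u, z)).eventually ((hs u hu).hol_chartSec he (hVe hu))
    filter_upwards [h1] with p hp
    have h2 : ContMDiffAt 𝓘(ℂ, ℂ²) (𝓘(ℂ, ℂ).prod 𝓘(ℂ, ℂ²)) ω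
        (fun p : ℂ² => (p.2, chartSec s e p.1)) p := by
      refine ContMDiffAt.prodMk contDiff_snd.contMDiff.contMDiffAt ?_
      exact hp.comp p contDiff_fst.contMDiff.contMDiffAt
    exact (h.holomorphic_vadd (p.2, chartSec s e p.1)).comp p h2
  inj := by
    rintro ⟨u, z⟩ ⟨hu, hz⟩ ⟨u', z'⟩ ⟨hu', hz'⟩ heq
    have h1 := congrArg π heq
    simp only [lift, h.proj_mk_vadd] at h1
    rw [(hs u hu).proj_chartSec, (hs u' hu').proj_chartSec] at h1
    have h2 : u = u' := e.symm.injOn (hVe hu) (hVe hu') h1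
    subst h2
    exact congrArg (Prod.mk u) (eq_of_mem_fd Λ hz hz' (h.sub_mem heq))

end Bundle

/-! ### Primitives of closed 1-forms -/

section Poincare

variable {E : Type} [NormedAddCommGroup E] [NormedSpace ℝ E] {M : Type*}
    [TopologicalSpace M] [ChartedSpace E M]
  {V F : Type} [NormedAddCommGroup V] [NormedSpace ℝ V] [NormedAddCommGroup F] [NormedSpace ℝ F]
  [CompleteSpace F]

theorem OneForm.Closed.exists_primitive {μ : OneForm E M F} (hμ : μ.Closed) {H : V → M} {S : Set V}
    (hS : Convex ℝ S) (hS' : IsOpen S) (hH : ∀ y ∈ S, SmAt (E := E) H y) :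
    ∃ f : V → F, ∀ y ∈ S, HasFDerivAt f (μ.val H y) y := by
  refine hS.exists_forall_hasFDerivAt_of_fderiv_symmetric hS'
    (fun y hy => (μ.differentiableAt (hH y hy)).differentiableWithinAt) fun y hy v w => ?_
  exact sub_eq_zero.1 (hμ (hH y hy) v w)

end Poincare

/-! ### Functions with isolated zeros of given index on a Riemann surface -/

section Phase

/-- The phase of a complex number. -/
def ph (u : ℂ) : ℂ := u / (‖u‖ : ℂ)

theorem ph_mul (u v : ℂ) : ph (u * v) = ph u * ph v := by
  simp only [ph, norm_mul, Complex.ofReal_mul, mul_div_mul_comm]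

theorem ph_inv (u : ℂ) : ph u⁻¹ = (ph u)⁻¹ := by
  simp only [ph, norm_inv, Complex.ofReal_inv, inv_div]
  rw [div_inv_eq_mul, mul_comm, div_eq_mul_inv]

theorem norm_ph {u : ℂ} (hu : u ≠ 0) : ‖ph u‖ = 1 := by
  have : ‖u‖ ≠ 0 := norm_ne_zero_iff.2 hu
  simp [ph, this]

theorem ph_ne_zero {u : ℂ} (hu : u ≠ 0) : ph u ≠ 0 := by
  rw [← norm_ne_zero_iff, norm_ph hu]; exact one_ne_zero

theorem ph_conj (u : ℂ) : ph ((starRingEnd ℂ) u) = (ph u)⁻¹ := by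
  rcases eq_or_ne u 0 with rfl | hu
  · simp [ph]
  · have h : (‖u‖ : ℂ) ≠ 0 := by exact_mod_cast norm_ne_zero_iff.2 hu
    rw [ph, ph, RCLike.norm_conj, inv_div, div_eq_div_iff h hu, mul_comm, Complex.mul_conj]
    rw [Complex.normSq_eq_norm_sq]; push_cast; ring

theorem ph_of_norm_eq_one {u : ℂ} (hu : ‖u‖ = 1) : ph u = u := by simp [ph, hu]

theorem contDiffAt_ph {u : ℂ} (hu : u ≠ 0) : ContDiffAt ℝ ∞ ph u := by
  have h1 : ContDiffAt ℝ ∞ (fun u : ℂ => ((‖u‖⁻¹ : ℝ) : ℂ) * u) u :=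
    (Complex.ofRealCLM.contDiff.contDiffAt.comp u
      ((contDiffAt_norm ℝ hu).inv (norm_ne_zero_iff.2 hu))).mul contDiffAt_id
  refine h1.congr_of_eventuallyEq (Filter.Eventually.of_forall fun v => ?_)
  simp [ph, div_eq_inv_mul]

end Phase

section SmNV

variable {E : Type} [NormedAddCommGroup E] [NormedSpace ℝ E] {M : Type*}
    [TopologicalSpace M] [ChartedSpace E M]

/-- The function `R` is smooth without zeros in a neighbourhood of `b`. -/
def SmNV (E : Type) [NormedAddCommGroup E] [NormedSpace ℝ E] {M : Type*}
    [TopologicalSpace M] [ChartedSpace E M] (R : M → ℂ) (b : M) : Prop :=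
  ∀ᶠ x in 𝓝 b, ContMDiffAt 𝓘(ℝ, E) 𝓘(ℝ, ℂ) ∞ R x ∧ R x ≠ 0

theorem SmNV.of {R : M → ℂ} {b : M} (h : ∀ᶠ x in 𝓝 b, ContMDiffAt 𝓘(ℝ, E) 𝓘(ℝ, ℂ) ∞ R x)
    (h0 : R b ≠ 0) : SmNV E R b :=
  h.and (h.self_of_nhds.continuousAt.eventually_ne h0)

theorem SmNV.ne_zero {R : M → ℂ} {b : M} (h : SmNV E R b) : R b ≠ 0 := h.self_of_nhds.2

theorem SmNV.eventually {R : M → ℂ} {b : M} (h : SmNV E R b) : ∀ᶠ x in 𝓝 b, SmNV E R x :=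
  eventually_eventually_nhds.2 h

theorem SmNV.congr {R R' : M → ℂ} {b : M} (h : SmNV E R b) (hR : R =ᶠ[𝓝 b] R') : SmNV E R' b := by
  filter_upwards [h, hR.eventuallyEq_nhds] with x hx hx'
  exact ⟨hx.1.congr_of_eventuallyEq hx'.symm, hx'.self_of_nhds ▸ hx.2⟩

theorem SmNV.comp_fn {R : M → ℂ} {b : M} (h : SmNV E R b) {f : ℂ → ℂ}
    (hf : ∀ u, u ≠ 0 → ContDiffAt ℝ ∞ f u ∧ f u ≠ 0) : SmNV E (fun x => f (R x)) b := by
  filter_upwards [h] with x hx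
  exact ⟨(hf _ hx.2).1.contMDiffAt.comp x hx.1, (hf _ hx.2).2⟩

theorem SmNV.inv {R : M → ℂ} {b : M} (h : SmNV E R b) : SmNV E (fun x => (R x)⁻¹) b :=
  h.comp_fn fun _ hu => ⟨contDiffAt_inv ℝ hu, inv_ne_zero hu⟩

theorem SmNV.phase {R : M → ℂ} {b : M} (h : SmNV E R b) :
    SmNV E (fun x => ph (R x)) b :=
  h.comp_fn fun _ hu => ⟨contDiffAt_ph hu, ph_ne_zero hu⟩

theorem contMDiffAt_mul' {f g : M → ℂ} {x : M} (hf : ContMDiffAt 𝓘(ℝ, E) 𝓘(ℝ, ℂ) ∞ f x)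
    (hg : ContMDiffAt 𝓘(ℝ, E) 𝓘(ℝ, ℂ) ∞ g x) :
    ContMDiffAt 𝓘(ℝ, E) 𝓘(ℝ, ℂ) ∞ (fun x => f x * g x) x :=
  ContMDiffAt.comp (g := fun p : ℂ² => p.1 * p.2) x
    ((contDiff_fst.mul contDiff_snd).contMDiff.contMDiffAt) (hf.prodMk_space hg)

theorem SmNV.mul {R R' : M → ℂ} {b : M} (h : SmNV E R b) (h' : SmNV E R' b) :
    SmNV E (fun x => R x * R' x) b := by
  filter_upwards [h, h'] with x hx hx'
  exact ⟨contMDiffAt_mul' hx.1 hx'.1, mul_ne_zero hx.2 hx'.2⟩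

theorem SmNV.const {c : ℂ} (hc : c ≠ 0) (b : M) : SmNV E (fun _ => c) b :=
  Filter.Eventually.of_forall fun _ => ⟨contMDiffAt_const, hc⟩

theorem SmNV.zpow {R : M → ℂ} {b : M} (h : SmNV E R b) (n : ℤ) : SmNV E (fun x => R x ^ n) b := by
  have hn : ∀ m : ℕ, SmNV E (fun x => R x ^ m) b := by
    intro m
    induction m with
    | zero => simpa using SmNV.const (E := E) one_ne_zero b
    | succ m ih => simpa [pow_succ] using ih.mul h
  cases n with
  | ofNat m => simpa using hn m
  | negSucc m => simpa [zpow_negSucc] using (hn (m + 1)).inv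

theorem SmNV.comp {E' : Type} [NormedAddCommGroup E']
    [NormedSpace ℝ E'] {M' : Type*} [TopologicalSpace M'] [ChartedSpace E' M']
    {R : M → ℂ} {T : M' → M} {b : M'} (h : SmNV E R (T b))
    (hT : ∀ᶠ x in 𝓝 b, ContMDiffAt 𝓘(ℝ, E') 𝓘(ℝ, E) ∞ T x) : SmNV E' (fun x => R (T x)) b := by
  filter_upwards [hT, hT.self_of_nhds.continuousAt.eventually h] with x hx hx'
  exact ⟨hx'.1.comp x hx, hx'.2⟩

end SmNV

section LocInd

variable {B : Type*} [TopologicalSpace B] [ChartedSpace ℂ B]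

/-- In a punctured neighbourhood of `b` the function `k` is the product of the `n`-th power of the
phase of the coordinate and a smooth function without zeros. -/
def LocInd (k : B → ℂ) (b : B) (n : ℤ) : Prop :=
  ∃ R : B → ℂ, SmNV ℂ R b ∧ ∀ᶠ x in 𝓝[≠] b, k x = ph (chartAt ℂ b x - chartAt ℂ b b) ^ n * R x

theorem LocInd.congr {k k' : B → ℂ} {b : B} {n : ℤ} (h : LocInd k b n) (hk : k =ᶠ[𝓝[≠] b] k') :
    LocInd k' b n := by
  obtain ⟨R, hR, h⟩ := h
  refine ⟨R, hR, ?_⟩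
  filter_upwards [h, hk] with x hx hx'
  rw [← hx', hx]

theorem SmNV.locInd {k : B → ℂ} {b : B} (h : SmNV ℂ k b) : LocInd k b 0 :=
  ⟨k, h, Filter.Eventually.of_forall fun x => by simp⟩

theorem chart_sub_ne_zero {b : B} {e : OpenPartialHomeomorph B ℂ} (hb : b ∈ e.source) :
    ∀ᶠ x in 𝓝[≠] b, x ∈ e.source ∧ e x - e b ≠ 0 := by
  rw [eventually_nhdsWithin_iff]
  filter_upwards [e.open_source.mem_nhds hb] with x hx hxb
  exact ⟨hx, fun h => hxb (e.injOn hx hb (sub_eq_zero.1 h))⟩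

theorem LocInd.mul {k k' : B → ℂ} {b : B} {n n' : ℤ} (h : LocInd k b n) (h' : LocInd k' b n') :
    LocInd (fun x => k x * k' x) b (n + n') := by
  obtain ⟨R, hR, h⟩ := h
  obtain ⟨R', hR', h'⟩ := h'
  refine ⟨_, hR.mul hR', ?_⟩
  filter_upwards [h, h', chart_sub_ne_zero (mem_chart_source ℂ b)] with x hx hx' hx0
  rw [hx, hx', zpow_add₀ (ph_ne_zero hx0.2)]
  ring

theorem LocInd.zpow {k : B → ℂ} {b : B} {n : ℤ} (h : LocInd k b n) (m : ℤ) :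
    LocInd (fun x => k x ^ m) b (m * n) := by
  obtain ⟨R, hR, h⟩ := h
  refine ⟨_, hR.zpow m, ?_⟩
  filter_upwards [h] with x hx
  rw [hx, mul_zpow, ← zpow_mul, mul_comm n m]

variable [IsManifold 𝓘(ℂ, ℂ) ω B]

theorem contMDiffAt_chart_curve {e : OpenPartialHomeomorph B ℂ} (he : e ∈ atlas ℂ B) {x : B}
    (hx : x ∈ e.source) : ContMDiffAt 𝓘(ℝ, ℂ) 𝓘(ℝ, ℂ) ∞ e x :=
  contMDiffAt_real_of_complex
    (contMDiffAt_of_mem_maximalAtlas (IsManifold.subset_maximalAtlas he) hx)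

theorem differentiableAt_transition {e e' : OpenPartialHomeomorph B ℂ} (he : e ∈ atlas ℂ B)
    (he' : e' ∈ atlas ℂ B) {x : B} (hx : x ∈ e.source) (hx' : x ∈ e'.source) :
    DifferentiableAt ℂ (fun u => e' (e.symm u)) (e x) := by
  have h1 : ContMDiffAt 𝓘(ℂ, ℂ) 𝓘(ℂ, ℂ) ω e' (e.symm (e x)) :=
    contMDiffAt_of_mem_maximalAtlas (IsManifold.subset_maximalAtlas he')
      (by rwa [e.left_inv hx])
  exact (h1.comp (e x) (contMDiffAt_symm_of_mem_maximalAtlas (IsManifold.subset_maximalAtlas he)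
    (e.map_source hx))).contDiffAt.differentiableAt (by simp)

/-- The index can be computed in an arbitrary chart. -/
theorem exists_ph_chart {e e' : OpenPartialHomeomorph B ℂ} (he : e ∈ atlas ℂ B)
    (he' : e' ∈ atlas ℂ B) {b : B} (hb : b ∈ e.source) (hb' : b ∈ e'.source) :
    ∃ R : B → ℂ, SmNV ℂ R b ∧ ∀ᶠ x in 𝓝 b, ph (e' x - e' b) = ph (e x - e b) * R x := by
  set F : ℂ → ℂ := fun u => e' (e.symm u) with hF
  set s : Set ℂ := e.target ∩ e.symm ⁻¹' e'.source with hs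
  have hso : IsOpen s := e.isOpen_inter_preimage_symm e'.open_source
  have hbs : e b ∈ s := ⟨e.map_source hb, by rw [Set.mem_preimage, e.left_inv hb]; exact hb'⟩
  have hFd : DifferentiableOn ℂ F s := by
    intro u hu
    have := differentiableAt_transition he he' (e.map_target hu.1) hu.2
    rw [e.right_inv hu.1] at this
    exact this.differentiableWithinAt
  have hD : DifferentiableOn ℂ (dslope F (e b)) s :=
    (Complex.differentiableOn_dslope (hso.mem_nhds hbs)).2 hFd
  have hcd : ∀ u ∈ s, ContDiffAt ℝ ∞ (dslope F (e b)) u := fun u hu =>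
    ((hD.analyticAt (hso.mem_nhds hu)).contDiffAt (n := ∞)).restrict_scalars ℝ
  have h0 : dslope F (e b) (e b) ≠ 0 := by
    rw [dslope_same]
    intro h
    have d1 := (differentiableAt_transition he he' hb hb').hasDerivAt
    have d2 := (differentiableAt_transition he' he hb' hb).hasDerivAt
    have h3 : F (e b) = e' b := by rw [hF]; simp only; rw [e.left_inv hb]
    have h4 : HasDerivAt (fun u => e (e'.symm u)) (deriv (fun u => e (e'.symm u)) (e' b))
      (F (e b)) := by rw [h3]; exact d2
    have h5 := h4.comp (e b) d1
    have h6 : ((fun u => e (e'.symm u)) ∘ F) =ᶠ[𝓝 (e b)] id := by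
      filter_upwards [hso.mem_nhds hbs] with u hu
      simp only [Function.comp_apply, hF, id]
      rw [e'.left_inv hu.2, e.right_inv hu.1]
    have h7 := (h5.congr_of_eventuallyEq h6.symm).unique (hasDerivAt_id _)
    change _ * deriv F (e b) = 1 at h7
    rw [h, mul_zero] at h7
    exact zero_ne_one h7
  refine ⟨fun x => ph (dslope F (e b) (e x)), SmNV.phase (SmNV.of ?_ h0), ?_⟩
  · have h1 : ∀ᶠ x in 𝓝 b, x ∈ e.source ∧ e x ∈ s :=
      (e.open_source.mem_nhds hb |> Filter.eventually_mem_set.2).and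
        ((e.continuousAt hb).eventually (hso.mem_nhds hbs))
    filter_upwards [h1] with x hx
    exact (hcd _ hx.2).contMDiffAt.comp x (contMDiffAt_chart_curve he hx.1)
  · filter_upwards [e.open_source.mem_nhds hb] with x hx
    rw [← ph_mul]
    congr 1
    have h1 := sub_smul_dslope F (e b) (e x)
    rw [smul_eq_mul] at h1
    rw [h1]
    simp only [hF]
    rw [e.left_inv hx, e.left_inv hb]

theorem LocInd.of_chart {k : B → ℂ} {b : B} {n : ℤ} {e : OpenPartialHomeomorph B ℂ}
    (he : e ∈ atlas ℂ B) (hb : b ∈ e.source) {R : B → ℂ} (hR : SmNV ℂ R b)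
    (h : ∀ᶠ x in 𝓝[≠] b, k x = ph (e x - e b) ^ n * R x) : LocInd k b n := by
  obtain ⟨R', hR', h'⟩ := exists_ph_chart (chart_mem_atlas ℂ b) he (mem_chart_source ℂ b) hb
  refine ⟨_, (hR'.zpow n).mul hR, ?_⟩
  filter_upwards [h, h'.filter_mono nhdsWithin_le_nhds] with x hx hx'
  rw [hx, hx', mul_zpow]
  ring

end LocInd

section HasDiv

variable {B : Type*} [TopologicalSpace B] [ChartedSpace ℂ B]

/-- The function `g` is smooth without zeros outside of a finite set, and has index `D b` at `b`. -/
def HasDiv (g : B → ℂ) (D : B → ℤ) : Prop :=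
  ∃ Z : Set B, Z.Finite ∧ (∀ x ∉ Z, SmNV ℂ g x ∧ D x = 0) ∧ ∀ b ∈ Z, LocInd g b (D b)

theorem HasDiv.locInd {g : B → ℂ} {D : B → ℤ} (h : HasDiv g D) (b : B) : LocInd g b (D b) := by
  obtain ⟨Z, -, h1, h2⟩ := h
  by_cases hb : b ∈ Z
  · exact h2 b hb
  · rw [(h1 b hb).2]; exact (h1 b hb).1.locInd

theorem HasDiv.mul {g g' : B → ℂ} {D D' : B → ℤ} (h : HasDiv g D) (h' : HasDiv g' D') :
    HasDiv (fun x => g x * g' x) (D + D') := by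
  have h3 := h.locInd
  have h3' := h'.locInd
  obtain ⟨Z, hZ, h1, h2⟩ := h
  obtain ⟨Z', hZ', h1', h2'⟩ := h'
  refine ⟨Z ∪ Z', hZ.union hZ', fun x hx => ?_, fun b _ => (h3 b).mul (h3' b)⟩
  rw [Set.mem_union, not_or] at hx
  refine ⟨(h1 x hx.1).1.mul (h1' x hx.2).1, ?_⟩
  rw [Pi.add_apply, (h1 x hx.1).2, (h1' x hx.2).2, add_zero]

theorem HasDiv.zpow {g : B → ℂ} {D : B → ℤ} (h : HasDiv g D) (m : ℤ) :
    HasDiv (fun x => g x ^ m) (fun x => m * D x) := by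
  have h3 := h.locInd
  obtain ⟨Z, hZ, h1, h2⟩ := h
  refine ⟨Z, hZ, fun x hx => ⟨(h1 x hx).1.zpow m, ?_⟩, fun b _ => (h3 b).zpow m⟩
  simp only [(h1 x hx).2, mul_zero]

theorem HasDiv.one : HasDiv (fun _ : B => 1) 0 :=
  ⟨∅, Set.finite_empty, fun x _ => ⟨SmNV.const one_ne_zero x, rfl⟩, fun _ h => h.elim⟩

end HasDiv

section Linked

variable {B : Type*} [TopologicalSpace B] [ChartedSpace ℂ B]

open Classical in
/-- The divisor of a point. -/
def delta (p x : B) : ℤ := if x = p then 1 else 0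

theorem delta_self (p : B) : delta p p = 1 := by simp [delta]

theorem delta_of_ne {p x : B} (h : x ≠ p) : delta p x = 0 := by simp [delta, h]

/-- The difference of the two points is the divisor of a function. -/
def Linked (p q : B) : Prop := ∃ g : B → ℂ, HasDiv g (fun x => delta p x - delta q x)

theorem Linked.refl (p : B) : Linked p p :=
  ⟨_, by simpa using! (HasDiv.one (B := B))⟩

theorem Linked.symm {p q : B} (h : Linked p q) : Linked q p := by
  obtain ⟨g, hg⟩ := h
  refine ⟨fun x => g x ^ (-1 : ℤ), ?_⟩
  convert! hg.zpow (-1) using 2 with x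
  ring

theorem Linked.trans {p q r : B} (h : Linked p q) (h' : Linked q r) : Linked p r := by
  obtain ⟨g, hg⟩ := h
  obtain ⟨g', hg'⟩ := h'
  refine ⟨fun x => g x * g' x, ?_⟩
  convert! hg.mul hg' using 2 with x
  simp

variable [IsManifold 𝓘(ℂ, ℂ) ω B] [T2Space B] [CompactSpace B]

theorem exists_bump {e : OpenPartialHomeomorph B ℂ} (he : e ∈ atlas ℂ B) {c : ℂ} {r r' : ℝ}
    (hr : r < r') (hb : Metric.closedBall c r' ⊆ e.target) :
    ∃ χ : B → ℝ, ContMDiff 𝓘(ℝ, ℂ) 𝓘(ℝ, ℝ) ∞ χ ∧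
      (∀ x ∈ e.source, ‖e x - c‖ ≤ r → ∀ᶠ y in 𝓝 x, χ y = 1) ∧ (∀ x, χ x ∈ Set.Icc (0 : ℝ) 1) ∧
      tsupport χ ⊆ e.source ∧ ∀ x ∈ e.source, r' < ‖e x - c‖ → ∀ᶠ y in 𝓝 x, χ y = 0 := by
  have := isManifold_real_curve B
  have hcs : ∀ ρ ≤ r', IsClosed (e.symm '' Metric.closedBall c ρ) := fun ρ hρ =>
    ((isCompact_closedBall c ρ).image_of_continuousOn (e.symm.continuousOn.mono
      ((Metric.closedBall_subset_closedBall hρ).trans hb))).isClosed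
  have hsub : e.symm '' Metric.closedBall c r ⊆ interior (e.symm '' Metric.closedBall c r') := by
    refine (Set.image_mono (Metric.closedBall_subset_ball hr)).trans ?_
    refine interior_maximal (Set.image_mono Metric.ball_subset_closedBall) ?_
    exact e.symm.isOpen_image_of_subset_source Metric.isOpen_ball
      (Metric.ball_subset_closedBall.trans hb)
  obtain ⟨χ, h1, h0, h01⟩ := exists_contMDiffMap_one_nhds_of_subset_interior (n := (⊤ : ℕ∞))
    𝓘(ℝ, ℂ) (hcs r hr.le) hsub
  have hts : tsupport χ ⊆ e.symm '' Metric.closedBall c r' :=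
    closure_minimal (fun x hx => by
      by_contra hx'
      exact hx (h0 x hx')) (hcs r' le_rfl)
  refine ⟨χ, χ.contMDiff, fun x hx hxr => ?_, h01, ?_, fun x hx hxr => ?_⟩
  · refine h1.filter_mono (nhds_le_nhdsSet ?_)
    exact ⟨e x, by simpa [dist_eq_norm] using hxr, e.left_inv hx⟩
  · refine hts.trans ?_
    rintro _ ⟨u, hu, rfl⟩
    exact e.map_target (hb hu)
  · have hx' : x ∉ e.symm '' Metric.closedBall c r' := by
      rintro ⟨u, hu, rfl⟩
      rw [e.right_inv (hb hu)] at hxr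
      rw [Metric.mem_closedBall, dist_eq_norm] at hu
      linarith
    filter_upwards [(hcs r' le_rfl).isOpen_compl.mem_nhds hx'] with y hy using h0 y hy

theorem linked_near (b : B) : ∀ᶠ p in 𝓝 b, Linked p b := by
  set e := chartAt ℂ b with he'
  have he : e ∈ atlas ℂ B := chart_mem_atlas _ _
  have hb : b ∈ e.source := mem_chart_source _ _
  obtain ⟨ε, hε, hball⟩ := Metric.nhds_basis_closedBall.mem_iff.1
    (e.open_target.mem_nhds (e.map_source hb))
  set r := ε / 4 with hr
  have hr0 : 0 < r := by positivity
  obtain ⟨χ, hχ, hχ1, hχ01, hχs, -⟩ := exists_bump he (c := e b) (r := 3 * r) (r' := ε)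
    (by rw [hr]; linarith) hball
  have h1 : ∀ᶠ p in 𝓝 b, p ∈ e.source ∧ e p ∈ Metric.ball (e b) r :=
    (e.open_source.mem_nhds hb |> Filter.eventually_mem_set.2).and
      ((e.continuousAt hb).eventually (Metric.ball_mem_nhds _ hr0))
  filter_upwards [h1] with p hp
  rcases eq_or_ne p b with rfl | hpb
  · exact Linked.refl p
  have hpr : ‖e p - e b‖ < r := by simpa [dist_eq_norm] using hp.2
  have hepb : e p - e b ≠ 0 := fun h => hpb (e.injOn hp.1 hb (sub_eq_zero.1 h))
  set G : B → ℂ := fun x => 1 + (χ x : ℂ) * ((e b - e p) / (e x - e b)) with hG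
  have hcoord : ∀ c : ℂ, ∀ x ∈ e.source, e x - c ≠ 0 → SmNV ℂ (fun x => e x - c) x := by
    intro c x hx hne
    refine SmNV.of ?_ hne
    filter_upwards [e.open_source.mem_nhds hx] with y hy
    exact (contMDiffAt_chart_curve he hy).sub contMDiffAt_const
  have hGval : ∀ x ∈ e.source, x ≠ b → ‖e x - e b‖ ≤ 3 * r →
      G =ᶠ[𝓝 x] fun y => (e y - e p) * (e y - e b)⁻¹ := by
    intro x hx hxb hxr
    have hne : e x - e b ≠ 0 := fun h => hxb (e.injOn hx hb (sub_eq_zero.1 h))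
    filter_upwards [hχ1 x hx hxr, (hcoord (e b) x hx hne)] with y hy hy'
    have := hy'.2
    simp only [hG, hy]
    field_simp
    push_cast
    ring
  have hGval' : ∀ x ∈ e.source, ‖e x - e b‖ ≤ 3 * r →
      ∀ᶠ y in 𝓝[≠] x, y ≠ b → G y = (e y - e p) * (e y - e b)⁻¹ := by
    intro x hx hxr
    filter_upwards [(hχ1 x hx hxr).filter_mono nhdsWithin_le_nhds,
      (e.open_source.mem_nhds hx |> Filter.eventually_mem_set.2).filter_mono nhdsWithin_le_nhds]
      with y hy hys hyb
    have hne : e y - e b ≠ 0 := fun h => hyb (e.injOn hys hb (sub_eq_zero.1 h))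
    simp only [hG, hy]
    field_simp
    push_cast
    ring
  have hGsm : ∀ x, x ≠ b → ∀ᶠ y in 𝓝 x, ContMDiffAt 𝓘(ℝ, ℂ) 𝓘(ℝ, ℂ) ∞ G y := by
    intro x hxb
    by_cases hx : x ∈ tsupport χ
    · have hxs := hχs hx
      have hne : e x - e b ≠ 0 := fun h => hxb (e.injOn hxs hb (sub_eq_zero.1 h))
      filter_upwards [(hcoord (e b) x hxs hne).inv] with y hy
      refine contMDiffAt_const.add (contMDiffAt_mul' ?_ ?_)
      · exact Complex.ofRealCLM.contDiff.contMDiff.contMDiffAt.comp y (hχ y)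
      · simp only [div_eq_mul_inv]
        exact contMDiffAt_mul' contMDiffAt_const hy.1
    · have h0 : G =ᶠ[𝓝 x] fun _ => 1 := by
        filter_upwards [(isClosed_tsupport χ).isOpen_compl.mem_nhds hx] with y hy
        simp only [hG, image_eq_zero_of_notMem_tsupport hy]
        simp
      filter_upwards [h0.eventuallyEq_nhds] with y hy
      exact contMDiffAt_const.congr_of_eventuallyEq hy
  have hGne : ∀ x, x ≠ b → x ≠ p → G x ≠ 0 := by
    intro x hxb hxp
    by_cases hx : x ∈ tsupport χ
    · have hxs := hχs hx
      have hne : e x - e b ≠ 0 := fun h => hxb (e.injOn hxs hb (sub_eq_zero.1 h))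
      have hne' : e x - e p ≠ 0 := fun h => hxp (e.injOn hxs hp.1 (sub_eq_zero.1 h))
      by_cases hxr : ‖e x - e b‖ ≤ 3 * r
      · rw [(hGval x hxs hxb hxr).self_of_nhds]
        exact mul_ne_zero hne' (inv_ne_zero hne)
      · intro h0
        have h2 : (χ x : ℂ) * ((e b - e p) / (e x - e b)) = -1 := by
          rw [hG] at h0; linear_combination h0
        have h3 : |χ x| * (‖e p - e b‖ / ‖e x - e b‖) = 1 := by
          have := congrArg norm h2
          rwa [norm_mul, norm_div, Complex.norm_real, Real.norm_eq_abs, norm_neg, norm_one,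
            norm_sub_rev (e b)] at this
        have h4 : ‖e p - e b‖ / ‖e x - e b‖ < 1 := by
          rw [div_lt_one (norm_pos_iff.2 hne)]
          push Not at hxr
          linarith
        have h5 : |χ x| ≤ 1 := abs_le.2 ⟨by linarith [(hχ01 x).1], (hχ01 x).2⟩
        have h6 : 0 ≤ ‖e p - e b‖ / ‖e x - e b‖ := by positivity
        nlinarith [abs_nonneg (χ x)]
    · simp only [hG, image_eq_zero_of_notMem_tsupport hx]
      simp
  refine ⟨fun x => ph (G x), {p, b}, by simp, fun x hx => ?_, ?_⟩
  · simp only [Set.mem_insert_iff, Set.mem_singleton_iff, not_or] at hx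
    refine ⟨(SmNV.of (hGsm x hx.2) (hGne x hx.2 hx.1)).phase, ?_⟩
    beta_reduce
    rw [delta_of_ne hx.1, delta_of_ne hx.2, sub_zero]
  · rintro x (rfl | rfl)
    · beta_reduce
      rw [delta_self, delta_of_ne hpb, sub_zero]
      refine LocInd.of_chart he hp.1 (hcoord (e b) x hp.1 hepb).inv.phase ?_
      filter_upwards [(hGval x hp.1 hpb (by linarith)).filter_mono nhdsWithin_le_nhds] with y hy
      rw [hy, ph_mul, zpow_one]
    · beta_reduce
      rw [delta_self, delta_of_ne (Ne.symm hpb), zero_sub]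
      have hne : e x - e p ≠ 0 := fun h => hepb (by rw [← neg_sub, h, neg_zero])
      refine LocInd.of_chart he hb (hcoord (e p) x hb hne).phase ?_
      have hne : ∀ᶠ y in 𝓝[≠] x, y ≠ x := eventually_mem_nhdsWithin
      filter_upwards [hGval' x hb (by simp; linarith), hne] with y hy hy'
      rw [hy hy', ph_mul, ph_inv, zpow_neg_one, mul_comm]

theorem linked [PreconnectedSpace B] (p q : B) : Linked p q := by
  have h1 : IsClopen {x | Linked x q} := by
    constructor
    · rw [← isOpen_compl_iff, isOpen_iff_mem_nhds]
      intro x hx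
      filter_upwards [linked_near x] with y hy hyq
      exact hx (hy.symm.trans hyq)
    · rw [isOpen_iff_mem_nhds]
      intro x hx
      filter_upwards [linked_near x] with y hy
      exact hy.trans hx
  rcases isClopen_iff.1 h1 with h2 | h2
  · have : q ∈ {x | Linked x q} := Linked.refl q
    rw [h2] at this
    exact this.elim
  · have : p ∈ {x | Linked x q} := by rw [h2]; trivial
    exact this

theorem exists_hasDiv_sum [PreconnectedSpace B] (q : B) (c : B → ℤ) (S : Finset B) :
    ∃ g : B → ℂ, HasDiv g (fun x => ∑ p ∈ S, c p * (delta q x - delta p x)) := by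
  classical
  induction S using Finset.induction_on with
  | empty => exact ⟨_, by simpa using! (HasDiv.one (B := B))⟩
  | insert p S hp ih =>
    obtain ⟨g, hg⟩ := ih
    obtain ⟨g', hg'⟩ := linked q p
    refine ⟨fun x => g' x ^ (c p) * g x, ?_⟩
    convert! (hg'.zpow (c p)).mul hg using 2 with x
    simp [Finset.sum_insert hp]

end Linked

section EquivariantFunctions

variable {X B : Type*} [TopologicalSpace X] [ChartedSpace ℂ² X]
    [TopologicalSpace B] [ChartedSpace ℂ B] {Λ : Submodule ℤ ℂ} [AddAction (Torus Λ) X] {π : X → B}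

/-- The character `z ↦ exp (2πi ℓ(z))`. -/
def chr (ℓ : ℂ →L[ℝ] ℝ) (z : ℂ) : ℂ := Complex.exp ((2 * Real.pi * ℓ z : ℝ) * I)

theorem chr_add (ℓ : ℂ →L[ℝ] ℝ) (z w : ℂ) : chr ℓ (z + w) = chr ℓ z * chr ℓ w := by
  rw [chr, chr, chr, ← Complex.exp_add]
  congr 1
  rw [map_add]; push_cast; ring

theorem norm_chr (ℓ : ℂ →L[ℝ] ℝ) (z : ℂ) : ‖chr ℓ z‖ = 1 := Complex.norm_exp_ofReal_mul_I _

theorem chr_ne_zero (ℓ : ℂ →L[ℝ] ℝ) (z : ℂ) : chr ℓ z ≠ 0 := Complex.exp_ne_zero _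

/-- The linear form takes integral values on the lattice. -/
def IntegralOn (Λ : Submodule ℤ ℂ) (ℓ : ℂ →L[ℝ] ℝ) : Prop := ∀ l ∈ Λ, ∃ n : ℤ, ℓ l = n

theorem chr_lattice {ℓ : ℂ →L[ℝ] ℝ} (hℓ : IntegralOn Λ ℓ) {l : ℂ} (hl : l ∈ Λ) : chr ℓ l = 1 := by
  obtain ⟨n, hn⟩ := hℓ l hl
  rw [chr, hn, Complex.exp_eq_one_iff]
  exact ⟨n, by push_cast; ring⟩

theorem chr_eq {ℓ : ℂ →L[ℝ] ℝ} (hℓ : IntegralOn Λ ℓ) {z w : ℂ} (h : z - w ∈ Λ) :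
    chr ℓ z = chr ℓ w := by
  rw [← sub_add_cancel z w, chr_add, chr_lattice hℓ h, one_mul]

theorem contDiff_chr (ℓ : ℂ →L[ℝ] ℝ) : ContDiff ℝ ∞ (chr ℓ) := by
  have h : ContDiff ℝ ∞ (fun z => (((2 * Real.pi * ℓ z : ℝ)) : ℂ) * I) :=
    (Complex.ofRealCLM.contDiff.comp (contDiff_const.mul ℓ.contDiff)).mul contDiff_const
  exact Complex.contDiff_exp.comp h

/-- The function `h` on the bundle is equivariant with respect to the character of `ℓ`. -/
def EquivFn (Λ : Submodule ℤ ℂ) {X : Type*} [AddAction (Torus Λ) X] (ℓ : ℂ →L[ℝ] ℝ) (h : X → ℂ) :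
    Prop :=
  ∀ (z : ℂ) (x : X), h (⟪z⟫[Λ] +ᵥ x) = chr ℓ z * h x

/-- The function `h` is smooth without zeros outside of a finite number of fibres, and has the
indices given by `D`. -/
def HasDivX (π : X → B) (h : X → ℂ) (D : B → ℤ) : Prop :=
  ∃ Z : Set B, Z.Finite ∧ (∀ x, π x ∉ Z → SmNV ℂ² h x) ∧ (∀ b ∉ Z, D b = 0) ∧
    ∀ b ∈ Z, ∃ s : B → X, LocSec π s b ∧ LocInd (fun x => h (s x)) b (D b)

theorem HasDivX.exists_locInd (hπ : IsPrincipalBundle Λ π) {h : X → ℂ} {D : B → ℤ}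
    (hD : HasDivX π h D) (b : B) :
    ∃ s : B → X, LocSec π s b ∧ LocInd (fun x => h (s x)) b (D b) := by
  obtain ⟨Z, -, h1, h2, h3⟩ := hD
  by_cases hb : b ∈ Z
  · exact h3 b hb
  · obtain ⟨s, hs⟩ := hπ.exists_locSec b
    refine ⟨s, hs, ?_⟩
    rw [h2 b hb]
    refine SmNV.locInd ?_
    exact (h1 (s b) (by rwa [hs.proj])).comp hs.smooth

theorem HasDivX.mul (hπ : IsPrincipalBundle Λ π) {h : X → ℂ} {D : B → ℤ} (hD : HasDivX π h D)
    {g : B → ℂ} {D' : B → ℤ} (hg : HasDiv g D') :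
    HasDivX π (fun x => h x * g (π x)) (D + D') := by
  have h4 := hD.exists_locInd hπ
  have h5 := hg.locInd
  obtain ⟨Z, hZ, h1, h2, h3⟩ := hD
  obtain ⟨Z', hZ', h1', h2'⟩ := hg
  refine ⟨Z ∪ Z', hZ.union hZ', fun x hx => ?_, fun b hb => ?_, fun b _ => ?_⟩
  · rw [Set.mem_union, not_or] at hx
    exact (h1 x hx.1).mul ((h1' _ hx.2).1.comp
      (Filter.Eventually.of_forall fun x => hπ.smooth_proj x))
  · rw [Set.mem_union, not_or] at hb
    rw [Pi.add_apply, h2 b hb.1, (h1' b hb.2).2, add_zero]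
  · obtain ⟨s, hs, hs'⟩ := h4 b
    refine ⟨s, hs, (hs'.mul (h5 b)).congr ?_⟩
    filter_upwards [hs.filter_mono nhdsWithin_le_nhds] with x hx
    rw [hx.2]

theorem EquivFn.mul_proj (hπ : IsPrincipalBundle Λ π) {ℓ : ℂ →L[ℝ] ℝ} {h : X → ℂ}
    (hE : EquivFn Λ ℓ h) (g : B → ℂ) : EquivFn Λ ℓ (fun x => h x * g (π x)) := by
  intro z x
  beta_reduce
  rw [hE, hπ.proj_mk_vadd, mul_assoc]

theorem exists_hasDivX_single [IsManifold 𝓘(ℂ, ℂ) ω B] [T2Space B] [CompactSpace B]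
    [PreconnectedSpace B] (hπ : IsPrincipalBundle Λ π) {ℓ : ℂ →L[ℝ] ℝ} {h : X → ℂ}
    (hE : EquivFn Λ ℓ h) {D : B → ℤ} (hD : HasDivX π h D) (q : B) :
    ∃ (h' : X → ℂ) (m : ℤ), EquivFn Λ ℓ h' ∧ HasDivX π h' (fun x => m * delta q x) := by
  have hD' := hD
  obtain ⟨Z, hZ, h1, h2, h3⟩ := hD'
  obtain ⟨g, hg⟩ := exists_hasDiv_sum q D hZ.toFinset
  refine ⟨_, ∑ p ∈ hZ.toFinset, D p, hE.mul_proj hπ g, ?_⟩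
  convert! hD.mul hπ hg using 2 with x
  rw [Pi.add_apply]
  simp only [mul_sub, Finset.sum_sub_distrib, ← Finset.sum_mul]
  have : ∑ p ∈ hZ.toFinset, D p * delta p x = D x := by
    by_cases hx : x ∈ Z
    · rw [Finset.sum_eq_single x]
      · rw [delta_self, mul_one]
      · intro p _ hpx
        rw [delta_of_ne (Ne.symm hpx), mul_zero]
      · intro h
        exact (h (hZ.mem_toFinset.2 hx)).elim
    · rw [h2 x hx]
      refine Finset.sum_eq_zero fun p hp => ?_
      rw [delta_of_ne, mul_zero]
      rintro rfl
      exact hx (hZ.mem_toFinset.1 hp)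
  rw [this]
  ring

/-- Removal of the singularities of index zero. -/
theorem exists_regular [T2Space B] (hπ : IsPrincipalBundle Λ π) {ℓ : ℂ →L[ℝ] ℝ}
    (hℓ : IntegralOn Λ ℓ) {h : X → ℂ}
    (hE : EquivFn Λ ℓ h) {D : B → ℤ} (hD : HasDivX π h D) :
    ∃ h' : X → ℂ, EquivFn Λ ℓ h' ∧ (∀ x, D (π x) = 0 → SmNV ℂ² h' x) ∧
      ∀ b, D b ≠ 0 → ∃ s : B → X, LocSec π s b ∧ LocInd (fun x => h' (s x)) b (D b) := by
  classical
  have h4 := hD.exists_locInd hπ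
  obtain ⟨Z, hZ, h1, h2, h3⟩ := hD
  choose s hs hsi using h4
  choose R hR hRs using hsi
  have hex : ∀ x : X, ∃ z : ℂ, ⟪z⟫[Λ] +ᵥ s (π x) (π x) = x := fun x =>
    hπ.exists_vadd_eq (hs (π x)).proj
  choose z hz using hex
  set h' : X → ℂ := fun x => if π x ∈ Z ∧ D (π x) = 0 then chr ℓ (z x) * R (π x) (π x) else h x
    with hh'
  have hz' : ∀ (x : X) (w : ℂ), ⟪w⟫[Λ] +ᵥ s (π x) (π x) = x →
      chr ℓ (z x) = chr ℓ w := fun x w hw => chr_eq hℓ (hπ.sub_mem ((hz x).trans hw.symm))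
  have hnear : ∀ b, ∀ᶠ x in 𝓝[≠] b, x ∉ Z := by
    intro b
    rw [eventually_nhdsWithin_iff]
    filter_upwards [((hZ.subset (Set.sdiff_subset (t := {b}))).isClosed.isOpen_compl.mem_nhds
      (by simp : b ∈ (Z \ {b})ᶜ))] with x hx hxb hxZ
    exact hx ⟨hxZ, hxb⟩
  refine ⟨h', fun w x => ?_, fun x hx => ?_, fun b hb => ⟨s b, hs b, ?_⟩⟩
  · simp only [hh', hπ.proj_mk_vadd]
    split_ifs with hc
    · rw [hz' _ (w + z x), chr_add, mul_assoc]
      rw [hπ.proj_mk_vadd, QuotientAddGroup.mk_add, add_vadd, hz]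
    · exact hE w x
  · by_cases hxZ : π x ∈ Z
    · obtain ⟨f, hf⟩ := hπ.exists_coord (hs (π x))
      have hsm : SmNV ℂ² (fun y => chr ℓ (f y) * R (π x) (π y)) x := by
        refine SmNV.mul (SmNV.of ?_ (chr_ne_zero _ _)) ((hR (π x)).comp
          (Filter.Eventually.of_forall fun x => hπ.smooth_proj x))
        filter_upwards [hf] with y hy
        exact (contDiff_chr ℓ).contMDiff.contMDiffAt.comp y (contMDiffAt_real_of_complex hy.1)
      refine hsm.congr ?_
      have hp : ∀ᶠ y in 𝓝 x, π y ≠ π x → π y ∉ Z ∧ h (s (π x) (π y)) = R (π x) (π y) := by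
        have := (hnear (π x)).and (hRs (π x))
        rw [eventually_nhdsWithin_iff] at this
        filter_upwards [hπ.continuous_proj.continuousAt.eventually this] with y hy hyx
        have h5 := hy hyx
        refine ⟨h5.1, ?_⟩
        rw [h5.2, hx, zpow_zero, one_mul]
      filter_upwards [hf, hp] with y hy hpy
      by_cases hyx : π y = π x
      · have h6 : π y ∈ Z ∧ D (π y) = 0 := by rw [hyx]; exact ⟨hxZ, hx⟩
        simp only [hh', if_pos h6]
        rw [hz' y (f y), hyx]
        conv_rhs => rw [← hy.2]
        rw [hyx]
      · obtain ⟨h7, h8⟩ := hpy hyx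
        have h6 : ¬ (π y ∈ Z ∧ D (π y) = 0) := fun h => h7 h.1
        simp only [hh', if_neg h6]
        rw [← h8, ← hE, hy.2]
    · refine (h1 x hxZ).congr ?_
      have : ∀ᶠ y in 𝓝 x, π y ∉ Z :=
        hπ.continuous_proj.continuousAt.eventually (hZ.isClosed.isOpen_compl.mem_nhds hxZ)
      filter_upwards [this] with y hy
      have h6 : ¬ (π y ∈ Z ∧ D (π y) = 0) := fun h => hy h.1
      simp only [hh', if_neg h6]
  · refine ⟨R b, hR b, ?_⟩
    filter_upwards [hRs b, hnear b, (hs b).filter_mono nhdsWithin_le_nhds] with x hx hx' hx2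
    have h6 : ¬ (π (s b x) ∈ Z ∧ D (π (s b x)) = 0) := fun h => hx' (hx2.2 ▸ h.1)
    simp only [hh', if_neg h6]
    exact hx

end EquivariantFunctions

section Sard

theorem isOpen_dense_nondegenerate {ι : Type*} [Fintype ι] {a : ι → ℂ → ℂ} {K : Set ℂ}
    (hK : IsCompact K) (ha : ∀ j, ∀ u ∈ K, ContDiffAt ℝ 1 (a j) u) (i : ι)
    (hi : ∀ u ∈ K, ∀ᶠ v in 𝓝 u, a i v = 1) :
    IsOpen {ε : ι → ℂ | ∀ u ∈ K, ∑ j, ε j * a j u = 0 → (∑ j, ε j • fderiv ℝ (a j) u).det ≠ 0} ∧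
    Dense {ε : ι → ℂ | ∀ u ∈ K, ∑ j, ε j * a j u = 0 → (∑ j, ε j • fderiv ℝ (a j) u).det ≠ 0} := by
  classical
  constructor
  · have := isCompact_iff_compactSpace.1 hK
    have hca : ∀ j, Continuous fun u : K => a j u := fun j => by
      rw [continuous_iff_continuousAt]
      exact fun u => ContinuousAt.comp (g := a j) (ha j u u.2).continuousAt
        continuous_subtype_val.continuousAt
    have hcd : ∀ j, Continuous fun u : K => fderiv ℝ (a j) u := fun j => by
      rw [continuous_iff_continuousAt]
      exact fun u => ContinuousAt.comp (g := fderiv ℝ (a j))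
        ((ha j u u.2).fderiv_right (m := 0) le_rfl).continuousAt
        continuous_subtype_val.continuousAt
    have hcl : IsClosed {p : (ι → ℂ) × K | ∑ j, p.1 j * a j p.2 = 0 ∧
        (∑ j, p.1 j • fderiv ℝ (a j) p.2).det = 0} := by
      refine IsClosed.inter (isClosed_eq ?_ continuous_const) (isClosed_eq ?_ continuous_const)
      · refine continuous_finsetSum _ fun j _ => ?_
        exact ((continuous_apply j).comp continuous_fst).mul ((hca j).comp continuous_snd)
      · refine ContinuousLinearMap.continuous_det.comp (continuous_finsetSum _ fun j _ => ?_)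
        exact ((continuous_apply j).comp continuous_fst).smul ((hcd j).comp continuous_snd)
    have := isClosedMap_fst_of_compactSpace _ hcl
    convert this.isOpen_compl using 1
    ext ε
    simp only [Set.mem_ofPred_eq, Set.mem_compl_iff, Set.mem_image, Prod.exists, exists_and_right,
      exists_eq_right, Subtype.exists, not_exists, not_and]
    exact ⟨fun h u hu => h u hu.1 hu.2, fun h u hu h0 => h u ⟨hu, h0⟩⟩
  · intro ε
    rw [mem_closure_iff_nhds]
    intro t ht
    set g : ℂ → ℂ := fun u => -∑ j ∈ Finset.univ.erase i, ε j * a j u with hg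
    set S := {u ∈ K | (fderiv ℝ g u).det = 0} with hS
    have hgd : ∀ u ∈ K, HasFDerivAt g (-∑ j ∈ Finset.univ.erase i, ε j • fderiv ℝ (a j) u) u := by
      intro u hu
      refine (HasFDerivAt.fun_sum fun j _ => ?_).neg
      exact ((ha j u hu).differentiableAt one_ne_zero).hasFDerivAt.const_mul (ε j)
    have h0 : volume (g '' S) = 0 :=
      addHaar_image_eq_zero_of_det_fderivWithin_eq_zero volume
        (f' := fun u => fderiv ℝ g u)
        (fun u hu => (hgd u hu.1).differentiableAt.hasFDerivAt.hasFDerivWithinAt) fun u hu => hu.2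
    have hdense : Dense (g '' S)ᶜ := by
      have h2 := Measure.dense_of_ae (μ := (volume : Measure ℂ)) (p := fun w => w ∈ (g '' S)ᶜ)
        (compl_mem_ae_iff.2 h0)
      exact h2
    have hcont : ContinuousAt (fun w : ℂ => Function.update ε i w) (ε i) := by fun_prop
    have ht' : {w : ℂ | Function.update ε i w ∈ t} ∈ 𝓝 (ε i) := by
      refine hcont ?_
      simpa using ht
    obtain ⟨w, hwt, hw⟩ := (mem_closure_iff_nhds.1 (hdense (ε i))) _ ht'
    refine ⟨Function.update ε i w, hwt, fun u hu hsum hdet => hw ?_⟩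
    have e1 : ∀ {M : Type} [AddCommGroup M] [Module ℂ M] (c : ι → M),
        ∑ j, Function.update ε i w j • c j = w • c i + ∑ j ∈ Finset.univ.erase i, ε j • c j := by
      intro M _ _ c
      rw [← Finset.add_sum_erase _ _ (Finset.mem_univ i)]
      congr 1
      · simp
      · refine Finset.sum_congr rfl fun j hj => ?_
        rw [Function.update_of_ne (Finset.ne_of_mem_erase hj)]
    have e2 := e1 fun j => a j u
    simp only [smul_eq_mul] at e2
    rw [e2, (hi u hu).self_of_nhds, mul_one] at hsum
    have hd : fderiv ℝ (a i) u = 0 := by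
      have : a i =ᶠ[𝓝 u] fun _ => 1 := hi u hu
      rw [this.fderiv_eq]
      simp
    refine ⟨u, ⟨hu, ?_⟩, ?_⟩
    · rw [e1 fun j => fderiv ℝ (a j) u, hd, smul_zero, zero_add] at hdet
      rw [(hgd u hu).fderiv]
      have : (-∑ j ∈ Finset.univ.erase i, ε j • fderiv ℝ (a j) u) =
        (-1 : ℝ) • ∑ j ∈ Finset.univ.erase i, ε j • fderiv ℝ (a j) u := by simp
      rw [this]
      change LinearMap.det ((-1 : ℝ) •
        ((∑ j ∈ Finset.univ.erase i, ε j • fderiv ℝ (a j) u : ℂ →L[ℝ] ℂ) : ℂ →ₗ[ℝ] ℂ)) = 0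
      rw [LinearMap.det_smul]
      exact mul_eq_zero_of_right _ hdet
    · rw [hg]
      linear_combination -hsum

/-- At a nondegenerate zero a function is comparable to a complex linear or antilinear form. -/
theorem exists_linear_model {f : ℂ → ℂ} {u₀ : ℂ} (hf : DifferentiableAt ℝ f u₀) (h0 : f u₀ = 0)
    (hdet : (fderiv ℝ f u₀).det ≠ 0) :
    ∃ (n : ℤ) (C : ℂ) (k : ℂ → ℂ), C ≠ 0 ∧ ContDiff ℝ ∞ k ∧ (∀ w, w ≠ 0 → k w ≠ 0) ∧
      (∀ w, ph (k w) = ph w ^ n * C) ∧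
      ∀ᶠ u in 𝓝[≠] u₀, f u / k (u - u₀) ∈ Complex.slitPlane := by
  set T := fderiv ℝ f u₀ with hT
  set α := (T 1 - I * T I) / 2 with hα
  set β := (T 1 + I * T I) / 2 with hβ
  have hTw : ∀ w, T w = α * w + β * (starRingEnd ℂ) w := by
    intro w
    have h1 : T w = (w.re : ℂ) * T 1 + (w.im : ℂ) * T I := by
      conv_lhs => rw [← Complex.re_add_im w]
      rw [map_add]
      congr 1
      · rw [← Complex.real_smul, ← map_smul, Complex.real_smul, mul_one]
      · rw [← Complex.real_smul, map_smul, Complex.real_smul]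
    have h2 : α * w + β * (starRingEnd ℂ) w = α * (w.re + w.im * I) +
        β * (w.re - w.im * I) := by
      congr 2
      · exact (Complex.re_add_im w).symm
      · apply Complex.ext <;> simp
    rw [h1, h2, hα, hβ]
    linear_combination ((w.im : ℂ) * T I) * Complex.I_sq
  have hdet' : T.det = Complex.normSq α - Complex.normSq β := by
    have : T.det = LinearMap.det (T : ℂ →ₗ[ℝ] ℂ) := rfl
    rw [this, ← LinearMap.det_toMatrix Complex.basisOneI, Matrix.det_fin_two]
    simp only [LinearMap.toMatrix_apply, Complex.coe_basisOneI, Complex.coe_basisOneI_repr]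
    simp [hα, hβ, Complex.normSq_apply]
    ring
  have key : ∀ (A B' : ℂ) (k k' : ℂ → ℂ), ‖B'‖ < ‖A‖ → (∀ w, ‖k w‖ = ‖A‖ * ‖w‖) →
      (∀ w, ‖k' w‖ = ‖B'‖ * ‖w‖) → (∀ w, T w = k w + k' w) →
      ∀ᶠ u in 𝓝[≠] u₀, f u / k (u - u₀) ∈ Complex.slitPlane := by
    intro A B' k k' hlt hk hk' hTk
    have h1 := hf.hasFDerivAt.isLittleO.def (c := (‖A‖ - ‖B'‖) / 2) (by linarith)
    rw [eventually_nhdsWithin_iff]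
    filter_upwards [h1] with u hu hne
    have hne' : 0 < ‖u - u₀‖ := norm_pos_iff.2 (sub_ne_zero.2 hne)
    have hA : 0 < ‖A‖ := (norm_nonneg _).trans_lt hlt
    have hk0 : k (u - u₀) ≠ 0 := by
      rw [← norm_ne_zero_iff, hk]; positivity
    rw [h0, sub_zero, ← hT, hTk] at hu
    have e : f u / k (u - u₀) = 1 + (f u - k (u - u₀)) / k (u - u₀) := by field_simp; ring
    rw [e]
    refine Complex.mem_slitPlane_of_norm_lt_one ?_
    rw [norm_div, hk, div_lt_one (by positivity)]
    calc ‖f u - k (u - u₀)‖ = ‖(f u - (k (u - u₀) + k' (u - u₀))) + k' (u - u₀)‖ := by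
          congr 1; ring
      _ ≤ (‖A‖ - ‖B'‖) / 2 * ‖u - u₀‖ + ‖B'‖ * ‖u - u₀‖ :=
          (norm_add_le _ _).trans (add_le_add hu (hk' _).le)
      _ < ‖A‖ * ‖u - u₀‖ := by nlinarith
  have hne : ‖α‖ ≠ ‖β‖ := by
    intro h
    apply hdet
    rw [hdet', Complex.normSq_eq_norm_sq, Complex.normSq_eq_norm_sq, h, sub_self]
  rcases lt_or_gt_of_ne hne with h | h
  · have hβ0 : β ≠ 0 := norm_pos_iff.1 ((norm_nonneg _).trans_lt h)
    refine ⟨-1, ph β, fun w => β * (starRingEnd ℂ) w, ph_ne_zero hβ0,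
      contDiff_const.mul Complex.conjCLE.contDiff, fun w hw => ?_, fun w => ?_, ?_⟩
    · exact mul_ne_zero hβ0 ((map_ne_zero _).2 hw)
    · rw [ph_mul, ph_conj, zpow_neg_one, mul_comm]
    · refine key β α (fun w => β * (starRingEnd ℂ) w) (fun w => α * w) h (fun w => ?_) (fun w => ?_) fun w => ?_
      · simp
      · simp
      · exact (hTw w).trans (add_comm _ _)
  · have hα0 : α ≠ 0 := norm_pos_iff.1 ((norm_nonneg _).trans_lt h)
    refine ⟨1, ph α, fun w => α * w, ph_ne_zero hα0,
      contDiff_const.mul contDiff_id, fun w hw => mul_ne_zero hα0 hw, fun w => ?_, ?_⟩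
    · rw [ph_mul, zpow_one, mul_comm]
    · refine key α β (fun w => α * w) (fun w => β * (starRingEnd ℂ) w) h (fun w => ?_) (fun w => ?_) fun w => ?_
      · simp
      · simp
      · exact hTw w

end Sard

section EquivariantSections

variable {X B : Type*} [TopologicalSpace X] [ChartedSpace ℂ² X]
    [TopologicalSpace B] [ChartedSpace ℂ B] {Λ : Submodule ℤ ℂ} [AddAction (Torus Λ) X] {π : X → B}

theorem EquivFn.smul_sum {ℓ : ℂ →L[ℝ] ℝ} {ι : Type*} [Fintype ι] {E : ι → X → ℂ}
    (hE : ∀ j, EquivFn Λ ℓ (E j)) (ε : ι → ℂ) : EquivFn Λ ℓ (fun x => ∑ j, ε j * E j x) := by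
  intro z x
  simp only [Finset.mul_sum]
  refine Finset.sum_congr rfl fun j _ => ?_
  rw [hE j]; ring

theorem EquivFn.phase {ℓ : ℂ →L[ℝ] ℝ} {h : X → ℂ} (hE : EquivFn Λ ℓ h) :
    EquivFn Λ ℓ (fun x => ph (h x)) := by
  intro z x
  beta_reduce
  rw [hE, ph_mul, ph_of_norm_eq_one (norm_chr _ _)]

variable [IsManifold 𝓘(ℂ, ℂ) ω B] [T2Space B] [CompactSpace B]

theorem exists_cutoff (b : B) {P : B → Prop} (hP : ∀ᶠ x in 𝓝 b, P x) :
    ∃ (ρ : ℝ) (ψ : B → ℝ), 0 < ρ ∧ Metric.closedBall (chartAt ℂ b b) ρ ⊆ (chartAt ℂ b).target ∧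
      ContMDiff 𝓘(ℝ, ℂ) 𝓘(ℝ, ℝ) ∞ ψ ∧
      (∀ u ∈ Metric.closedBall (chartAt ℂ b b) ρ, ∀ᶠ y in 𝓝 ((chartAt ℂ b).symm u), ψ y = 1) ∧
      ∀ x ∈ tsupport ψ, x ∈ (chartAt ℂ b).source ∧ P x := by
  set e := chartAt ℂ b
  have hb : b ∈ e.source := mem_chart_source _ _
  have h1 : ∀ᶠ u in 𝓝 (e b), u ∈ e.target ∧ P (e.symm u) := by
    refine (Filter.eventually_mem_set.2 (e.open_target.mem_nhds (e.map_source hb))).and ?_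
    refine (e.continuousAt_symm (e.map_source hb)).eventually ?_
    rwa [e.left_inv hb]
  obtain ⟨ε, hε, hball⟩ := Metric.nhds_basis_closedBall.mem_iff.1 h1
  obtain ⟨ψ, h2, h3, -, h4, h5⟩ := exists_bump (chart_mem_atlas ℂ b) (half_lt_self hε)
    fun u hu => (hball hu).1
  refine ⟨ε / 2, ψ, half_pos hε, fun u hu =>
    (hball (Metric.closedBall_subset_closedBall (half_le_self hε.le) hu)).1, h2, fun u hu => ?_,
    fun x hx => ?_⟩
  · have hu' := (hball (Metric.closedBall_subset_closedBall (half_le_self hε.le) hu)).1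
    refine h3 _ (e.map_target hu') ?_
    rw [e.right_inv hu']
    simpa [dist_eq_norm] using hu
  · have hxs := h4 hx
    refine ⟨hxs, ?_⟩
    have : e x ∈ Metric.closedBall (e b) ε := by
      rw [Metric.mem_closedBall, dist_eq_norm]
      by_contra hlt
      push Not at hlt
      have h6 := h5 x hxs hlt
      exact (notMem_tsupport_iff_eventuallyEq.2 h6) hx
    have := (hball this).2
    rwa [e.left_inv hxs] at this

theorem exists_local_equivFn (hπ : IsPrincipalBundle Λ π) {ℓ : ℂ →L[ℝ] ℝ} (hℓ : IntegralOn Λ ℓ)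
    (b : B) : ∃ (ρ : ℝ) (s : B → X) (E : X → ℂ), 0 < ρ ∧
      Metric.closedBall (chartAt ℂ b b) ρ ⊆ (chartAt ℂ b).target ∧
      ContMDiff 𝓘(ℝ, ℂ²) 𝓘(ℝ, ℂ) ∞ E ∧ EquivFn Λ ℓ E ∧
      ∀ u ∈ Metric.closedBall (chartAt ℂ b b) ρ, LocSec π s ((chartAt ℂ b).symm u) ∧
        ∀ᶠ v in 𝓝 u, E (s ((chartAt ℂ b).symm v)) = 1 := by
  classical
  obtain ⟨s, hs⟩ := hπ.exists_locSec b
  obtain ⟨ρ, ψ, hρ, hsub, hψ, hψ1, hψs⟩ := exists_cutoff b hs.eventually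
  set e := chartAt ℂ b
  have hex : ∀ x : X, ∃ z : ℂ, π (s (π x)) = π x →
      ⟪z⟫[Λ] +ᵥ s (π x) = x := fun x => by
    by_cases h : π (s (π x)) = π x
    · obtain ⟨z, hz⟩ := hπ.exists_vadd_eq h
      exact ⟨z, fun _ => hz⟩
    · exact ⟨0, fun h' => (h h').elim⟩
  choose z hz using hex
  have hz' : ∀ (x : X) (w : ℂ), ⟪w⟫[Λ] +ᵥ s (π x) = x →
      chr ℓ (z x) = chr ℓ w := fun x w hw => by
    exact chr_eq hℓ (hπ.sub_mem ((hz x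
      ((hπ.proj_mk_vadd w (s (π x))).symm.trans (congrArg π hw))).trans hw.symm))
  have hψ0 : ∀ x, x ∉ tsupport ψ → ψ x = 0 := fun x hx => image_eq_zero_of_notMem_tsupport hx
  have hmem : ∀ u ∈ Metric.closedBall (e b) ρ, e.symm u ∈ tsupport ψ := fun u hu => by
    by_contra h
    have := (hψ1 u hu).self_of_nhds
    rw [hψ0 _ h] at this
    exact zero_ne_one this
  refine ⟨ρ, s, fun x => chr ℓ (z x) * (ψ (π x) : ℂ), hρ, hsub, fun x => ?_, fun w x => ?_,
    fun u hu => ⟨(hψs _ (hmem u hu)).2, ?_⟩⟩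
  · by_cases hx : π x ∈ tsupport ψ
    · obtain ⟨f, hf⟩ := hπ.exists_coord (hψs _ hx).2
      have h1 : ContMDiffAt 𝓘(ℝ, ℂ²) 𝓘(ℝ, ℂ) ∞ (fun y => chr ℓ (f y)) x :=
        (contDiff_chr ℓ).contMDiff.contMDiffAt.comp x (contMDiffAt_real_of_complex hf.self_of_nhds.1)
      have h2 : ContMDiffAt 𝓘(ℝ, ℂ²) 𝓘(ℝ, ℂ) ∞ (fun y => (ψ (π y) : ℂ)) x :=
        Complex.ofRealCLM.contDiff.contMDiff.contMDiffAt.comp x ((hψ (π x)).comp x (hπ.smooth_proj x))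
      refine (contMDiffAt_mul' h1 h2).congr_of_eventuallyEq ?_
      filter_upwards [hf] with y hy
      rw [hz' y (f y) hy.2]
    · have : ContMDiffAt 𝓘(ℝ, ℂ²) 𝓘(ℝ, ℂ) ∞ (fun _ : X => (0 : ℂ)) x := contMDiffAt_const
      refine this.congr_of_eventuallyEq ?_
      filter_upwards [hπ.continuous_proj.continuousAt.eventually
        ((isClosed_tsupport ψ).isOpen_compl.mem_nhds hx)] with y hy
      rw [hψ0 _ hy, Complex.ofReal_zero, mul_zero]
  · beta_reduce
    rw [hπ.proj_mk_vadd]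
    by_cases hx : π x ∈ tsupport ψ
    · rw [hz' _ (w + z x), chr_add, mul_assoc]
      rw [hπ.proj_mk_vadd, QuotientAddGroup.mk_add, add_vadd, hz x (hψs _ hx).2.proj]
    · rw [hψ0 _ hx]; simp
  · have h1 : ∀ᶠ v in 𝓝 u, ψ (e.symm v) = 1 ∧ LocSec π s (e.symm v) :=
      (e.continuousAt_symm (hsub hu)).eventually ((hψ1 u hu).and (hψs _ (hmem u hu)).2.eventually)
    filter_upwards [h1] with v hv
    rw [hz' _ 0, hv.2.proj, hv.1]
    · simp [chr]
    · rw [hv.2.proj, QuotientAddGroup.mk_zero, zero_vadd]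

/-- Equivariant functions with nondegenerate zeros. -/
theorem exists_nondegenerate_equivFn (hπ : IsPrincipalBundle Λ π) {ℓ : ℂ →L[ℝ] ℝ}
    (hℓ : IntegralOn Λ ℓ) : ∃ F : X → ℂ, ContMDiff 𝓘(ℝ, ℂ²) 𝓘(ℝ, ℂ) ∞ F ∧ EquivFn Λ ℓ F ∧
      ∀ x : B, ∃ (s : B → X) (e : OpenPartialHomeomorph B ℂ), LocSec π s x ∧ e ∈ atlas ℂ B ∧
        x ∈ e.source ∧
        (F (s x) = 0 → (fderiv ℝ (fun u => F (s (e.symm u))) (e x)).det ≠ 0) := by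
  classical
  choose ρ s E hρ hsub hE hEq hK using fun b : B => exists_local_equivFn hπ hℓ b
  have hnh : ∀ b : B, (chartAt ℂ b).source ∩ chartAt ℂ b ⁻¹' Metric.closedBall (chartAt ℂ b b) (ρ b)
      ∈ 𝓝 b := fun b => Filter.inter_mem (chart_source_mem_nhds ℂ b)
    ((chartAt ℂ b).continuousAt (mem_chart_source _ _) (Metric.closedBall_mem_nhds _ (hρ b)))
  obtain ⟨J, hJ⟩ := CompactSpace.elim_nhds_subcover _ hnh
  have hsm : ∀ (i j : B), ∀ u ∈ Metric.closedBall (chartAt ℂ i i) (ρ i),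
      ContDiffAt ℝ 1 (fun u => E j (s i ((chartAt ℂ i).symm u))) u := by
    intro i j u hu
    have h1 : ContMDiffAt 𝓘(ℝ, ℂ) 𝓘(ℝ, ℂ²) ∞ (chartSec (s i) (chartAt ℂ i)) u :=
      ((hK i u hu).1.smAt_chartSec (chart_mem_atlas ℂ i) (hsub i hu)).self_of_nhds
    exact (((hE j _).comp u h1).contDiffAt).of_le (by exact_mod_cast le_top)
  have hgood := fun i : J => isOpen_dense_nondegenerate (ι := J)
    (a := fun j u => E j (s i ((chartAt ℂ (i : B)).symm u)))
    (isCompact_closedBall (chartAt ℂ (i : B) i) (ρ i)) (fun j u hu => hsm i j u hu) i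
    (fun u hu => (hK i u hu).2)
  obtain ⟨ε, hε⟩ := (dense_iInter_of_isOpen (fun i => (hgood i).1) fun i => (hgood i).2).nonempty
  rw [Set.mem_iInter] at hε
  refine ⟨fun x => ∑ j : J, ε j * E j x, ?_, EquivFn.smul_sum (E := fun j : J => E j) (fun j => hEq j) ε, fun x => ?_⟩
  · intro x
    refine contMDiffAt_finsetSum fun j _ => ?_
    exact contMDiffAt_mul' contMDiffAt_const (hE j x)
  · have hx : x ∈ ⋃ b ∈ J, (chartAt ℂ b).source ∩
        chartAt ℂ b ⁻¹' Metric.closedBall (chartAt ℂ b b) (ρ b) := by rw [hJ]; trivial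
    simp only [Set.mem_iUnion] at hx
    obtain ⟨i, hi, hxs, hxb⟩ := hx
    have h1 := (hK i _ hxb).1
    have h2 := hε ⟨i, hi⟩ _ hxb
    rw [(chartAt ℂ i).left_inv hxs] at h1
    simp only [(chartAt ℂ i).left_inv hxs] at h2
    refine ⟨s i, chartAt ℂ i, h1, chart_mem_atlas ℂ i, hxs, fun h0 => ?_⟩
    have h3 := h2 h0
    have h4 : HasFDerivAt (fun u => ∑ j : J, ε j * E j (s i ((chartAt ℂ i).symm u)))
        (∑ j : J, ε j • fderiv ℝ (fun u => E j (s i ((chartAt ℂ i).symm u))) (chartAt ℂ i x))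
        (chartAt ℂ i x) := by
      refine HasFDerivAt.fun_sum fun j _ => ?_
      exact ((hsm i j _ hxb).differentiableAt one_ne_zero).hasFDerivAt.const_mul (ε j)
    rw [h4.fderiv]
    exact h3

theorem exists_zero_correction {F : X → ℂ}
    (hF : ContMDiff 𝓘(ℝ, ℂ²) 𝓘(ℝ, ℂ) ∞ F) {p : B} {s : B → X}
    {e : OpenPartialHomeomorph B ℂ} (hs : LocSec π s p) (he : e ∈ atlas ℂ B) (hp : p ∈ e.source)
    (h0 : F (s p) = 0) (hdet : (fderiv ℝ (fun u => F (s (e.symm u))) (e p)).det ≠ 0) :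
    (∀ᶠ x in 𝓝[≠] p, F (s x) ≠ 0) ∧ ∃ (κ : B → ℂ) (n : ℤ), (∀ x, x ≠ p → SmNV ℂ κ x) ∧
      LocInd (fun x => ph (F (s x) * κ x)) p n := by
  have hsm : ContMDiffAt 𝓘(ℝ, ℂ) 𝓘(ℝ, ℂ²) ∞ (chartSec s e) (e p) :=
    (LocSec.smAt_chartSec he (e.map_source hp) (by rwa [e.left_inv hp])).self_of_nhds
  have hd : DifferentiableAt ℝ (fun u => F (s (e.symm u))) (e p) :=
    (((hF _).comp (e p) hsm).contDiffAt).differentiableAt (by simp)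
  obtain ⟨n, C, k, hC, hk, hk0, hkph, hslit⟩ := exists_linear_model hd
    (by simpa [e.left_inv hp] using h0) hdet
  set q : B → ℂ := fun x => F (s x) / k (e x - e p) with hq
  have hq1 : ∀ᶠ x in 𝓝 p, x ≠ p → q x ∈ Complex.slitPlane := by
    rw [eventually_nhdsWithin_iff] at hslit
    filter_upwards [(e.continuousAt hp).eventually hslit, e.open_source.mem_nhds hp] with x hx hxs hxp
    have := hx fun h => hxp (e.injOn hxs hp h)
    rwa [e.left_inv hxs] at this
  have hP : ∀ᶠ x in 𝓝 p, x ∈ e.source ∧ LocSec π s x ∧ (x ≠ p → q x ∈ Complex.slitPlane) :=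
    (Filter.eventually_mem_set.2 (e.open_source.mem_nhds hp)).and (hs.eventually.and hq1)
  obtain ⟨ρ, ψ, hρ, hsub, hψ, hψ1, hψs⟩ := exists_cutoff p hP
  have hψp : ∀ᶠ x in 𝓝 p, ψ x = 1 := by
    have := hψ1 _ (Metric.mem_closedBall_self hρ.le)
    rwa [(chartAt ℂ p).left_inv (mem_chart_source _ _)] at this
  refine ⟨?_, fun x => Complex.exp (-((ψ x : ℂ) * Complex.log (q x))), n, fun x hx => ?_, ?_⟩
  · rw [eventually_nhdsWithin_iff]
    filter_upwards [hq1] with x hx hxp h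
    have := Complex.slitPlane_ne_zero (hx hxp)
    exact this (by simp [hq, h])
  · refine SmNV.of ?_ (Complex.exp_ne_zero _)
    by_cases hxs : x ∈ tsupport ψ
    · have hcl : ∀ᶠ y in 𝓝 x, y ≠ p ∧ y ∈ e.source ∧ LocSec π s y ∧ q y ∈ Complex.slitPlane := by
        obtain ⟨-, h1, h2, h3⟩ := hψs x hxs
        have hqc : ContinuousAt q x := by
          refine ContinuousAt.div ?_ ?_ ?_
          · exact ContinuousAt.comp (g := F) (hF _).continuousAt h2.continuousAt
          · exact ContinuousAt.comp (g := k) hk.continuous.continuousAt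
              ((e.continuousAt h1).sub continuousAt_const)
          · exact hk0 _ (sub_ne_zero.2 fun h => hx (e.injOn h1 hp h))
        filter_upwards [isOpen_ne.mem_nhds hx, e.open_source.mem_nhds h1, h2.eventually,
          hqc.eventually (Complex.isOpen_slitPlane.mem_nhds (h3 hx))] with y a b c d
        exact ⟨a, b, c, d⟩
      filter_upwards [hcl] with y hy
      obtain ⟨hyp, hys, hyl, hyq⟩ := hy
      have h1 : ContMDiffAt 𝓘(ℝ, ℂ) 𝓘(ℝ, ℂ) ∞ (fun x => F (s x)) y :=
        (hF _).comp y hyl.smooth.self_of_nhds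
      have h2 : SmNV ℂ (fun x => k (e x - e p)) y := by
        refine SmNV.of ?_ (hk0 _ (sub_ne_zero.2 fun h => hyp (e.injOn hys hp h)))
        filter_upwards [e.open_source.mem_nhds hys] with w hw
        exact hk.contMDiff.contMDiffAt.comp w
          ((contMDiffAt_chart_curve he hw).sub contMDiffAt_const)
      have h3 : ContMDiffAt 𝓘(ℝ, ℂ) 𝓘(ℝ, ℂ) ∞ q y := by
        simp only [hq, div_eq_mul_inv]
        exact contMDiffAt_mul' h1 h2.inv.self_of_nhds.1
      have h4 : ContMDiffAt 𝓘(ℝ, ℂ) 𝓘(ℝ, ℂ) ∞ (fun x => Complex.log (q x)) y :=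
        ((Complex.contDiffAt_log hyq).restrict_scalars ℝ).contMDiffAt.comp y h3
      have h5 : ContMDiffAt 𝓘(ℝ, ℂ) 𝓘(ℝ, ℂ) ∞ (fun x => (ψ x : ℂ)) y :=
        Complex.ofRealCLM.contDiff.contMDiff.contMDiffAt.comp y (hψ y)
      exact ContMDiffAt.comp (g := fun u : ℂ => Complex.exp (-u)) y
        (Complex.contDiff_exp.comp contDiff_neg).contMDiff.contMDiffAt (contMDiffAt_mul' h5 h4)
    · have h1 : (fun x => Complex.exp (-((ψ x : ℂ) * Complex.log (q x)))) =ᶠ[𝓝 x] fun _ => 1 := by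
        filter_upwards [(isClosed_tsupport ψ).isOpen_compl.mem_nhds hxs] with y hy
        rw [image_eq_zero_of_notMem_tsupport hy]
        simp
      filter_upwards [h1.eventuallyEq_nhds] with y hy
      exact contMDiffAt_const.congr_of_eventuallyEq hy
  · refine LocInd.of_chart he hp (SmNV.const hC p) ?_
    rw [eventually_nhdsWithin_iff]
    filter_upwards [hq1, hψp] with x hx hxψ hxp
    have hq0 := Complex.slitPlane_ne_zero (hx hxp)
    rw [hxψ, Complex.ofReal_one, one_mul, Complex.exp_neg, Complex.exp_log hq0, ← hkph]
    congr 1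
    simp only [hq] at hq0 ⊢
    have := div_ne_zero_iff.1 hq0
    field_simp [this.1, this.2]

/-- Equivariant functions of norm one with isolated singularities. -/
theorem exists_hasDivX (hπ : IsPrincipalBundle Λ π) {ℓ : ℂ →L[ℝ] ℝ} (hℓ : IntegralOn Λ ℓ) :
    ∃ (h : X → ℂ) (D : B → ℤ), EquivFn Λ ℓ h ∧ HasDivX π h D := by
  classical
  obtain ⟨F, hF, hFE, hex⟩ := exists_nondegenerate_equivFn hπ hℓ
  choose s e hs he hxe hdet using hex
  have hzero : ∀ x y, π x = π y → F x = 0 → F y = 0 := by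
    intro x y hxy hx
    obtain ⟨z, rfl⟩ := hπ.exists_vadd_eq hxy
    rw [hFE, hx, mul_zero]
  set Z : Set B := {b | F (s b b) = 0} with hZdef
  have hcorr := fun (b : B) (hb : b ∈ Z) =>
    exists_zero_correction hF (hs b) (he b) (hxe b) hb (hdet b hb)
  have hnear : ∀ b, ∃ U ∈ 𝓝 b, U ∩ Z ⊆ {b} := by
    intro b
    have h1 : ∀ᶠ x in 𝓝[≠] b, F (s b x) ≠ 0 := by
      by_cases hb : b ∈ Z
      · exact (hcorr b hb).1
      · have : ContinuousAt (fun x => F (s b x)) b :=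
          ContinuousAt.comp (g := F) (hF _).continuousAt (hs b).continuousAt
        exact (this.eventually_ne hb).filter_mono nhdsWithin_le_nhds
    rw [eventually_nhdsWithin_iff] at h1
    refine ⟨_, h1.and (hs b).eventually, fun x hx => ?_⟩
    by_contra hxb
    refine hx.1.1 hxb (hzero (s x x) _ ?_ hx.2)
    rw [(hs x).proj, hx.1.2.proj]
  have hZ : Z.Finite := by
    choose U hU hUZ using hnear
    obtain ⟨t, ht⟩ := CompactSpace.elim_nhds_subcover U hU
    refine t.finite_toSet.subset fun x hx => ?_
    have h1 : x ∈ ⋃ b ∈ t, U b := by rw [ht]; trivial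
    simp only [Set.mem_iUnion] at h1
    obtain ⟨b, hb, hxb⟩ := h1
    have := hUZ b ⟨hxb, hx⟩
    rw [Set.mem_singleton_iff] at this
    rwa [this]
  have hc2 : ∀ b, ∃ (κ : B → ℂ) (n : ℤ), (∀ x, x ≠ b → SmNV ℂ κ x) ∧
      (b ∈ Z → LocInd (fun x => ph (F (s b x) * κ x)) b n) := by
    intro b
    by_cases hb : b ∈ Z
    · obtain ⟨-, κ, n, h1, h2⟩ := hcorr b hb
      exact ⟨κ, n, h1, fun _ => h2⟩
    · exact ⟨fun _ => 1, 0, fun x _ => SmNV.const one_ne_zero x, fun h => (hb h).elim⟩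
  choose κ n hκ hκZ using hc2
  have hprod : ∀ (S : Finset B) (x : B), x ∉ S → SmNV ℂ (fun y => ∏ b ∈ S, κ b y) x := by
    intro S x hxS
    induction S using Finset.induction_on with
    | empty => simpa using SmNV.const one_ne_zero x
    | insert p S hp ih =>
      rw [Finset.mem_insert, not_or] at hxS
      simp only [Finset.prod_insert hp]
      exact (hκ p x hxS.1).mul (ih hxS.2)
  refine ⟨fun x => ph (F x * ∏ b ∈ hZ.toFinset, κ b (π x)), fun b => if b ∈ Z then n b else 0,
    (hFE.mul_proj hπ (fun y => ∏ b ∈ hZ.toFinset, κ b y)).phase, Z, hZ, fun x hx => ?_,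
    fun b hb => if_neg hb, fun b hb => ⟨s b, hs b, ?_⟩⟩
  · refine (SmNV.mul (SmNV.of (Filter.Eventually.of_forall fun y => hF y) ?_) ?_).phase
    · exact fun h => hx (hzero x _ (hs (π x)).proj.symm h)
    · exact (hprod hZ.toFinset (π x) (by simpa using hx)).comp
        (Filter.Eventually.of_forall fun x => hπ.smooth_proj x)
  · simp only [if_pos hb]
    have h1 := (hκZ b hb).mul (hprod (hZ.toFinset.erase b) b (by simp)).phase.locInd
    rw [add_zero] at h1
    refine h1.congr ?_
    filter_upwards [(hs b).filter_mono nhdsWithin_le_nhds] with x hx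
    rw [← ph_mul, hx.2, mul_assoc, Finset.mul_prod_erase _ (fun b => κ b x) (hZ.mem_toFinset.2 hb)]

end EquivariantSections

section PhaseForm

variable {V W : Type} [NormedAddCommGroup V] [NormedSpace ℝ V] [NormedAddCommGroup W]
  [NormedSpace ℝ W]

/-- The differential `(1/2π) Im (dk/k)` of the phase of a function. -/
def dphase (k : V → ℂ) (y : V) : V →L[ℝ] ℝ :=
  (1 / (2 * Real.pi)) • Complex.imCLM.comp ((k y)⁻¹ • fderiv ℝ k y)

theorem dphase_apply (k : V → ℂ) (y v : V) :
    dphase k y v = 1 / (2 * Real.pi) * ((k y)⁻¹ * fderiv ℝ k y v).im := rfl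

theorem dphase_congr {k k' : V → ℂ} {y : V} (h : k =ᶠ[𝓝 y] k') : dphase k y = dphase k' y := by
  rw [dphase, dphase, h.fderiv_eq, h.self_of_nhds]

theorem HasFDerivAt.dphase_eq {k : V → ℂ} {k' : V →L[ℝ] ℂ} {y : V} (h : HasFDerivAt k k' y)
    (v : V) : dphase k y v = 1 / (2 * Real.pi) * ((k y)⁻¹ * k' v).im := by
  rw [dphase_apply, h.fderiv]

theorem dphase_mul {k k' : V → ℂ} {y : V} (h : DifferentiableAt ℝ k y)
    (h' : DifferentiableAt ℝ k' y) (h0 : k y ≠ 0) (h0' : k' y ≠ 0) :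
    dphase (fun y => k y * k' y) y = dphase k y + dphase k' y := by
  refine ContinuousLinearMap.ext fun v => ?_
  rw [HasFDerivAt.dphase_eq (h.hasFDerivAt.fun_mul h'.hasFDerivAt),
    add_apply (dphase k y), dphase_apply, dphase_apply, ← mul_add, ← Complex.add_im]
  congr 2
  simp only [add_apply, smul_apply, smul_eq_mul]
  field_simp
  ring

theorem dphase_const (c : ℂ) (y : V) : dphase (fun _ => c) y = 0 := by
  refine ContinuousLinearMap.ext fun v => ?_
  rw [HasFDerivAt.dphase_eq (hasFDerivAt_const c y)]
  simp

theorem dphase_zpow {k : V → ℂ} {y : V} (h : DifferentiableAt ℝ k y) (h0 : k y ≠ 0) (n : ℤ) :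
    dphase (fun y => k y ^ n) y = (n : ℝ) • dphase k y := by
  refine ContinuousLinearMap.ext fun v => ?_
  have h1 := ((hasDerivAt_zpow n (k y) (Or.inl h0)).hasFDerivAt.restrictScalars ℝ).comp y
    h.hasFDerivAt
  rw [HasFDerivAt.dphase_eq (k := fun y => k y ^ n) h1, smul_apply, dphase_apply, smul_eq_mul,
    mul_left_comm]
  congr 1
  rw [← Complex.im_ofReal_mul]
  congr 1
  simp only [ContinuousLinearMap.comp_apply, ContinuousLinearMap.coe_restrictScalars',
    toSpanSingleton_apply, smul_eq_mul]
  rw [zpow_sub_one₀ h0]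
  have := zpow_ne_zero n h0
  push_cast
  field_simp

theorem dphase_ofReal {r : V → ℝ} {y : V} (h : DifferentiableAt ℝ r y) :
    dphase (fun y => (r y : ℂ)) y = 0 := by
  refine ContinuousLinearMap.ext fun v => ?_
  rw [HasFDerivAt.dphase_eq (k := fun y => (r y : ℂ))
    (Complex.ofRealCLM.hasFDerivAt.comp y h.hasFDerivAt)]
  simp [← Complex.ofReal_inv, -Complex.ofReal_inv]

theorem dphase_ph {k : V → ℂ} {y : V} (h : DifferentiableAt ℝ k y) (h0 : k y ≠ 0) :
    dphase (fun y => ph (k y)) y = dphase k y := by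
  have hn : DifferentiableAt ℝ (fun y => ‖k y‖) y := h.norm ℝ h0
  have h1 : k = fun y => ph (k y) * (‖k y‖ : ℂ) := by
    funext y
    rcases eq_or_ne (k y) 0 with h | h
    · simp [h]
    · have : (‖k y‖ : ℂ) ≠ 0 := by exact_mod_cast norm_ne_zero_iff.2 h
      simp [ph, this]
  have hd : DifferentiableAt ℝ (fun y => ph (k y)) y :=
    DifferentiableAt.comp (g := ph) y ((contDiffAt_ph h0).differentiableAt (by simp)) h
  have hn' : DifferentiableAt ℝ (fun y => (‖k y‖ : ℂ)) y :=
    DifferentiableAt.comp (g := Complex.ofRealCLM) y Complex.ofRealCLM.differentiableAt hn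
  conv_rhs => rw [h1]
  rw [dphase_mul hd hn' (ph_ne_zero h0) (by exact_mod_cast norm_ne_zero_iff.2 h0),
    dphase_ofReal hn, add_zero]

theorem dphase_chr (ℓ : ℂ →L[ℝ] ℝ) {f : V → ℂ} {y : V} (hf : DifferentiableAt ℝ f y) :
    dphase (fun y => chr ℓ (f y)) y = ℓ.comp (fderiv ℝ f y) := by
  refine ContinuousLinearMap.ext fun v => ?_
  have h1 : HasFDerivAt (fun y => (((2 * Real.pi * ℓ (f y) : ℝ)) : ℂ) * I)
      (I • Complex.ofRealCLM.comp ((2 * Real.pi) • ℓ.comp (fderiv ℝ f y))) y :=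
    (Complex.ofRealCLM.hasFDerivAt.comp y
      ((ℓ.hasFDerivAt.comp y hf.hasFDerivAt).const_mul (2 * Real.pi))).mul_const I
  have h2 := ((Complex.hasDerivAt_exp _).hasFDerivAt.restrictScalars ℝ).comp y h1
  rw [HasFDerivAt.dphase_eq (k := fun y => chr ℓ (f y)) h2]
  simp only [chr, ContinuousLinearMap.comp_apply, ContinuousLinearMap.coe_restrictScalars',
    toSpanSingleton_apply, smul_eq_mul, smul_apply]
  rw [mul_comm (_ * _) (Complex.exp _), inv_mul_cancel_left₀ (Complex.exp_ne_zero _)]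
  have := Real.pi_ne_zero
  simp
  field_simp

theorem dphase_comp {k : W → ℂ} {g : V → W} {y : V} (hk : DifferentiableAt ℝ k (g y))
    (hg : DifferentiableAt ℝ g y) :
    dphase (fun y => k (g y)) y = (dphase k (g y)).comp (fderiv ℝ g y) := by
  refine ContinuousLinearMap.ext fun v => ?_
  rw [HasFDerivAt.dphase_eq (k := fun y => k (g y)) (hk.hasFDerivAt.comp y hg.hasFDerivAt)]
  rfl

theorem contDiffAt_dphase {k : V → ℂ} {y : V} (hk : ContDiffAt ℝ ∞ k y) (h0 : k y ≠ 0) :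
    ContDiffAt ℝ ∞ (dphase k) y := by
  have h1 : ContDiffAt ℝ ∞ (fun y => (k y)⁻¹ • fderiv ℝ k y) y :=
    (hk.inv h0).smul (hk.fderiv_right (by simp))
  exact ((contDiffAt_const (c := Complex.imCLM)).clm_comp h1).const_smul _

theorem d1_dphase {k : V → ℂ} {y : V} (hk : ContDiffAt ℝ ∞ k y) (h0 : k y ≠ 0) (v w : V) :
    d1 (dphase k) y v w = 0 := by
  have hk2 : DifferentiableAt ℝ (fderiv ℝ k) y :=
    (hk.fderiv_right (m := ∞) (by simp)).differentiableAt (by simp)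
  have hinv := ((hasDerivAt_inv h0).hasFDerivAt.restrictScalars ℝ).comp y
    (hk.differentiableAt (by simp)).hasFDerivAt
  have h1 := ((hasFDerivAt_const Complex.imCLM y).clm_comp
    (hinv.smul hk2.hasFDerivAt)).const_smul (1 / (2 * Real.pi))
  have hs : fderiv ℝ (fderiv ℝ k) y v w = fderiv ℝ (fderiv ℝ k) y w v :=
    (hk.isSymmSndFDerivAt (by simp only [minSmoothness_of_isRCLikeNormedField]; exact WithTop.coe_le_coe.2 le_top)) v w
  have h2 : HasFDerivAt (dphase k) _ y := h1
  rw [d1, h2.fderiv]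
  simp [hs]
  ring

theorem d1_congr {F : Type} [NormedAddCommGroup F] [NormedSpace ℝ F] {B B' : V → V →L[ℝ] F} {y : V}
    (h : B =ᶠ[𝓝 y] B') (v w : V) : d1 B y v w = d1 B' y v w := by
  rw [d1, d1, h.fderiv_eq]

theorem d1_smul {g : V → ℝ} {B : V → V →L[ℝ] ℝ} {y : V} (hg : DifferentiableAt ℝ g y)
    (hB : DifferentiableAt ℝ B y) (v w : V) :
    d1 (fun y => g y • B y) y v w =
      fderiv ℝ g y v * B y w - fderiv ℝ g y w * B y v + g y * d1 B y v w := by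
  rw [d1, (hg.hasFDerivAt.fun_smul hB.hasFDerivAt).fderiv, d1]
  simp
  ring

end PhaseForm

section Radial

/-- A cutoff function on the half line. -/
def radialCut (ρ : ℝ) (t : ℝ) : ℝ := Real.smoothTransition (2 - 2 * t / ρ)

theorem contDiff_radialCut (ρ : ℝ) : ContDiff ℝ ∞ (radialCut ρ) :=
  Real.smoothTransition.contDiff.comp (by fun_prop)

theorem radialCut_one {ρ t : ℝ} (hρ : 0 < ρ) (ht : t ≤ ρ / 2) : radialCut ρ t = 1 := by
  refine Real.smoothTransition.one_of_one_le ?_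
  have : 2 * t / ρ ≤ 1 := by rw [div_le_one hρ]; linarith
  linarith

theorem radialCut_zero {ρ t : ℝ} (hρ : 0 < ρ) (ht : ρ ≤ t) : radialCut ρ t = 0 := by
  refine Real.smoothTransition.zero_of_nonpos ?_
  have : 2 ≤ 2 * t / ρ := by rw [le_div_iff₀ hρ]; linarith
  linarith

theorem deriv_radialCut_eq_zero {ρ t : ℝ} (hρ : 0 < ρ) (ht : t < ρ / 2 ∨ ρ < t) :
    deriv (radialCut ρ) t = 0 := by
  rcases ht with ht | ht
  · have : radialCut ρ =ᶠ[𝓝 t] fun _ => 1 := by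
      filter_upwards [gt_mem_nhds ht] with s hs using radialCut_one hρ hs.le
    rw [this.deriv_eq, deriv_const]
  · have : radialCut ρ =ᶠ[𝓝 t] fun _ => 0 := by
      filter_upwards [lt_mem_nhds ht] with s hs using radialCut_zero hρ hs.le
    rw [this.deriv_eq, deriv_const]

theorem integral_deriv_radialCut {ρ : ℝ} (hρ : 0 < ρ) :
    ∫ w : ℂ, deriv (radialCut ρ) (‖w‖ ^ 2) = -Real.pi := by
  have h1 := integral_fun_norm_addHaar (volume : Measure ℂ)
    (fun r : ℝ => deriv (radialCut ρ) (r ^ 2))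
  rw [h1, Complex.finrank_real_complex]
  have h2 : ∀ x ∈ Set.Ici (0 : ℝ), HasDerivAt (fun r : ℝ => radialCut ρ (r ^ 2) / 2)
      (x ^ (2 - 1) • deriv (radialCut ρ) (x ^ 2)) x := by
    intro x _
    have h3 : HasDerivAt (radialCut ρ) (deriv (radialCut ρ) (x ^ 2)) (x ^ 2) :=
      ((contDiff_radialCut ρ).differentiable (by simp) _).hasDerivAt
    have h4 := (HasDerivAt.comp (h₂ := radialCut ρ) (h := fun x => x ^ 2) x h3 (hasDerivAt_pow 2 x)).div_const 2
    convert! h4 using 1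
    simp
    ring
  have hz : ∀ x : ℝ, Real.sqrt ρ < x → ρ < x ^ 2 := fun x hx => by
    rw [← Real.sq_sqrt hρ.le]
    exact pow_lt_pow_left₀ hx (Real.sqrt_nonneg _) two_ne_zero
  have h5 : IntegrableOn (fun x : ℝ => x ^ (2 - 1) • deriv (radialCut ρ) (x ^ 2)) (Set.Ioi 0) := by
    refine Integrable.integrableOn ?_
    have hc : Continuous (fun x : ℝ => x ^ (2 - 1) • deriv (radialCut ρ) (x ^ 2)) := by
      have : Continuous (deriv (radialCut ρ)) :=
        (contDiff_radialCut ρ).continuous_deriv (by simp)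
      fun_prop
    refine hc.integrable_of_hasCompactSupport ?_
    refine HasCompactSupport.intro (isCompact_Icc (a := -Real.sqrt ρ) (b := Real.sqrt ρ))
      fun x hx => ?_
    have : ρ < x ^ 2 := by
      rw [Set.mem_Icc, not_and_or, not_le, not_le] at hx
      rcases hx with hx | hx
      · rw [← neg_sq]; exact hz _ (by linarith)
      · exact hz _ hx
    rw [deriv_radialCut_eq_zero hρ (Or.inr this), smul_zero]
  have h6 : Filter.Tendsto (fun r : ℝ => radialCut ρ (r ^ 2) / 2) Filter.atTop (𝓝 0) := by
    refine tendsto_const_nhds.congr' ?_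
    filter_upwards [Filter.eventually_gt_atTop (Real.sqrt ρ)] with r hr
    rw [radialCut_zero hρ (hz r hr).le, zero_div]
  rw [integral_Ioi_of_hasDerivAt_of_tendsto' h2 h5 h6]
  rw [radialCut_one hρ (by rw [zero_pow two_ne_zero]; positivity)]
  simp [Measure.real, Complex.volume_ball]
  ring

end Radial

section CutForm

variable {E : Type} [NormedAddCommGroup E] [NormedSpace ℝ E] {M : Type*}
    [TopologicalSpace M] [ChartedSpace E M]
  {V W : Type} [NormedAddCommGroup V] [NormedSpace ℝ V] [NormedAddCommGroup W] [NormedSpace ℝ W]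

/-- Composition of a 1-form with a linear map. -/
def OneForm.map {F G : Type} [NormedAddCommGroup F] [NormedSpace ℝ F] [NormedAddCommGroup G]
    [NormedSpace ℝ G] (η : OneForm E M F) (L : F →L[ℝ] G) : OneForm E M G where
  val H y := L.comp (η.val H y)
  congr hH h := by rw [η.congr hH h]
  natural hH hg := by rw [η.natural hH hg]; rfl
  smooth hH := contDiffAt_const.clm_comp (η.smooth hH)

theorem OneForm.map_apply {F G : Type} [NormedAddCommGroup F] [NormedSpace ℝ F]
    [NormedAddCommGroup G] [NormedSpace ℝ G] (η : OneForm E M F) (L : F →L[ℝ] G) (H : V → M)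
    (y v : V) : (η.map L).val H y v = L (η.val H y v) := rfl

theorem OneForm.Closed.map {F G : Type} [NormedAddCommGroup F] [NormedSpace ℝ F]
    [NormedAddCommGroup G] [NormedSpace ℝ G] {η : OneForm E M F} (hη : η.Closed) (L : F →L[ℝ] G) :
    (η.map L).Closed := by
  intro V _ _ H y hH v w
  have h1 : HasFDerivAt ((η.map L).val H) _ y :=
    (hasFDerivAt_const L y).clm_comp (η.differentiableAt hH).hasFDerivAt
  rw [d1, h1.fderiv]
  have := hη hH v w
  rw [d1] at this
  simp [← map_sub, this]

theorem SmNV.smF {h : M → ℂ} {H : V → M} {y : V} (hh : SmNV E h (H y)) (hH : SmAt (E := E) H y) :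
    SmF (fun z => h (H z)) y :=
  SmAt.comp_left (hh.mono fun _ hx => hx.1) hH

/-- The form `f (dθ - α)`, where `θ` is the phase of `h`. -/
def cutForm (α : OneForm E M ℝ) (h : M → ℂ) (f : M → ℝ) (hf : ContMDiff 𝓘(ℝ, E) 𝓘(ℝ, ℝ) ∞ f)
    (hreg : ∀ x, SmNV E h x ∨ ∀ᶠ y in 𝓝 x, f y = 0) : OneForm E M ℝ where
  val H y := f (H y) • (dphase (fun z => h (H z)) y - α.val H y)
  congr {V} _ _ {H H' y} hH hHH' := by
    have h1 : (fun z => h (H z)) =ᶠ[𝓝 y] fun z => h (H' z) := hHH'.fun_comp h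
    rw [α.congr hH hHH', dphase_congr h1, hHH'.self_of_nhds]
  natural {V W} _ _ _ _ {H g y} hH hg := by
    rcases hreg (H (g y)) with h1 | h1
    · rw [α.natural hH hg, dphase_comp (k := fun z => h (H z)) (h1.smF hH).differentiableAt
        hg.differentiableAt]
      rfl
    · rw [h1.self_of_nhds, zero_smul, zero_smul, ContinuousLinearMap.zero_comp]
  smooth {V} _ _ {H y} hH := by
    have hfs : ContDiffAt ℝ ∞ (fun y => f (H y)) y :=
      (SmAt.comp_left (W := ℝ) (Filter.Eventually.of_forall fun x => hf x) hH).contDiffAt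
    rcases hreg (H y) with h1 | h1
    · exact hfs.smul ((contDiffAt_dphase (h1.smF hH).contDiffAt h1.ne_zero).sub (α.smooth hH))
    · refine (contDiffAt_const (c := 0)).congr_of_eventuallyEq ?_
      filter_upwards [hH.continuousAt.eventually h1] with z hz
      rw [hz, zero_smul]

end CutForm

section IndexZero

variable {X B : Type*} [TopologicalSpace X] [ChartedSpace ℂ² X]
    [TopologicalSpace B] [ChartedSpace ℂ B] {Λ : Submodule ℤ ℂ} [AddAction (Torus Λ) X] {π : X → B}
  {V : Type} [NormedAddCommGroup V] [NormedSpace ℝ V]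

/-- A smooth cutoff function of the distance from a point of a Riemann surface. -/
theorem contMDiff_radialCut [IsManifold 𝓘(ℂ, ℂ) ω B] [T2Space B]
    {e : OpenPartialHomeomorph B ℂ} (he : e ∈ atlas ℂ B) {c : ℂ} {ρ : ℝ} (hρ : 0 < ρ)
    (hb : Metric.closedBall c (Real.sqrt ρ) ⊆ e.target) :
    ContMDiff 𝓘(ℝ, ℂ) 𝓘(ℝ, ℝ) ∞ (e.source.indicator fun x => radialCut ρ (‖e x - c‖ ^ 2)) ∧
    ∀ x, (∀ u ∈ Metric.closedBall c (Real.sqrt ρ), e.symm u ≠ x) →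
      ∀ᶠ y in 𝓝 x, e.source.indicator (fun x => radialCut ρ (‖e x - c‖ ^ 2)) y = 0 := by
  have hcl : IsClosed (e.symm '' Metric.closedBall c (Real.sqrt ρ)) :=
    ((isCompact_closedBall c _).image_of_continuousOn (e.symm.continuousOn.mono hb)).isClosed
  have h0 : ∀ x, (∀ u ∈ Metric.closedBall c (Real.sqrt ρ), e.symm u ≠ x) →
      ∀ᶠ y in 𝓝 x, e.source.indicator (fun x => radialCut ρ (‖e x - c‖ ^ 2)) y = 0 := by
    intro x hx
    have hx' : x ∉ e.symm '' Metric.closedBall c (Real.sqrt ρ) := fun ⟨u, hu, hux⟩ => hx u hu hux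
    filter_upwards [hcl.isOpen_compl.mem_nhds hx'] with y hy
    by_cases hys : y ∈ e.source
    · rw [Set.indicator_of_mem hys]
      refine radialCut_zero hρ ?_
      by_contra hlt
      push Not at hlt
      refine hy ⟨e y, ?_, e.left_inv hys⟩
      rw [Metric.mem_closedBall, dist_eq_norm]
      exact Real.le_sqrt_of_sq_le hlt.le
    · exact Set.indicator_of_notMem hys _
  refine ⟨fun x => ?_, h0⟩
  by_cases hx : x ∈ e.source
  · have h1 : ContMDiffAt 𝓘(ℝ, ℂ) 𝓘(ℝ, ℝ) ∞ (fun x => radialCut ρ (‖e x - c‖ ^ 2)) x := by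
      have h2 : ContDiff ℝ ∞ (fun u : ℂ => radialCut ρ (‖u - c‖ ^ 2)) :=
        (contDiff_radialCut ρ).comp ((contDiff_id.sub contDiff_const).norm_sq ℝ)
      exact h2.contMDiff.contMDiffAt.comp x (contMDiffAt_chart_curve he hx)
    refine h1.congr_of_eventuallyEq ?_
    filter_upwards [e.open_source.mem_nhds hx] with y hy using Set.indicator_of_mem hy _
  · refine (contMDiffAt_const (c := (0 : ℝ))).congr_of_eventuallyEq (h0 x ?_)
    rintro u hu rfl
    exact hx (e.map_target (hb hu))

variable [DiscreteTopology Λ] [IsZLattice ℝ Λ]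

/-- The connection form attached to an invariant closed 2-form with nontrivial integral over the
fibres. -/
def TwoForm.connection (hact : SmoothAction Λ X) (χ : TwoForm ℂ² X) (a : ℝ)
    (ℓ : ℂ →L[ℝ] ℝ) : OneForm ℂ² X ℝ :=
  (χ.mu hact).map (a⁻¹ • ℓ)

variable [IsManifold 𝓘(ℝ, ℂ²) ∞ X]

theorem cutForm_lift (hπ : IsPrincipalBundle Λ π) {χ : TwoForm ℂ² X} (hi : χ.Invariant Λ)
    {a : ℝ} (ha : a ≠ 0) (hfib : ∀ x, χ.fib Λ x = a) {ℓ : ℂ →L[ℝ] ℝ} {h : X → ℂ}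
    (hE : EquivFn Λ ℓ h) {f : B → ℝ} (hf : ContMDiff 𝓘(ℝ, ℂ²) 𝓘(ℝ, ℝ) ∞ (fun x => f (π x)))
    (hreg : ∀ x, SmNV ℂ² h x ∨ ∀ᶠ y in 𝓝 x, f (π y) = 0) {H : V → X} {y : V}
    (hH : SmX H y) (z : ℂ) :
    (cutForm (χ.connection hπ.smoothAction a ℓ) h _ hf hreg).val (lift Λ H) (y, z) =
      ((cutForm (χ.connection hπ.smoothAction a ℓ) h _ hf hreg).val H y).comp
        (fst ℝ V ℂ) := by
  have hp : ∀ p, π (lift Λ H p) = π (H p.1) := fun p => hπ.proj_mk_vadd _ _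
  change f (π (lift Λ H (y, z))) • _ = (f (π (H y)) • _ : V →L[ℝ] ℝ).comp _
  rw [hp]
  rcases hreg (H y) with h1 | h1
  · have h2 : (fun p : V × ℂ => h (lift Λ H p)) = fun p => chr ℓ p.2 * h (H p.1) := by
      funext p; exact hE _ _
    have h3 : DifferentiableAt ℝ (fun y => h (H y)) y := (h1.smF hH).differentiableAt
    have h4 : DifferentiableAt ℝ (fun p : V × ℂ => h (H p.1)) (y, z) :=
      DifferentiableAt.comp (g := fun y => h (H y)) (f := Prod.fst) (y, z) h3 differentiableAt_fst
    have h5 : DifferentiableAt ℝ (fun p : V × ℂ => chr ℓ p.2) (y, z) :=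
      DifferentiableAt.comp (g := chr ℓ) (f := Prod.snd) (y, z)
        ((contDiff_chr ℓ).contDiffAt.differentiableAt (by simp)) differentiableAt_snd
    rw [h2, dphase_mul h5 h4 (chr_ne_zero _ _) h1.ne_zero, dphase_chr ℓ differentiableAt_snd,
      dphase_comp (k := fun y => h (H y)) (g := Prod.fst) h3 differentiableAt_fst]
    refine ContinuousLinearMap.ext fun vw => ?_
    obtain ⟨v, w⟩ := vw
    have h6 := χ.mu_lift hπ.smoothAction hi hH z w v
    rw [hfib] at h6
    have h7 : a⁻¹ • ℓ ((a : ℂ) * w) = ℓ w := by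
      rw [← Complex.real_smul, map_smul, smul_smul, inv_mul_cancel₀ ha, one_smul]
    simp only [smul_apply, sub_apply, add_apply, ContinuousLinearMap.comp_apply,
      TwoForm.connection, OneForm.map_apply, h6]
    rw [map_add, smul_add, h7]
    simp [fderiv_snd, fderiv_fst]
    ring_nf
    simp
  · rw [h1.self_of_nhds]; simp

variable [IsManifold 𝓘(ℂ, ℂ) ω B] [T2Space B] [IsManifold 𝓘(ℂ, ℂ²) ω X] [T2Space X]
  [CompactSpace X]

/-- An equivariant function has total index zero. -/
theorem index_eq_zero (hπ : IsPrincipalBundle Λ π) {χ : TwoForm ℂ² X} (hχ : χ.Closed)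
    (hi : χ.Invariant Λ) {a : ℝ} (ha : a ≠ 0) (hfib : ∀ x, χ.fib Λ x = a) {ℓ : ℂ →L[ℝ] ℝ}
    {h : X → ℂ} (hE : EquivFn Λ ℓ h) {q : B} {m : ℤ} {s : B → X} (hs : LocSec π s q)
    (hreg : ∀ x, π x ≠ q → SmNV ℂ² h x) (hm : LocInd (fun x => h (s x)) q m) : m = 0 := by
  obtain ⟨R, hR, hRs⟩ := hm
  set e := chartAt ℂ q
  have he : e ∈ atlas ℂ B := chart_mem_atlas ℂ q
  have hq : q ∈ e.source := mem_chart_source ℂ q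
  set c := e q with hc
  have hnb : ∀ᶠ u in 𝓝 c, u ∈ e.target ∧ LocSec π s (e.symm u) ∧ SmNV ℂ R (e.symm u) ∧
      (u ≠ c → h (s (e.symm u)) = ph (u - c) ^ m * R (e.symm u)) := by
    have h1 := e.open_target.mem_nhds (e.map_source hq)
    have h2 : Filter.Tendsto e.symm (𝓝 c) (𝓝 q) := by
      have := e.continuousAt_symm (e.map_source hq)
      rwa [ContinuousAt, e.left_inv hq] at this
    rw [eventually_nhdsWithin_iff] at hRs
    filter_upwards [h1, h2.eventually hs.eventually, h2.eventually hR.eventually, h2.eventually hRs]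
      with u a1 a2 a3 a4
    refine ⟨a1, a2, a3, fun hu => ?_⟩
    have := a4 (fun h => hu (by rw [hc, ← h, e.right_inv a1]))
    rwa [e.right_inv a1] at this
  obtain ⟨r, hr, hball⟩ := Metric.nhds_basis_closedBall.mem_iff.1 hnb
  set ρ := (r / 2) ^ 2 with hρdef
  have hρ : 0 < ρ := by positivity
  have hsq : Real.sqrt ρ = r / 2 := Real.sqrt_sq (by positivity)
  have hbt : Metric.closedBall c (Real.sqrt ρ) ⊆ e.target := fun u hu =>
    (hball (Metric.closedBall_subset_closedBall (by rw [hsq]; linarith) hu)).1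
  obtain ⟨hψ, hψ0⟩ := contMDiff_radialCut he hρ hbt
  set ψ : B → ℝ := e.source.indicator fun x => radialCut ρ (‖e x - c‖ ^ 2) with hψdef
  have hf : ContMDiff 𝓘(ℝ, ℂ²) 𝓘(ℝ, ℝ) ∞ (fun x => 1 - ψ (π x)) := fun x =>
    contMDiffAt_const.sub ((hψ (π x)).comp x (hπ.smooth_proj x))
  have hψ1 : ∀ᶠ x in 𝓝 q, 1 - ψ x = 0 := by
    have h1 : ∀ᶠ x in 𝓝 q, ‖e x - c‖ ^ 2 < ρ / 2 := by
      have : ContinuousAt (fun x => ‖e x - c‖ ^ 2) q :=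
        (((e.continuousAt hq).sub continuousAt_const).norm).pow 2
      refine this.eventually (gt_mem_nhds ?_)
      simpa [hc] using hρ
    filter_upwards [h1, e.open_source.mem_nhds hq] with x hx hxs
    rw [hψdef, Set.indicator_of_mem hxs, radialCut_one hρ hx.le, sub_self]
  have hreg' : ∀ x, SmNV ℂ² h x ∨ ∀ᶠ y in 𝓝 x, 1 - ψ (π y) = 0 := by
    intro x
    by_cases hx : π x = q
    · exact Or.inr (hπ.continuous_proj.continuousAt.eventually (by rwa [hx]))
    · exact Or.inl (hreg x hx)
  set α := χ.connection hπ.smoothAction a ℓ with hα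
  have hαc : α.Closed := OneForm.Closed.map (TwoForm.closed_mu hπ.smoothAction hχ hi) _
  have := isManifold_real_curve B
  set β := cutForm α h _ hf hreg' with hβ
  set H := chartSec s e
  set b : ℂ → ℂ →L[ℝ] ℝ := β.val H with hb
  set S := Metric.ball c r
  have hSb : ∀ u ∈ S, _ := fun u hu => hball (Metric.ball_subset_closedBall hu)
  have hsm : ∀ u ∈ S, SmX H u := fun u hu =>
    (hSb u hu).2.1.smAt_chartSec he (hSb u hu).1
  have hval : ∀ u ∈ S, ∀ z, (β.d.wedge χ).val (lift Λ H) (u, z) =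
      d1 b u 1 I * (a / covolume Λ) := by
    intro u hu z
    have h1 : β.val (lift Λ H) =ᶠ[𝓝 (u, z)] fun p => (b p.1).comp (fderiv ℝ Prod.fst p) := by
      filter_upwards [(continuous_fst.tendsto (u, z)).eventually (hsm u hu).eventually] with p hp
      rw [fderiv_fst]
      exact cutForm_lift hπ hi ha hfib hE (f := fun x => 1 - ψ x) hf hreg' hp p.2
    have h2 : ∀ v w, β.d.val (lift Λ H) (u, z) v w = d1 b u v.1 w.1 := by
      intro v w
      rw [OneForm.d_apply, d1_congr h1, d1_comp (g := Prod.fst) (β.differentiableAt (hsm u hu))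
        contDiffAt_fst, fderiv_fst]
      rfl
    have h3 : χ.val (lift Λ H) (u, z) (0, 1) (0, I) = a / covolume Λ := by
      rw [hi (hsm u hu) z, eq_div_iff (covolume_ne_zero Λ volume), mul_comm,
        ← χ.fib_comp hπ.smoothAction (hsm u hu), hfib]
    have h4 : ∀ v, d1 b u v 0 = 0 := fun v => by simp [d1]
    change wdens (β.d.val (lift Λ H) (u, z)) (χ.val (lift Λ H) (u, z)) = _
    simp only [wdens, wedgeVal, h2, h3, h4]
    ring
  set g : ℂ → ℝ := fun u => radialCut ρ (‖u - c‖ ^ 2) with hg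
  have hgs : ContDiff ℝ ∞ g := (contDiff_radialCut ρ).comp
    ((contDiff_id.sub contDiff_const).norm_sq ℝ)
  have hψg : ∀ u ∈ S, ψ (e.symm u) = g u := fun u hu => by
    rw [hψdef, Set.indicator_of_mem (e.map_target (hSb u hu).1), e.right_inv (hSb u hu).1]
  set k : ℂ → ℂ := fun u => R (e.symm u)
  set η : ℂ → ℂ →L[ℝ] ℝ := fun u => dphase k u - α.val H u with hη
  have hks : ∀ u ∈ S, SmNV ℂ k u := fun u hu =>
    (hSb u hu).2.2.1.comp (smAt_chart_symm he (hSb u hu).1)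
  have hηs : ∀ u ∈ S, ContDiffAt ℝ ∞ η u := fun u hu =>
    (contDiffAt_dphase (hks u hu).self_of_nhds.1.contDiffAt (hks u hu).ne_zero).sub
      (α.smooth (hsm u hu))
  have hηc : ∀ u ∈ S, ∀ v w, d1 η u v w = 0 := by
    intro u hu v w
    have h1 := d1_dphase (hks u hu).self_of_nhds.1.contDiffAt (hks u hu).ne_zero v w
    have h2 := hαc (hsm u hu) v w
    have h3 := ((contDiffAt_dphase (hks u hu).self_of_nhds.1.contDiffAt
      (hks u hu).ne_zero).differentiableAt (by simp)).hasFDerivAt.sub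
      (α.differentiableAt (hsm u hu)).hasFDerivAt
    have h4 : HasFDerivAt η _ u := h3
    rw [d1] at h1 h2 ⊢
    rw [h4.fderiv]
    simp only [sub_apply]
    linear_combination h1 - h2
  have hG : ∀ u ∈ S, d1 b u 1 I = -(m / Real.pi) * deriv (radialCut ρ) (‖u - c‖ ^ 2) -
      (fderiv ℝ (fun u => g u * η u I) u 1 -
        fderiv ℝ (fun u => g u * η u 1) u I) := by
    intro u hu
    have hgd : DifferentiableAt ℝ g u := hgs.contDiffAt.differentiableAt (by simp)
    have hηd : DifferentiableAt ℝ η u := (hηs u hu).differentiableAt (by simp)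
    have h1 : fderiv ℝ (fun u => g u * η u I) u 1 -
        fderiv ℝ (fun u => g u * η u 1) u I =
        fderiv ℝ g u 1 * η u I - fderiv ℝ g u I * η u 1 := by
      have h2 : ∀ v, HasFDerivAt (fun u => g u * η u v) _ u := fun v =>
        hgd.hasFDerivAt.fun_mul (hηd.hasFDerivAt.clm_apply (hasFDerivAt_const v u))
      rw [(h2 _).fderiv, (h2 _).fderiv]
      have := hηc u hu 1 I
      rw [d1] at this
      simp
      linear_combination g u * this
    have hgd' : ∀ v, fderiv ℝ g u v = deriv (radialCut ρ) (‖u - c‖ ^ 2) *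
        (2 * ((starRingEnd ℂ) (u - c) * v).re) := by
      intro v
      have h3 : HasFDerivAt (fun u : ℂ => ‖u - c‖ ^ 2) _ u :=
        ((hasFDerivAt_id u).sub_const c).norm_sq
      have h4 := ((contDiff_radialCut ρ).differentiable (by simp)
        (‖u - c‖ ^ 2)).hasDerivAt.comp_hasFDerivAt u h3
      have h5 : HasFDerivAt g _ u := h4
      rw [h5.fderiv]
      simp [Complex.inner]
      left
      ring
    rw [h1]
    by_cases huc : u = c
    · have hg1 : g =ᶠ[𝓝 u] fun _ => 1 := by
        have : ContinuousAt (fun x => ‖x - c‖ ^ 2) u := by fun_prop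
        filter_upwards [this.eventually (show ∀ᶠ t in 𝓝 (‖u - c‖ ^ 2), t < ρ / 2 from
          gt_mem_nhds (by simpa [huc] using hρ))]
          with x hx using radialCut_one hρ hx.le
      have hb0 : b =ᶠ[𝓝 u] fun _ => 0 := by
        filter_upwards [hg1, Metric.isOpen_ball.mem_nhds hu] with x hx hxS
        change (1 - ψ (π (H x))) • _ = _
        rw [LocSec.proj_chartSec (hSb x hxS).2.1, hψg x hxS, hx, sub_self, zero_smul]
      have hd0 : deriv (radialCut ρ) (‖u - c‖ ^ 2) = 0 :=
        deriv_radialCut_eq_zero hρ (Or.inl (by simpa [huc] using hρ))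
      rw [d1_congr hb0, hgd', hgd', hd0]
      simp [d1]
    · have hu0 : u - c ≠ 0 := sub_ne_zero.2 huc
      set P : ℂ → ℂ →L[ℝ] ℝ := fun u => dphase (fun u => u - c) u with hP
      have hbu : b =ᶠ[𝓝 u] fun u => (1 - g u) • ((m : ℝ) • P u + η u) := by
        filter_upwards [Metric.isOpen_ball.mem_nhds hu, isOpen_ne.mem_nhds huc] with x hx hxc
        have hx0 : x - c ≠ 0 := sub_ne_zero.2 hxc
        change (1 - ψ (π (H x))) • (dphase (fun z => h (H z)) x - α.val H x) = _
        rw [LocSec.proj_chartSec (hSb x hx).2.1, hψg x hx]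
        have h6 : (fun z => h (H z)) =ᶠ[𝓝 x] fun z => ph (z - c) ^ m * k z := by
          filter_upwards [Metric.isOpen_ball.mem_nhds hx, isOpen_ne.mem_nhds hxc] with y hy hyc
          exact (hSb y hy).2.2.2 hyc
        have h7 : DifferentiableAt ℝ (fun z => ph (z - c)) x :=
          DifferentiableAt.comp (g := ph) x ((contDiffAt_ph hx0).differentiableAt (by simp))
            (by fun_prop)
        have h8 : DifferentiableAt ℝ (fun z => ph (z - c) ^ m) x :=
          DifferentiableAt.comp (g := fun w : ℂ => w ^ m) x
            ((differentiableAt_zpow.2 (Or.inl (ph_ne_zero hx0))).restrictScalars ℝ) h7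
        rw [dphase_congr h6, dphase_mul h8 ((hks x hx).self_of_nhds.1.contDiffAt.differentiableAt
          (by simp)) (zpow_ne_zero _ (ph_ne_zero hx0)) (hks x hx).ne_zero,
          dphase_zpow h7 (ph_ne_zero hx0), dphase_ph (k := fun z => z - c) (by fun_prop) hx0, add_sub_assoc]
      have hPs : ContDiffAt ℝ ∞ P u := contDiffAt_dphase (k := fun u => u - c) (by fun_prop) hu0
      have hPd : DifferentiableAt ℝ P u := hPs.differentiableAt (by simp)
      have hPv : ∀ v, P u v = 1 / (2 * Real.pi) * ((u - c)⁻¹ * v).im := fun v => by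
        rw [hP]
        beta_reduce
        rw [HasFDerivAt.dphase_eq (k := fun u => u - c) ((hasFDerivAt_id (𝕜 := ℝ) u).sub_const c)]
        rfl
      have hmη : d1 (fun u => (m : ℝ) • P u + η u) u 1 I = 0 := by
        have h6 : HasFDerivAt (fun u => (m : ℝ) • P u + η u) _ u :=
          (hPd.hasFDerivAt.fun_const_smul (m : ℝ)).add hηd.hasFDerivAt
        have h7 : d1 P u 1 I = 0 := d1_dphase (k := fun u => u - c) (by fun_prop) hu0 _ _
        have h8 := hηc u hu 1 I
        rw [d1] at h7 h8 ⊢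
        rw [h6.fderiv]
        simp only [add_apply, smul_apply, smul_eq_mul]
        linear_combination (m : ℝ) * h7 + h8
      have hg' : fderiv ℝ (fun u => 1 - g u) u = - fderiv ℝ g u := by
        rw [fderiv_const_sub]
      rw [d1_congr hbu, d1_smul (g := fun u => 1 - g u) (B := fun u => (m : ℝ) • P u + η u) (hgd.const_sub 1) ((hPd.fun_const_smul (m : ℝ)).add hηd), hmη, hg']
      simp only [neg_apply, add_apply, smul_apply, smul_eq_mul, hPv, hgd']
      have hn : Complex.normSq (u - c) ≠ 0 := (map_ne_zero _).2 hu0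
      have hπ0 := Real.pi_ne_zero
      have e1 : ((u - c)⁻¹ * 1).im = - (u - c).im / Complex.normSq (u - c) := by
        rw [mul_one, Complex.inv_im]
      have e2 : ((u - c)⁻¹ * I).im = (u - c).re / Complex.normSq (u - c) := by
        simp [Complex.inv_re]
      have e3 : ((starRingEnd ℂ) (u - c) * 1).re = (u - c).re := by simp
      have e4 : ((starRingEnd ℂ) (u - c) * I).re = (u - c).im := by simp; ring
      rw [e1, e2, e3, e4]
      have e5 : Complex.normSq (u - c) = (u - c).re * (u - c).re + (u - c).im * (u - c).im :=
        Complex.normSq_apply _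
      field_simp
      rw [e5]
      ring
  have hKS : Metric.closedBall c (r / 2) ⊆ S := Metric.closedBall_subset_ball (by linarith)
  have hfar : ∀ u, u ∉ Metric.closedBall c (r / 2) → ρ < ‖u - c‖ ^ 2 := by
    intro u hu
    rw [Metric.mem_closedBall, dist_eq_norm, not_le] at hu
    exact pow_lt_pow_left₀ hu (by positivity) two_ne_zero
  have hex : ∀ v w : ℂ, IntegrableOn (fun u => fderiv ℝ (fun u => g u * η u v) u w) S ∧
      ∫ u in S, fderiv ℝ (fun u => g u * η u v) u w = 0 := by
    intro v w
    refine setIntegral_fderiv_eq_zero Metric.isOpen_ball (isCompact_closedBall c (r / 2))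
      (fun u hu => ?_) (fun u _ hu => ?_) hKS w
    · exact (hgs.contDiffAt.mul ((hηs u hu).clm_apply contDiffAt_const)).of_le
        (by exact_mod_cast le_top)
    · have : g u = 0 := radialCut_zero hρ (hfar u hu).le
      rw [this, zero_mul]
  have hrad : IntegrableOn (fun u => deriv (radialCut ρ) (‖u - c‖ ^ 2)) S ∧
      ∫ u in S, deriv (radialCut ρ) (‖u - c‖ ^ 2) = -Real.pi := by
    have hc1 : Continuous (deriv (radialCut ρ)) := (contDiff_radialCut ρ).continuous_deriv (by simp)
    constructor
    · have hc2 : Continuous fun u => deriv (radialCut ρ) (‖u - c‖ ^ 2) := by fun_prop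
      exact (hc2.continuousOn.integrableOn_compact (isCompact_closedBall c r)).mono_set
        Metric.ball_subset_closedBall
    · rw [setIntegral_eq_integral_of_forall_compl_eq_zero]
      · rw [integral_sub_right_eq_self (fun u : ℂ => deriv (radialCut ρ) (‖u‖ ^ 2)) c]
        exact integral_deriv_radialCut hρ
      · intro u hu
        exact deriv_radialCut_eq_zero hρ (Or.inr (hfar u fun h => hu (hKS h)))
  have hGi : IntegrableOn (fun u => d1 b u 1 I) S ∧
      ∫ u in S, d1 b u 1 I = m := by
    have hi0 : IntegrableOn (fun u => fderiv ℝ (fun u => g u * η u I) u 1 -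
        fderiv ℝ (fun u => g u * η u 1) u I) S := (hex I 1).1.sub (hex 1 I).1
    have hi1 : IntegrableOn (fun u => -(m / Real.pi) * deriv (radialCut ρ) (‖u - c‖ ^ 2) -
        (fderiv ℝ (fun u => g u * η u I) u 1 -
        fderiv ℝ (fun u => g u * η u 1) u I)) S :=
      Integrable.sub (hrad.1.const_mul (-(m / Real.pi))) hi0
    constructor
    · exact hi1.congr_fun (fun u hu => (hG u hu).symm) measurableSet_ball
    · rw [setIntegral_congr_fun measurableSet_ball hG]
      rw [integral_sub (hrad.1.const_mul (-(m / Real.pi))) hi0, integral_sub (hex I 1).1 (hex 1 I).1, (hex _ _).2, (hex _ _).2,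
        integral_const_mul, hrad.2]
      field_simp
      simp
  have hP : PosParam (S ×ˢ fd Λ) (lift Λ H) := hπ.posParam he measurableSet_ball
    (fun u hu => (hSb u hu).1) fun u hu => (hSb u hu).2.1
  have hvol : (volume : Measure ℂ²).restrict (S ×ˢ fd Λ) =
      (volume.restrict S).prod (volume.restrict (fd Λ)) := by
    rw [Measure.volume_eq_prod, Measure.prod_restrict]
  have hcongr : ∀ p ∈ S ×ˢ fd Λ, (β.d.wedge χ).val (lift Λ H) p =
      d1 b p.1 1 I * (a / covolume Λ) := fun p hp => hval p.1 hp.1 p.2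
  have hstokes := β.int_d_wedge hχ
  rw [TopForm.int_eq_sum (β.d.wedge χ) (ι := Unit) (D := fun _ => S ×ˢ fd Λ)
    (Ψ := fun _ => lift Λ H) (fun _ => hP) (fun i j hij => (hij (Subsingleton.elim i j)).elim)
    ?_ ?_] at hstokes
  · rw [Fintype.sum_unique, setIntegral_congr_fun hP.meas hcongr, hvol,
      integral_fun_fst (fun u => d1 b u 1 I * (a / covolume Λ volume)),
      integral_mul_const, hGi.2, measureReal_restrict_apply_univ, volume_real_fd] at hstokes
    have hA := covolume_ne_zero Λ (volume : Measure ℂ)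
    simpa [ha, hA] using hstokes
  · intro K y hK hy
    have hy' : ∀ᶠ x in 𝓝 (π (K y)), ψ x = 0 := by
      refine hψ0 _ fun u hu hue => hy () ?_
      have huS : u ∈ S := hKS (by rwa [hsq] at hu)
      obtain ⟨z, hz⟩ := hπ.exists_vadd_eq ((LocSec.proj_chartSec (hSb u huS).2.1).trans hue)
      obtain ⟨w, hw, hwz⟩ := exists_mem_fd Λ z
      refine ⟨(u, w), ⟨huS, hw⟩, ?_⟩
      have : lift Λ H (u, w) = lift Λ H (u, w + (z - w)) := (lift_add_lattice H u w hwz).symm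
      rw [this, add_sub_cancel]
      exact hz
    have hyq : π (K y) ≠ q := fun h => by
      have h1 := hψ1.self_of_nhds
      have h2 := hy'.self_of_nhds
      rw [h] at h2
      rw [h2] at h1
      norm_num at h1
    have h1 : β.val K =ᶠ[𝓝 y] fun z => dphase (fun z => h (K z)) z - α.val K z := by
      filter_upwards [(hπ.continuous_proj.continuousAt.comp hK.continuousAt).eventually hy']
        with z hz
      change (1 - ψ (π (K z))) • _ = _
      have hz' : ψ (π (K z)) = 0 := hz
      rw [hz', sub_zero, one_smul]
    have hh := hreg _ hyq
    have hks := (hh.smF hK).contDiffAt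
    have h2 : β.d.val K y = 0 := by
      refine bilin_ext fun v w => ?_
      rw [OneForm.d_apply, d1_congr h1]
      have h3 := ((contDiffAt_dphase hks hh.ne_zero).differentiableAt (by simp)).hasFDerivAt.fun_sub
        (α.differentiableAt hK).hasFDerivAt
      have h4 := d1_dphase hks hh.ne_zero v w
      have h5 := hαc hK v w
      rw [d1] at h4 h5 ⊢
      rw [h3.fderiv]
      simp only [sub_apply, zero_apply]
      linear_combination h4 - h5
    change wdens (β.d.val K y) _ = 0
    rw [h2, wdens_zero_left]
  · intro _
    refine IntegrableOn.congr_fun ?_ (fun p hp => (hcongr p hp).symm) hP.meas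
    rw [IntegrableOn, hvol]
    exact (hGi.1.mul_const _).comp_fst _

end IndexZero

section TorusCoordinates

variable (Λ : Submodule ℤ ℂ) [DiscreteTopology Λ] [IsZLattice ℝ Λ]

/-- The coordinate forms of the lattice basis. -/
def latCoord (i : Fin 2) : ℂ →L[ℝ] ℝ := LinearMap.toContinuousLinearMap ((realBasis Λ).coord i)

theorem sum_latCoord (z : ℂ) : ∑ i, latCoord Λ i z • realBasis Λ i = z :=
  (realBasis Λ).sum_repr z

theorem integralOn_latCoord (i : Fin 2) : IntegralOn Λ (latCoord Λ i) := by
  intro l hl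
  refine ⟨(latBasis Λ).repr ⟨l, hl⟩ i, ?_⟩
  exact (latBasis Λ).ofZLatticeBasis_repr_apply ℝ Λ ⟨l, hl⟩ i

/-- The point of `ℂ / Λ` whose coordinates are the arguments of two complex numbers. -/
def torusOf (w : Fin 2 → ℂ) : Torus Λ :=
  QuotientAddGroup.mk (∑ i, (Complex.arg (w i) / (2 * Real.pi)) • realBasis Λ i)

theorem ph_eq_exp_arg {w : ℂ} (hw : w ≠ 0) :
    ph w = Complex.exp ((2 * Real.pi * (Complex.arg w / (2 * Real.pi)) : ℝ) * I) := by
  have h1 := Complex.norm_mul_exp_arg_mul_I w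
  have h2 : (‖w‖ : ℂ) ≠ 0 := by exact_mod_cast norm_ne_zero_iff.2 hw
  rw [mul_div_cancel₀ _ (by positivity), ph, div_eq_iff h2, mul_comm, h1]

theorem torusOf_eq {w : Fin 2 → ℂ} (hw : ∀ i, w i ≠ 0) {θ : Fin 2 → ℝ}
    (h : ∀ i, ph (w i) = Complex.exp ((2 * Real.pi * θ i : ℝ) * I)) :
    torusOf Λ w = QuotientAddGroup.mk (∑ i, θ i • realBasis Λ i) := by
  rw [torusOf, QuotientAddGroup.eq, ← sub_eq_neg_add, ← Finset.sum_sub_distrib]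
  refine Submodule.sum_mem Λ fun i _ => ?_
  have h1 := (ph_eq_exp_arg (hw i)).symm.trans (h i)
  rw [Complex.exp_eq_exp_iff_exists_int] at h1
  obtain ⟨n, hn⟩ := h1
  have h2 : Complex.arg (w i) / (2 * Real.pi) = θ i + n := by
    have h3 : ((Complex.arg (w i) / (2 * Real.pi) : ℝ) : ℂ) = ((θ i + n : ℝ) : ℂ) := by
      have hp : (2 * Real.pi * I : ℂ) ≠ 0 := Complex.two_pi_I_ne_zero
      apply mul_left_cancel₀ hp
      push_cast at hn ⊢
      linear_combination hn
    exact_mod_cast h3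
  rw [h2, ← sub_smul, sub_add_cancel_left, neg_smul]
  refine Submodule.neg_mem _ ?_
  rw [Int.cast_smul_eq_zsmul]
  exact Submodule.smul_mem _ _ (realBasis_mem Λ i)

theorem ph_eq_exp_arg_div {w v : ℂ} (hw : w ≠ 0) (hv : v ≠ 0) :
    ph w = Complex.exp ((2 * Real.pi * ((Complex.arg (w / v) + Complex.arg v) / (2 * Real.pi)) : ℝ)
      * I) := by
  have h1 : w = w / v * v := by field_simp
  conv_lhs => rw [h1, ph_mul, ph_eq_exp_arg (div_ne_zero hw hv), ph_eq_exp_arg hv,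
    ← Complex.exp_add]
  congr 1
  push_cast
  ring

theorem continuousAt_torusOf {Y : Type*} [TopologicalSpace Y] {w : Fin 2 → Y → ℂ} {y : Y}
    (hw : ∀ i, ContinuousAt (w i) y) (h0 : ∀ i, w i y ≠ 0) :
    ContinuousAt (fun y => torusOf Λ fun i => w i y) y := by
  have h1 : (fun y => torusOf Λ fun i => w i y) =ᶠ[𝓝 y] fun x => QuotientAddGroup.mk (∑ i,
      ((Complex.arg (w i x / w i y) + Complex.arg (w i y)) / (2 * Real.pi)) • realBasis Λ i) := by
    have : ∀ᶠ x in 𝓝 y, ∀ i, w i x ≠ 0 :=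
      Filter.eventually_all.2 fun i => (hw i).eventually_ne (h0 i)
    filter_upwards [this] with x hx
    exact torusOf_eq Λ hx fun i => ph_eq_exp_arg_div (hx i) (h0 i)
  refine ContinuousAt.congr ?_ h1.symm
  refine ContinuousAt.comp (f := fun x => ∑ i, ((Complex.arg (w i x / w i y) +
    Complex.arg (w i y)) / (2 * Real.pi)) • realBasis Λ i)
    (g := (QuotientAddGroup.mk : ℂ → Torus Λ))
    QuotientAddGroup.continuous_mk.continuousAt ?_
  refine tendsto_finsetSum _ fun i _ => ?_
  have h2 : ContinuousAt (fun x => Complex.arg (w i x / w i y)) y := by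
    refine ContinuousAt.comp (g := Complex.arg) (Complex.continuousAt_arg ?_)
      ((hw i).div continuousAt_const (h0 i))
    rw [div_self (h0 i)]
    exact Complex.one_mem_slitPlane
  exact ((h2.add continuousAt_const).div_const _).smul continuousAt_const

end TorusCoordinates

section Triviality

variable {X B : Type*} [TopologicalSpace X] [ChartedSpace ℂ² X]
  [TopologicalSpace B] [ChartedSpace ℂ B] {Λ : Submodule ℤ ℂ} [AddAction (Torus Λ) X] {π : X → B}
  [DiscreteTopology Λ] [IsZLattice ℝ Λ]
  [IsManifold 𝓘(ℂ, ℂ) ω B] [T2Space B] [IsManifold 𝓘(ℂ, ℂ²) ω X] [T2Space X] [CompactSpace X]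

theorem isTopologicallyTrivial_of_equivFn (hπ : IsPrincipalBundle Λ π) {h : Fin 2 → X → ℂ}
    (hc : ∀ i, Continuous (h i)) (h0 : ∀ i x, h i x ≠ 0)
    (hE : ∀ i, EquivFn Λ (latCoord Λ i) (h i)) : IsTopologicallyTrivial Λ π := by
  set S : X → Torus Λ := fun x => torusOf Λ fun i => h i x with hS
  have hSeq : ∀ (z : ℂ) (x : X),
      S (⟪z⟫[Λ] +ᵥ x) = QuotientAddGroup.mk z + S x := by
    intro z x
    simp only [hS]
    rw [torusOf_eq Λ (fun i => h0 i _) (θ := fun i => latCoord Λ i z +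
      Complex.arg (h i x) / (2 * Real.pi)) fun i => ?_]
    · simp only [add_smul, Finset.sum_add_distrib, sum_latCoord, torusOf, QuotientAddGroup.mk_add]
    · rw [hE i, ph_mul, ph_of_norm_eq_one (norm_chr _ _), ph_eq_exp_arg (h0 i x), chr,
        ← Complex.exp_add]
      congr 1
      push_cast
      ring
  have hcont : Continuous fun x => (π x, S x) := by
    refine hπ.continuous_proj.prodMk (continuous_iff_continuousAt.2 fun x => ?_)
    exact continuousAt_torusOf Λ (fun i => (hc i).continuousAt) fun i => h0 i x
  have hinj : Function.Injective fun x => (π x, S x) := by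
    intro x y hxy
    obtain ⟨h1, h2⟩ := Prod.ext_iff.1 hxy
    obtain ⟨z, rfl⟩ := hπ.exists_vadd_eq h1
    simp only [hSeq] at h2
    rw [right_eq_add.1 h2, zero_vadd]
  have hsurj : Function.Surjective fun x => (π x, S x) := by
    rintro ⟨b, t⟩
    obtain ⟨s, hs⟩ := hπ.exists_locSec b
    obtain ⟨z, hz⟩ := QuotientAddGroup.mk_surjective (t - S (s b))
    refine ⟨⟪z⟫[Λ] +ᵥ s b, ?_⟩
    change (π _, S _) = _
    rw [hSeq, hπ.proj_mk_vadd, hs.proj, hz, sub_add_cancel]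
  have : DiscreteTopology Λ.toAddSubgroup := inferInstanceAs (DiscreteTopology Λ)
  have hcl : IsClosed (Λ.toAddSubgroup : Set ℂ) := AddSubgroup.isClosed_of_discrete
  exact ⟨hcont.homeoOfEquivCompactToT2 (f := Equiv.ofBijective _ ⟨hinj, hsurj⟩), fun x => rfl⟩

/-- If some invariant closed 2-form has a nontrivial integral over the fibres then the bundle is
topologically trivial. -/
theorem isTopologicallyTrivial_of_fib [CompactSpace B] [ConnectedSpace B]
    (hπ : IsPrincipalBundle Λ π) {χ : TwoForm ℂ² X} (hχ : χ.Closed)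
    (hi : χ.Invariant Λ) {a : ℝ} (ha : a ≠ 0) (hfib : ∀ x, χ.fib Λ x = a) :
    IsTopologicallyTrivial Λ π := by
  have := isManifold_real X
  obtain ⟨q⟩ := (inferInstance : Nonempty B)
  have key : ∀ ℓ : ℂ →L[ℝ] ℝ, IntegralOn Λ ℓ → ∃ h : X → ℂ, EquivFn Λ ℓ h ∧
      ∀ x, SmNV ℂ² h x := by
    intro ℓ hℓ
    obtain ⟨h₀, D, hE₀, hD₀⟩ := exists_hasDivX hπ hℓ
    obtain ⟨h₁, m, hE₁, hD₁⟩ := exists_hasDivX_single hπ hE₀ hD₀ q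
    obtain ⟨h, hE, hreg, hsing⟩ := exists_regular hπ hℓ hE₁ hD₁
    have hm : m = 0 := by
      by_contra hm
      obtain ⟨s, hs, hsm⟩ := hsing q (by rwa [delta_self, mul_one])
      refine hm ?_
      have := index_eq_zero hπ hχ hi ha hfib hE hs (fun x hx => hreg x ?_) hsm
      · rwa [delta_self, mul_one] at this
      · rw [delta_of_ne hx, mul_zero]
    exact ⟨h, hE, fun x => hreg x (by rw [hm, zero_mul])⟩
  choose h hE hreg using fun i => key _ (integralOn_latCoord Λ i)
  exact isTopologicallyTrivial_of_equivFn hπ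
    (fun i => continuous_iff_continuousAt.2 fun x => (hreg i x).self_of_nhds.1.continuousAt)
    (fun i x => (hreg i x).ne_zero) hE

end Triviality

section PhaseIntegration

variable {V : Type} [NormedAddCommGroup V] [NormedSpace ℝ V]

/-- The unit complex number with argument `2π t`. -/
def cis (t : ℝ) : ℂ := Complex.exp ((2 * Real.pi * t : ℝ) * I)

theorem cis_add (s t : ℝ) : cis (s + t) = cis s * cis t := by
  rw [cis, cis, cis, ← Complex.exp_add]
  congr 1
  push_cast; ring

theorem cis_zero : cis 0 = 1 := by simp [cis]

theorem cis_ne_zero (t : ℝ) : cis t ≠ 0 := Complex.exp_ne_zero _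

theorem im_ofReal_mul_I (r : ℝ) : ((r : ℂ) * I).im = r := by simp

theorem contDiff_cis : ContDiff ℝ ∞ cis :=
  Complex.contDiff_exp.comp ((Complex.ofRealCLM.contDiff.comp
    (contDiff_const.mul contDiff_id : ContDiff ℝ ∞ fun t : ℝ => 2 * Real.pi * t)).mul contDiff_const)

theorem hasFDerivAt_cis {f : V → ℝ} {f' : V →L[ℝ] ℝ} {y : V} (hf : HasFDerivAt f f' y) :
    HasFDerivAt (fun y => cis (f y)) ((2 * Real.pi * I * cis (f y)) •
      Complex.ofRealCLM.comp f') y := by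
  have h1 : HasFDerivAt (fun y => ((2 * Real.pi * f y : ℝ) : ℂ) * I)
      (I • Complex.ofRealCLM.comp ((2 * Real.pi) • f')) y :=
    (Complex.ofRealCLM.hasFDerivAt.comp y (hf.const_mul (2 * Real.pi))).mul_const I
  have h2 := ((Complex.hasDerivAt_exp _).hasFDerivAt.restrictScalars ℝ).comp y h1
  have h3 : HasFDerivAt (fun y => cis (f y)) _ y := h2
  refine h3.congr_fderiv (ContinuousLinearMap.ext fun v => ?_)
  simp only [cis, ContinuousLinearMap.comp_apply, ContinuousLinearMap.coe_restrictScalars',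
    toSpanSingleton_apply, smul_eq_mul, smul_apply, Complex.ofRealCLM_apply]
  push_cast
  ring

theorem dphase_cis {f : V → ℝ} {y : V} (hf : DifferentiableAt ℝ f y) :
    dphase (fun y => cis (f y)) y = fderiv ℝ f y := by
  refine ContinuousLinearMap.ext fun v => ?_
  rw [HasFDerivAt.dphase_eq (hasFDerivAt_cis hf.hasFDerivAt)]
  have h : (cis (f y))⁻¹ * (((2 * Real.pi * I * cis (f y)) •
      Complex.ofRealCLM.comp (fderiv ℝ f y) : V →L[ℝ] ℂ) v) =
      ((2 * Real.pi * fderiv ℝ f y v : ℝ) : ℂ) * I := by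
    have := cis_ne_zero (f y)
    simp only [smul_apply, ContinuousLinearMap.comp_apply, smul_eq_mul, Complex.ofRealCLM_apply]
    push_cast
    field_simp
  rw [h, im_ofReal_mul_I]
  field_simp

/-- The phase of a function determines its derivative up to the phase. -/
theorem hasFDerivAt_ph {k : V → ℂ} {y : V} (hk : DifferentiableAt ℝ k y) (h0 : k y ≠ 0) :
    HasFDerivAt (fun y => ph (k y)) ((2 * Real.pi * I * ph (k y)) •
      Complex.ofRealCLM.comp (dphase k y)) y := by
  have hd : DifferentiableAt ℝ (fun y => ph (k y)) y :=
    DifferentiableAt.comp (g := ph) y ((contDiffAt_ph h0).differentiableAt (by simp)) hk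
  refine hd.hasFDerivAt.congr_fderiv (ContinuousLinearMap.ext fun v => ?_)
  set w' := fderiv ℝ (fun y => ph (k y)) y v with hw'
  have hp := ph_ne_zero h0
  have h1 : (fun y => ‖ph (k y)‖ ^ 2) =ᶠ[𝓝 y] fun _ => (1 : ℝ) := by
    filter_upwards [hk.continuousAt.eventually_ne h0] with z hz
    rw [norm_ph hz, one_pow]
  have h2 := (hd.hasFDerivAt.norm_sq).fderiv
  have h2' : (2 : ℝ) * (w' * (starRingEnd ℂ) (ph (k y))).re = 0 := by
    rw [h1.fderiv_eq] at h2
    have h3 := congrArg (fun L : V →L[ℝ] ℝ => L v) h2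
    have h4 := h3.symm
    simp only [smul_apply, ContinuousLinearMap.comp_apply, innerSL_apply_apply, Complex.inner] at h4
    simp [Complex.mul_re] at h4 ⊢
    linarith
  have h4 : dphase k y v = 1 / (2 * Real.pi) * ((ph (k y))⁻¹ * w').im := by
    rw [← dphase_ph hk h0, dphase_apply]
  have h5 : ((ph (k y))⁻¹ * w').re = 0 := by
    have h6 : (ph (k y))⁻¹ = (starRingEnd ℂ) (ph (k y)) := by
      rw [Complex.inv_def, Complex.normSq_eq_norm_sq, norm_ph h0]
      simp
    rw [h6, mul_comm]
    linarith
  have h7 : (ph (k y))⁻¹ * w' = (2 * Real.pi * dphase k y v : ℝ) * I := by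
    apply Complex.ext
    · rw [h5]; simp
    · rw [im_ofReal_mul_I, h4]
      field_simp
  have h8 : w' = ph (k y) * ((2 * Real.pi * dphase k y v : ℝ) * I) := by
    rw [← h7, mul_inv_cancel_left₀ hp]
  rw [h8]
  simp only [smul_apply, ContinuousLinearMap.comp_apply, smul_eq_mul, Complex.ofRealCLM_apply]
  push_cast
  ring

theorem ph_eq_of_dphase {k : V → ℂ} {θ : V → ℝ} {S : Set V} (hS : Convex ℝ S) (hSo : IsOpen S)
    (hk : ∀ y ∈ S, DifferentiableAt ℝ k y) (h0 : ∀ y ∈ S, k y ≠ 0)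
    (hθ : ∀ y ∈ S, HasFDerivAt θ (dphase k y) y) {y z : V} (hy : y ∈ S) (hz : z ∈ S) :
    ph (k z) = ph (k y) * cis (θ z - θ y) := by
  have h1 : ∀ x ∈ S, HasFDerivAt (fun x => ph (k x) * cis (-θ x)) (0 : V →L[ℝ] ℂ) x := by
    intro x hx
    have h2 := (hasFDerivAt_ph (hk x hx) (h0 x hx)).mul (hasFDerivAt_cis (hθ x hx).neg)
    refine h2.congr_fderiv (ContinuousLinearMap.ext fun v => ?_)
    simp only [add_apply, smul_apply, ContinuousLinearMap.comp_apply, smul_eq_mul,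
      Complex.ofRealCLM_apply, neg_apply, zero_apply]
    push_cast
    ring
  have h3 : ph (k z) * cis (-θ z) = ph (k y) * cis (-θ y) := by
    refine hS.is_const_of_fderivWithin_eq_zero (𝕜 := ℝ)
      (f := fun x => ph (k x) * cis (-θ x))
      (fun x hx => (h1 x hx).differentiableAt.differentiableWithinAt) (fun x hx => ?_) hz hy
    rw [fderivWithin_of_isOpen hSo hx, (h1 x hx).fderiv]
  calc ph (k z) = ph (k z) * cis (-θ z) * cis (θ z) := by
        rw [mul_assoc, ← cis_add, neg_add_cancel, cis_zero, mul_one]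
    _ = _ := by rw [h3, mul_assoc, ← cis_add, neg_add_eq_sub]

theorem cis_integral_dphase {k : ℝ → ℂ} {a b : ℝ} (hab : a ≤ b)
    (hk : ∀ t ∈ Set.Icc a b, SmF k t) (h0 : ∀ t ∈ Set.Icc a b, k t ≠ 0) :
    cis (∫ t in a..b, dphase k t 1) * ph (k a) = ph (k b) := by
  rcases eq_or_lt_of_le hab with rfl | hab'
  · simp [cis_zero]
  have hd : ∀ t ∈ Set.Icc a b, ContinuousAt (fun t => dphase k t 1) t := fun t ht =>
    (contDiffAt_dphase (hk t ht).contDiffAt (h0 t ht)).continuousAt.clm_apply continuousAt_const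
  have hint : IntervalIntegrable (fun t => dphase k t 1) volume a b := by
    refine ContinuousOn.intervalIntegrable fun t ht => ?_
    rw [Set.uIcc_of_le hab] at ht
    exact (hd t ht).continuousWithinAt
  have h1 : ∀ t ∈ Set.Icc a b, HasDerivWithinAt
      (fun t => ph (k t) * cis (-∫ s in a..t, dphase k s 1)) 0 (Set.Icc a b) t := by
    intro t ht
    have e1 := (hasFDerivAt_ph (hk t ht).differentiableAt (h0 t ht)).hasDerivAt
    have : Fact (t ∈ Set.Icc a b) := ⟨ht⟩
    have e2 : HasDerivWithinAt (fun t => ∫ s in a..t, dphase k s 1) (dphase k t 1)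
        (Set.Icc a b) t := by
      refine intervalIntegral.integral_hasDerivWithinAt_right
        (hint.mono_set (Set.uIcc_subset_uIcc_left (by rwa [Set.uIcc_of_le hab]))) ?_
        (hd t ht).continuousWithinAt
      refine ⟨Set.Icc a b, self_mem_nhdsWithin, ?_⟩
      refine ContinuousOn.aestronglyMeasurable (fun s hs => (hd s hs).continuousWithinAt)
        measurableSet_Icc
    have e3 : HasDerivAt (fun s : ℝ => cis (-s)) _ (∫ s in a..t, dphase k s 1) :=
      (hasFDerivAt_cis ((hasFDerivAt_id (𝕜 := ℝ) (∫ s in a..t, dphase k s 1)).neg)).hasDerivAt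
    have e4 := e1.hasDerivWithinAt.mul (e3.scomp_hasDerivWithinAt t e2)
    convert! e4 using 1
    simp
    ring
  have h2 := (convex_Icc a b).is_const_of_fderivWithin_eq_zero (𝕜 := ℝ)
    (f := fun t => ph (k t) * cis (-∫ s in a..t, dphase k s 1))
    (fun t ht => (h1 t ht).differentiableWithinAt) (fun t ht => by
      rw [((h1 t ht).hasFDerivWithinAt.fderivWithin ((uniqueDiffOn_Icc hab') t ht))]
      simp)
    (Set.left_mem_Icc.2 hab) (Set.right_mem_Icc.2 hab)
  simp only [intervalIntegral.integral_same, neg_zero, cis_zero, mul_one] at h2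
  rw [h2, mul_comm, mul_assoc, ← cis_add, neg_add_cancel, cis_zero, mul_one]

end PhaseIntegration

section Orbits

variable {Λ : Submodule ℤ ℂ} {X : Type*} [TopologicalSpace X] [ChartedSpace ℂ² X]
  [AddAction (Torus Λ) X] {V : Type} [NormedAddCommGroup V] [NormedSpace ℝ V]

/-- The curve `t ↦ [t l] + H y` through the points of the image of `H`. -/
def orb (Λ : Submodule ℤ ℂ) {X : Type*} [AddAction (Torus Λ) X] {V : Type*} (l : ℂ) (H : V → X) :
    V × ℝ → X :=
  fun p => ⟪(p.2 : ℂ) * l⟫[Λ] +ᵥ H p.1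

theorem smF_orb (l : ℂ) (p : V × ℝ) : SmF (fun p : V × ℝ => (p.1, (p.2 : ℂ) * l)) p := by
  refine SmF.of_contDiff ?_ p
  exact contDiff_fst.prodMk ((Complex.ofRealCLM.contDiff.comp contDiff_snd).mul contDiff_const)

theorem hasFDerivAt_orb (l : ℂ) (p : V × ℝ) : HasFDerivAt (fun p : V × ℝ => (p.1, (p.2 : ℂ) * l))
    ((fst ℝ V ℝ).prod
      ((snd ℝ V ℝ).smulRight l)) p := by
  refine (hasFDerivAt_fst (𝕜 := ℝ)).prodMk ?_
  refine (((Complex.ofRealCLM.hasFDerivAt.comp p (hasFDerivAt_snd (𝕜 := ℝ))).mul_const l)).congr_fderiv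
    (ContinuousLinearMap.ext fun v => ?_)
  simp [mul_comm]

theorem SmAt.orb (hact : SmoothAction Λ X) (l : ℂ) {H : V → X} {y : V}
    (hH : SmX H y) (t : ℝ) : SmX (orb Λ l H) (y, t) :=
  SmAt.comp (H := PrincipalElliptic.lift Λ H) (g := fun p : V × ℝ => (p.1, (p.2 : ℂ) * l)) (y, t)
    (hH.lift hact _) (smF_orb l _)

theorem TwoForm.val_orb (hact : SmoothAction Λ X) (χ : TwoForm ℂ² X) (l : ℂ) {H : V → X}
    {y : V} (hH : SmX H y) (t : ℝ) (v : V) :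
    χ.val (orb Λ l H) (y, t) (v, 0) (0, 1) =
      χ.val (lift Λ H) (y, (t : ℂ) * l) (v, 0) (0, l) := by
  have h1 := χ.natural (H := lift Λ H)
    (g := fun p : V × ℝ => (p.1, (p.2 : ℂ) * l)) (y := (y, t)) (hH.lift hact _) (smF_orb l _)
  rw [(hasFDerivAt_orb l _).fderiv] at h1
  have h2 : orb Λ l H =
    fun p => lift Λ H (p.1, (p.2 : ℂ) * l) := rfl
  rw [h2, h1]
  simp

/-- The curve `t ↦ [t l] + x`. -/
def orbit (Λ : Submodule ℤ ℂ) {X : Type*} [AddAction (Torus Λ) X] (l : ℂ) (x : X) (t : ℝ) : X :=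
  ⟪(t : ℂ) * l⟫[Λ] +ᵥ x

theorem smAt_const_fun {x : X} (y : V) : SmX (fun _ : V => x) y :=
  Filter.Eventually.of_forall fun _ => contMDiffAt_const

theorem smAt_orbit (hact : SmoothAction Λ X) (l : ℂ) (x : X) (t : ℝ) :
    SmX (orbit Λ l x) t :=
  SmAt.comp (H := orb Λ l fun _ : ℝ => x) (g := fun t : ℝ => ((0 : ℝ), t)) t
    (SmAt.orb hact l (smAt_const_fun 0) t) (SmF.of_contDiff (by fun_prop) _)

/-- The integral of a 1-form over a piece of the orbit of a point. -/
def orbInt (Λ : Submodule ℤ ℂ) {X : Type*} [TopologicalSpace X] [ChartedSpace ℂ² X]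
    [AddAction (Torus Λ) X] (P : OneForm ℂ² X ℝ) (l : ℂ) (a b : ℝ) (x : X) : ℝ :=
  ∫ t in a..b, P.val (orbit Λ l x) t 1

theorem OneForm.val_orbit (hact : SmoothAction Λ X) (P : OneForm ℂ² X ℝ) (l : ℂ) {H : V → X}
    {y : V} (hH : SmX H y) (t : ℝ) :
    P.val (orbit Λ l (H y)) t 1 = P.val (orb Λ l H) (y, t) (0, 1) := by
  have h1 := P.natural (H := orb Λ l H) (g := fun t : ℝ => (y, t)) (y := t)
    (hH.orb hact l t) (SmF.of_contDiff (by fun_prop) _)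
  rw [(hasFDerivAt_prodMk_right y t).fderiv] at h1
  have h2 : orbit Λ l (H y) = fun t => orb Λ l H (y, t) := rfl
  rw [h2, h1]
  simp

theorem continuous_val_orbit (hact : SmoothAction Λ X) (P : OneForm ℂ² X ℝ) (l : ℂ) (x : X) :
    Continuous fun t => P.val (orbit Λ l x) t 1 :=
  continuous_iff_continuousAt.2 fun t =>
    (P.smooth (smAt_orbit hact l x t)).continuousAt.clm_apply continuousAt_const

theorem orbInt_comp_eq (hact : SmoothAction Λ X) (P : OneForm ℂ² X ℝ) (l : ℂ) {a b : ℝ}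
    (hab : a ≤ b) {H : V → X} {y : V} (hH : SmX H y) :
    (fun y => orbInt Λ P l a b (H y)) =ᶠ[𝓝 y] fun y =>
      ∫ t in Set.Ioc a b, P.val (orb Λ l H) (y, t) (0, 1) := by
  filter_upwards [hH.eventually] with z hz
  rw [orbInt, intervalIntegral.integral_of_le hab]
  exact integral_congr_ae (Filter.Eventually.of_forall fun t => P.val_orbit hact l hz t)

theorem ae_mem_Icc {a b : ℝ} : ∀ᵐ t ∂(volume.restrict (Set.Ioc a b)), t ∈ Set.Icc a b :=
  (ae_restrict_mem measurableSet_Ioc).mono fun _ ht => Set.Ioc_subset_Icc_self ht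

theorem contDiffAt_orbInt (hact : SmoothAction Λ X) (P : OneForm ℂ² X ℝ) (l : ℂ) {a b : ℝ}
    (hab : a ≤ b) {H : V → X} {y : V} (hH : SmX H y) :
    ContDiffAt ℝ ∞ (fun y => orbInt Λ P l a b (H y)) y := by
  refine ContDiffAt.congr_of_eventuallyEq ?_ (orbInt_comp_eq hact P l hab hH)
  refine contDiffAt_integral (f := fun p => P.val (orb Λ l H) p (0, 1))
    (isCompact_Icc (a := a) (b := b)) ae_mem_Icc fun t _ => ?_
  exact (P.smooth (hH.orb hact l t)).clm_apply contDiffAt_const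

theorem fderiv_orbInt (hact : SmoothAction Λ X) (P : OneForm ℂ² X ℝ) (l : ℂ) {a b : ℝ}
    (hab : a ≤ b) {H : V → X} {y : V} (hH : SmX H y) (v : V) :
    fderiv ℝ (fun y => orbInt Λ P l a b (H y)) y v = P.val (orb Λ l H) (y, b) (v, 0) -
      P.val (orb Λ l H) (y, a) (v, 0) +
      ∫ t in a..b, P.d.val (orb Λ l H) (y, t) (v, 0) (0, 1) := by
  set K := orb Λ l H with hK
  have hKs : ∀ t, ContDiffAt ℝ ∞ (P.val K) (y, t) := fun t => P.smooth (hH.orb hact l t)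
  have hKd : ∀ t, HasFDerivAt (P.val K) (fderiv ℝ (P.val K) (y, t)) (y, t) := fun t =>
    ((hKs t).differentiableAt (by simp)).hasFDerivAt
  have hcd : ∀ u w, Continuous fun t => fderiv ℝ (P.val K) (y, t) u w := fun u w =>
    continuous_iff_continuousAt.2 fun t => by
      have h1 : ContinuousAt (fderiv ℝ (P.val K)) (y, t) :=
        ((hKs t).fderiv_right (m := 0) (by simp)).continuousAt
      have h2 : ContinuousAt (fun t => fderiv ℝ (P.val K) (y, t)) t :=
        ContinuousAt.comp (g := fderiv ℝ (P.val K)) (f := fun t => (y, t)) h1 (by fun_prop)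
      exact (h2.clm_apply continuousAt_const).clm_apply continuousAt_const
  have h1 := hasFDerivAt_integral_of_contDiffAt (f := fun p => P.val K p (0, 1)) (y := y)
    (isCompact_Icc (a := a) (b := b)) ae_mem_Icc
    fun t _ => ((hKs t).clm_apply contDiffAt_const).of_le (by exact_mod_cast le_top)
  have hf : ∀ t, fderiv ℝ (fun p => P.val K p (0, 1)) (y, t) =
      (fderiv ℝ (P.val K) (y, t)).flip (0, 1) := fun t => by
    rw [((hKd t).clm_apply (hasFDerivAt_const ((0 : V), (1 : ℝ)) _)).fderiv]
    refine ContinuousLinearMap.ext fun w => ?_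
    simp
  rw [(orbInt_comp_eq hact P l hab hH).fderiv_eq, h1.fderiv]
  rw [integral_apply]
  · have h2 : ∀ t, (fderiv ℝ (fun p => P.val K p (0, 1)) (y, t)).comp
        (inl ℝ V ℝ) v = fderiv ℝ (P.val K) (y, t) (0, 1) (v, 0) +
        P.d.val K (y, t) (v, 0) (0, 1) := by
      intro t
      rw [hf, OneForm.d_apply, d1]
      simp
    simp_rw [h2]
    rw [← intervalIntegral.integral_of_le hab]
    have hd1 : Continuous fun t => P.d.val K (y, t) (v, 0) (0, 1) := by
      simp only [OneForm.d_apply, d1]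
      exact (hcd _ _).sub (hcd _ _)
    rw [intervalIntegral.integral_add ((hcd _ _).intervalIntegrable _ _)
      (hd1.intervalIntegrable _ _)]
    congr 1
    refine intervalIntegral.integral_eq_sub_of_hasDerivAt (f := fun t => P.val K (y, t) (v, 0))
      (fun t _ => ?_) ((hcd _ _).intervalIntegrable _ _)
    have h3 := ((hKd t).comp_hasDerivAt (f := fun t => (y, t)) t
      ((hasFDerivAt_prodMk_right y t).hasDerivAt)).clm_apply (hasDerivAt_const t ((v, 0) : V × ℝ))
    simpa using! h3
  · refine integrable_of_continuousAt (isCompact_Icc (a := a) (b := b)) ae_mem_Icc fun t _ => ?_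
    have h2 : ContinuousAt (fderiv ℝ (fun p => P.val K p (0, 1))) (y, t) :=
      (((hKs t).clm_apply contDiffAt_const).fderiv_right (m := 0) (by simp)).continuousAt
    have h3 : ContinuousAt (fun t => fderiv ℝ (fun p => P.val K p (0, 1)) (y, t)) t :=
      ContinuousAt.comp (f := fun t => (y, t)) h2 (by fun_prop)
    exact h3.clm_comp continuousAt_const

end Orbits

section Holonomy

variable {Λ : Submodule ℤ ℂ} {X : Type*} [TopologicalSpace X] [ChartedSpace ℂ² X]
  [AddAction (Torus Λ) X] {V : Type} [NormedAddCommGroup V] [NormedSpace ℝ V]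

/-- Local connection forms `P i` of a unitary connection with curvature `χ` on a complex line
bundle. The functions `κ i` are the components of a family of nonzero vectors, which need not be
continuous, in the local frames. -/
structure PotentialSystem (χ : TwoForm ℂ² X) where
  U : X → Set X
  isOpen : ∀ i, IsOpen (U i)
  mem : ∀ i, i ∈ U i
  P : X → OneForm ℂ² X ℝ
  κ : X → X → ℂ
  κ_ne : ∀ i, ∀ x ∈ U i, κ i x ≠ 0
  curv : ∀ i {V : Type} [NormedAddCommGroup V] [NormedSpace ℝ V] {H : V → X} {y : V},
    SmX H y → H y ∈ U i → ∀ v w, d1 ((P i).val H) y v w = χ.val H y v w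
  smooth : ∀ i j, ∀ x ∈ U i, x ∈ U j → SmNV ℂ² (fun z => κ j z / κ i z) x
  trans : ∀ i j {V : Type} [NormedAddCommGroup V] [NormedSpace ℝ V] {H : V → X} {y : V},
    SmX H y → H y ∈ U i → H y ∈ U j →
    (P j).val H y = (P i).val H y + dphase (fun z => κ j (H z) / κ i (H z)) y

theorem continuous_orbit (hact : SmoothAction Λ X) (l : ℂ) :
    Continuous fun p : X × ℝ => orbit Λ l p.1 p.2 :=
  hact.continuous.comp (f := fun p : X × ℝ => ((p.2 : ℂ) * l, p.1)) (by fun_prop)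

theorem orbit_orbit (l : ℂ) (x : X) (s t : ℝ) :
    orbit Λ l (orbit Λ l x s) t = orbit Λ l x (s + t) := by
  rw [orbit, orbit, orbit, vadd_vadd, ← QuotientAddGroup.mk_add]
  congr 2
  push_cast; ring

theorem orbit_zero (l : ℂ) (x : X) : orbit Λ l x 0 = x := by simp [orbit]

theorem orbit_one {l : ℂ} (hl : l ∈ Λ) (x : X) : orbit Λ l x 1 = x := by
  have : ⟪l⟫[Λ] = 0 := (QuotientAddGroup.eq_zero_iff l).2 hl
  simp [orbit, this]

theorem SmAt.orbit (hact : SmoothAction Λ X) (l : ℂ) {H : V → X} {y : V}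
    (hH : SmX H y) (t : ℝ) :
    SmX (fun y => orbit Λ l (H y) t) y :=
  SmAt.comp (H := PrincipalElliptic.orb Λ l H) (g := fun y => (y, t)) y (hH.orb hact l t)
    (SmF.of_contDiff (by fun_prop) _)

theorem OneForm.val_orb_slice (hact : SmoothAction Λ X) (P : OneForm ℂ² X ℝ) (l : ℂ)
    {H : V → X} {y : V} (hH : SmX H y) (t : ℝ) (v : V) :
    P.val (orb Λ l H) (y, t) (v, 0) = P.val (fun y => orbit Λ l (H y) t) y v := by
  have h1 := P.natural (H := orb Λ l H) (g := fun y => (y, t)) (y := y)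
    (hH.orb hact l t) (SmF.of_contDiff (by fun_prop) _)
  rw [(hasFDerivAt_prodMk_left y t).fderiv] at h1
  have h2 : (fun y => orbit Λ l (H y) t) = fun y => orb Λ l H (y, t) := rfl
  rw [h2, h1]
  simp

theorem TwoForm.val_orb_orbit (hact : SmoothAction Λ X) (χ : TwoForm ℂ² X) (l : ℂ)
    {H : V → X} {y : V} (hH : SmX H y) (s t : ℝ) (v : V) :
    χ.val (orb Λ l fun y => orbit Λ l (H y) s) (y, t) (v, 0) (0, 1) =
      χ.val (orb Λ l H) (y, s + t) (v, 0) (0, 1) := by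
  have h0 : HasFDerivAt (fun p : V × ℝ => (p.1, s + p.2)) (ContinuousLinearMap.id ℝ (V × ℝ))
      (y, t) := by
    refine ((hasFDerivAt_fst (𝕜 := ℝ)).prodMk
      ((hasFDerivAt_snd (𝕜 := ℝ)).const_add s)).congr_fderiv ?_
    exact ContinuousLinearMap.ext fun v => rfl
  have h1 := χ.natural (H := orb Λ l H) (g := fun p : V × ℝ => (p.1, s + p.2))
    (y := (y, t)) (hH.orb hact l _) (SmF.of_contDiff (by fun_prop) _)
  rw [h0.fderiv] at h1
  have h2 : (orb Λ l fun y => orbit Λ l (H y) s) =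
      fun p => orb Λ l H (p.1, s + p.2) :=
    funext fun p => orbit_orbit l (H p.1) s p.2
  rw [h2, h1]
  rfl

variable {χ : TwoForm ℂ² X} (D : PotentialSystem χ)

/-- Parallel transport along a piece of an orbit in the domain of the frame `i`. -/
def PotentialSystem.trp (D : PotentialSystem χ) (Λ : Submodule ℤ ℂ) [AddAction (Torus Λ) X]
    (l : ℂ) (δ : ℝ) (i x : X) : ℂ :=
  cis (orbInt Λ (D.P i) l 0 δ x) * (ph (D.κ i x) / ph (D.κ i (orbit Λ l x δ)))

theorem PotentialSystem.trp_eq (hact : SmoothAction Λ X) (l : ℂ) {δ : ℝ} (hδ : 0 ≤ δ) {i j x : X}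
    (hi : ∀ t ∈ Set.Icc 0 δ, orbit Λ l x t ∈ D.U i)
    (hj : ∀ t ∈ Set.Icc 0 δ, orbit Λ l x t ∈ D.U j) : D.trp Λ l δ i x = D.trp Λ l δ j x := by
  have h0 : (0 : ℝ) ∈ Set.Icc 0 δ := Set.left_mem_Icc.2 hδ
  have h1 : δ ∈ Set.Icc 0 δ := Set.right_mem_Icc.2 hδ
  set k : ℝ → ℂ := fun t => D.κ j (orbit Λ l x t) / D.κ i (orbit Λ l x t) with hk
  have hc := cis_integral_dphase (k := k) hδ
    (fun t ht => (D.smooth i j _ (hi t ht) (hj t ht)).smF (smAt_orbit hact l x t))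
    fun t ht => div_ne_zero (D.κ_ne j _ (hj t ht)) (D.κ_ne i _ (hi t ht))
  have hP : orbInt Λ (D.P j) l 0 δ x = orbInt Λ (D.P i) l 0 δ x + ∫ t in (0 : ℝ)..δ, dphase k t 1 := by
    have h2 : ∀ t ∈ Set.uIcc 0 δ, dphase k t 1 =
        (D.P j).val (orbit Λ l x) t 1 - (D.P i).val (orbit Λ l x) t 1 := fun t ht => by
      rw [Set.uIcc_of_le hδ] at ht
      rw [D.trans i j (smAt_orbit hact l x t) (hi t ht) (hj t ht), add_apply,
        add_sub_cancel_left]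
    rw [intervalIntegral.integral_congr h2, intervalIntegral.integral_sub
      ((continuous_val_orbit hact _ l x).intervalIntegrable _ _)
      ((continuous_val_orbit hact _ l x).intervalIntegrable _ _), orbInt, orbInt]
    ring
  rw [PotentialSystem.trp, PotentialSystem.trp, hP, cis_add]
  simp only [hk, div_eq_mul_inv, ph_mul, ph_inv] at hc
  rw [orbit_zero] at hc
  have n1 := ph_ne_zero (D.κ_ne i _ (hi δ h1))
  have n2 := ph_ne_zero (D.κ_ne j _ (hj δ h1))
  have n3 := ph_ne_zero (D.κ_ne i _ (hi 0 h0))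
  rw [orbit_zero] at n3
  simp only [← div_eq_mul_inv] at hc
  set I := ∫ t in (0 : ℝ)..δ, dphase k t 1 with hI
  field_simp
  have hc' : cis I * ph (D.κ j x) * ph (D.κ i (orbit Λ l x δ)) =
      ph (D.κ j (orbit Λ l x δ)) * ph (D.κ i x) := by
    have hc2 : cis I * (ph (D.κ j x) / ph (D.κ i x)) =
      ph (D.κ j (orbit Λ l x δ)) / ph (D.κ i (orbit Λ l x δ)) := hc
    field_simp at hc2
    rw [hc2, mul_comm]
  linear_combination (-cis (orbInt Λ (D.P i) l 0 δ x)) * hc'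

open Classical in
/-- Parallel transport along short pieces of orbits. -/
def PotentialSystem.step (D : PotentialSystem χ) (Λ : Submodule ℤ ℂ) [AddAction (Torus Λ) X]
    (l : ℂ) (δ : ℝ) (x : X) : ℂ :=
  if h : ∃ i, ∀ t ∈ Set.Icc 0 δ, orbit Λ l x t ∈ D.U i then D.trp Λ l δ h.choose x else 1

theorem PotentialSystem.step_eq (hact : SmoothAction Λ X) (l : ℂ) {δ : ℝ} (hδ : 0 ≤ δ) {i x : X}
    (hi : ∀ t ∈ Set.Icc 0 δ, orbit Λ l x t ∈ D.U i) : D.step Λ l δ x = D.trp Λ l δ i x := by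
  have h : ∃ i, ∀ t ∈ Set.Icc 0 δ, orbit Λ l x t ∈ D.U i := ⟨i, hi⟩
  rw [PotentialSystem.step, dif_pos h]
  exact D.trp_eq hact l hδ h.choose_spec hi

theorem PotentialSystem.exists_step [CompactSpace X] (hact : SmoothAction Λ X) (l : ℂ) :
    ∃ N : ℕ, 0 < N ∧ ∀ x, ∃ i, ∀ t ∈ Set.Icc (0 : ℝ) (1 / N), orbit Λ l x t ∈ D.U i := by
  obtain ⟨δ, hδ, h⟩ := (isCompact_univ (X := X)).induction_on
    (p := fun S => ∃ δ : ℝ, 0 < δ ∧ ∀ x ∈ S, ∃ i, ∀ t ∈ Set.Icc 0 δ, orbit Λ l x t ∈ D.U i)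
    ⟨1, one_pos, fun x hx => absurd hx (Set.notMem_empty x)⟩
    (fun S T hST ⟨δ, hδ, h⟩ => ⟨δ, hδ, fun x hx => h x (hST hx)⟩)
    (fun S T ⟨δ, hδ, h⟩ ⟨δ', hδ', h'⟩ => ⟨min δ δ', lt_min hδ hδ', fun x hx => by
      rcases hx with hx | hx
      · obtain ⟨i, hi⟩ := h x hx
        exact ⟨i, fun t ht => hi t ⟨ht.1, ht.2.trans (min_le_left _ _)⟩⟩
      · obtain ⟨i, hi⟩ := h' x hx
        exact ⟨i, fun t ht => hi t ⟨ht.1, ht.2.trans (min_le_right _ _)⟩⟩⟩)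
    (fun x _ => by
      have h1 : ∀ᶠ p : X × ℝ in 𝓝 (x, 0), orbit Λ l p.1 p.2 ∈ D.U x := by
        refine (continuous_orbit hact l).continuousAt.eventually_mem
          ((D.isOpen x).mem_nhds ?_)
        simpa [orbit_zero] using D.mem x
      rw [nhds_prod_eq] at h1
      obtain ⟨pa, ha, pb, hb, hab⟩ := Filter.eventually_prod_iff.1 h1
      obtain ⟨δ, hδ, hδb⟩ := Metric.eventually_nhds_iff.1 hb
      refine ⟨{x | pa x}, mem_nhdsWithin_of_mem_nhds ha, δ / 2, half_pos hδ, fun z hz =>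
        ⟨x, fun t ht => hab hz (hδb ?_)⟩⟩
      rw [Real.dist_eq, sub_zero, abs_of_nonneg ht.1]
      linarith [ht.2])
  obtain ⟨n, hn⟩ := exists_nat_one_div_lt hδ
  refine ⟨n + 1, n.succ_pos, fun x => ?_⟩
  obtain ⟨i, hi⟩ := h x trivial
  refine ⟨i, fun t ht => hi t ⟨ht.1, ht.2.trans ?_⟩⟩
  push_cast
  exact hn.le

theorem eventually_orbit_mem (hact : SmoothAction Λ X) (l : ℂ) {δ : ℝ} {x : X} {U : Set X}
    (hU : IsOpen U) (h : ∀ t ∈ Set.Icc 0 δ, orbit Λ l x t ∈ U) :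
    ∀ᶠ z in 𝓝 x, ∀ t ∈ Set.Icc 0 δ, orbit Λ l z t ∈ U :=
  (isCompact_Icc (a := 0) (b := δ)).eventually_forall_of_forall_eventually
    (P := fun z t => orbit Λ l z t ∈ U) fun t ht =>
    (continuous_orbit hact l).continuousAt.eventually_mem (hU.mem_nhds (h t ht))

/-- The holonomy around the orbits. -/
def PotentialSystem.hol (D : PotentialSystem χ) (Λ : Submodule ℤ ℂ) [AddAction (Torus Λ) X]
    (l : ℂ) (N : ℕ) (x : X) : ℂ :=
  ∏ k ∈ Finset.range N, D.step Λ l (1 / N) (orbit Λ l x (k / N))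

theorem PotentialSystem.exists_local_hol (hact : SmoothAction Λ X) {l : ℂ} (hl : l ∈ Λ) {N : ℕ}
    (hN : 0 < N) (hD : ∀ x, ∃ i, ∀ t ∈ Set.Icc (0 : ℝ) (1 / N), orbit Λ l x t ∈ D.U i) (x : X) :
    ∃ i : ℕ → X, i N = i 0 ∧ ∀ᶠ z in 𝓝 x, (∀ k < N, ∀ t ∈ Set.Icc (0 : ℝ) (1 / N),
        orbit Λ l (orbit Λ l z (k / N)) t ∈ D.U (i k)) ∧
      D.hol Λ l N z = (∏ k ∈ Finset.range N, cis (orbInt Λ (D.P (i k)) l 0 (1 / N)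
          (orbit Λ l z (k / N)))) *
        ∏ k ∈ Finset.range N, ph (D.κ (i (k + 1)) (orbit Λ l z ((k + 1 : ℕ) / N)) /
          D.κ (i k) (orbit Λ l z ((k + 1 : ℕ) / N))) := by
  have hN' : (N : ℝ) ≠ 0 := by exact_mod_cast hN.ne'
  choose j hj using hD
  set i : ℕ → X := fun k => j (orbit Λ l x (k / N)) with hi
  have hiN : i N = i 0 := by
    simp only [hi, div_self hN', orbit_one hl, Nat.cast_zero, zero_div, orbit_zero]
  refine ⟨i, hiN, ?_⟩
  have h1 : ∀ᶠ z in 𝓝 x, ∀ k ∈ Finset.range N, ∀ t ∈ Set.Icc (0 : ℝ) (1 / N),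
        orbit Λ l (orbit Λ l z (k / N)) t ∈ D.U (i k) := by
    rw [Filter.eventually_all_finset]
    intro k _
    have hc : ContinuousAt (fun z => orbit Λ l z (k / N)) x :=
      ((continuous_orbit hact l).comp (f := fun z => (z, (k / N : ℝ))) (by fun_prop)).continuousAt
    exact hc.eventually (eventually_orbit_mem hact l (D.isOpen (i k)) (hj _))
  filter_upwards [h1] with z hz
  refine ⟨fun k hk => hz k (Finset.mem_range.2 hk), ?_⟩
  have hδ : (0 : ℝ) ≤ 1 / N := by positivity
  have h0 : ∀ k : ℕ, orbit Λ l (orbit Λ l z (k / N)) (1 / N) = orbit Λ l z ((k + 1 : ℕ) / N) :=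
    fun k => by
      rw [orbit_orbit]
      congr 1
      push_cast; ring
  have h2 : D.hol Λ l N z = ∏ k ∈ Finset.range N, (cis (orbInt Λ (D.P (i k)) l 0 (1 / N)
      (orbit Λ l z (k / N))) * (ph (D.κ (i k) (orbit Λ l z (k / N))) /
        ph (D.κ (i k) (orbit Λ l z ((k + 1 : ℕ) / N))))) := by
    refine Finset.prod_congr rfl fun k hk => ?_
    rw [D.step_eq hact l hδ (hz k hk), PotentialSystem.trp, h0]
  rw [h2, Finset.prod_mul_distrib]
  congr 1
  set A : ℕ → ℂ := fun k => ph (D.κ (i k) (orbit Λ l z (k / N))) with hA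
  have hAN : A N = A 0 := by
    simp only [hA, div_self hN', orbit_one hl, Nat.cast_zero, zero_div, orbit_zero, hiN]
  have hA0 : A 0 ≠ 0 := by
    have h3 := hz 0 (Finset.mem_range.2 hN) 0 ⟨le_rfl, hδ⟩
    rw [orbit_zero] at h3
    exact ph_ne_zero (D.κ_ne _ _ h3)
  have h4 : ∏ k ∈ Finset.range N, A k = ∏ k ∈ Finset.range N, A (k + 1) := by
    have h5 := Finset.prod_range_succ A N
    rw [Finset.prod_range_succ', hAN] at h5
    exact (mul_right_cancel₀ hA0 h5).symm
  rw [Finset.prod_div_distrib]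
  change (∏ k ∈ Finset.range N, A k) / _ = _
  rw [h4, ← Finset.prod_div_distrib]
  refine Finset.prod_congr rfl fun k _ => ?_
  rw [div_eq_mul_inv (D.κ _ _), ph_mul, ph_inv, ← div_eq_mul_inv]

theorem SmNV.finset_prod {ι : Type*} {s : Finset ι} {R : ι → X → ℂ} {x : X}
    (h : ∀ k ∈ s, SmNV ℂ² (R k) x) : SmNV ℂ² (fun z => ∏ k ∈ s, R k z) x := by
  classical
  induction s using Finset.induction_on with
  | empty => simpa using SmNV.const one_ne_zero x
  | insert a s ha ih =>
    simp only [Finset.prod_insert ha]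
    exact (h a (Finset.mem_insert_self a s)).mul
      (ih fun k hk => h k (Finset.mem_insert_of_mem hk))

theorem differentiableAt_finset_prod {ι : Type*} {s : Finset ι} {R : ι → V → ℂ} {y : V}
    (h : ∀ k ∈ s, DifferentiableAt ℝ (R k) y) : DifferentiableAt ℝ (fun z => ∏ k ∈ s, R k z) y := by
  classical
  induction s using Finset.induction_on with
  | empty => simp
  | insert a s ha ih =>
    simp only [Finset.prod_insert ha]
    exact (h a (Finset.mem_insert_self a s)).mul
      (ih fun k hk => h k (Finset.mem_insert_of_mem hk))

theorem dphase_finset_prod {ι : Type*} {s : Finset ι} {R : ι → V → ℂ} {y : V}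
    (h : ∀ k ∈ s, DifferentiableAt ℝ (R k) y) (h0 : ∀ k ∈ s, R k y ≠ 0) :
    dphase (fun z => ∏ k ∈ s, R k z) y = ∑ k ∈ s, dphase (R k) y := by
  classical
  induction s using Finset.induction_on with
  | empty => simpa using dphase_const 1 y
  | insert a s ha ih =>
    simp only [Finset.prod_insert ha, Finset.sum_insert ha]
    rw [dphase_mul (k := R a) (k' := fun z => ∏ k ∈ s, R k z)
      (h a (Finset.mem_insert_self a s))
      (differentiableAt_finset_prod fun k hk => h k (Finset.mem_insert_of_mem hk))
      (h0 a (Finset.mem_insert_self a s))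
      (Finset.prod_ne_zero_iff.2 fun k hk => h0 k (Finset.mem_insert_of_mem hk)),
      ih (fun k hk => h k (Finset.mem_insert_of_mem hk))
        (fun k hk => h0 k (Finset.mem_insert_of_mem hk))]

theorem contMDiffAt_of_comp [IsManifold 𝓘(ℝ, ℂ²) ∞ X] {F : Type} [NormedAddCommGroup F]
    [NormedSpace ℝ F] {f : X → F}
    (h : ∀ {H : ℂ² → X} {y : ℂ²}, SmX H y → ContDiffAt ℝ ∞ (fun y => f (H y)) y)
    (x : X) : ContMDiffAt 𝓘(ℝ, ℂ²) 𝓘(ℝ, F) ∞ f x := by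
  set e := chartAt ℂ² x with he
  have hx : x ∈ e.source := mem_chart_source ℂ² x
  have h1 := h (smAt_chart_symm (chart_mem_atlas ℂ² x) (e.map_source hx))
  have h2 : ContMDiffAt 𝓘(ℝ, ℂ²) 𝓘(ℝ, ℂ²) ∞ e x :=
    contMDiffAt_of_mem_maximalAtlas (IsManifold.subset_maximalAtlas (chart_mem_atlas _ x)) hx
  have h3 : ContMDiffAt 𝓘(ℝ, ℂ²) 𝓘(ℝ, F) ∞ (fun z => f (e.symm (e z))) x :=
    ContMDiffAt.comp (g := fun y => f (e.symm y)) x h1.contMDiffAt h2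
  refine h3.congr_of_eventuallyEq ?_
  filter_upwards [e.open_source.mem_nhds hx] with z hz
  rw [e.left_inv hz]

theorem smNV_cis_orbInt [IsManifold 𝓘(ℝ, ℂ²) ∞ X] (hact : SmoothAction Λ X)
    (P : OneForm ℂ² X ℝ) (l : ℂ) {a b : ℝ} (hab : a ≤ b) (x : X) :
    SmNV ℂ² (fun z => cis (orbInt Λ P l a b z)) x :=
  SmNV.of (Filter.Eventually.of_forall fun z => contMDiffAt_of_comp (X := X) (fun {H y} hH =>
    ContDiffAt.comp (g := cis) (f := fun y => orbInt Λ P l a b (H y)) y contDiff_cis.contDiffAt (contDiffAt_orbInt hact P l hab hH)) z)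
    (cis_ne_zero _)

theorem SmNV.orbit (hact : SmoothAction Λ X) {R : X → ℂ} {x : X} (l : ℂ) (t : ℝ)
    (hR : SmNV ℂ² R (orbit Λ l x t)) :
    SmNV ℂ² (fun z => R (orbit Λ l z t)) x := by
  refine SmNV.comp (E' := ℂ²) (T := fun z => PrincipalElliptic.orbit Λ l z t) hR (Filter.Eventually.of_forall fun z => ?_)
  refine ContMDiffAt.comp (g := fun p : ℂ × X => ⟪p.1⟫[Λ] +ᵥ p.2)
    (f := fun z => ((t : ℂ) * l, z)) z (hact _) ?_
  exact contMDiffAt_const.prodMk contMDiffAt_id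

/-- The phase of the holonomy of a connection around the orbits of a period is smooth, and its
derivative is given by integration of the curvature. -/
theorem PotentialSystem.exists_holonomy (D : PotentialSystem χ) [IsManifold 𝓘(ℝ, ℂ²) ∞ X] [CompactSpace X]
    (hact : SmoothAction Λ X) {l : ℂ} (hl : l ∈ Λ) :
    ∃ h : X → ℂ, (∀ x, SmNV ℂ² h x) ∧ ∀ {V : Type} [NormedAddCommGroup V] [NormedSpace ℝ V]
      {H : V → X} {y : V}, SmX H y → ∀ v, dphase (fun z => h (H z)) y v =
        ∫ t in (0 : ℝ)..1, χ.val (orb Λ l H) (y, t) (v, 0) (0, 1) := by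
  obtain ⟨N, hN, hD⟩ := D.exists_step hact l
  have hN' : (N : ℝ) ≠ 0 := by exact_mod_cast hN.ne'
  have hδ : (0 : ℝ) ≤ 1 / N := by positivity
  have h0 : ∀ (z : X) (k : ℕ),
      orbit Λ l (orbit Λ l z (k / N)) (1 / N) = orbit Λ l z ((k + 1 : ℕ) / N) := fun z k => by
    rw [orbit_orbit]
    congr 1
    push_cast; ring
  have hmem : ∀ {x : X} {i : ℕ → X}, i N = i 0 → (∀ k < N, ∀ t ∈ Set.Icc (0 : ℝ) (1 / N),
        orbit Λ l (orbit Λ l x (k / N)) t ∈ D.U (i k)) → ∀ k < N,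
      orbit Λ l x ((k + 1 : ℕ) / N) ∈ D.U (i k) ∧
        orbit Λ l x ((k + 1 : ℕ) / N) ∈ D.U (i (k + 1)) := by
    intro x i hiN hx k hk
    refine ⟨?_, ?_⟩
    · rw [← h0]
      exact hx k hk _ ⟨hδ, le_rfl⟩
    · rcases Nat.lt_or_ge (k + 1) N with h | h
      · have := hx (k + 1) h 0 ⟨le_rfl, hδ⟩
        rwa [orbit_zero] at this
      · have hk1 : k + 1 = N := by omega
        rw [hk1, hiN, div_self hN', orbit_one hl]
        have := hx 0 hN 0 ⟨le_rfl, hδ⟩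
        rwa [orbit_zero, Nat.cast_zero, zero_div, orbit_zero] at this
  refine ⟨D.hol Λ l N, fun x => ?_, fun {V} _ _ {H y} hH v => ?_⟩
  · obtain ⟨i, hiN, hev⟩ := D.exists_local_hol hact hl hN hD x
    have hx := hev.self_of_nhds.1
    refine SmNV.congr (SmNV.mul (SmNV.finset_prod (s := Finset.range N) (R := fun k z =>
      cis (orbInt Λ (D.P (i k)) l 0 (1 / N) (orbit Λ l z (k / N)))) fun k _ =>
      SmNV.orbit hact l (k / N) (smNV_cis_orbInt hact (D.P (i k)) l hδ _))
      (SmNV.finset_prod fun k hk => SmNV.orbit hact l _ (SmNV.phase (D.smooth (i k) (i (k + 1)) _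
        (hmem hiN hx k (Finset.mem_range.1 hk)).1 (hmem hiN hx k (Finset.mem_range.1 hk)).2)))) ?_
    filter_upwards [hev] with z hz
    exact hz.2.symm
  · obtain ⟨i, hiN, hev⟩ := D.exists_local_hol hact hl hN hD (H y)
    have hx := hev.self_of_nhds.1
    have hmem' := fun k (hk : k ∈ Finset.range N) => hmem hiN hx k (Finset.mem_range.1 hk)
    have hHk : ∀ t : ℝ, SmX (fun y => orbit Λ l (H y) t) y := fun t =>
      hH.orbit hact l t
    have e1 : (fun z => D.hol Λ l N (H z)) =ᶠ[𝓝 y] fun z => (∏ k ∈ Finset.range N,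
        cis (orbInt Λ (D.P (i k)) l 0 (1 / N) (orbit Λ l (H z) (k / N)))) *
        ∏ k ∈ Finset.range N, ph (D.κ (i (k + 1)) (orbit Λ l (H z) ((k + 1 : ℕ) / N)) /
          D.κ (i k) (orbit Λ l (H z) ((k + 1 : ℕ) / N))) := by
      filter_upwards [hH.continuousAt.eventually hev] with z hz
      exact hz.2
    have d1' : ∀ k : ℕ, DifferentiableAt ℝ (fun z => orbInt Λ (D.P (i k)) l 0 (1 / N)
        (orbit Λ l (H z) (k / N))) y := fun k =>
      (contDiffAt_orbInt hact (D.P (i k)) l hδ (hHk (k / N))).differentiableAt (by simp)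
    have c1 : ∀ k ∈ Finset.range N, DifferentiableAt ℝ (fun z => cis (orbInt Λ (D.P (i k)) l 0 (1 / N)
        (orbit Λ l (H z) (k / N)))) y := fun k _ => (hasFDerivAt_cis (d1' k).hasFDerivAt).differentiableAt
    have s2 : ∀ k ∈ Finset.range N, SmF (fun z => D.κ (i (k + 1)) (orbit Λ l (H z) ((k + 1 : ℕ) / N)) /
          D.κ (i k) (orbit Λ l (H z) ((k + 1 : ℕ) / N))) y := fun k hk =>
      (D.smooth (i k) (i (k + 1)) _ (hmem' k hk).1 (hmem' k hk).2).smF (H := fun y => orbit Λ l (H y) ((k + 1 : ℕ) / N)) (hHk _)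
    have n2 : ∀ k ∈ Finset.range N, D.κ (i (k + 1)) (orbit Λ l (H y) ((k + 1 : ℕ) / N)) /
          D.κ (i k) (orbit Λ l (H y) ((k + 1 : ℕ) / N)) ≠ 0 := fun k hk =>
      div_ne_zero (D.κ_ne _ _ (hmem' k hk).2) (D.κ_ne _ _ (hmem' k hk).1)
    have c2 : ∀ k ∈ Finset.range N, DifferentiableAt ℝ (fun z =>
        ph (D.κ (i (k + 1)) (orbit Λ l (H z) ((k + 1 : ℕ) / N)) /
          D.κ (i k) (orbit Λ l (H z) ((k + 1 : ℕ) / N)))) y := fun k hk =>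
      (hasFDerivAt_ph (s2 k hk).differentiableAt (n2 k hk)).differentiableAt
    rw [dphase_congr e1, dphase_mul
      (k := fun z => ∏ k ∈ Finset.range N,
        cis (orbInt Λ (D.P (i k)) l 0 (1 / N) (orbit Λ l (H z) (k / N))))
      (k' := fun z => ∏ k ∈ Finset.range N, ph (D.κ (i (k + 1)) (orbit Λ l (H z) ((k + 1 : ℕ) / N)) /
          D.κ (i k) (orbit Λ l (H z) ((k + 1 : ℕ) / N))))
      (differentiableAt_finset_prod c1) (differentiableAt_finset_prod c2)
      (Finset.prod_ne_zero_iff.2 fun k _ => cis_ne_zero _)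
      (Finset.prod_ne_zero_iff.2 fun k hk => ph_ne_zero (n2 k hk)),
      dphase_finset_prod c1 (fun k _ => cis_ne_zero _),
      dphase_finset_prod c2 (fun k hk => ph_ne_zero (n2 k hk)), add_apply,
      sum_apply, sum_apply, ← Finset.sum_add_distrib]
    set T : ℕ → ℝ := fun k => (D.P (i k)).val (fun y => orbit Λ l (H y) (k / N)) y v with hT
    set F : ℝ → ℝ := fun t => χ.val (orb Λ l H) (y, t) (v, 0) (0, 1) with hF
    have hFc : Continuous F := continuous_iff_continuousAt.2 fun t => by
      have h2 : ContinuousAt (fun t => χ.val (orb Λ l H) (y, t)) t :=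
        ContinuousAt.comp (g := χ.val (orb Λ l H)) (f := fun t => (y, t))
          (χ.smooth (hH.orb hact l t)).continuousAt (by fun_prop)
      exact (h2.clm_apply continuousAt_const).clm_apply continuousAt_const
    have hterm : ∀ k ∈ Finset.range N,
        dphase (fun z => cis (orbInt Λ (D.P (i k)) l 0 (1 / N) (orbit Λ l (H z) (k / N)))) y v +
        dphase (fun z => ph (D.κ (i (k + 1)) (orbit Λ l (H z) ((k + 1 : ℕ) / N)) /
          D.κ (i k) (orbit Λ l (H z) ((k + 1 : ℕ) / N)))) y v =
        (T (k + 1) - T k) + ∫ t in ((k : ℝ) / N)..((k + 1 : ℕ) / N), F t := by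
      intro k hk
      rw [dphase_cis (d1' k), fderiv_orbInt hact (D.P (i k)) l hδ (hHk (k / N)),
        OneForm.val_orb_slice hact _ l (hHk (k / N)), OneForm.val_orb_slice hact _ l (hHk (k / N)),
        dphase_ph (k := fun z => D.κ (i (k + 1)) (orbit Λ l (H z) ((k + 1 : ℕ) / N)) /
          D.κ (i k) (orbit Λ l (H z) ((k + 1 : ℕ) / N))) (s2 k hk).differentiableAt (n2 k hk)]
      have t1 := congrArg (fun L : V →L[ℝ] ℝ => L v) (D.trans (i k) (i (k + 1))
        (hHk ((k + 1 : ℕ) / N)) (hmem' k hk).1 (hmem' k hk).2)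
      simp only [add_apply] at t1
      simp only [h0, orbit_zero]
      have t2 : ∫ t in (0 : ℝ)..(1 / N), (D.P (i k)).d.val
          (orb Λ l fun y => orbit Λ l (H y) (k / N)) (y, t) (v, 0) (0, 1) =
          ∫ t in ((k : ℝ) / N)..((k + 1 : ℕ) / N), F t := by
        have t3 : ∀ t ∈ Set.uIcc 0 (1 / (N : ℝ)), (D.P (i k)).d.val
          (orb Λ l fun y => orbit Λ l (H y) (k / N)) (y, t) (v, 0) (0, 1) = F (k / N + t) := by
          intro t ht
          rw [Set.uIcc_of_le hδ] at ht
          rw [OneForm.d_apply, D.curv (i k) ((hHk (k / N)).orb hact l t)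
            (hx k (Finset.mem_range.1 hk) t ht), TwoForm.val_orb_orbit hact χ l hH]
        rw [intervalIntegral.integral_congr t3, intervalIntegral.integral_comp_add_left F]
        congr 1
        · ring
        · push_cast; ring
      rw [t2]
      simp only [hT]
      linarith
    rw [Finset.sum_congr rfl hterm, Finset.sum_add_distrib, Finset.sum_range_sub]
    have hTN : T N = T 0 := by
      simp only [hT, hiN, div_self hN', orbit_one hl, Nat.cast_zero, zero_div, orbit_zero]
    rw [hTN, sub_self, zero_add, intervalIntegral.sum_integral_adjacent_intervals
      (a := fun k : ℕ => (k : ℝ) / N) fun k _ => hFc.intervalIntegrable _ _]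
    simp [div_self hN']

end Holonomy

section Sum

variable {E : Type} [NormedAddCommGroup E] [NormedSpace ℝ E] {M : Type*}
    [TopologicalSpace M] [ChartedSpace E M]

/-- The sum of two 1-forms. -/
def OneForm.add {F : Type} [NormedAddCommGroup F] [NormedSpace ℝ F] (η ζ : OneForm E M F) :
    OneForm E M F where
  val H y := η.val H y + ζ.val H y
  congr hH h := by rw [η.congr hH h, ζ.congr hH h]
  natural hH hg := by rw [η.natural hH hg, ζ.natural hH hg, ContinuousLinearMap.add_comp]
  smooth hH := (η.smooth hH).add (ζ.smooth hH)

theorem OneForm.d1_add {F : Type} [NormedAddCommGroup F] [NormedSpace ℝ F] (η ζ : OneForm E M F)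
    {V : Type} [NormedAddCommGroup V] [NormedSpace ℝ V] {H : V → M} {y : V}
    (hH : SmAt (E := E) H y) (v w : V) :
    d1 ((η.add ζ).val H) y v w = d1 (η.val H) y v w + d1 (ζ.val H) y v w := by
  have h : fderiv ℝ ((η.add ζ).val H) y = fderiv ℝ (η.val H) y + fderiv ℝ (ζ.val H) y :=
    (((η.smooth hH).differentiableAt (by simp)).hasFDerivAt.add
      ((ζ.smooth hH).differentiableAt (by simp)).hasFDerivAt).fderiv
  simp only [d1, h, add_apply]
  abel

end Sum

section AveragedHolonomy

variable {Λ : Submodule ℤ ℂ} [DiscreteTopology Λ] [IsZLattice ℝ Λ] {X : Type*}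
  [TopologicalSpace X] [ChartedSpace ℂ² X] [AddAction (Torus Λ) X]
  {χ : TwoForm ℂ² X}

/-- The potentials for the average of the curvature. -/
def PotentialSystem.avg (hact : SmoothAction Λ X) (D : PotentialSystem χ) (hχ : χ.Closed) :
    PotentialSystem (χ.avg hact) where
  U := D.U
  isOpen := D.isOpen
  mem := D.mem
  P i := (D.P i).add (χ.hom hact)
  κ := D.κ
  κ_ne := D.κ_ne
  curv i {V} _ _ {H y} hH hy v w := by
    rw [OneForm.d1_add _ _ hH, D.curv i hH hy, TwoForm.Closed.avg_cohomologous hact hχ hH]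
  smooth := D.smooth
  trans i j {V} _ _ {H y} hH hi hj := by
    change (D.P j).val H y + _ = (D.P i).val H y + _ + _
    rw [D.trans i j hH hi hj]
    abel

theorem TwoForm.Invariant.latticeIntersection_mu (hact : SmoothAction Λ X)
    {χ : TwoForm ℂ² X} (hi : χ.Invariant Λ) {V : Type} [NormedAddCommGroup V]
    [NormedSpace ℝ V] {H : V → X} {y : V} (hH : SmX H y) (l : ℂ) (t : ℝ) (v : V) :
    χ.val (orb Λ l H) (y, t) (v, 0) (0, 1) =
      latticeIntersection Λ ((χ.mu hact).val H y v) l := by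
  rw [χ.val_orb hact l hH, hi hH, χ.latticeIntersection_mu hact hH]

theorem PotentialSystem.exists_period_function [IsManifold 𝓘(ℝ, ℂ²) ∞ X] [CompactSpace X]
    (hact : SmoothAction Λ X) (D : PotentialSystem χ) (hχ : χ.Closed) {l : ℂ} (hl : l ∈ Λ) :
    ∃ h : X → ℂ, (∀ x, SmNV ℂ² h x) ∧ ∀ {V : Type} [NormedAddCommGroup V] [NormedSpace ℝ V]
      {H : V → X} {y : V}, SmX H y → ∀ v, dphase (fun z => h (H z)) y v =
        latticeIntersection Λ (((χ.avg hact).mu hact).val H y v) l := by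
  obtain ⟨h, h1, h2⟩ := (D.avg hact hχ).exists_holonomy hact hl
  refine ⟨h, h1, fun {V} _ _ {H y} hH v => ?_⟩
  rw [h2 hH]
  simp_rw [TwoForm.Invariant.latticeIntersection_mu hact (χ.invariant_avg hact) hH]
  simp

end AveragedHolonomy

section ChernPotential

/-- The linear map inverse to `linForm`. -/
def oneAlt (V : Type) [NormedAddCommGroup V] [NormedSpace ℝ V] :
    (V →L[ℝ] ℝ) →L[ℝ] (V [⋀^Fin 1]→L[ℝ] ℝ) :=
  ((ContinuousAlternatingMap.ofSubsingletonLIE (𝕜 := ℝ) (E := V) (F := ℝ)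
      (0 : Fin 1)).toContinuousLinearEquiv :
      (V →L[ℝ] ℝ) →L[ℝ] (V [⋀^Fin 1]→L[ℝ] ℝ))

theorem oneAlt_apply {V : Type} [NormedAddCommGroup V] [NormedSpace ℝ V] (L : V →L[ℝ] ℝ)
    (v : Fin 1 → V) : oneAlt V L v = L (v 0) := rfl

/-- The 1-form `(1/4π) df ∘ J`. -/
def dcLin (f : ℂ² → ℝ) (y : ℂ²) : ℂ² →L[ℝ] ℝ :=
  (1 / (4 * Real.pi)) • (fderiv ℝ f y).comp (I • ContinuousLinearMap.id ℝ ℂ²)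

theorem dcLin_apply (f : ℂ² → ℝ) (y v : ℂ²) :
    dcLin f y v = 1 / (4 * Real.pi) * fderiv ℝ f y (I • v) := rfl

theorem dcLin_congr {f g : ℂ² → ℝ} {y : ℂ²} (h : f =ᶠ[𝓝 y] g) : dcLin f y = dcLin g y := by
  rw [dcLin, dcLin, h.fderiv_eq]

theorem contDiffAt_dcLin {f : ℂ² → ℝ} {y : ℂ²} (h : ContDiffAt ℝ ∞ f y) :
    ContDiffAt ℝ ∞ (dcLin f) y :=
  ContDiffAt.const_smul (f := fun y => (fderiv ℝ f y).comp
    (I • ContinuousLinearMap.id ℝ ℂ²)) (1 / (4 * Real.pi))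
    ((h.fderiv_right (m := ∞) (by simp)).clm_comp contDiffAt_const)

theorem fderiv_I_smul {E F : Type*} [NormedAddCommGroup E] [NormedSpace ℂ E]
    [NormedAddCommGroup F] [NormedSpace ℂ F] {τ : E → F} {y : E} (h : DifferentiableAt ℂ τ y)
    (v : E) : fderiv ℝ τ y (I • v) = I • fderiv ℝ τ y v := by
  rw [h.fderiv_restrictScalars ℝ]
  simp

theorem dcLin_comp {f g : ℂ² → ℝ} {τ : ℂ² → ℂ²} {y : ℂ²} (h : DifferentiableAt ℂ τ y)
    (hg : DifferentiableAt ℝ g (τ y)) (hf : f =ᶠ[𝓝 y] fun z => g (τ z)) (v : ℂ²) :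
    dcLin f y v = dcLin g (τ y) (fderiv ℝ τ y v) := by
  rw [dcLin_apply, dcLin_apply, ← fderiv_I_smul h, hf.fderiv_eq,
    fderiv_fun_comp (g := g) (f := τ) y hg (h.restrictScalars ℝ)]
  rfl

theorem dcLin_log_norm_sq {G : ℂ² → ℂ} {y : ℂ²} (h : DifferentiableAt ℂ G y)
    (h0 : G y ≠ 0) : dcLin (fun z => Real.log (‖G z‖ ^ 2)) y = -dphase G y := by
  refine ContinuousLinearMap.ext fun v => ?_
  have hG := (h.restrictScalars ℝ).hasFDerivAt
  have h1 : HasFDerivAt (fun z => Real.log (‖G z‖ ^ 2)) _ y :=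
    hG.norm_sq.log (pow_ne_zero 2 (norm_ne_zero_iff.2 h0))
  rw [dcLin_apply, h1.fderiv, neg_apply, dphase_apply]
  simp only [smul_apply, ContinuousLinearMap.comp_apply, fderiv_I_smul h, innerSL_apply_apply,
    Complex.inner, smul_eq_mul]
  have h3 : ‖G y‖ ^ 2 ≠ 0 := pow_ne_zero 2 (norm_ne_zero_iff.2 h0)
  rw [Complex.inv_def, Complex.normSq_eq_norm_sq]
  set D := fderiv ℝ G y v
  simp [Complex.mul_re, Complex.mul_im, ← Complex.ofReal_pow]
  have hpi := Real.pi_ne_zero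
  field_simp
  ring

theorem fderiv_dcLin {f : ℂ² → ℝ} {y : ℂ²} (h : ContDiffAt ℝ ∞ f y) (v w : ℂ²) :
    fderiv ℝ (dcLin f) y v w = 1 / (4 * Real.pi) * fderiv ℝ (fderiv ℝ f) y v (I • w) := by
  have h1 := ((h.fderiv_right (m := ∞) (by simp)).differentiableAt (by simp)).hasFDerivAt
  have h2 : HasFDerivAt (dcLin f) _ y :=
    (h1.clm_comp (hasFDerivAt_const (I • ContinuousLinearMap.id ℝ ℂ²) y)).const_smul
      (1 / (4 * Real.pi))
  rw [h2.fderiv]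
  simp

variable {X : Type*} [TopologicalSpace X] [ChartedSpace ℂ² X]

theorem differentiableAt_transition_surface [IsManifold 𝓘(ℂ, ℂ²) ω X]
    {e e' : OpenPartialHomeomorph X ℂ²}
    (he : e ∈ atlas ℂ² X) (he' : e' ∈ atlas ℂ² X) {y : ℂ²}
    (hy : y ∈ (e.symm.trans e').source) : DifferentiableAt ℂ (fun z => e' (e.symm z)) y := by
  have h1 : ContMDiffAt 𝓘(ℂ, ℂ²) 𝓘(ℂ, ℂ²) ω e' (e.symm y) :=
    contMDiffAt_of_mem_maximalAtlas (IsManifold.subset_maximalAtlas he') hy.2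
  have h2 : ContMDiffAt 𝓘(ℂ, ℂ²) 𝓘(ℂ, ℂ²) ω e.symm y :=
    contMDiffAt_symm_of_mem_maximalAtlas (IsManifold.subset_maximalAtlas he) hy.1
  exact (h1.comp y h2).contDiffAt.differentiableAt (by simp)

theorem contDiffAt_comp_chart_symm [IsManifold 𝓘(ℝ, ℂ²) ∞ X] {u : X → ℝ}
    (hu : ContMDiff 𝓘(ℝ, ℂ²) 𝓘(ℝ, ℝ) ∞ u) {e : OpenPartialHomeomorph X ℂ²}
    (he : e ∈ atlas ℂ² X) {y : ℂ²} (hy : y ∈ e.target) :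
    ContDiffAt ℝ ∞ (fun z => u (e.symm z)) y :=
  ((hu _).comp y (contMDiffAt_symm_of_mem_maximalAtlas
    (IsManifold.subset_maximalAtlas he) hy)).contDiffAt

/-- The 1-form `(1/4π) du ∘ J` of a smooth function. -/
def dcForm [IsManifold 𝓘(ℂ, ℂ²) ω X] (u : X → ℝ) (hu : ContMDiff 𝓘(ℝ, ℂ²) 𝓘(ℝ, ℝ) ∞ u) :
    Form X 1 where
  toFun e y := oneAlt _ (dcLin (fun z => u (e.symm z)) y)
  smooth e he y hy := by
    have := isManifold_real X
    have h1 := contDiffAt_dcLin (contDiffAt_comp_chart_symm hu he hy)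
    have h2 : ContDiff ℝ ∞ (oneAlt ℂ²) :=
      ContinuousLinearMap.contDiff (𝕜 := ℝ) (E := ℂ² →L[ℝ] ℝ) (oneAlt ℂ²)
    exact (h2.contDiffAt.comp (g := oneAlt ℂ²) y h1).contDiffWithinAt
  compat e he e' he' y hy := by
    have := isManifold_real X
    have hd := differentiableAt_transition_surface he he' hy
    ext v
    rw [ContinuousAlternatingMap.compContinuousLinearMap_apply, oneAlt_apply, oneAlt_apply]
    refine dcLin_comp (τ := fun z => e' (e.symm z)) hd
      ((contDiffAt_comp_chart_symm hu he' (e'.map_source hy.2)).differentiableAt (by simp)) ?_ _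
    filter_upwards [(e.symm.trans e').open_source.mem_nhds hy] with z hz
    exact congrArg u (e'.left_inv hz.2).symm

variable [IsManifold 𝓘(ℂ, ℂ²) ω X] [IsManifold 𝓘(ℝ, ℂ²) ∞ X] {u : X → ℝ} (hu : ContMDiff 𝓘(ℝ, ℂ²) 𝓘(ℝ, ℝ) ∞ u)
  {V : Type} [NormedAddCommGroup V] [NormedSpace ℝ V]

theorem extDeriv_dcForm {e : OpenPartialHomeomorph X ℂ²} (he : e ∈ atlas ℂ² X)
    {y : ℂ²} (hy : y ∈ e.target) (a b : ℂ²) :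
    extDeriv ((dcForm u hu).toFun e) y ![a, b] = ddc (fun z => u (e.symm z)) y a b := by
  have h0 := contDiffAt_comp_chart_symm hu he hy
  have h : ∀ v w : ℂ², fderiv ℝ ((dcForm u hu).toFun e) y v ![w] =
      fderiv ℝ (dcLin fun z => u (e.symm z)) y v w := by
    intro v w
    have h1 : HasFDerivAt (oneAlt ℂ²) (oneAlt ℂ²) (dcLin (fun z => u (e.symm z)) y) :=
      ContinuousLinearMap.hasFDerivAt (𝕜 := ℝ) (E := ℂ² →L[ℝ] ℝ) (oneAlt ℂ²)
    have h2 := (HasFDerivAt.comp (g := oneAlt ℂ²) y h1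
      ((contDiffAt_dcLin h0).differentiableAt (by simp)).hasFDerivAt).fderiv
    change fderiv ℝ ((dcForm u hu).toFun e) y = _ at h2
    rw [h2, ContinuousLinearMap.comp_apply, oneAlt_apply]
    rfl
  rw [extDeriv, ContinuousAlternatingMap.alternatizeUncurryFin_apply]
  have e1 : (0 : Fin 2).removeNth ![a, b] = ![b] := by ext i <;> fin_cases i <;> rfl
  have e2 : (1 : Fin 2).removeNth ![a, b] = ![a] := by ext i <;> fin_cases i <;> rfl
  have h3 : (![a, b] : Fin 2 → ℂ²) 0 = a := rfl
  have h4 : (![a, b] : Fin 2 → ℂ²) 1 = b := rfl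
  rw [Fin.sum_univ_two, h3, h4, e1, e2, h, h, fderiv_dcLin h0, fderiv_dcLin h0, ddc]
  simp
  ring

theorem dcForm_val {H : V → X} {y : V} (hH : SmX H y)
    {e : OpenPartialHomeomorph X ℂ²} (he : e ∈ atlas ℂ² X) (hy : H y ∈ e.source) (v : V) :
    (dcForm u hu).toOneForm.val H y v = dcLin (fun z => u (e.symm z)) (e (H y))
      (fderiv ℝ (fun z => e (H z)) y v) := by
  change linForm V ((dcForm u hu).pb H y) v = _
  rw [linForm_apply, (dcForm u hu).pb_eq hH he hy]
  rfl

theorem d1_dcForm {H : V → X} {y : V} (hH : SmX H y)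
    {e : OpenPartialHomeomorph X ℂ²} (he : e ∈ atlas ℂ² X) (hy : H y ∈ e.source)
    (v w : V) :
    d1 ((dcForm u hu).toOneForm.val H) y v w = ddc (fun z => u (e.symm z)) (e (H y))
      (fderiv ℝ (fun z => e (H z)) y v) (fderiv ℝ (fun z => e (H z)) y w) := by
  rw [Form.d1_toOneForm _ hH, Form.extDeriv_pb _ hH he hy, ← extDeriv_dcForm hu he (e.map_source hy),
    ContinuousAlternatingMap.compContinuousLinearMap_apply]
  congr 1
  ext i <;> fin_cases i <;> rfl

theorem ddc_congr {f g : ℂ² → ℝ} {y : ℂ²} (h : f =ᶠ[𝓝 y] g) (v w : ℂ²) :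
    ddc f y v w = ddc g y v w := by
  rw [ddc, ddc, h.fderiv.fderiv_eq]

theorem toTwoForm_eq (χ : Form X 2) {H : V → X} {y : V} (hH : SmX H y)
    {e : OpenPartialHomeomorph X ℂ²} (he : e ∈ atlas ℂ² X) (hy : H y ∈ e.source)
    (v w : V) :
    χ.toTwoForm.val H y v w = χ.toFun e (e (H y))
      ![fderiv ℝ (fun z => e (H z)) y v, fderiv ℝ (fun z => e (H z)) y w] := by
  rw [χ.toTwoForm_apply, χ.pb_eq hH he hy, ContinuousAlternatingMap.compContinuousLinearMap_apply]
  congr 1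
  ext i <;> fin_cases i <;> rfl

end ChernPotential

section LineBundle

variable {X : Type*} [TopologicalSpace X] [ChartedSpace ℂ² X]
  {L : X → Type*} [∀ x, AddCommGroup (L x)] [∀ x, Module ℂ (L x)]
  [∀ x, TopologicalSpace (L x)] [TopologicalSpace (Bundle.TotalSpace ℂ L)] [FiberBundle ℂ L]
  [VectorBundle ℂ ℂ L]

variable (L) in
/-- The local frame given by the trivialization at a point. -/
def frame (i x : X) : L x := (trivializationAt ℂ L i).symm x 1

variable (L) in
/-- The transition function between two local frames: `frame L i = transition L i j • frame L j`. -/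
def transition (i j x : X) : ℂ :=
  (trivializationAt ℂ L i).coordChangeL ℂ (trivializationAt ℂ L j) x 1

theorem frame_ne_zero {i x : X} (hx : x ∈ (trivializationAt ℂ L i).baseSet) : frame L i x ≠ 0 := by
  intro h
  have h1 := (trivializationAt ℂ L i).apply_mk_symm hx (1 : ℂ)
  have h2 := ((trivializationAt ℂ L i).linear ℂ hx).map_zero
  change (trivializationAt ℂ L i ⟨x, frame L i x⟩) = _ at h1
  rw [h] at h1
  rw [h1] at h2
  exact one_ne_zero h2

theorem transition_eq {i j x : X} (hi : x ∈ (trivializationAt ℂ L i).baseSet)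
    (hj : x ∈ (trivializationAt ℂ L j).baseSet) :
    transition L i j x = (trivializationAt ℂ L j ⟨x, frame L i x⟩).2 :=
  (trivializationAt ℂ L i).coordChangeL_apply (trivializationAt ℂ L j) ⟨hi, hj⟩ 1

theorem frame_eq {i j x : X} (hi : x ∈ (trivializationAt ℂ L i).baseSet)
    (hj : x ∈ (trivializationAt ℂ L j).baseSet) :
    frame L i x = transition L i j x • frame L j x := by
  have h1 := (trivializationAt ℂ L j).symm_apply_apply_mk hj (frame L i x)
  rw [← transition_eq hi hj] at h1
  rw [← h1, frame, ← (trivializationAt ℂ L j).symmₗ_apply (R := ℂ) hj,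
    ← (trivializationAt ℂ L j).symmₗ_apply (R := ℂ) hj, ← map_smul, smul_eq_mul, mul_one]

theorem transition_ne_zero {i j x : X} (hi : x ∈ (trivializationAt ℂ L i).baseSet)
    (hj : x ∈ (trivializationAt ℂ L j).baseSet) : transition L i j x ≠ 0 := by
  intro h
  have h1 := frame_eq hi hj
  rw [h, zero_smul] at h1
  exact frame_ne_zero hi h1

theorem transition_mul {i j k x : X} (hi : x ∈ (trivializationAt ℂ L i).baseSet)
    (hj : x ∈ (trivializationAt ℂ L j).baseSet) (hk : x ∈ (trivializationAt ℂ L k).baseSet) :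
    transition L i j x * transition L j k x = transition L i k x := by
  have h1 : (transition L i j x * transition L j k x) • frame L k x =
      transition L i k x • frame L k x := by
    rw [mul_smul, ← frame_eq hj hk, ← frame_eq hi hj, ← frame_eq hi hk]
  have h2 : (transition L i j x * transition L j k x - transition L i k x) • frame L k x = 0 := by
    rw [sub_smul, h1, sub_self]
  rcases smul_eq_zero.1 h2 with h | h
  · exact sub_eq_zero.1 h
  · exact absurd h (frame_ne_zero hk)

variable [IsManifold 𝓘(ℂ, ℂ²) ω X] [ContMDiffVectorBundle ω ℂ L 𝓘(ℂ, ℂ²)]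

theorem contMDiffAt_transition {i j x : X} (hi : x ∈ (trivializationAt ℂ L i).baseSet)
    (hj : x ∈ (trivializationAt ℂ L j).baseSet) :
    ContMDiffAt 𝓘(ℂ, ℂ²) 𝓘(ℂ, ℂ) ω (transition L i j) x := by
  have h1 : ContMDiffAt 𝓘(ℂ, ℂ²) 𝓘(ℂ, ℂ →L[ℂ] ℂ) ω (fun b =>
      ((trivializationAt ℂ L i).coordChangeL ℂ (trivializationAt ℂ L j) b : ℂ →L[ℂ] ℂ)) x :=
    contMDiffAt_coordChangeL hi hj
  exact h1.clm_apply contMDiffAt_const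

variable (h : HermitianMetric L)

/-- The logarithm of the squared length of a local frame. -/
def HermitianMetric.pot (i x : X) : ℝ := Real.log (h.normSq x (frame L i x))

theorem HermitianMetric.contMDiffAt_pot {i x : X} (hi : x ∈ (trivializationAt ℂ L i).baseSet) :
    ContMDiffAt 𝓘(ℝ, ℂ²) 𝓘(ℝ, ℝ) ∞ (h.pot i) x := by
  have h1 := (h.smooth i).contMDiffAt ((trivializationAt ℂ L i).open_baseSet.mem_nhds hi)
  have h2 : ContDiffAt ℝ ∞ Real.log (h.normSq x (frame L i x)) :=
    Real.contDiffAt_log.2 (h.pos _ _ (frame_ne_zero hi)).ne'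
  exact ContMDiffAt.comp x h2.contMDiffAt h1

theorem HermitianMetric.pot_eq {i j x : X} (hi : x ∈ (trivializationAt ℂ L i).baseSet)
    (hj : x ∈ (trivializationAt ℂ L j).baseSet) :
    h.pot i x = Real.log (‖transition L i j x‖ ^ 2) + h.pot j x := by
  rw [HermitianMetric.pot, frame_eq hi hj, h.smul, Real.log_mul, HermitianMetric.pot]
  · exact pow_ne_zero 2 (norm_ne_zero_iff.2 (transition_ne_zero hi hj))
  · exact (h.pos _ _ (frame_ne_zero hj)).ne'

theorem HermitianMetric.exists_global_pot [IsManifold 𝓘(ℝ, ℂ²) ∞ X] [T2Space X] (i : X) :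
    ∃ (U : Set X) (u : X → ℝ), IsOpen U ∧ i ∈ U ∧ U ⊆ (trivializationAt ℂ L i).baseSet ∧
      ContMDiff 𝓘(ℝ, ℂ²) 𝓘(ℝ, ℝ) ∞ u ∧ ∀ x ∈ U, u x = h.pot i x := by
  obtain ⟨f, -, hf⟩ := (SmoothBumpFunction.nhds_basis_tsupport (I := 𝓘(ℝ, ℂ²)) i).mem_iff.1
    ((trivializationAt ℂ L i).open_baseSet.mem_nhds (FiberBundle.mem_baseSet_trivializationAt' i))
  refine ⟨interior {x | f x = 1} ∩ (trivializationAt ℂ L i).baseSet, fun x => f x * h.pot i x,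
    isOpen_interior.inter (trivializationAt ℂ L i).open_baseSet,
    ⟨mem_interior_iff_mem_nhds.2 f.eventuallyEq_one, FiberBundle.mem_baseSet_trivializationAt' i⟩,
    Set.inter_subset_right, ?_, fun x hx => ?_⟩
  · refine contMDiff_of_tsupport fun x hx => ?_
    have hx' : x ∈ tsupport f := closure_mono (Function.support_mul_subset_left _ _) hx
    exact f.contMDiff.contMDiffAt.mul (h.contMDiffAt_pot (hf hx'))
  · have h1 : x ∈ {x | f x = 1} := interior_subset hx.1
    change f x = 1 at h1
    change f x * h.pot i x = h.pot i x
    rw [h1, one_mul]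

theorem IsChernForm.nonempty_potentialSystem [IsManifold 𝓘(ℝ, ℂ²) ∞ X] [T2Space X]
    {h : HermitianMetric L} {χ : Form X 2} (hχ : IsChernForm h χ) :
    Nonempty (PotentialSystem χ.toTwoForm) := by
  choose U u hU hiU hUb hu huU using h.exists_global_pot
  have hκ : ∀ i, ∀ x ∈ U i, transition L x i x ≠ 0 := fun i x hx =>
    transition_ne_zero (FiberBundle.mem_baseSet_trivializationAt' x) (hUb i hx)
  have hdiv : ∀ i j, ∀ x ∈ U i, x ∈ U j →
      (fun z => transition L z j z / transition L z i z) =ᶠ[𝓝 x] transition L i j := by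
    intro i j x hi hj
    filter_upwards [(hU i).mem_nhds hi, (hU j).mem_nhds hj] with z hz hz'
    rw [div_eq_iff (hκ i z hz), mul_comm]
    exact (transition_mul (FiberBundle.mem_baseSet_trivializationAt' z) (hUb i hz) (hUb j hz')).symm
  refine ⟨⟨U, hU, hiU, fun i => (dcForm (u i) (hu i)).toOneForm, fun i x => transition L x i x, hκ,
    fun i {V} _ _ {H y} hH hy v w => ?_, fun i j x hi hj => ?_,
    fun i j {V} _ _ {H y} hH hi hj => ?_⟩⟩
  · set e := chartAt ℂ² (H y) with he
    have hes : H y ∈ e.source := mem_chart_source _ _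
    have hea : e ∈ atlas ℂ² X := chart_mem_atlas _ _
    rw [d1_dcForm (hu i) hH hea hes, toTwoForm_eq χ hH hea hes,
      hχ e hea i (e (H y)) (e.map_source hes) (by rw [e.left_inv hes]; exact hUb i hy)]
    refine ddc_congr ?_ _ _
    have hc : ContinuousAt e.symm (e (H y)) := e.continuousAt_symm (e.map_source hes)
    filter_upwards [hc.eventually_mem ((hU i).mem_nhds (by rwa [e.left_inv hes]))] with z hz
    exact huU i _ hz
  · refine SmNV.congr ?_ (hdiv i j x hi hj).symm
    refine SmNV.of ?_ (transition_ne_zero (hUb i hi) (hUb j hj))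
    filter_upwards [(hU i).mem_nhds hi, (hU j).mem_nhds hj] with z hz hz'
    exact contMDiffAt_real_of_complex (contMDiffAt_transition (hUb i hz) (hUb j hz'))
  · set e := chartAt ℂ² (H y) with he
    have hes : H y ∈ e.source := mem_chart_source _ _
    have hea : e ∈ atlas ℂ² X := chart_mem_atlas _ _
    set G : ℂ² → ℂ := fun z => transition L i j (e.symm z) with hG
    have hGd : DifferentiableAt ℂ G (e (H y)) := by
      have h2 : ContMDiffAt 𝓘(ℂ, ℂ²) 𝓘(ℂ, ℂ²) ω e.symm (e (H y)) :=
        contMDiffAt_symm_of_mem_maximalAtlas (IsManifold.subset_maximalAtlas hea)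
          (e.map_source hes)
      have h3 : ContMDiffAt 𝓘(ℂ, ℂ²) 𝓘(ℂ, ℂ) ω (transition L i j) (e.symm (e (H y))) := by
        rw [e.left_inv hes]
        exact contMDiffAt_transition (hUb i hi) (hUb j hj)
      exact (h3.comp (e (H y)) h2).contDiffAt.differentiableAt (by simp)
    have hG0 : G (e (H y)) ≠ 0 := by
      simp only [hG, e.left_inv hes]
      exact transition_ne_zero (hUb i hi) (hUb j hj)
    have hs := hH.chart hea hes
    refine ContinuousLinearMap.ext fun v => ?_
    rw [add_apply, dcForm_val (hu j) hH hea hes, dcForm_val (hu i) hH hea hes]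
    have e1 : (fun z => u i (e.symm z)) =ᶠ[𝓝 (e (H y))]
        fun z => Real.log (‖G z‖ ^ 2) + u j (e.symm z) := by
      have hc : ContinuousAt e.symm (e (H y)) := e.continuousAt_symm (e.map_source hes)
      filter_upwards [hc.eventually_mem ((hU i).mem_nhds (by rwa [e.left_inv hes])),
        hc.eventually_mem ((hU j).mem_nhds (by rwa [e.left_inv hes]))] with z hz hz'
      rw [huU i _ hz, huU j _ hz', h.pot_eq (hUb i hz) (hUb j hz')]
    have e2 : dcLin (fun z => u i (e.symm z)) (e (H y)) =
        -dphase G (e (H y)) + dcLin (fun z => u j (e.symm z)) (e (H y)) := by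
      rw [dcLin_congr e1, ← dcLin_log_norm_sq hGd hG0]
      have d1 : DifferentiableAt ℝ (fun z => Real.log (‖G z‖ ^ 2)) (e (H y)) :=
        (((hGd.restrictScalars ℝ).norm_sq ℝ)).log (pow_ne_zero 2 (norm_ne_zero_iff.2 hG0))
      have d2 := (contDiffAt_comp_chart_symm (hu j) hea (e.map_source hes)).differentiableAt (by simp)
      refine ContinuousLinearMap.ext fun w => ?_
      rw [add_apply, dcLin_apply, dcLin_apply, dcLin_apply, fderiv_fun_add d1 d2, add_apply]
      ring
    have e3 : (fun z => transition L (H z) j (H z) / transition L (H z) i (H z)) =ᶠ[𝓝 y]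
        fun z => G (e (H z)) := by
      filter_upwards [hH.continuousAt.eventually (hdiv i j _ hi hj),
        hH.continuousAt.eventually_mem (e.open_source.mem_nhds hes)] with z hz hz'
      simp only [hG, e.left_inv hz']
      exact hz
    rw [e2, dphase_congr e3, dphase_comp (k := G) (g := fun z => e (H z))
      (hGd.restrictScalars ℝ) hs.differentiableAt]
    simp

end LineBundle

section TypeOneOne

theorem ddc_I_smul {f : ℂ² → ℝ} {y : ℂ²} (hf : ContDiffAt ℝ ∞ f y) (a b : ℂ²) :
    ddc f y (I • a) (I • b) = ddc f y a b := by
  have hs : IsSymmSndFDerivAt ℝ f y := hf.isSymmSndFDerivAt (by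
    simp only [minSmoothness_of_isRCLikeNormedField]; exact WithTop.coe_le_coe.2 le_top)
  have h1 : ∀ c : ℂ², I • I • c = -c := fun c => by
    rw [smul_smul, Complex.I_mul_I, neg_one_smul]
  rw [ddc, ddc, h1, h1, map_neg, map_neg, hs.eq (I • a) b, hs.eq (I • b) a]
  ring

variable {X : Type*} [TopologicalSpace X] [ChartedSpace ℂ² X]
  {L : X → Type*} [∀ x, AddCommGroup (L x)] [∀ x, Module ℂ (L x)]
  [∀ x, TopologicalSpace (L x)] [TopologicalSpace (Bundle.TotalSpace ℂ L)] [FiberBundle ℂ L]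
  [VectorBundle ℂ ℂ L] [IsManifold 𝓘(ℂ, ℂ²) ω X] [IsManifold 𝓘(ℝ, ℂ²) ∞ X]
  {Λ : Submodule ℤ ℂ} [DiscreteTopology Λ] [IsZLattice ℝ Λ] [AddAction (Torus Λ) X]

/-- The form is of type `(1, 1)`, tested on holomorphic maps from `ℂ²`. -/
def TwoForm.OneOne (χ : TwoForm ℂ² X) : Prop :=
  ∀ {K : ℂ² → X} {p : ℂ²}, SmX K p →
    ContMDiffAt 𝓘(ℂ, ℂ²) 𝓘(ℂ, ℂ²) ω K p →
    ∀ a b : ℂ², χ.val K p (I • a) (I • b) = χ.val K p a b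

theorem IsChernForm.oneOne [ContMDiffVectorBundle ω ℂ L 𝓘(ℂ, ℂ²)] {h : HermitianMetric L} {χ : Form X 2} (hχ : IsChernForm h χ) :
    χ.toTwoForm.OneOne := by
  intro K p hK hK' a b
  set e := chartAt ℂ² (K p) with he
  have hes : K p ∈ e.source := mem_chart_source _ _
  have hea : e ∈ atlas ℂ² X := chart_mem_atlas _ _
  have h1 : ContMDiffAt 𝓘(ℂ, ℂ²) 𝓘(ℂ, ℂ²) ω e (K p) :=
    contMDiffAt_of_mem_maximalAtlas (IsManifold.subset_maximalAtlas hea) hes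
  have h2 : DifferentiableAt ℂ (fun z => e (K z)) p :=
    (h1.comp p hK').contDiffAt.differentiableAt (by simp)
  have hb : e.symm (e (K p)) ∈ (trivializationAt ℂ L (K p)).baseSet := by
    rw [e.left_inv hes]
    exact FiberBundle.mem_baseSet_trivializationAt' _
  rw [toTwoForm_eq χ hK hea hes, toTwoForm_eq χ hK hea hes, fderiv_I_smul h2, fderiv_I_smul h2,
    hχ e hea (K p) _ (e.map_source hes) hb, hχ e hea (K p) _ (e.map_source hes) hb]
  refine ddc_I_smul ?_ _ _
  have h3 : ContMDiffAt 𝓘(ℝ, ℂ²) 𝓘(ℝ, ℝ) ∞ (h.pot (K p)) (e.symm (e (K p))) :=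
    h.contMDiffAt_pot hb
  exact (h3.comp (e (K p)) (contMDiffAt_symm_of_mem_maximalAtlas
    (IsManifold.subset_maximalAtlas hea) (e.map_source hes))).contDiffAt

theorem latticeIntersection_injective {a b : ℂ}
    (h : ∀ w, latticeIntersection Λ a w = latticeIntersection Λ b w) : a = b := by
  have hA : covolume Λ ≠ 0 := covolume_ne_zero Λ volume
  have h1 := h 1
  have h2 := h I
  simp only [latticeIntersection, div_left_inj' hA] at h1 h2
  apply Complex.ext
  · simpa using h2
  · simpa using h1

theorem TwoForm.OneOne.mu_I {B : Type*} [TopologicalSpace B] [ChartedSpace ℂ B] {π : X → B}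
    (hπ : IsPrincipalBundle Λ π) {χ : TwoForm ℂ² X} (hχ : χ.OneOne) {H : ℂ → X} {u : ℂ}
    (hH : SmX H u) (hH' : ContMDiffAt 𝓘(ℂ, ℂ) 𝓘(ℂ, ℂ²) ω H u) (v : ℂ) :
    ((χ.avg hπ.smoothAction).mu hπ.smoothAction).val H u (I * v) =
      I * ((χ.avg hπ.smoothAction).mu hπ.smoothAction).val H u v := by
  have hact := hπ.smoothAction
  have hlift : ∀ z, ContMDiffAt 𝓘(ℂ, ℂ²) 𝓘(ℂ, ℂ²) ω (lift Λ H) (u, z) := fun z => by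
    refine ContMDiffAt.comp (I' := 𝓘(ℂ, ℂ).prod 𝓘(ℂ, ℂ²))
      (g := fun p : ℂ × X => ⟪p.1⟫[Λ] +ᵥ p.2)
      (f := fun p : ℂ² => (p.2, H p.1)) (u, z) (hπ.holomorphic_vadd _) ?_
    exact contDiffAt_snd.contMDiffAt.prodMk
      (ContMDiffAt.comp (g := H) (f := Prod.fst) (u, z) hH' contDiffAt_fst.contMDiffAt)
  have havg : ∀ a b : ℂ², (χ.avg hact).val (lift Λ H) (u, 0) (I • a) (I • b) =
      (χ.avg hact).val (lift Λ H) (u, 0) a b := fun a b => by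
    rw [χ.avg_lift_apply hact hH, χ.avg_lift_apply hact hH]
    congr 2
    funext z
    exact hχ (hH.lift hact z) (hlift z) a b
  refine latticeIntersection_injective (Λ := Λ) fun w => ?_
  rw [TwoForm.latticeIntersection_mu hact _ hH]
  have h1 := havg (v, 0) (0, -I * w)
  have e1 : I • ((v, 0) : ℂ²) = (I * v, 0) := by simp
  have e2 : I • ((0, -I * w) : ℂ²) = (0, w) := by
    simp [← mul_assoc]
  rw [e1, e2] at h1
  rw [h1, ← TwoForm.latticeIntersection_mu hact _ hH, latticeIntersection, latticeIntersection]
  congr 2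
  simp
  ring

end TypeOneOne

section PeriodMap

variable {X B : Type*} [TopologicalSpace X] [ChartedSpace ℂ² X]
  [TopologicalSpace B] [ChartedSpace ℂ B] {Λ : Submodule ℤ ℂ} [AddAction (Torus Λ) X] {π : X → B}
  [DiscreteTopology Λ] [IsZLattice ℝ Λ]

theorem exists_sign : ∃ σ : ℤ, (σ : ℝ) * σ = 1 ∧
    ∀ w : ℂ, latCoord Λ 0 w = σ * latticeIntersection Λ w (realBasis Λ 1) ∧
      latCoord Λ 1 w = -σ * latticeIntersection Λ w (realBasis Λ 0) := by
  have hA : covolume Λ ≠ 0 := covolume_ne_zero Λ volume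
  set r := realBasis Λ with hr
  set D := ((starRingEnd ℂ) (r 0) * r 1).im with hD
  have hc : covolume Λ = |D| := covolume_eq Λ
  have hD0 : D ≠ 0 := fun h => hA (by rw [hc, h, abs_zero])
  have key : ∀ σ : ℤ, (σ : ℝ) * σ = 1 → D = σ * |D| → ∃ σ : ℤ, (σ : ℝ) * σ = 1 ∧
      ∀ w : ℂ, latCoord Λ 0 w = σ * latticeIntersection Λ w (r 1) ∧
      latCoord Λ 1 w = -σ * latticeIntersection Λ w (r 0) := by
    intro σ hσ hs
    refine ⟨σ, hσ, fun w => ?_⟩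
    have hw : latCoord Λ 0 w • r 0 + latCoord Λ 1 w • r 1 = w := by
      rw [← Fin.sum_univ_two (fun i => latCoord Λ i w • r i), hr, sum_latCoord]
    have e1 : ((starRingEnd ℂ) w * r 1).im = latCoord Λ 0 w * D := by
      conv_lhs => rw [← hw]
      rw [hD]
      simp
      ring
    have e2 : ((starRingEnd ℂ) w * r 0).im = -latCoord Λ 1 w * D := by
      conv_lhs => rw [← hw]
      rw [hD]
      simp
      ring
    have hD' : (|D| : ℝ) ≠ 0 := abs_ne_zero.2 hD0
    rw [latticeIntersection, latticeIntersection, e1, e2, hc]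
    constructor
    · conv_rhs => rw [show latCoord Λ 0 w * D = latCoord Λ 0 w * (σ * |D|) by rw [← hs]]
      field_simp
      linear_combination (-(latCoord Λ 0 w)) * hσ
    · conv_rhs => rw [show -latCoord Λ 1 w * D = -latCoord Λ 1 w * (σ * |D|) by rw [← hs]]
      field_simp
      linear_combination (-(latCoord Λ 1 w)) * hσ
  rcases lt_or_gt_of_ne hD0 with h | h
  · exact key (-1) (by norm_num) (by rw [abs_of_neg h]; push_cast; ring)
  · exact key 1 (by norm_num) (by rw [abs_of_pos h]; push_cast; ring)

variable [IsManifold 𝓘(ℝ, ℂ²) ∞ X] [CompactSpace X]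

theorem PotentialSystem.exists_torus_map (hact : SmoothAction Λ X) {χ : TwoForm ℂ² X}
    (D : PotentialSystem χ) (hχ : χ.Closed) : ∃ Φ : X → Torus Λ,
    ∀ {V : Type} [NormedAddCommGroup V] [NormedSpace ℝ V] {H : V → X} {S : Set V},
      Convex ℝ S → IsOpen S → (∀ y ∈ S, SmX H y) → ∀ {F : V → ℂ},
      (∀ y ∈ S, HasFDerivAt F (((χ.avg hact).mu hact).val H y) y) →
      ∃ c : ℂ, ∀ z ∈ S, ⟪F z + c⟫[Λ] = Φ (H z) := by
  obtain ⟨σ, hσ, hco⟩ := exists_sign (Λ := Λ)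
  have hw : ∀ i : Fin 2, ∃ w : X → ℂ, (∀ x, SmNV ℂ² w x) ∧ ∀ {V : Type}
      [NormedAddCommGroup V] [NormedSpace ℝ V] {H : V → X} {y : V}, SmX H y → ∀ v,
        dphase (fun z => w (H z)) y v = latCoord Λ i (((χ.avg hact).mu hact).val H y v) := by
    have aux : ∀ (j : Fin 2) (n : ℤ), ∃ w : X → ℂ, (∀ x, SmNV ℂ² w x) ∧ ∀ {V : Type}
      [NormedAddCommGroup V] [NormedSpace ℝ V] {H : V → X} {y : V}, SmX H y → ∀ v,
        dphase (fun z => w (H z)) y v =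
          n * latticeIntersection Λ (((χ.avg hact).mu hact).val H y v) (realBasis Λ j) := by
      intro j n
      obtain ⟨h, h1, h2⟩ := D.exists_period_function hact hχ (realBasis_mem Λ j)
      refine ⟨fun x => h x ^ n, fun x => (h1 x).zpow n, fun {V} _ _ {H y} hH v => ?_⟩
      rw [dphase_zpow (k := fun z => h (H z)) ((h1 _).smF hH).differentiableAt (h1 _).ne_zero,
        smul_apply, h2 hH, smul_eq_mul]
    intro i
    fin_cases i
    · obtain ⟨w, h1, h2⟩ := aux 1 σ
      refine ⟨w, h1, fun {V} _ _ {H y} hH v => ?_⟩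
      rw [h2 hH]
      exact (hco _).1.symm
    · obtain ⟨w, h1, h2⟩ := aux 0 (-σ)
      refine ⟨w, h1, fun {V} _ _ {H y} hH v => ?_⟩
      rw [h2 hH]
      push_cast
      exact (hco _).2.symm
  choose w h1 h2 using hw
  refine ⟨fun x => torusOf Λ fun i => w i x, fun {V} _ _ {H S} hS hSo hH {F} hF => ?_⟩
  rcases S.eq_empty_or_nonempty with rfl | ⟨y, hy⟩
  · exact ⟨0, fun z hz => absurd hz (Set.notMem_empty z)⟩
  set θ : Fin 2 → ℝ := fun i => Complex.arg (w i (H y)) / (2 * Real.pi) with hθ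
  refine ⟨∑ i, θ i • realBasis Λ i - F y, fun z hz => ?_⟩
  change _ = torusOf Λ fun i => w i (H z)
  rw [torusOf_eq Λ (fun i => (h1 i _).ne_zero) (θ := fun i => θ i + (latCoord Λ i (F z) -
    latCoord Λ i (F y)))]
  · simp only [add_smul, sub_smul, Finset.sum_add_distrib, Finset.sum_sub_distrib, sum_latCoord]
    congr 1
    ring
  · intro i
    rw [ph_eq_of_dphase (k := fun z => w i (H z)) (θ := fun z => latCoord Λ i (F z)) hS hSo
      (fun y hy => ((h1 i _).smF (hH y hy)).differentiableAt) (fun y _ => (h1 i _).ne_zero)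
      (fun y hy => ?_) hy hz, ph_eq_exp_arg (h1 i _).ne_zero, cis, ← Complex.exp_add]
    · have hθi : Complex.arg (w i (H y)) / (2 * Real.pi) = θ i := rfl
      rw [hθi]
      congr 1
      push_cast
      ring
    · refine ((latCoord Λ i).hasFDerivAt.comp y (hF y hy)).congr_fderiv ?_
      exact ContinuousLinearMap.ext fun v => (h2 i (hH y hy) v).symm

end PeriodMap

section Descent

variable {X B : Type*} [TopologicalSpace X] [ChartedSpace ℂ² X]
  [TopologicalSpace B] [ChartedSpace ℂ B] {Λ : Submodule ℤ ℂ} [AddAction (Torus Λ) X] {π : X → B}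
  [DiscreteTopology Λ] [IsZLattice ℝ Λ] [IsManifold 𝓘(ℝ, ℂ²) ∞ X] [CompactSpace X]

theorem OneForm.val_const {E : Type} [NormedAddCommGroup E] [NormedSpace ℝ E] {M : Type*}
    [TopologicalSpace M] [ChartedSpace E M] {F : Type} [NormedAddCommGroup F] [NormedSpace ℝ F]
    (μ : OneForm E M F) {V : Type} [NormedAddCommGroup V] [NormedSpace ℝ V] (x : M) (y : V) :
    μ.val (fun _ : V => x) y = 0 := by
  have h := μ.natural (H := fun _ : V => x) (g := fun _ : V => (0 : V)) (y := y)
    (Filter.Eventually.of_forall fun _ => contMDiffAt_const) (SmF.of_contDiff contDiff_const y)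
  rw [h]
  simp

theorem TwoForm.mu_fibre (hact : SmoothAction Λ X) {χ : TwoForm ℂ² X} (hi : χ.Invariant Λ)
    (hfib : ∀ x, χ.fib Λ x = 0) (x : X) (z : ℂ) :
    (χ.mu hact).val (fun z : ℂ => ⟪z⟫[Λ] +ᵥ x) z = 0 := by
  refine ContinuousLinearMap.ext fun w => ?_
  have h1 := (χ.mu hact).natural (H := lift Λ fun _ : ℂ => x)
    (g := fun z : ℂ => ((0 : ℂ), z)) (y := z) ((smAt_const_fun 0).lift hact z)
    (SmF.of_contDiff (by fun_prop) _)
  have h2 : (fun z : ℂ => ⟪z⟫[Λ] +ᵥ x) =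
    fun z : ℂ => lift Λ (fun _ : ℂ => x) ((0 : ℂ), z) := rfl
  rw [h2, h1, (hasFDerivAt_prodMk_right (0 : ℂ) z).fderiv]
  change (χ.mu hact).val (lift Λ fun _ : ℂ => x) (0, z) (0, w) = 0
  rw [TwoForm.mu_lift hact hi (smAt_const_fun 0), hfib, OneForm.val_const]
  simp

variable [IsManifold 𝓘(ℂ, ℂ²) ω X] [IsManifold 𝓘(ℂ, ℂ) ω B]

/-- The map `φ` on the base is the integral of the form `μ` on `X`. -/
def IsPeriodMap (Λ : Submodule ℤ ℂ) (π : X → B) (μ : OneForm ℂ² X ℂ) (φ : B → Torus Λ) : Prop :=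
  ∀ {V : Type} [NormedAddCommGroup V] [NormedSpace ℝ V] {H : V → X} {S : Set V},
      Convex ℝ S → IsOpen S → (∀ y ∈ S, SmX H y) → ∀ {F : V → ℂ},
      (∀ y ∈ S, HasFDerivAt F (μ.val H y) y) →
      ∃ c : ℂ, ∀ z ∈ S, ⟪F z + c⟫[Λ] = φ (π (H z))

theorem hasDerivAt_of_I_smul {f : ℂ → ℂ} {f' : ℂ →L[ℝ] ℂ} {u : ℂ} (hf : HasFDerivAt f f' u)
    (h : ∀ v, f' (I * v) = I * f' v) : HasDerivAt f (f' 1) u := by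
  rw [hasDerivAt_iff_hasFDerivAt]
  refine hasFDerivAt_of_restrictScalars ℝ hf (ContinuousLinearMap.ext fun v => ?_)
  have h1 : v = v.re • (1 : ℂ) + v.im • (I * 1) := by
    apply Complex.ext <;> simp
  conv_rhs => rw [h1]
  rw [map_add, map_smul, map_smul, h]
  simp only [ContinuousLinearMap.coe_restrictScalars', toSpanSingleton_apply,
    smul_eq_mul, Complex.real_smul]
  conv_lhs => rw [← Complex.re_add_im v]
  ring

/-- The form is complex linear along holomorphic curves. -/
def OneForm.IsComplexLinear (μ : OneForm ℂ² X ℂ) : Prop :=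
  ∀ {H : ℂ → X} {u : ℂ}, SmX H u → ContMDiffAt 𝓘(ℂ, ℂ) 𝓘(ℂ, ℂ²) ω H u →
    ∀ v, μ.val H u (I * v) = I * μ.val H u v

theorem IsPeriodMap.exists_hasDerivAt {μ : OneForm ℂ² X ℂ}
    (hμ : μ.Closed) (hI : μ.IsComplexLinear) {φ : B → Torus Λ} (hφ : IsPeriodMap Λ π μ φ) {s : B → X}
    {e : OpenPartialHomeomorph B ℂ} (he : e ∈ atlas ℂ B) {u : ℂ} (hu : u ∈ e.target)
    (hs : LocSec π s (e.symm u)) : ∃ F : ℂ → ℂ, ∀ᶠ z in 𝓝 u,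
      HasDerivAt F (μ.val (chartSec s e) z 1) z ∧
        ⟪F z⟫[Λ] = φ (e.symm z) := by
  have h1 : ∀ᶠ v in 𝓝 u, v ∈ e.target ∧ LocSec π s (e.symm v) :=
    (e.open_target.eventually_mem hu).and ((e.symm.continuousAt hu).eventually hs.eventually)
  obtain ⟨r, hr, hrs⟩ := Metric.eventually_nhds_iff_ball.1 h1
  have hK : ∀ z ∈ Metric.ball u r, SmX (chartSec s e) z := fun z hz =>
    (hrs z hz).2.smAt_chartSec he (hrs z hz).1
  obtain ⟨F, hF⟩ := hμ.exists_primitive (convex_ball u r) Metric.isOpen_ball hK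
  obtain ⟨c, hc⟩ := hφ (convex_ball u r) Metric.isOpen_ball hK hF
  refine ⟨fun z => F z + c, ?_⟩
  filter_upwards [Metric.ball_mem_nhds u hr] with z hz
  have h2 := ((hrs z hz).2.hol_chartSec he (hrs z hz).1).self_of_nhds
  refine ⟨(hasDerivAt_of_I_smul (hF z hz) (hI (hK z hz) h2)).add_const c, ?_⟩
  rw [hc z hz, (hrs z hz).2.proj_chartSec]

theorem IsPeriodMap.holomorphic (hπ : IsPrincipalBundle Λ π) {μ : OneForm ℂ² X ℂ}
    (hμ : μ.Closed) (hI : μ.IsComplexLinear) {φ : B → Torus Λ} (hφ : IsPeriodMap Λ π μ φ) :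
    IsHolomorphicToTorus Λ φ := by
  intro b
  obtain ⟨s, hs⟩ := hπ.exists_locSec b
  set e := chartAt ℂ b
  have hb : b ∈ e.source := mem_chart_source ℂ b
  obtain ⟨F, hF⟩ := hφ.exists_hasDerivAt hμ hI (chart_mem_atlas ℂ b) (e.map_source hb)
    (by rwa [e.left_inv hb])
  obtain ⟨S, hS, hSo, hbS⟩ := mem_nhds_iff.1 hF
  have hFc : ContDiffOn ℂ ω F S := DifferentiableOn.contDiffOn (fun u hu =>
    (hS hu).1.differentiableAt.differentiableWithinAt) hSo
  refine ⟨e.source ∩ e ⁻¹' S, e.isOpen_inter_preimage hSo, ⟨hb, hbS⟩, fun x => F (e x),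
    fun x hx => ?_, fun x hx => ?_⟩
  · exact (ContMDiffAt.comp (g := F) x (hFc.contDiffAt (hSo.mem_nhds hx.2)).contMDiffAt
      (contMDiffAt_of_mem_maximalAtlas (IsManifold.subset_maximalAtlas (chart_mem_atlas ℂ b))
        hx.1)).contMDiffWithinAt
  · rw [(hS hx.2).2, e.left_inv hx.1]

theorem PotentialSystem.exists_periodMap (hπ : IsPrincipalBundle Λ π) {χ : TwoForm ℂ² X}
    (D : PotentialSystem χ) (hχ : χ.Closed)
    (hfib : ∀ x, (χ.avg hπ.smoothAction).fib Λ x = 0) :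
    ∃ φ : B → Torus Λ, IsPeriodMap Λ π ((χ.avg hπ.smoothAction).mu hπ.smoothAction) φ := by
  have hact := hπ.smoothAction
  obtain ⟨Φ, hΦ⟩ := D.exists_torus_map hact hχ
  have hinv : ∀ (z : ℂ) (x : X), Φ (⟪z⟫[Λ] +ᵥ x) = Φ x := by
    intro z x
    have hsm : ∀ z : ℂ, SmX (fun z : ℂ => ⟪z⟫[Λ] +ᵥ x) z :=
      fun z => SmAt.comp (H := lift Λ fun _ : ℂ => x)
        (g := fun z : ℂ => ((0 : ℂ), z)) z ((smAt_const_fun 0).lift hact z)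
        (SmF.of_contDiff (by fun_prop) _)
    obtain ⟨c, hc⟩ := hΦ (H := fun z : ℂ => ⟪z⟫[Λ] +ᵥ x) convex_univ
      isOpen_univ (fun z _ => hsm z) (F := fun _ => 0) (fun z _ => by
        rw [TwoForm.mu_fibre hact (χ.invariant_avg hact) hfib]
        exact hasFDerivAt_const _ _)
    rw [← hc z trivial, ← (by simpa using hc 0 trivial : _ = Φ x)]
    simp
  have hsec : ∀ b : B, ∃ x : X, π x = b := fun b => by
    obtain ⟨s, hs⟩ := hπ.exists_locSec b
    exact ⟨s b, hs.proj⟩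
  choose s hs using hsec
  refine ⟨fun b => Φ (s b), fun {V} _ _ {H S} hS hSo hH {F} hF => ?_⟩
  obtain ⟨c, hc⟩ := hΦ hS hSo hH hF
  refine ⟨c, fun z hz => ?_⟩
  obtain ⟨w, hw⟩ := hπ.exists_vadd_eq (hs (π (H z)))
  rw [hc z hz]
  conv_lhs => rw [← hw, hinv]

end Descent

section Covering

variable (Λ : Submodule ℤ ℂ) [DiscreteTopology Λ]

theorem isCoveringMap_mk : IsCoveringMap (QuotientAddGroup.mk : ℂ → Torus Λ) :=
  (AddSubgroup.isAddQuotientCoveringMap Λ.toAddSubgroup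
    ⟨(inferInstance : DiscreteTopology Λ)⟩).isCoveringMap

theorem exists_lift {p : ℝ → Torus Λ} (hp : Continuous p) :
    ∃ f : ℝ → ℂ, Continuous f ∧ ∀ t, ⟪f t⟫[Λ] = p t := by
  obtain ⟨z, hz⟩ := QuotientAddGroup.mk_surjective (p 0)
  obtain ⟨F, ⟨-, hF⟩, -⟩ := (isCoveringMap_mk Λ).existsUnique_continuousMap_lifts
    (⟨p, hp⟩ : C(ℝ, Torus Λ)) 0 z hz
  exact ⟨F, F.continuous, fun t => congrFun hF t⟩

variable {Λ}

/-- Two lifts of the same map on a connected set differ by a constant. -/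
theorem sub_eq_of_lifts {A : Type*} [TopologicalSpace A] {S : Set A} (hS : IsPreconnected S)
    {f g : A → ℂ} (hf : ContinuousOn f S) (hg : ContinuousOn g S)
    (h : ∀ t ∈ S, ⟪f t⟫[Λ] = QuotientAddGroup.mk (g t)) {s t : A}
    (hs : s ∈ S) (ht : t ∈ S) : f t - f s = g t - g s := by
  have hmem : ∀ t ∈ S, f t - g t ∈ Λ := fun t ht => by
    have h1 := QuotientAddGroup.eq.1 (h t ht).symm
    rwa [neg_add_eq_sub] at h1
  have hc : ContinuousOn (fun t => f t - g t) S := hf.sub hg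
  have hp : PreconnectedSpace S := isPreconnected_iff_preconnectedSpace.1 hS
  have h2 : Continuous fun t : S => (⟨f t - g t, hmem t t.2⟩ : Λ) :=
    Continuous.subtype_mk (continuousOn_iff_continuous_domRestrict.1 hc) _
  have h3 := PreconnectedSpace.constant hp h2 (x := ⟨s, hs⟩) (y := ⟨t, ht⟩)
  have h4 : f s - g s = f t - g t := congrArg Subtype.val h3
  linear_combination -h4

theorem IsHolomorphicToTorus.continuous {B : Type*} [TopologicalSpace B] [ChartedSpace ℂ B]
    {φ : B → Torus Λ} (h : IsHolomorphicToTorus Λ φ) : Continuous φ := by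
  refine continuous_iff_continuousAt.2 fun b => ?_
  obtain ⟨U, hU, hb, f, hf, hfφ⟩ := h b
  have h1 : ContinuousAt f b := (hf.continuousOn b hb).continuousAt (hU.mem_nhds hb)
  have h2 : ContinuousAt (fun u => ⟪f u⟫[Λ]) b :=
    ContinuousAt.comp (g := (QuotientAddGroup.mk : ℂ → Torus Λ))
      QuotientAddGroup.continuous_mk.continuousAt h1
  refine h2.congr ?_
  filter_upwards [hU.mem_nhds hb] with u hu
  exact hfφ u hu

end Covering

section TorusIntegrals

variable {X : Type*} [TopologicalSpace X] [ChartedSpace ℂ² X]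
  {Λ : Submodule ℤ ℂ} [AddAction (Torus Λ) X]

theorem SmAt.of_contMDiff {V : Type} [NormedAddCommGroup V] [NormedSpace ℝ V] {H : V → X}
    (h : ContMDiff 𝓘(ℝ, V) 𝓘(ℝ, ℂ²) ∞ H) (y : V) : SmX H y :=
  Filter.Eventually.of_forall fun z => h z

theorem squareIntegral_eq [IsManifold 𝓘(ℝ, ℂ²) ∞ X] (hact : SmoothAction Λ X) (c : Form X 2)
    (l : ℂ) {γ : ℝ → X} (hγ : ContMDiff 𝓘(ℝ, ℝ) 𝓘(ℝ, ℂ²) ∞ γ) :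
    squareIntegral c (fun s t => ⟪(t : ℂ) * l⟫[Λ] +ᵥ γ s) =
      ∫ s in (0 : ℝ)..1, ∫ t in (0 : ℝ)..1, c.toTwoForm.val (orb Λ l γ) (s, t) (1, 0) (0, 1) := by
  rw [squareIntegral]
  congr 1
  funext s
  congr 1
  funext t
  have hs := (SmAt.of_contMDiff hγ s).orb hact l t
  rw [Form.toTwoForm_apply, Form.pb, ContinuousAlternatingMap.compContinuousLinearMap_apply]
  have hd := ((hs.chart (chart_mem_atlas ℂ² (orb Λ l γ (s, t)))
    (mem_chart_source _ _)).differentiableAt).hasFDerivAt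
  have h1 := (hd.comp_hasDerivAt (f := fun s => (s, t)) s
    ((hasFDerivAt_prodMk_left s t).hasDerivAt)).deriv
  have h2 := (hd.comp_hasDerivAt (f := fun t => (s, t)) t
    ((hasFDerivAt_prodMk_right s t).hasDerivAt)).deriv
  change c.toFun (chartAt ℂ² (orb Λ l γ (s, t))) (chartAt ℂ² (orb Λ l γ (s, t))
    (orb Λ l γ (s, t))) ![_, _] = _
  congr 1
  ext i <;> fin_cases i
  · exact congrArg Prod.fst h1
  · exact congrArg Prod.fst h2
  · exact congrArg Prod.snd h1
  · exact congrArg Prod.snd h2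

theorem TwoForm.CohomologousVia.torus_integral_eq (hact : SmoothAction Λ X)
    {α β : TwoForm ℂ² X} {η : OneForm ℂ² X ℝ} (h : α.CohomologousVia β η)
    {l : ℂ} (hl : l ∈ Λ) {γ : ℝ → X} (hγ : ContMDiff 𝓘(ℝ, ℝ) 𝓘(ℝ, ℂ²) ∞ γ)
    (hp : Function.Periodic γ 1) :
    ∫ s in (0 : ℝ)..1, ∫ t in (0 : ℝ)..1, α.val (orb Λ l γ) (s, t) (1, 0) (0, 1) =
      ∫ s in (0 : ℝ)..1, ∫ t in (0 : ℝ)..1, β.val (orb Λ l γ) (s, t) (1, 0) (0, 1) := by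
  have hγs := SmAt.of_contMDiff hγ
  have hcont : ∀ s (χ : TwoForm ℂ² X),
      Continuous fun t => χ.val (orb Λ l γ) (s, t) (1, 0) (0, 1) := fun s χ =>
    continuous_iff_continuousAt.2 fun t => by
      have h2 : ContinuousAt (fun t => χ.val (orb Λ l γ) (s, t)) t :=
        ContinuousAt.comp (g := χ.val (orb Λ l γ)) (f := fun t => (s, t))
          (χ.smooth ((hγs s).orb hact l t)).continuousAt (by fun_prop)
      exact (h2.clm_apply continuousAt_const).clm_apply continuousAt_const
  have hF : ∀ s, ContDiffAt ℝ ∞ (fun s => orbInt Λ η l 0 1 (γ s)) s := fun s =>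
    contDiffAt_orbInt hact η l zero_le_one (hγs s)
  have hFc : ContDiff ℝ ∞ fun s => orbInt Λ η l 0 1 (γ s) := contDiff_iff_contDiffAt.2 hF
  have hin : ∀ s, (∫ t in (0 : ℝ)..1, α.val (orb Λ l γ) (s, t) (1, 0) (0, 1)) =
      (∫ t in (0 : ℝ)..1, β.val (orb Λ l γ) (s, t) (1, 0) (0, 1)) +
        deriv (fun s => orbInt Λ η l 0 1 (γ s)) s := by
    intro s
    have h1 := fderiv_orbInt hact η l (zero_le_one (α := ℝ)) (hγs s) 1
    rw [η.val_orb_slice hact l (hγs s), η.val_orb_slice hact l (hγs s)] at h1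
    simp only [orbit_one hl, orbit_zero, sub_self, zero_add] at h1
    rw [← fderiv_apply_one_eq_deriv, h1, ← intervalIntegral.integral_add
      ((hcont s β).intervalIntegrable _ _) ((hcont s η.d).intervalIntegrable _ _)]
    congr 1
    funext t
    rw [h ((hγs s).orb hact l t), OneForm.d_apply]
  have hβ : Continuous fun s => ∫ t in (0 : ℝ)..1, β.val (orb Λ l γ) (s, t) (1, 0) (0, 1) := by
    refine intervalIntegral.continuous_parametric_intervalIntegral_of_continuous'
      (f := fun s t => β.val (orb Λ l γ) (s, t) (1, 0) (0, 1)) ?_ 0 1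
    refine continuous_iff_continuousAt.2 fun p => ?_
    exact ((β.smooth ((hγs p.1).orb hact l p.2)).continuousAt.clm_apply
      continuousAt_const).clm_apply continuousAt_const
  have hd : Continuous (deriv fun s => orbInt Λ η l 0 1 (γ s)) :=
    hFc.continuous_deriv (by simp)
  simp_rw [hin]
  rw [intervalIntegral.integral_add (hβ.intervalIntegrable _ _) (hd.intervalIntegrable _ _),
    intervalIntegral.integral_deriv_eq_sub (fun s _ => (hF s).differentiableAt (by simp))
      (hd.intervalIntegrable _ _)]
  have h0 : γ 1 = γ 0 := by simpa using hp 0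
  rw [h0, sub_self, add_zero]

theorem latticeIntersection_integral {f : ℝ → ℂ} (hf : Continuous f) (l : ℂ) (a b : ℝ) :
    ∫ s in a..b, latticeIntersection Λ (f s) l = latticeIntersection Λ (∫ s in a..b, f s) l := by
  set T : ℂ →L[ℝ] ℝ := (covolume Λ)⁻¹ • Complex.imCLM.comp
    ((ContinuousLinearMap.mul ℝ ℂ l).comp (Complex.conjCLE : ℂ →L[ℝ] ℂ)) with hT
  have h1 : ∀ w, latticeIntersection Λ w l = T w := fun w => by
    rw [latticeIntersection, hT, div_eq_inv_mul, mul_comm (_ : ℂ) l]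
    rfl
  simp_rw [h1]
  exact T.intervalIntegral_comp_comm (hf.intervalIntegrable _ _)

variable [DiscreteTopology Λ] [IsZLattice ℝ Λ] {B : Type*} [TopologicalSpace B] [ChartedSpace ℂ B]
  {π : X → B}

/-- A period map of the averaged form corresponds to the class of the form. -/
theorem IsPeriodMap.squareIntegral_eq [IsManifold 𝓘(ℝ, ℂ²) ∞ X] (hact : SmoothAction Λ X)
    {c : Form X 2} {χ : TwoForm ℂ² X} (hχ : χ.Closed) {η : OneForm ℂ² X ℝ}
    (hc : c.toTwoForm.CohomologousVia χ η) {φ : B → Torus Λ}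
    (hφ : IsPeriodMap Λ π ((χ.avg hact).mu hact) φ) {γ : ℝ → X}
    (hγ : ContMDiff 𝓘(ℝ, ℝ) 𝓘(ℝ, ℂ²) ∞ γ) (hp : Function.Periodic γ 1) {f : ℝ → ℂ}
    (hf : Continuous f) (hfφ : ∀ s, ⟪f s⟫[Λ] = φ (π (γ s)))
    {l : ℂ} (hl : l ∈ Λ) :
    squareIntegral c (fun s t => ⟪(t : ℂ) * l⟫[Λ] +ᵥ γ s) =
      latticeIntersection Λ (f 1 - f 0) l := by
  have hγs := SmAt.of_contMDiff hγ
  set μ := (χ.avg hact).mu hact with hμ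
  rw [PrincipalElliptic.squareIntegral_eq hact c l hγ, hc.torus_integral_eq hact hl hγ hp,
    ← TwoForm.CohomologousVia.torus_integral_eq hact (TwoForm.Closed.avg_cohomologous hact hχ) hl hγ hp]
  simp_rw [TwoForm.Invariant.latticeIntersection_mu hact (χ.invariant_avg hact) (hγs _)]
  have hμc : Continuous fun s => μ.val γ s 1 := continuous_iff_continuousAt.2 fun s =>
    (μ.smooth (hγs s)).continuousAt.clm_apply continuousAt_const
  simp only [intervalIntegral.integral_const, sub_zero, one_smul]
  rw [latticeIntersection_integral hμc]
  congr 1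
  set F : ℝ → ℂ := fun s => ∫ u in (0 : ℝ)..s, μ.val γ u 1 with hF
  have hFd : ∀ s, HasFDerivAt F (μ.val γ s) s := fun s => by
    have h1 : HasDerivAt F (μ.val γ s 1) s :=
      intervalIntegral.integral_hasDerivAt_right (hμc.intervalIntegrable _ _)
        (hμc.stronglyMeasurableAtFilter _ _) hμc.continuousAt
    refine h1.hasFDerivAt.congr_fderiv (ContinuousLinearMap.ext fun v => ?_)
    rw [toSpanSingleton_apply, ← map_smul, smul_eq_mul, mul_one]
  obtain ⟨k, hk⟩ := hφ (H := γ) convex_univ isOpen_univ (fun s _ => hγs s) (F := F)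
    fun s _ => hFd s
  have h2 := sub_eq_of_lifts (Λ := Λ) (S := Set.univ) isPreconnected_univ hf.continuousOn
    (g := fun s => F s + k) ((continuous_iff_continuousAt.2 fun s =>
      (hFd s).continuousAt).add continuous_const).continuousOn
    (fun t _ => by rw [hfφ, hk t trivial]) (Set.mem_univ (0 : ℝ)) (Set.mem_univ 1)
  rw [h2]
  simp [hF]

end TorusIntegrals

section Uniqueness

variable {Λ : Submodule ℤ ℂ} {X B : Type*} [TopologicalSpace X] [ChartedSpace ℂ² X]
  [TopologicalSpace B] [ChartedSpace ℂ B] [AddAction (Torus Λ) X] {π : X → B}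

/-- There is a smooth path from `x` to `y`, constant near the ends, such that the difference of
the ends of a lift of the image of the path under `δ` is `w`. -/
def PathRel (δ : X → Torus Λ) (x y : X) (w : ℂ) : Prop :=
  ∃ (T : ℝ) (γ : ℝ → X) (g : ℝ → ℂ), 0 ≤ T ∧ ContMDiff 𝓘(ℝ, ℝ) 𝓘(ℝ, ℂ²) ∞ γ ∧ Continuous g ∧
    (∀ t, ⟪g t⟫[Λ] = δ (γ t)) ∧
    (∀ t ≤ 0, γ t = x ∧ g t = g 0) ∧ ∀ t, T ≤ t → γ t = y ∧ g t = g 0 + w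

theorem PathRel.symm {δ : X → Torus Λ} {x y : X} {w : ℂ} (h : PathRel δ x y w) :
    PathRel δ y x (-w) := by
  obtain ⟨T, γ, g, hT, hγ, hg, hl, h0, h1⟩ := h
  refine ⟨T, fun t => γ (T - t), fun t => g (T - t), hT, ?_, by fun_prop, fun t => hl _,
    fun t ht => ?_, fun t ht => ?_⟩
  · exact hγ.comp (contDiff_const.sub contDiff_id).contMDiff
  · have h2 := h1 (T - t) (by linarith)
    refine ⟨h2.1, ?_⟩
    beta_reduce
    rw [h2.2, sub_zero, (h1 T le_rfl).2]
  · have h2 := h0 (T - t) (by linarith)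
    refine ⟨h2.1, ?_⟩
    beta_reduce
    rw [h2.2, sub_zero, (h1 T le_rfl).2]
    ring

theorem PathRel.trans {δ : X → Torus Λ} {x y z : X} {w w' : ℂ} (h : PathRel δ x y w)
    (h' : PathRel δ y z w') : PathRel δ x z (w + w') := by
  classical
  obtain ⟨T, γ, g, hT, hγ, hg, hl, h0, h1⟩ := h
  obtain ⟨T', γ', g', hT', hγ', hg', hl', h0', h1'⟩ := h'
  set S : Set ℝ := Set.Iio (T + 1) with hS
  have hfr : frontier S = {T + 1} := frontier_Iio
  have near : ∀ᶠ t in 𝓝 (T + 1), T < t ∧ t < T + 2 :=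
    Ioo_mem_nhds (by linarith) (by linarith)
  have hk : ⟪g' 0⟫[Λ] = QuotientAddGroup.mk (g T) := by
    rw [hl', hl, (h0' 0 le_rfl).1, (h1 T le_rfl).1]
  refine ⟨T + T' + 2, S.piecewise γ fun t => γ' (t - (T + 2)),
    S.piecewise g fun t => g' (t - (T + 2)) + (g T - g' 0), by linarith, ?_, ?_, ?_, ?_, ?_⟩
  · refine hγ.piecewise (hγ'.comp (contDiff_id.sub contDiff_const).contMDiff) fun t ht => ?_
    rw [hfr] at ht
    rw [Set.mem_singleton_iff.1 ht]
    filter_upwards [near] with s hs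
    rw [(h1 s hs.1.le).1]
    exact ((h0' (s - (T + 2)) (by linarith [hs.2])).1).symm
  · refine hg.piecewise (fun t ht => ?_) (by fun_prop)
    rw [hfr] at ht
    rw [Set.mem_singleton_iff.1 ht, (h1 (T + 1) (by linarith)).2, (h1 T le_rfl).2,
      (h0' _ (by linarith)).2]
    ring
  · intro t
    by_cases ht : t ∈ S
    · rw [Set.piecewise_eq_of_mem _ _ _ ht, Set.piecewise_eq_of_mem _ _ _ ht, hl]
    · rw [Set.piecewise_eq_of_notMem _ _ _ ht, Set.piecewise_eq_of_notMem _ _ _ ht,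
        QuotientAddGroup.mk_add, QuotientAddGroup.mk_sub, hk, sub_self, add_zero, hl']
  · intro t ht
    have m1 : t ∈ S := by simp only [hS, Set.mem_Iio]; linarith
    have m2 : (0 : ℝ) ∈ S := by simp only [hS, Set.mem_Iio]; linarith
    rw [Set.piecewise_eq_of_mem _ _ _ m1, Set.piecewise_eq_of_mem _ _ _ m1,
      Set.piecewise_eq_of_mem _ _ _ m2]
    exact h0 t ht
  · intro t ht
    have m1 : t ∉ S := by simp only [hS, Set.mem_Iio]; linarith
    have m2 : (0 : ℝ) ∈ S := by simp only [hS, Set.mem_Iio]; linarith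
    rw [Set.piecewise_eq_of_notMem _ _ _ m1, Set.piecewise_eq_of_notMem _ _ _ m1,
      Set.piecewise_eq_of_mem _ _ _ m2]
    have h2 := h1' (t - (T + 2)) (by linarith)
    refine ⟨h2.1, ?_⟩
    rw [h2.2, (h1 T le_rfl).2]
    ring

theorem PathRel.mk_eq {δ : X → Torus Λ} {x y : X} {w : ℂ} (h : PathRel δ x y w) :
    δ y = δ x + QuotientAddGroup.mk w := by
  obtain ⟨T, γ, g, hT, hγ, hg, hl, h0, h1⟩ := h
  rw [← (h1 T le_rfl).1, ← (h0 0 le_rfl).1, ← hl, ← hl, (h1 T le_rfl).2, QuotientAddGroup.mk_add]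

/-- A closed path gives a smooth loop. -/
theorem PathRel.exists_loop [DiscreteTopology Λ] {δ : X → Torus Λ} (hδ : Continuous δ) {x : X}
    {w : ℂ} (h : PathRel δ x x w) : ∃ Γ : ℝ → X, ContMDiff 𝓘(ℝ, ℝ) 𝓘(ℝ, ℂ²) ∞ Γ ∧
      Function.Periodic Γ 1 ∧ ∀ f : ℝ → ℂ, Continuous f →
        (∀ t, ⟪f t⟫[Λ] = δ (Γ t)) → f 1 - f 0 = w := by
  obtain ⟨T, γ, g, hT, hγ, hg, hl, h0, h1⟩ := h
  have hP : 0 < T + 1 := by linarith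
  set P := T + 1 with hPd
  have key : ∀ (n : ℤ) (t : ℝ), (n : ℝ) - 1 / P < t → t < n + 1 →
      γ (P * Int.fract t) = γ (P * (t - n)) := by
    intro n t h2 h3
    rcases le_or_gt (n : ℝ) t with h4 | h4
    · have h5 : ⌊t⌋ = n := Int.floor_eq_iff.2 ⟨h4, h3⟩
      rw [Int.fract, h5]
    · have h7 : 1 / P ≤ 1 := by
        rw [div_le_one hP]; linarith
      have h5 : ⌊t⌋ = n - 1 := Int.floor_eq_iff.2 (by
        push_cast
        constructor <;> linarith)
      rw [Int.fract, h5, (h0 (P * (t - n)) (by nlinarith)).1]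
      refine (h1 _ ?_).1
      have h6 : 1 / P * P = 1 := by field_simp
      push_cast
      nlinarith
  refine ⟨fun t => γ (P * Int.fract t), fun t => ?_, fun t => by simp [Int.fract_add_one], ?_⟩
  · set n := ⌊t⌋ with hn
    have hsm : ContMDiffAt 𝓘(ℝ, ℝ) 𝓘(ℝ, ℂ²) ∞ (fun t => γ (P * (t - n))) t :=
      (hγ.comp (contDiff_const.mul (contDiff_id.sub contDiff_const)).contMDiff) t
    refine hsm.congr_of_eventuallyEq ?_
    have h2 : (n : ℝ) - 1 / P < t := by
      have := Int.floor_le t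
      have h3 : 0 < 1 / P := by positivity
      linarith
    filter_upwards [Ioo_mem_nhds h2 (Int.lt_floor_add_one t)] with s hs
    exact key n s hs.1 hs.2
  · intro f hf hfl
    have h2 : ∀ t ∈ Set.Icc (0 : ℝ) 1, γ (P * Int.fract t) = γ (P * t) := by
      intro t ht
      rcases ht.2.lt_or_eq with h3 | h3
      · have h4 := key 0 t (by
          have h3 : 0 < 1 / P := by positivity
          push_cast; linarith [ht.1]) (by push_cast; linarith)
        rw [h4]; simp
      · rw [h3]
        simp [(h0 0 le_rfl).1, (h1 P (by linarith)).1]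
    have h3 := sub_eq_of_lifts (Λ := Λ) (S := Set.Icc (0 : ℝ) 1) isPreconnected_Icc hf.continuousOn
      (g := fun t => g (P * t)) (by fun_prop) (fun t ht => by rw [hfl, hl, ← h2 t ht])
      (Set.left_mem_Icc.2 zero_le_one) (Set.right_mem_Icc.2 zero_le_one)
    rw [h3]
    simp only [mul_one, mul_zero]
    rw [(h1 P (by linarith)).2]
    ring

/-- Nearby points are joined by paths. -/
theorem eventually_pathRel [IsManifold 𝓘(ℝ, ℂ²) ∞ X] {δ : X → Torus Λ} {f : X → ℂ} {x : X}
    (hf : ∀ᶠ y in 𝓝 x, ContinuousAt f y ∧ ⟪f y⟫[Λ] = δ y) :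
    ∀ᶠ y in 𝓝 x, PathRel δ x y (f y - f x) := by
  set e := chartAt ℂ² x with he
  have hx : x ∈ e.source := mem_chart_source _ x
  have hea : e ∈ atlas ℂ² X := chart_mem_atlas _ _
  have h1 : ∀ᶠ u in 𝓝 (e x), u ∈ e.target ∧ ContinuousAt f (e.symm u) ∧
      ⟪f (e.symm u)⟫[Λ] = δ (e.symm u) := by
    have hc : ContinuousAt e.symm (e x) := e.continuousAt_symm (e.map_source hx)
    have hf' : ∀ᶠ y in 𝓝 (e.symm (e x)), ContinuousAt f y ∧
        ⟪f y⟫[Λ] = δ y := by rwa [e.left_inv hx]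
    exact Filter.Eventually.and (e.open_target.mem_nhds (e.map_source hx)) (hc.eventually hf')
  obtain ⟨r, hr, hrs⟩ := Metric.eventually_nhds_iff_ball.1 h1
  have h2 : ∀ᶠ y in 𝓝 x, y ∈ e.source ∧ e y ∈ Metric.ball (e x) r :=
    Filter.Eventually.and (e.open_source.mem_nhds hx)
      ((e.continuousAt hx).eventually_mem (Metric.ball_mem_nhds _ hr))
  filter_upwards [h2] with y hy
  set c : ℝ → ℂ² := fun t => e x + Real.smoothTransition t • (e y - e x) with hc
  have hcs : ContDiff ℝ ∞ c :=
    contDiff_const.add (Real.smoothTransition.contDiff.smul contDiff_const)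
  have hcm : ∀ t, c t ∈ Metric.ball (e x) r := fun t => by
    refine (convex_ball (e x) r).add_smul_sub_mem (Metric.mem_ball_self hr) hy.2
      ⟨Real.smoothTransition.nonneg t, Real.smoothTransition.le_one t⟩
  refine ⟨1, fun t => e.symm (c t), fun t => f (e.symm (c t)), zero_le_one, fun t => ?_,
    continuous_iff_continuousAt.2 fun t => ?_, fun t => (hrs _ (hcm t)).2.2, fun t ht => ?_,
    fun t ht => ?_⟩
  · exact (contMDiffAt_symm_of_mem_maximalAtlas (IsManifold.subset_maximalAtlas hea)
      (hrs _ (hcm t)).1).comp t hcs.contMDiff.contMDiffAt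
  · exact ContinuousAt.comp (g := f) (f := fun t => e.symm (c t)) (hrs _ (hcm t)).2.1
      (ContinuousAt.comp (g := e.symm) (e.continuousAt_symm (hrs _ (hcm t)).1)
        hcs.continuous.continuousAt)
  · have h3 : c t = e x := by simp [hc, Real.smoothTransition.zero_of_nonpos ht]
    have h4 : c 0 = e x := by simp [hc, Real.smoothTransition.zero_of_nonpos le_rfl]
    simp only [h3, h4, e.left_inv hx, and_self]
  · have h3 : c t = e y := by simp [hc, Real.smoothTransition.one_of_one_le ht]
    have h4 : c 0 = e x := by simp [hc, Real.smoothTransition.zero_of_nonpos le_rfl]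
    simp only [h3, h4, e.left_inv hx, e.left_inv hy.1, true_and]
    ring

variable [DiscreteTopology Λ] [IsZLattice ℝ Λ] [IsManifold 𝓘(ℂ, ℂ²) ω X]
  [IsManifold 𝓘(ℝ, ℂ²) ∞ X] [CompactSpace X] [PreconnectedSpace X]

/-- Two maps corresponding to the same class differ by a translation. -/
theorem Corresponds.exists_eq_add (hπ : IsPrincipalBundle Λ π) {c : Form X 2} {φ ψ : B → Torus Λ}
    (hφ : Corresponds Λ π c φ) (hψ : Corresponds Λ π c ψ) :
    ∃ a : Torus Λ, ∀ b, ψ b = φ b + a := by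
  rcases isEmpty_or_nonempty B with hB | ⟨⟨b₀⟩⟩
  · exact ⟨0, fun b => hB.elim b⟩
  have hsec : ∀ b : B, ∃ x : X, π x = b := fun b => by
    obtain ⟨s, hs⟩ := hπ.exists_locSec b
    exact ⟨s b, hs.proj⟩
  obtain ⟨x₀, hx₀⟩ := hsec b₀
  have hφc := hφ.1.continuous
  have hψc := hψ.1.continuous
  have hπc := hπ.continuous_proj
  set δ : X → Torus Λ := fun x => ψ (π x) - φ (π x) with hδ
  have hδc : Continuous δ := (hψc.comp hπc).sub (hφc.comp hπc)
  have hloop : ∀ {x : X} {w : ℂ}, PathRel δ x x w → w = 0 := by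
    intro x w hw
    obtain ⟨Γ, hΓ, hΓp, hΓf⟩ := hw.exists_loop hδc
    obtain ⟨f, hf, hfl⟩ := exists_lift Λ (p := fun t => φ (π (Γ t)))
      (hφc.comp (hπc.comp hΓ.continuous))
    obtain ⟨f', hf', hfl'⟩ := exists_lift Λ (p := fun t => ψ (π (Γ t)))
      (hψc.comp (hπc.comp hΓ.continuous))
    rw [← hΓf (fun t => f' t - f t) (hf'.sub hf)
      (fun t => by rw [QuotientAddGroup.mk_sub, hfl, hfl'])]
    refine eq_zero_of_latticeIntersection Λ fun l hl => ?_
    have e1 := hφ.2 Γ hΓ hΓp f hf hfl l hl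
    have e2 := hψ.2 Γ hΓ hΓp f' hf' hfl' l hl
    rw [e1, latticeIntersection, latticeIntersection] at e2
    rw [latticeIntersection, show f' 1 - f 1 - (f' 0 - f 0) = (f' 1 - f' 0) - (f 1 - f 0) by ring,
      map_sub, sub_mul, Complex.sub_im, sub_div, e2, sub_self]
  have hloc : ∀ x : X, ∃ f : X → ℂ, (∀ᶠ y in 𝓝 x, ContMDiffAt 𝓘(ℂ, ℂ²) 𝓘(ℂ, ℂ) ω f y ∧
      ⟪f y⟫[Λ] = δ y) := by
    intro x
    obtain ⟨U, hU, hxU, f, hf, hfl⟩ := hφ.1 (π x)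
    obtain ⟨U', hU', hxU', f', hf', hfl'⟩ := hψ.1 (π x)
    refine ⟨fun y => f' (π y) - f (π y), ?_⟩
    filter_upwards [hπc.continuousAt.eventually_mem (hU.mem_nhds hxU),
      hπc.continuousAt.eventually_mem (hU'.mem_nhds hxU')] with y hy hy'
    refine ⟨?_, by rw [QuotientAddGroup.mk_sub, hfl _ hy, hfl' _ hy']⟩
    have m1 := ((hf.contMDiffAt (hU.mem_nhds hy)).comp y (hπ.holomorphic_proj y))
    have m2 := ((hf'.contMDiffAt (hU'.mem_nhds hy')).comp y (hπ.holomorphic_proj y))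
    exact m2.sub m1
  choose f hf using hloc
  have hrel : ∀ x, ∀ᶠ y in 𝓝 x, PathRel δ x y (f x y - f x x) := fun x =>
    eventually_pathRel ((hf x).mono fun y hy => ⟨hy.1.continuousAt, hy.2⟩)
  have hall : ∀ x, ∃ w, PathRel δ x₀ x w := by
    have hcl : IsClopen {x | ∃ w, PathRel δ x₀ x w} := by
      constructor
      · refine isClosed_of_closure_subset fun x hx => ?_
        obtain ⟨y, hy, w, hw⟩ := mem_closure_iff_nhds.1 hx _ (hrel x)
        exact ⟨_, hw.trans hy.symm⟩
      · refine isOpen_iff_mem_nhds.2 fun x ⟨w, hw⟩ => ?_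
        filter_upwards [hrel x] with y hy
        exact ⟨_, hw.trans hy⟩
    have hne : ({x | ∃ w, PathRel δ x₀ x w}).Nonempty := by
      obtain h := (hrel x₀).self_of_nhds
      exact ⟨x₀, _, h⟩
    have := hcl.eq_univ hne
    exact fun x => by
      have hx : x ∈ (Set.univ : Set X) := trivial
      rw [← this] at hx
      exact hx
  choose F hF using hall
  have hFloc : ∀ x, F =ᶠ[𝓝 x] fun y => F x + (f x y - f x x) := fun x => by
    filter_upwards [hrel x] with y hy
    have := hloop (((hF x).trans hy).trans (hF y).symm)
    linear_combination -this
  have hFd : MDifferentiable 𝓘(ℂ, ℂ²) 𝓘(ℂ, ℂ) F := fun x => by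
    have h1 : ContMDiffAt 𝓘(ℂ, ℂ²) 𝓘(ℂ, ℂ) ω (fun y => F x + (f x y - f x x)) x :=
      contMDiffAt_const.add ((hf x).self_of_nhds.1.sub contMDiffAt_const)
    exact (h1.congr_of_eventuallyEq (hFloc x)).mdifferentiableAt (by simp)
  have : IsManifold 𝓘(ℂ, ℂ²) 1 X := IsManifold.of_le (n := ω) le_top
  obtain ⟨v, hv⟩ := hFd.exists_eq_const_of_compactSpace
  refine ⟨ψ b₀ - φ b₀, fun b => ?_⟩
  obtain ⟨x, rfl⟩ := hsec b
  have h1 : F x₀ = 0 := hloop (hF x₀)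
  have h2 : F x = 0 := by rw [← h1, hv]; rfl
  have h3 := (hF x).mk_eq
  rw [h2, QuotientAddGroup.mk_zero, add_zero] at h3
  simp only [hδ, hx₀] at h3
  rw [← h3]
  abel

end Uniqueness

section Degree

open Filter Set

variable {Λ : Submodule ℤ ℂ} [DiscreteTopology Λ] {B : Type*} [TopologicalSpace B]
  [ChartedSpace ℂ B]

def LocallyInjectiveAt {A A' : Type*} [TopologicalSpace A] (f : A → A') (a : A) : Prop :=
  ∃ N ∈ 𝓝 a, InjOn f N

theorem LocallyInjectiveAt.eventually_ne {A A' : Type*} [TopologicalSpace A] {f : A → A'} {a : A}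
    (h : LocallyInjectiveAt f a) : ∀ᶠ b in 𝓝[≠] a, f b ≠ f a := by
  obtain ⟨N, hN, hi⟩ := h
  filter_upwards [mem_nhdsWithin_of_mem_nhds hN, self_mem_nhdsWithin] with b hb hba he
  exact hba (hi hb (mem_of_mem_nhds hN) he)

theorem LocallyInjectiveAt.comp {A A' A'' : Type*} [TopologicalSpace A] [TopologicalSpace A']
    {f : A → A'} {g : A' → A''} {a : A} (hg : LocallyInjectiveAt g (f a))
    (hf : LocallyInjectiveAt f a) (hc : ContinuousAt f a) :
    LocallyInjectiveAt (fun x => g (f x)) a := by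
  obtain ⟨N, hN, hi⟩ := hf
  obtain ⟨M, hM, hj⟩ := hg
  exact ⟨N ∩ f ⁻¹' M, inter_mem hN (hc hM), fun x hx y hy h => hi hx.1 hy.1 (hj hx.2 hy.2 h)⟩

theorem LocallyInjectiveAt.congr {A A' : Type*} [TopologicalSpace A] {f g : A → A'} {a : A}
    (hf : LocallyInjectiveAt f a) (h : f =ᶠ[𝓝 a] g) : LocallyInjectiveAt g a := by
  obtain ⟨N, hN, hi⟩ := hf
  refine ⟨_, inter_mem hN h, fun x hx y hy hxy => hi hx.1 hy.1 ?_⟩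
  rw [hx.2, hy.2, hxy]

theorem locallyInjectiveAt_of_openPartialHomeomorph {A A' : Type*} [TopologicalSpace A]
    [TopologicalSpace A'] (e : OpenPartialHomeomorph A A') {a : A} (ha : a ∈ e.source) :
    LocallyInjectiveAt e a :=
  ⟨_, e.open_source.mem_nhds ha, e.injOn⟩

theorem locallyInjectiveAt_mk (z : ℂ) :
    LocallyInjectiveAt (QuotientAddGroup.mk : ℂ → Torus Λ) z := by
  obtain ⟨e, he, h⟩ := (isCoveringMap_mk Λ).isLocalHomeomorph z
  rw [h]
  exact locallyInjectiveAt_of_openPartialHomeomorph e he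

theorem locallyInjectiveAt_of_deriv_ne_zero {F : ℂ → ℂ} {z : ℂ} (hF : AnalyticAt ℂ F z)
    (h : deriv F z ≠ 0) : LocallyInjectiveAt F z := by
  have h1 := hF.hasStrictDerivAt.hasStrictFDerivAt_equiv h
  have h2 := locallyInjectiveAt_of_openPartialHomeomorph (h1.toOpenPartialHomeomorph F)
    h1.mem_toOpenPartialHomeomorph_source
  exact h2

theorem eventually_sub_eq_of_lifts {A : Type*} [TopologicalSpace A] {f g : A → ℂ} {a : A}
    (hf : ContinuousAt f a) (hg : ContinuousAt g a)
    (h : ∀ᶠ t in 𝓝 a, ⟪f t⟫[Λ] = QuotientAddGroup.mk (g t)) :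
    ∀ᶠ t in 𝓝 a, f t = g t + (f a - g a) := by
  obtain ⟨N, hN, hi⟩ := locallyInjectiveAt_mk (Λ := Λ) (f a)
  have h1 : ContinuousAt (fun t => g t + (f a - g a)) a := hg.add continuousAt_const
  have h2 : g a + (f a - g a) = f a := by ring
  have h3 := h1.eventually (p := (· ∈ N)) (by beta_reduce; rw [h2]; exact hN)
  have hm : ⟪f a - g a⟫[Λ] = 0 := by
    rw [QuotientAddGroup.mk_sub, h.self_of_nhds, sub_self]
  filter_upwards [h, hf hN, h3] with t ht h4 h5
  refine hi h4 h5 ?_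
  rw [QuotientAddGroup.mk_add, hm, add_zero, ht]

theorem IsHolomorphicToTorus.exists_analyticAt [IsManifold 𝓘(ℂ, ℂ) ω B] {φ : B → Torus Λ}
    (hφ : IsHolomorphicToTorus Λ φ) {e : OpenPartialHomeomorph B ℂ} (he : e ∈ atlas ℂ B) {u : ℂ}
    (hu : u ∈ e.target) : ∃ F : ℂ → ℂ, AnalyticAt ℂ F u ∧
      ∀ᶠ z in 𝓝 u, ⟪F z⟫[Λ] = φ (e.symm z) := by
  obtain ⟨U, hU, hb, f, hf, hfφ⟩ := hφ (e.symm u)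
  refine ⟨fun z => f (e.symm z), ?_, ?_⟩
  · exact ((hf.contMDiffAt (hU.mem_nhds hb)).comp u (contMDiffAt_symm_of_mem_maximalAtlas
      (IsManifold.subset_maximalAtlas he) hu)).contDiffAt.analyticAt
  · filter_upwards [(e.symm.continuousAt hu).preimage_mem_nhds (hU.mem_nhds hb)] with z hz
    exact hfφ _ hz

/-- The local behaviour of a holomorphic map. -/
theorem IsHolomorphicToTorus.eventually_eq_or [IsManifold 𝓘(ℂ, ℂ) ω B] {φ : B → Torus Λ}
    (hφ : IsHolomorphicToTorus Λ φ) (b : B) : (∀ᶠ x in 𝓝 b, φ x = φ b) ∨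
      𝓝 (φ b) ≤ map φ (𝓝 b) ∧ ∀ᶠ x in 𝓝[≠] b, LocallyInjectiveAt φ x := by
  set e := chartAt ℂ b with he
  have hbs : b ∈ e.source := mem_chart_source ℂ b
  have hbe := e.left_inv hbs
  obtain ⟨F, hF, hFφ⟩ := hφ.exists_analyticAt (chart_mem_atlas ℂ b) (e.map_source hbs)
  rw [← he] at hFφ
  have hec : ContinuousAt e b := e.continuousAt hbs
  have hsrc : ∀ᶠ x in 𝓝 b, x ∈ e.source := e.open_source.mem_nhds hbs
  have hFb : ⟪F (e b)⟫[Λ] = φ b := by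
    rw [hFφ.self_of_nhds, hbe]
  have hconst : (∀ᶠ z in 𝓝 (e b), F z = F (e b)) → ∀ᶠ x in 𝓝 b, φ x = φ b := by
    intro h
    filter_upwards [hsrc, hec.eventually h, hec.eventually hFφ] with x hx h1 h2
    rw [e.left_inv hx] at h2
    rw [← h2, h1, hFb]
  rcases hF.deriv.eventually_eq_zero_or_eventually_ne_zero with h0 | h0
  · left
    refine hconst ?_
    obtain ⟨r, hr, hball⟩ := Metric.eventually_nhds_iff_ball.1 (h0.and hF.eventually_analyticAt)
    filter_upwards [Metric.ball_mem_nhds _ hr] with z hz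
    exact Metric.isOpen_ball.is_const_of_deriv_eq_zero (convex_ball _ _).isPreconnected
      (fun y hy => (hball y hy).2.differentiableAt.differentiableWithinAt)
      (fun y hy => (hball y hy).1) hz (Metric.mem_ball_self hr)
  rcases hF.eventually_constant_or_nhds_le_map_nhds with h1 | h1
  · exact Or.inl (hconst h1)
  right
  constructor
  · rw [← hFb, ← (isCoveringMap_mk Λ).isLocalHomeomorph.map_nhds_eq]
    refine (map_mono h1).trans ?_
    rw [map_map, map_congr (m₁ := QuotientAddGroup.mk ∘ F) (m₂ := fun z => φ (e.symm z)) hFφ,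
      ← e.symm_map_nhds_eq hbs, map_map]
    exact le_rfl
  · have hloc : ∀ᶠ z in 𝓝[≠] (e b), LocallyInjectiveAt (fun z => φ (e.symm z)) z := by
      filter_upwards [h0, mem_nhdsWithin_of_mem_nhds hF.eventually_analyticAt,
        mem_nhdsWithin_of_mem_nhds hFφ.eventually_nhds] with z h2 h3 h4
      exact ((locallyInjectiveAt_mk (F z)).comp (locallyInjectiveAt_of_deriv_ne_zero h3 h2)
        h3.continuousAt).congr h4
    have ht : Tendsto e (𝓝[≠] b) (𝓝[≠] (e b)) := by
      refine tendsto_nhdsWithin_iff.2 ⟨hec.tendsto.mono_left nhdsWithin_le_nhds, ?_⟩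
      filter_upwards [mem_nhdsWithin_of_mem_nhds hsrc, self_mem_nhdsWithin] with x hx hxb h
      exact hxb (e.injOn hx hbs h)
    filter_upwards [ht.eventually hloc, mem_nhdsWithin_of_mem_nhds hsrc] with x h2 hx
    refine (LocallyInjectiveAt.comp (f := e) h2 (locallyInjectiveAt_of_openPartialHomeomorph e hx)
      (e.continuousAt hx)).congr ?_
    filter_upwards [e.open_source.mem_nhds hx] with y hy
    rw [e.left_inv hy]

theorem finite_of_eventually_notMem {A : Type*} [TopologicalSpace A] [CompactSpace A] {S : Set A}
    (h : ∀ a, ∀ᶠ x in 𝓝[≠] a, x ∉ S) : S.Finite := by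
  have h1 : ∀ a, {x | x ≠ a → x ∉ S} ∈ 𝓝 a := fun a => eventually_nhdsWithin_iff.1 (h a)
  obtain ⟨t, ht⟩ := CompactSpace.elim_nhds_subcover _ h1
  refine t.finite_toSet.subset fun x hx => ?_
  have hx' : x ∈ ⋃ a ∈ t, {x | x ≠ a → x ∉ S} := by rw [ht]; trivial
  obtain ⟨a, hat, hxa⟩ := mem_iUnion₂.1 hx'
  by_contra h2
  exact hxa (fun h3 => h2 (by rw [h3]; exact hat)) hx

theorem not_locallyInjectiveAt {A : Type*} {φ : B → A} {b : B} (h : ∀ᶠ x in 𝓝 b, φ x = φ b) :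
    ¬ LocallyInjectiveAt φ b := by
  intro hi
  have h1 : ∀ᶠ x in 𝓝 b, x = b := by
    filter_upwards [h, eventually_nhdsWithin_iff.1 hi.eventually_ne] with x h2 h3
    by_contra h4
    exact h3 h4 h2
  set e := chartAt ℂ b
  have hb : b ∈ e.source := mem_chart_source ℂ b
  have h2 : ∀ᶠ z in 𝓝 (e b), z = e b := by
    rw [← e.map_nhds_eq hb, eventually_map]
    exact h1.mono fun x hx => by rw [hx]
  have h3 : (∅ : Set ℂ) ∈ 𝓝[≠] (e b) := by
    filter_upwards [mem_nhdsWithin_of_mem_nhds h2, self_mem_nhdsWithin] with z h4 h5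
    exact h5 h4
  exact empty_notMem _ h3

/-- A holomorphic map on a connected Riemann surface is constant or open and locally injective
off a discrete set. -/
theorem IsHolomorphicToTorus.eq_const_or [IsManifold 𝓘(ℂ, ℂ) ω B] [PreconnectedSpace B]
    {φ : B → Torus Λ} (hφ : IsHolomorphicToTorus Λ φ) : (∀ a b, φ a = φ b) ∨
      IsOpenMap φ ∧ ∀ b, ∀ᶠ x in 𝓝[≠] b, LocallyInjectiveAt φ x := by
  have hclopen : IsClopen {b | ∀ᶠ x in 𝓝 b, φ x = φ b} := by
    constructor
    · refine isOpen_compl_iff.1 (isOpen_iff_mem_nhds.2 fun b hb => ?_)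
      have h1 := ((hφ.eventually_eq_or b).resolve_left hb).2
      filter_upwards [eventually_nhdsWithin_iff.1 h1] with x hx
      by_cases hxb : x = b
      · rw [hxb]; exact hb
      · exact fun h => not_locallyInjectiveAt h (hx hxb)
    · refine isOpen_iff_mem_nhds.2 fun b hb => ?_
      filter_upwards [hb.eventually_nhds, hb] with x hx hxb
      change ∀ᶠ y in 𝓝 x, φ y = φ x
      rw [hxb]
      exact hx
  rcases isClopen_iff.1 hclopen with h | h
  · right
    have h1 := fun b => (hφ.eventually_eq_or b).resolve_left fun hb =>
      notMem_empty b (h ▸ hb)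
    exact ⟨IsOpenMap.of_nhds_le fun b => (h1 b).1, fun b => (h1 b).2⟩
  · left
    have h1 : IsLocallyConstant φ := (IsLocallyConstant.iff_eventually_eq φ).2 fun b =>
      (h ▸ mem_univ b : b ∈ {b | ∀ᶠ x in 𝓝 b, φ x = φ b})
    exact fun a b => h1.apply_eq_of_preconnectedSpace a b

theorem countable_preimage_mk [IsZLattice ℝ Λ] {S : Set (Torus Λ)} (hS : S.Countable) :
    ((QuotientAddGroup.mk : ℂ → Torus Λ) ⁻¹' S).Countable := by
  rw [← biUnion_preimage_singleton]
  refine hS.biUnion fun q _ => ?_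
  obtain ⟨z, rfl⟩ := QuotientAddGroup.mk_surjective q
  refine (countable_range fun l : Λ => z + (l : ℂ)).mono fun w hw => ?_
  exact ⟨⟨-z + w, QuotientAddGroup.eq.1 (Eq.symm hw)⟩, by simp⟩

/-- The degree of an open map with discrete branching: generic fibres have the same number of
points. -/
theorem exists_card_fibre [T2Space B] [CompactSpace B]
    [IsZLattice ℝ Λ] {φ : B → Torus Λ} (hφ : Continuous φ) (ho : IsOpenMap φ)
    (hi : ∀ b, ∀ᶠ x in 𝓝[≠] b, LocallyInjectiveAt φ x) :
    {b | ¬ LocallyInjectiveAt φ b}.Finite ∧ ∃ n : ℕ, ∀ q ∉ φ '' {b | ¬ LocallyInjectiveAt φ b},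
      (φ ⁻¹' {q}).Finite ∧ (φ ⁻¹' {q}).ncard = n := by
  set C := {b | ¬ LocallyInjectiveAt φ b}
  have hC : C.Finite := finite_of_eventually_notMem fun b => by
    filter_upwards [hi b] with x hx h using h hx
  refine ⟨hC, ?_⟩
  have hinj : ∀ q ∉ φ '' C, ∀ b ∈ φ ⁻¹' {q}, LocallyInjectiveAt φ b := fun q hq b hb => by
    by_contra h
    exact hq ⟨b, h, hb⟩
  have hfin : ∀ q ∉ φ '' C, (φ ⁻¹' {q}).Finite := fun q hq => finite_of_eventually_notMem fun b => by
    by_cases hb : φ b = q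
    · filter_upwards [(hinj q hq b hb).eventually_ne] with x hx h
      exact hx (h.trans hb.symm)
    · exact mem_nhdsWithin_of_mem_nhds (hφ.continuousAt.eventually_ne hb)
  have hlh : IsLocalHomeomorphOn φ (φ ⁻¹' (φ '' C)ᶜ) := by
    refine .mk _ _ fun b hb => ?_
    obtain ⟨N, hN, hNi⟩ := hinj (φ b) hb b rfl
    have : Nonempty B := ⟨b⟩
    refine ⟨OpenPartialHomeomorph.ofContinuousOpen
      ((hNi.mono interior_subset).bijOn_image.toPartialEquiv φ (interior N) _)
      hφ.continuousOn ho isOpen_interior, mem_interior_iff_mem_nhds.2 hN, fun x _ => rfl⟩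
  have hcov := IsCoveringMapOn.of_isLocalHomeomorphOn hφ hlh
  have hloc : ContinuousOn (fun q => (φ ⁻¹' {q}).ncard) (φ '' C)ᶜ := by
    intro p hp
    obtain ⟨hI, U, hpU, hU, -, H, hH⟩ := hcov p hp
    have hcard : ∀ q ∈ U, (φ ⁻¹' {q}).ncard = Nat.card (φ ⁻¹' {p}) := by
      intro q hq
      refine Nat.card_congr ⟨fun x => (H ⟨x.1, by
        have h : φ x.1 = q := x.2
        rw [mem_preimage, h]; exact hq⟩).2, fun i => ⟨(H.symm (⟨q, hq⟩, i)).1, ?_⟩, ?_, ?_⟩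
      · have h := hH (H.symm (⟨q, hq⟩, i))
        rw [H.apply_symm_apply] at h
        exact h.symm
      · rintro ⟨x, hx⟩
        have hx' : φ x = q := hx
        subst hx'
        have h := hH ⟨x, hq⟩
        apply Subtype.ext
        change (H.symm (⟨φ x, hq⟩, (H ⟨x, hq⟩).2)).1 = x
        have h' : ((⟨φ x, hq⟩ : U), (H ⟨x, hq⟩).2) = H ⟨x, hq⟩ :=
          Prod.ext (Subtype.ext h.symm) rfl
        rw [h', H.symm_apply_apply]
      · intro i
        change (H (H.symm (⟨q, hq⟩, i))).2 = i
        rw [H.apply_symm_apply]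
    refine (continuousAt_const (y := Nat.card (φ ⁻¹' {p}))).congr ?_ |>.continuousWithinAt
    filter_upwards [hU.mem_nhds hpU] with q hq
    exact (hcard q hq).symm
  have hcount := countable_preimage_mk (hC.image φ).countable
  have hconn : IsPreconnected (φ '' C)ᶜ := by
    have h1 := (hcount.isPathConnected_compl_of_one_lt_rank
      (by rw [Complex.rank_real_complex]; norm_num)).isConnected.isPreconnected
    have h2 := h1.image (QuotientAddGroup.mk : ℂ → Torus Λ)
      QuotientAddGroup.continuous_mk.continuousOn
    rwa [← preimage_compl, image_preimage_eq _ QuotientAddGroup.mk_surjective] at h2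
  by_cases hne : ∃ q, q ∉ φ '' C
  · obtain ⟨q₀, hq₀⟩ := hne
    exact ⟨_, fun q hq => ⟨hfin q hq, hconn.constant hloc hq hq₀⟩⟩
  · exact ⟨0, fun q hq => (hne ⟨q, hq⟩).elim⟩

end Degree

section Area

open Filter Set
open scoped Pointwise

variable {Λ : Submodule ℤ ℂ} [DiscreteTopology Λ] [IsZLattice ℝ Λ] {B : Type*}
  [TopologicalSpace B] [ChartedSpace ℂ B]

/-- The area formula for an injective holomorphic map to a torus. -/
theorem lintegral_deriv_sq {W : Set ℂ} (hW : MeasurableSet W) {F g : ℂ → ℂ}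
    (hd : ∀ u ∈ W, HasDerivAt F (g u) u)
    (hi : InjOn (fun u => ⟪F u⟫[Λ]) W) :
    MeasurableSet (fd Λ ∩ QuotientAddGroup.mk ⁻¹'
      ((fun u => ⟪F u⟫[Λ]) '' W)) ∧
    ∫⁻ u in W, ‖g u‖ₑ ^ 2 = volume (fd Λ ∩ QuotientAddGroup.mk ⁻¹'
      ((fun u => ⟪F u⟫[Λ]) '' W)) := by
  have hF' : ∀ u ∈ W, HasFDerivWithinAt F
      ((toSpanSingleton ℂ (g u)).restrictScalars ℝ) W u := fun u hu =>
    ((hd u hu).hasFDerivAt.restrictScalars ℝ).hasFDerivWithinAt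
  have hFi : InjOn F W := fun u hu v hv h => hi hu hv (by simp only [h])
  have hdet : ∀ u, ENNReal.ofReal
      |((toSpanSingleton ℂ (g u)).restrictScalars ℝ).det| = ‖g u‖ₑ ^ 2 := by
    intro u
    have h1 : ((toSpanSingleton ℂ (g u)).restrictScalars ℝ).det =
        Complex.normSq (LinearMap.det
          ((toSpanSingleton ℂ (g u) : ℂ →L[ℂ] ℂ) : ℂ →ₗ[ℂ] ℂ)) := by
      rw [← Algebra.norm_complex_apply, ← LinearMap.det_restrictScalars]
      rfl
    have h2 : LinearMap.det
        ((toSpanSingleton ℂ (g u) : ℂ →L[ℂ] ℂ) : ℂ →ₗ[ℂ] ℂ) = g u := by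
      rw [LinearMap.det_ring]
      simp
    rw [h1, h2, Complex.normSq_eq_norm_sq, abs_of_nonneg (sq_nonneg _),
      ENNReal.ofReal_pow (norm_nonneg _), ofReal_norm]
  have hm : MeasurableSet (F '' W) := measurable_image_of_fderivWithin hW hF' hFi
  have hT : fd Λ ∩ QuotientAddGroup.mk ⁻¹'
      ((fun u => ⟪F u⟫[Λ]) '' W) =
      ⋃ l : Λ, (l +ᵥ F '' W) ∩ fd Λ := by
    ext z
    simp only [mem_inter_iff, mem_preimage, mem_iUnion]
    constructor
    · rintro ⟨hz, u, hu, huz⟩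
      refine ⟨⟨-F u + z, QuotientAddGroup.eq.1 huz⟩, ⟨F u, ⟨u, hu, rfl⟩, ?_⟩, hz⟩
      change -F u + z + F u = z
      ring
    · rintro ⟨l, ⟨_, ⟨u, hu, rfl⟩, rfl⟩, hz⟩
      refine ⟨hz, u, hu, QuotientAddGroup.eq.2 ?_⟩
      change -F u + ((l : ℂ) + F u) ∈ Λ
      rw [neg_add_eq_sub, add_sub_cancel_right]
      exact l.2
  have hml : ∀ l : Λ, MeasurableSet ((l +ᵥ F '' W) ∩ fd Λ) := fun l =>
    (hm.const_vadd l).inter (measurableSet_fd Λ)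
  have : VAddInvariantMeasure Λ ℂ volume :=
    inferInstanceAs (VAddInvariantMeasure Λ.toAddSubgroup ℂ volume)
  rw [hT]
  refine ⟨MeasurableSet.iUnion hml, ?_⟩
  rw [measure_iUnion _ hml, ← (isAddFundamentalDomain_fd Λ).measure_eq_tsum,
    ← lintegral_abs_det_fderiv_eq_addHaar_image volume hW hF' hFi]
  · exact lintegral_congr fun u => (hdet u).symm
  · intro l l' hll
    refine Set.disjoint_left.2 ?_
    rintro _ ⟨⟨_, ⟨u, hu, rfl⟩, rfl⟩, -⟩ ⟨⟨_, ⟨v, hv, rfl⟩, h⟩, -⟩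
    have h' : (l' : ℂ) + F v = (l : ℂ) + F u := h
    have huv : u = v := hi hu hv (QuotientAddGroup.eq.2 (by
      have h3 : -F u + F v = ((l - l' : Λ) : ℂ) := by push_cast; linear_combination h'
      rw [h3]
      exact (l - l').2))
    subst huv
    exact hll (Subtype.ext (add_right_cancel h').symm)

/-- A measurable set of points at which `φ` is locally injective is a countable union of pieces on
which `φ` is injective and lifts to `ℂ`. -/
theorem IsHolomorphicToTorus.exists_pieces [IsManifold 𝓘(ℂ, ℂ) ω B] {φ : B → Torus Λ}
    (hφ : IsHolomorphicToTorus Λ φ) {e : OpenPartialHomeomorph B ℂ} (he : e ∈ atlas ℂ B)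
    {V : Set ℂ} (hV : MeasurableSet V) (hVe : V ⊆ e.target)
    (hinj : ∀ u ∈ V, LocallyInjectiveAt φ (e.symm u)) {g : ℂ → ℂ}
    (hg : ∀ u ∈ V, ∃ F, HasDerivAt F (g u) u ∧
      ∀ᶠ z in 𝓝 u, ⟪F z⟫[Λ] = φ (e.symm z)) :
    ∃ W : ℕ → Set ℂ, (∀ n, MeasurableSet (W n)) ∧ Pairwise (Function.onFun Disjoint W) ∧
      ⋃ n, W n = V ∧ ∀ n, InjOn (fun u => φ (e.symm u)) (W n) ∧ ∃ F : ℂ → ℂ, ∀ u ∈ W n,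
        HasDerivAt F (g u) u ∧ ⟪F u⟫[Λ] = φ (e.symm u) := by
  have h1 : ∀ u : ℂ, ∃ O : Set ℂ, IsOpen O ∧ (u ∈ V → u ∈ O ∧
      InjOn (fun u => φ (e.symm u)) O ∧ ∃ F : ℂ → ℂ, ∀ v ∈ V ∩ O,
        HasDerivAt F (g v) v ∧ ⟪F v⟫[Λ] = φ (e.symm v)) := by
    intro u
    by_cases hu : u ∈ V
    swap
    · exact ⟨∅, isOpen_empty, fun h => (hu h).elim⟩
    obtain ⟨N, hN, hNi⟩ := LocallyInjectiveAt.comp (f := e.symm) (hinj u hu)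
      (locallyInjectiveAt_of_openPartialHomeomorph e.symm (hVe hu)) (e.symm.continuousAt (hVe hu))
    obtain ⟨F, hF, hFφ⟩ := hφ.exists_analyticAt he (hVe hu)
    obtain ⟨O, hO, hOo, huO⟩ := mem_nhds_iff.1
      (inter_mem hN (hF.eventually_analyticAt.and hFφ.eventually_nhds))
    refine ⟨O, hOo, fun _ => ⟨huO, hNi.mono fun v hv => (hO hv).1, F, fun v hv => ?_⟩⟩
    obtain ⟨hFa, hFe⟩ : AnalyticAt ℂ F v ∧ ∀ᶠ z in 𝓝 v, _ := (hO hv.2).2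
    obtain ⟨G, hG, hGφ⟩ := hg v hv.1
    refine ⟨?_, hFe.self_of_nhds⟩
    have h2 := eventually_sub_eq_of_lifts (Λ := Λ) hFa.continuousAt hG.continuousAt
      (hFe.mp (hGφ.mono fun z h3 h4 => h4.trans h3.symm))
    exact (hG.add_const _).congr_of_eventuallyEq h2
  choose O hO hOV using h1
  rcases V.eq_empty_or_nonempty with rfl | hne
  · exact ⟨fun _ => ∅, fun _ => .empty, fun _ _ _ => disjoint_empty _, iUnion_empty,
      fun _ => ⟨injOn_empty _, fun _ => 0, fun _ h => h.elim⟩⟩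
  obtain ⟨t, htV, htc, hcov⟩ := TopologicalSpace.countable_cover_nhdsWithin (f := O) (s := V)
    fun u hu => mem_nhdsWithin_of_mem_nhds ((hO u).mem_nhds (hOV u hu).1)
  have htne : t.Nonempty := by
    obtain ⟨u, hu⟩ := hne
    obtain ⟨x, hx, -⟩ := mem_iUnion₂.1 (hcov hu)
    exact ⟨x, hx⟩
  obtain ⟨x, rfl⟩ := htc.exists_eq_range htne
  have hsub : ∀ n, V ∩ disjointed (fun n => O (x n)) n ⊆ V ∩ O (x n) := fun n =>
    inter_subset_inter_right _ (disjointed_subset _ n)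
  refine ⟨fun n => V ∩ disjointed (fun n => O (x n)) n, fun n => hV.inter
    (MeasurableSet.disjointed (fun n => (hO (x n)).measurableSet) n), fun i j hij =>
    (disjoint_disjointed _ hij).mono inter_subset_right inter_subset_right, ?_, fun n => ?_⟩
  · rw [← inter_iUnion, iUnion_disjointed]
    refine inter_eq_left.2 (hcov.trans ?_)
    rw [biUnion_range]
  · obtain ⟨-, hi, F, hF⟩ := hOV _ (htV (mem_range_self n))
    exact ⟨hi.mono ((hsub n).trans inter_subset_right), F, fun u hu => hF u (hsub n hu)⟩

/-- The degree of a holomorphic map `φ` to a torus as the area of the image of `φ`. -/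
theorem IsHolomorphicToTorus.exists_hasDegree [IsManifold 𝓘(ℂ, ℂ) ω B] [T2Space B]
    [CompactSpace B] [ConnectedSpace B] {φ : B → Torus Λ} (hφ : IsHolomorphicToTorus Λ φ)
    {κ : Type*} [Fintype κ] {e : κ → OpenPartialHomeomorph B ℂ} (he : ∀ k, e k ∈ atlas ℂ B)
    {V : κ → Set ℂ} (hV : ∀ k, MeasurableSet (V k)) (hVe : ∀ k, V k ⊆ (e k).target)
    (hdisj : Pairwise (Function.onFun Disjoint fun k => (e k).symm '' V k))
    (hcover : ∀ b, ∃ k, b ∈ (e k).symm '' V k) {g : κ → ℂ → ℂ}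
    (hg : ∀ k, ∀ u ∈ V k, ∃ F, HasDerivAt F (g k u) u ∧
      ∀ᶠ z in 𝓝 u, ⟪F z⟫[Λ] = φ ((e k).symm z)) :
    ∃ n : ℕ, HasDegree φ n ∧ ∑ k, ∫⁻ u in V k, ‖g k u‖ₑ ^ 2 = n * volume (fd Λ) := by
  rcases hφ.eq_const_or with hc | ⟨ho, hi⟩
  · refine ⟨0, ?_, ?_⟩
    · obtain ⟨b₀⟩ := (inferInstance : Nonempty B)
      filter_upwards [(finite_singleton (φ b₀)).compl_mem_cofinite] with p hp
      have h : φ ⁻¹' {p} = ∅ := eq_empty_of_forall_notMem fun b hb =>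
        hp ((mem_singleton_iff.1 hb).symm.trans (hc b b₀))
      rw [h]
      exact ⟨finite_empty, ncard_empty _⟩
    · rw [Nat.cast_zero, zero_mul]
      refine Finset.sum_eq_zero fun k _ => ?_
      refine (setLIntegral_congr_fun (g := fun _ => 0) (hV k) fun u hu => ?_).trans lintegral_zero
      obtain ⟨F, hF, hFφ⟩ := hg k u hu
      have h1 := eventually_sub_eq_of_lifts (Λ := Λ) (g := fun _ => F u) hF.continuousAt
        continuousAt_const (hFφ.mono fun z hz => by
          rw [hz, hFφ.self_of_nhds]; exact hc _ _)
      have h2 : g k u = 0 := hF.unique ((hasDerivAt_const u (F u)).congr_of_eventuallyEq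
        (h1.mono fun z hz => by rw [hz]; ring))
      simp [h2]
  obtain ⟨hC, n, hn⟩ := exists_card_fibre hφ.continuous ho hi
  set C := {b | ¬ LocallyInjectiveAt φ b}
  refine ⟨n, ?_, ?_⟩
  · filter_upwards [(hC.image φ).compl_mem_cofinite] with q hq using hn q hq
  have hfin : ∀ k, (V k ∩ (e k).symm ⁻¹' C).Finite := fun k =>
    (hC.subset (image_subset_iff.2 inter_subset_right)).of_finite_image
      ((e k).symm.injOn.mono (inter_subset_left.trans (hVe k)))
  have hV' : ∀ k, MeasurableSet (V k \ (V k ∩ (e k).symm ⁻¹' C)) := fun k =>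
    (hV k).diff (hfin k).measurableSet
  choose W hWm hWd hWV hWi F hF using fun k => hφ.exists_pieces (he k) (hV' k)
    (sdiff_subset.trans (hVe k)) (fun u hu => by_contra fun h => hu.2 ⟨hu.1, h⟩)
    (g := g k) fun u hu => hg k u hu.1
  have hWsub : ∀ k i, W k i ⊆ V k := fun k i u hu => by
    have h : u ∈ ⋃ i, W k i := mem_iUnion.2 ⟨i, hu⟩
    rw [hWV] at h
    exact h.1
  let Q : κ × ℕ → Set B := fun j => (e j.1).symm '' W j.1 j.2
  let A : κ × ℕ → Set ℂ := fun j => fd Λ ∩ QuotientAddGroup.mk ⁻¹' (φ '' Q j)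
  have hQi : ∀ j, InjOn φ (Q j) := by
    rintro j _ ⟨u, hu, rfl⟩ _ ⟨v, hv, rfl⟩ h
    rw [hWi j.1 j.2 hu hv h]
  have hQu : ∀ t ∉ C, ∃ j, t ∈ Q j ∧ ∀ j', t ∈ Q j' → j' = j := by
    intro t ht
    obtain ⟨k, u, hu, rfl⟩ := hcover t
    have hu' : u ∈ ⋃ i, W k i := by
      rw [hWV]
      exact ⟨hu, fun h => ht h.2⟩
    obtain ⟨i, hi⟩ := mem_iUnion.1 hu'
    refine ⟨(k, i), ⟨u, hi, rfl⟩, ?_⟩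
    rintro ⟨k', i'⟩ ⟨v, hv, hvu⟩
    have hk : k' = k := by
      by_contra hkk
      exact Set.disjoint_left.1 (hdisj hkk) ⟨v, hWsub _ _ hv, hvu⟩ ⟨u, hu, rfl⟩
    subst hk
    have huv : v = u := (e k').symm.injOn (hVe _ (hWsub _ _ hv)) (hVe _ hu) hvu
    subst huv
    by_contra hne
    exact Set.disjoint_left.1 (hWd k' fun h : i' = i => hne (by rw [h])) hv hi
  have harea : ∀ j : κ × ℕ, MeasurableSet (A j) ∧
      ∫⁻ u in W j.1 j.2, ‖g j.1 u‖ₑ ^ 2 = volume (A j) := by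
    intro j
    have h1 : φ '' Q j = (fun u => ⟪F j.1 j.2 u⟫[Λ]) '' W j.1 j.2 := by
      rw [image_image]
      exact image_congr fun u hu => (hF j.1 j.2 u hu).2.symm
    have h2 := lintegral_deriv_sq (Λ := Λ) (hWm j.1 j.2) (fun u hu => (hF j.1 j.2 u hu).1)
      fun u hu v hv h => hWi j.1 j.2 hu hv (by
        beta_reduce
        rw [← (hF j.1 j.2 u hu).2, ← (hF j.1 j.2 v hv).2]; exact h)
    rwa [← h1] at h2
  have hsum : ∀ k, ∫⁻ u in V k, ‖g k u‖ₑ ^ 2 = ∑' i, volume (A (k, i)) := by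
    intro k
    rw [← setLIntegral_congr (sdiff_null_ae_eq_self ((hfin k).measure_zero volume)), ← hWV,
      lintegral_iUnion (hWm k) (hWd k)]
    exact tsum_congr fun i => (harea (k, i)).2
  have hcount : ∀ z ∈ fd Λ, ⟪z⟫[Λ] ∉ φ '' C →
      ∑' j, (A j).indicator (fun _ => (1 : ENNReal)) z = n := by
    intro z hz hzC
    obtain ⟨hTf, hTn⟩ := hn _ hzC
    set T := φ ⁻¹' {⟪z⟫[Λ]}
    have h1 : ∀ j, (A j).indicator (fun _ => (1 : ENNReal)) z =
        ∑ t ∈ hTf.toFinset, (Q j).indicator (fun _ => (1 : ENNReal)) t := by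
      intro j
      by_cases hzj : z ∈ A j
      · obtain ⟨t, htQ, htz⟩ := hzj.2
        rw [indicator_of_mem hzj, Finset.sum_eq_single t, indicator_of_mem htQ]
        · intro s hs hst
          refine indicator_of_notMem (fun hsQ => hst (hQi j hsQ htQ ?_)) _
          rw [htz]
          exact hTf.mem_toFinset.1 hs
        · exact fun h => (h (hTf.mem_toFinset.2 htz)).elim
      · rw [indicator_of_notMem hzj]
        refine (Finset.sum_eq_zero fun s hs => indicator_of_notMem (fun hsQ => hzj ?_) _).symm
        exact ⟨hz, s, hsQ, hTf.mem_toFinset.1 hs⟩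
    rw [tsum_congr h1, Summable.tsum_finsetSum fun _ _ => ENNReal.summable,
      Finset.sum_congr rfl (g := fun _ => 1) fun t ht => ?_]
    · rw [Finset.sum_const, nsmul_one, ← hTn, ncard_eq_toFinset_card T hTf]
    · have htC : t ∉ C := fun h => hzC ⟨t, h, hTf.mem_toFinset.1 ht⟩
      obtain ⟨j, hj, hju⟩ := hQu t htC
      rw [tsum_eq_single j fun j' hj' => indicator_of_notMem (fun h => hj' (hju j' h)) _,
        indicator_of_mem hj]
  rw [Finset.sum_congr rfl fun k _ => hsum k, ← tsum_fintype (L := .unconditional κ),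
    ← ENNReal.tsum_prod (f := fun k i => volume (A (k, i)))]
  calc ∑' j : κ × ℕ, volume (A j)
      = ∑' j, ∫⁻ z in fd Λ, (A j).indicator (fun _ => 1) z := by
        refine tsum_congr fun j => ?_
        rw [lintegral_indicator_const (harea j).1, Measure.restrict_apply (harea j).1, one_mul,
          inter_eq_left.2 inter_subset_left]
    _ = ∫⁻ z in fd Λ, ∑' j, (A j).indicator (fun _ => 1) z :=
        (lintegral_tsum fun j => (measurable_const.indicator (harea j).1).aemeasurable).symm
    _ = ∫⁻ z in fd Λ, n := by
        refine lintegral_congr_ae ?_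
        have h1 := (countable_preimage_mk (hC.image φ).countable).ae_notMem
          ((volume : Measure ℂ).restrict (fd Λ))
        filter_upwards [h1, ae_restrict_mem (measurableSet_fd Λ)] with z h2 h3
        exact hcount z h3 h2
    _ = n * volume (fd Λ) := by rw [setLIntegral_const]

end Area

section SelfIntersection

variable {X B : Type*} [TopologicalSpace X] [ChartedSpace ℂ² X]
  [TopologicalSpace B] [ChartedSpace ℂ B] {Λ : Submodule ℤ ℂ} [AddAction (Torus Λ) X] {π : X → B}

/-- A decomposition of the base into measurable pieces with local sections. -/
theorem IsPrincipalBundle.exists_decomposition [CompactSpace B] (hπ : IsPrincipalBundle Λ π) :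
    ∃ (m : ℕ) (e : Fin m → OpenPartialHomeomorph B ℂ) (s : Fin m → B → X) (V : Fin m → Set ℂ),
      (∀ k, e k ∈ atlas ℂ B) ∧ (∀ k, MeasurableSet (V k)) ∧ (∀ k, V k ⊆ (e k).target) ∧
      (∀ k, ∀ u ∈ V k, LocSec π (s k) ((e k).symm u)) ∧
      Pairwise (Function.onFun Disjoint fun k => (e k).symm '' V k) ∧
      ∀ b, ∃ k, b ∈ (e k).symm '' V k := by
  have h1 : ∀ b : B, ∃ (s : B → X) (N : Set B), IsOpen N ∧ b ∈ N ∧ N ⊆ (chartAt ℂ b).source ∧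
      ∀ x ∈ N, LocSec π s x := by
    intro b
    obtain ⟨s, hs⟩ := hπ.exists_locSec b
    obtain ⟨N, hN, hNo, hb⟩ := mem_nhds_iff.1 hs.eventually
    exact ⟨s, N ∩ (chartAt ℂ b).source, hNo.inter (chartAt ℂ b).open_source,
      ⟨hb, mem_chart_source ℂ b⟩, Set.inter_subset_right, fun x hx => hN hx.1⟩
  choose s N hNo hbN hNs hN using h1
  obtain ⟨t, ht⟩ := CompactSpace.elim_nhds_subcover N fun b => (hNo b).mem_nhds (hbN b)
  let p : Fin t.card → B := fun k => t.equivFin.symm k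
  let e : Fin t.card → OpenPartialHomeomorph B ℂ := fun k => chartAt ℂ (p k)
  let O : Fin t.card → Fin t.card → Set ℂ := fun k j => (e k).target ∩ (e k).symm ⁻¹' N (p j)
  have hO : ∀ k j, MeasurableSet (O k j) := fun k j =>
    ((e k).isOpen_inter_preimage_symm (hNo _)).measurableSet
  refine ⟨t.card, e, fun k => s (p k), fun k => O k k \ ⋃ j : {j // j < k}, O k j,
    fun k => chart_mem_atlas _ _, fun k => (hO k k).diff (MeasurableSet.iUnion fun j => hO k j),
    fun k u hu => hu.1.1, fun k u hu => hN _ _ hu.1.2, ?_, fun b => ?_⟩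
  · have h2 : ∀ i j, i < j → Disjoint ((e i).symm '' (O i i \ ⋃ l : {l // l < i}, O i l))
        ((e j).symm '' (O j j \ ⋃ l : {l // l < j}, O j l)) := by
      intro i j hij
      refine Set.disjoint_left.2 ?_
      rintro _ ⟨u, hu, rfl⟩ ⟨v, hv, h⟩
      refine hv.2 (Set.mem_iUnion.2 ⟨⟨i, hij⟩, hv.1.1, ?_⟩)
      rw [Set.mem_preimage, h]
      exact hu.1.2
    intro i j hij
    rcases lt_or_gt_of_ne hij with h | h
    · exact h2 i j h
    · exact (h2 j i h).symm
  · have hne : {k | b ∈ N (p k)}.Nonempty := by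
      have hb : b ∈ ⋃ x ∈ t, N x := by rw [ht]; trivial
      obtain ⟨x, hx, hbx⟩ := Set.mem_iUnion₂.1 hb
      refine ⟨t.equivFin ⟨x, hx⟩, ?_⟩
      simpa [p] using hbx
    obtain ⟨k, hk, hmin⟩ := WellFounded.has_min wellFounded_lt _ hne
    have hbs : b ∈ (e k).source := hNs _ hk
    refine ⟨k, e k b, ⟨⟨(e k).map_source hbs, ?_⟩, fun h => ?_⟩, (e k).left_inv hbs⟩
    · rw [Set.mem_preimage, (e k).left_inv hbs]
      exact hk
    · obtain ⟨⟨j, hj⟩, hbj⟩ := Set.mem_iUnion.1 h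
      have h3 : (e k).symm (e k b) ∈ N (p j) := hbj.2
      rw [(e k).left_inv hbs] at h3
      exact hmin j h3 hj

variable [DiscreteTopology Λ] [IsZLattice ℝ Λ]

/-- The density of the square of an invariant form without component along the fibres. -/
theorem TwoForm.Invariant.wedge_self_lift (hact : SmoothAction Λ X) {χ : TwoForm ℂ² X}
    (hi : χ.Invariant Λ) (hfib : ∀ x, χ.fib Λ x = 0) {H : ℂ → X} {u : ℂ}
    (hH : SmX H u)
    (hI : (χ.mu hact).val H u I = I * (χ.mu hact).val H u 1) (z : ℂ) :
    (χ.wedge χ).val (lift Λ H) (u, z) =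
      -2 / covolume Λ ^ 2 * ‖(χ.mu hact).val H u 1‖ ^ 2 := by
  have hA := covolume_ne_zero Λ volume
  have h3 : χ.val (lift Λ H) (u, z) (0, 1) (0, I) = 0 := by
    have h := χ.fib_comp hact hH
    rw [hfib] at h
    rw [hi hH z]
    exact (mul_eq_zero.1 h.symm).resolve_left hA
  have h4 : ∀ v l, χ.val (lift Λ H) (u, z) (v, 0) (0, l) =
      latticeIntersection Λ ((χ.mu hact).val H u v) l := fun v l => by
    rw [hi hH z, χ.latticeIntersection_mu hact hH]
  change wdens (χ.val (lift Λ H) (u, z)) (χ.val (lift Λ H) (u, z)) = _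
  simp only [wdens, wedgeVal, h3, h4, hI]
  rw [← Complex.normSq_eq_norm_sq, Complex.normSq_apply]
  simp only [latticeIntersection, map_mul, Complex.conj_I, Complex.mul_im, Complex.mul_re,
    Complex.conj_re, Complex.conj_im, Complex.neg_re, Complex.neg_im, Complex.I_re, Complex.I_im,
    Complex.one_re, Complex.one_im]
  field_simp
  ring

theorem IsPrincipalBundle.exists_lift_eq (hπ : IsPrincipalBundle Λ π) {s : B → X} {x : X}
    (hs : LocSec π s (π x)) : ∃ z ∈ fd Λ, ⟪z⟫[Λ] +ᵥ s (π x) = x := by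
  obtain ⟨z, hz⟩ := hπ.exists_vadd_eq hs.proj
  obtain ⟨w, hw, hzw⟩ := exists_mem_fd Λ z
  refine ⟨w, hw, ?_⟩
  have h : ⟪w⟫[Λ] = QuotientAddGroup.mk z :=
    QuotientAddGroup.eq.2 (by rwa [neg_add_eq_sub])
  rw [h, hz]

variable [IsManifold 𝓘(ℂ, ℂ) ω B] [IsManifold 𝓘(ℂ, ℂ²) ω X] [IsManifold 𝓘(ℝ, ℂ²) ∞ X]
  [T2Space B] [CompactSpace B] [ConnectedSpace B] [T2Space X] [CompactSpace X]

/-- The degree of the period map as a self-intersection. -/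
theorem IsPeriodMap.exists_hasDegree (hπ : IsPrincipalBundle Λ π) {χ : TwoForm ℂ² X}
    (hc : χ.Closed) (hi : χ.Invariant Λ) (hfib : ∀ x, χ.fib Λ x = 0)
    (hI : (χ.mu hπ.smoothAction).IsComplexLinear)
    {φ : B → Torus Λ} (hφ : IsPeriodMap Λ π (χ.mu hπ.smoothAction) φ) :
    ∃ n : ℕ, HasDegree φ n ∧ (χ.wedge χ).int = -2 * n := by
  have hact := hπ.smoothAction
  have hμ : (χ.mu hact).Closed := TwoForm.closed_mu hact hc hi
  obtain ⟨m, e, s, V, he, hV, hVe, hs, hdisj, hcover⟩ := hπ.exists_decomposition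
  set g : Fin m → ℂ → ℂ := fun k u => (χ.mu hact).val (chartSec (s k) (e k)) u 1 with hg
  obtain ⟨n, hn, hsum⟩ := (hφ.holomorphic hπ hμ hI).exists_hasDegree he hV hVe hdisj hcover
    (g := g) fun k u hu => by
      obtain ⟨F, hF⟩ := hφ.exists_hasDerivAt hμ hI (he k) (hVe k hu) (hs k u hu)
      exact ⟨F, hF.self_of_nhds.1, hF.mono fun z hz => hz.2⟩
  refine ⟨n, hn, ?_⟩
  have hsm : ∀ k, ∀ u ∈ V k, SmX (chartSec (s k) (e k)) u := fun k u hu =>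
    (hs k u hu).smAt_chartSec (he k) (hVe k hu)
  have hgc : ∀ k, ContinuousOn (g k) (V k) := fun k u hu =>
    (((χ.mu hact).smooth (hsm k u hu)).continuousAt.clm_apply
      continuousAt_const).continuousWithinAt
  have hlt : ∀ k, ∫⁻ u in V k, ‖g k u‖ₑ ^ 2 < ⊤ := fun k => by
    refine (Finset.single_le_sum (f := fun k => ∫⁻ u in V k, ‖g k u‖ₑ ^ 2) (fun _ _ => zero_le)
      (Finset.mem_univ k)).trans_lt ?_
    rw [hsum]
    exact ENNReal.mul_lt_top (ENNReal.natCast_lt_top n) (volume_fd_lt_top Λ)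
  have hmeas : ∀ k, AEStronglyMeasurable (fun u => ‖g k u‖ ^ 2) (volume.restrict (V k)) := fun k =>
    ((hgc k).norm.pow 2).aestronglyMeasurable (hV k)
  have hint : ∀ k, IntegrableOn (fun u => ‖g k u‖ ^ 2) (V k) := fun k => by
    refine ⟨hmeas k, ?_⟩
    rw [HasFiniteIntegral]
    simpa only [enorm_pow, enorm_norm] using hlt k
  have hval : ∀ k, ∀ y ∈ V k ×ˢ fd Λ,
      (χ.wedge χ).val (lift Λ (chartSec (s k) (e k))) y =
        -2 / covolume Λ ^ 2 * ‖g k y.1‖ ^ 2 * 1 := by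
    rintro k ⟨u, z⟩ ⟨hu, -⟩
    rw [hi.wedge_self_lift hact hfib (hsm k u hu), mul_one]
    have h := hI (hsm k u hu)
      ((hs k u hu).hol_chartSec (he k) (hVe k hu)).self_of_nhds 1
    rwa [mul_one] at h
  have hP : ∀ k, PosParam (V k ×ˢ fd Λ) (lift Λ (chartSec (s k) (e k))) := fun k =>
    hπ.posParam (he k) (hV k) (hVe k) (hs k)
  have hproj : ∀ k, ∀ y ∈ V k ×ˢ fd Λ,
      π (lift Λ (chartSec (s k) (e k)) y) ∈ (e k).symm '' V k := by
    rintro k ⟨u, z⟩ ⟨hu, -⟩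
    refine ⟨u, hu, ?_⟩
    rw [lift, hπ.proj_mk_vadd, (hs k u hu).proj_chartSec]
  rw [TopForm.int_eq_sum _ hP]
  · have hk : ∀ k, ∫ y in V k ×ˢ fd Λ, (χ.wedge χ).val (lift Λ (chartSec (s k) (e k))) y =
        -2 / covolume Λ * (∫⁻ u in V k, ‖g k u‖ₑ ^ 2).toReal := fun k => by
      rw [setIntegral_congr_fun (hP k).meas (hval k), Measure.volume_eq_prod,
        setIntegral_prod_mul (fun u => -2 / covolume Λ volume ^ 2 * ‖g k u‖ ^ 2)
          (fun _ => 1),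
        integral_const_mul, integral_eq_lintegral_of_nonneg_ae
          (.of_forall fun u => sq_nonneg _) (hmeas k), setIntegral_const, volume_real_fd]
      have h : ∀ u, ENNReal.ofReal (‖g k u‖ ^ 2) = ‖g k u‖ₑ ^ 2 := fun u => by
        rw [ENNReal.ofReal_pow (norm_nonneg _), ofReal_norm]
      simp_rw [h]
      have hA := covolume_ne_zero Λ volume
      rw [smul_eq_mul, mul_one]
      field_simp
    rw [Finset.sum_congr rfl fun k _ => hk k, ← Finset.mul_sum,
      ← ENNReal.toReal_sum fun k _ => (hlt k).ne, hsum, ENNReal.toReal_mul, ENNReal.toReal_natCast,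
      ← measureReal_def, volume_real_fd]
    field_simp [covolume_ne_zero Λ volume]
  · intro i j hij
    refine Set.disjoint_left.2 ?_
    rintro _ ⟨y, hy, rfl⟩ ⟨y', hy', h⟩
    exact Set.disjoint_left.1 (hdisj hij) (hproj i y hy) (h ▸ hproj j y' hy')
  · intro H y _ h
    obtain ⟨k, u, hu, hux⟩ := hcover (π (H y))
    obtain ⟨z, hz, hzx⟩ := hπ.exists_lift_eq (x := H y) (hux ▸ hs k u hu)
    refine (h k ⟨(u, z), ⟨hu, hz⟩, ?_⟩).elim
    rw [← hzx, ← hux]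
    rfl
  · intro k
    rw [integrableOn_congr_fun (hval k) (hP k).meas, IntegrableOn, Measure.volume_eq_prod,
      ← Measure.prod_restrict]
    exact ((hint k).const_mul _).mul_prod (integrable_const _)

end SelfIntersection

section ChernClass

variable {X : Type*} [TopologicalSpace X] [ChartedSpace ℂ² X]
  [IsManifold 𝓘(ℝ, ℂ²) ∞ X]

theorem Form.IsClosed.of_cohomologous {α β : Form X 2} (hα : α.IsClosed)
    (h : α.Cohomologous β) : β.IsClosed := by
  obtain ⟨η, hη⟩ := h
  intro e he y hy
  have hr : minSmoothness ℝ 2 ≤ (∞ : WithTop ℕ∞) := by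
    simp only [minSmoothness_of_isRCLikeNormedField]
    exact WithTop.coe_le_coe.2 le_top
  have h1 : ∀ᶠ z in 𝓝 y, α.toFun e z = β.toFun e z + extDeriv (η.toFun e) z := by
    filter_upwards [e.open_target.mem_nhds hy] with z hz using hη e he z hz
  have h2 : DifferentiableAt ℝ (β.toFun e) y := (β.toFun_smooth he hy).differentiableAt (by simp)
  have h3 : ∀ᶠ z in 𝓝 y, extDeriv (η.toFun e) z = α.toFun e z - β.toFun e z :=
    h1.mono fun z hz => by rw [hz]; abel
  have h4 : DifferentiableAt ℝ (extDeriv (η.toFun e)) y :=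
    (((α.toFun_smooth he hy).differentiableAt (by simp)).sub h2).congr_of_eventuallyEq h3
  have h5 := Filter.EventuallyEq.extDeriv_eq h1
  rw [hα e he y hy, extDeriv_fun_add h2 h4,
    extDeriv_extDeriv_apply (η.toFun_smooth he hy) hr, add_zero] at h5
  exact h5.symm

end ChernClass

theorem HasDegree.add_const {B G : Type*} [AddGroup G] {φ ψ : B → G} {n : ℕ}
    (h : HasDegree φ n) (a : G) (hψ : ∀ b, ψ b = φ b + a) : HasDegree ψ n := by
  have h1 : ∀ p, ψ ⁻¹' {p} = φ ⁻¹' {p - a} := fun p => by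
    ext b
    simp only [Set.mem_preimage, Set.mem_singleton_iff, hψ, eq_sub_iff_add_eq]
  unfold HasDegree
  simp_rw [h1]
  exact (sub_left_injective (b := a)).tendsto_cofinite.eventually h

end PrincipalElliptic

end

theorem lemma1p2
    (Λ : Submodule ℤ ℂ) [DiscreteTopology Λ] [IsZLattice ℝ Λ]
    {B : Type*} [TopologicalSpace B] [ChartedSpace ℂ B] [IsManifold 𝓘(ℂ, ℂ) ω B]
    [T2Space B] [CompactSpace B] [ConnectedSpace B]
    {X : Type*} [TopologicalSpace X] [ChartedSpace (ℂ × ℂ) X] [IsManifold 𝓘(ℂ, ℂ × ℂ) ω X]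
    [T2Space X] [CompactSpace X]
    [AddAction (PrincipalElliptic.Torus Λ) X] (π : X → B)
    (hπ : PrincipalElliptic.IsPrincipalBundle Λ π)
    (hX : ¬ PrincipalElliptic.IsTopologicallyTrivial Λ π)
    (L : X → Type*) [∀ x, AddCommGroup (L x)] [∀ x, Module ℂ (L x)]
    [∀ x, TopologicalSpace (L x)] [TopologicalSpace (Bundle.TotalSpace ℂ L)]
    [FiberBundle ℂ L] [VectorBundle ℂ ℂ L] [ContMDiffVectorBundle ω ℂ L 𝓘(ℂ, ℂ × ℂ)]
    (c : PrincipalElliptic.Form X 2) (hc : PrincipalElliptic.RepresentsChernClass L c) :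
    (∃ φ : B → PrincipalElliptic.Torus Λ, PrincipalElliptic.Corresponds Λ π c φ) ∧
    (∀ φ ψ : B → PrincipalElliptic.Torus Λ,
      PrincipalElliptic.Corresponds Λ π c φ → PrincipalElliptic.Corresponds Λ π c ψ →
      ∃ a : PrincipalElliptic.Torus Λ, ∀ b, ψ b = φ b + a) ∧
    (∀ φ : B → PrincipalElliptic.Torus Λ, PrincipalElliptic.Corresponds Λ π c φ →
      ∃ n : ℕ, PrincipalElliptic.HasDegree φ n ∧
        PrincipalElliptic.intersection c c = -2 * (n : ℝ)) := by
  open PrincipalElliptic in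
  have := isManifold_real X
  have := hπ.preconnectedSpace
  have hact := hπ.smoothAction
  obtain ⟨hcc, h, χ, hχ, hcχ⟩ := hc
  have hχc : χ.toTwoForm.Closed := (hcc.of_cohomologous hcχ).toTwoForm
  obtain ⟨η, hη⟩ := hcχ
  have hcoh : c.toTwoForm.CohomologousVia χ.toTwoForm η.toOneForm := Form.cohomologousVia hη
  have hcc' : c.toTwoForm.Closed := hcc.toTwoForm
  obtain ⟨D⟩ := hχ.nonempty_potentialSystem
  have hac : (χ.toTwoForm.avg hact).Closed := TwoForm.Closed.avg hact hχc
  have hai : (χ.toTwoForm.avg hact).Invariant Λ := TwoForm.invariant_avg hact _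
  have hfib : ∀ x, (χ.toTwoForm.avg hact).fib Λ x = 0 := fun x => by_contra fun hx =>
    hX (isTopologicallyTrivial_of_fib hπ hac hai hx fun y => TwoForm.fib_eq hact hac hai y x)
  obtain ⟨φ₀, hφ₀⟩ := D.exists_periodMap hπ hχc hfib
  have hI : ((χ.toTwoForm.avg hact).mu hact).IsComplexLinear := fun hH hH' v =>
    TwoForm.OneOne.mu_I hπ (IsChernForm.oneOne hχ) hH hH' v
  have havg : (χ.toTwoForm.avg hact).CohomologousVia χ.toTwoForm (χ.toTwoForm.hom hact) :=
    TwoForm.Closed.avg_cohomologous hact hχc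
  have hcor : Corresponds Λ π c φ₀ :=
    ⟨hφ₀.holomorphic hπ (TwoForm.closed_mu hact hac hai) hI,
      fun γ hγ hp f hf hfφ l hl => hφ₀.squareIntegral_eq hact hχc hcoh hγ hp hf hfφ hl⟩
  obtain ⟨n, hn, hint⟩ := hφ₀.exists_hasDegree hπ hac hai hfib hI
  refine ⟨⟨φ₀, hcor⟩, fun φ ψ hφ hψ => hφ.exists_eq_add hπ hψ, fun φ hφ => ⟨n, ?_, ?_⟩⟩
  · obtain ⟨a, ha⟩ := hcor.exists_eq_add hπ hφ
    exact hn.add_const a ha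
  · rw [intersection_eq, hcoh.int_wedge_self hcc' hχc, ← hint]
    exact (havg.int_wedge_self hac hχc).symm
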